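/- **Notation.** Let $d\in\{1,2\}$, $\langle\xi\rangle=(1+|\xi|^2)^{1/2}$, and $\widehat{G(D)u}(\xi)=G(\xi)\hat u(\xi)$ (with $D=-i\nabla$). A pair $(\mathrm G_1,\mathrm G_2)=(G_1(D),G_2(D))$ with real symbols is *admissible* if, for $k\in\{1,2\}$, $G_k\in L^\infty(\mathbb R^d)$ and $\langle\cdot\rangle\nabla G_k\in L^\infty(\mathbb R^d)^d$, $G_k$ is even (so that $\mathrm G_k$ maps real functions to real functions), and $G_1(\xi)>0$, $|G_2(\xi)|\le G_1(\xi)$ for all $\xi$. For $r\ge 0$, $X^r$ is the Banach space of real-valued $U=(\zeta,v)$, $v=(v_1,\dots,v_d)$, whose Fourier transforms are measurable functions with $$|U|_{X^r}:=|\zeta|_{H^r}+|\mathrm G_1 v|_{H^r}<\infty,\qquad |f|_{H^r}=|\langle D\rangle^r f|_{L^2}.$$ For $\underline U=(\underline\zeta,\underline v)$ and $W=(\eta,w)$, $A_j(\underline U)[W]$ has first component $$\epsilon\mathrm G_2\big[\mathrm G_2[\underline v_j]\,\eta\big]+\mathrm G_1^2[w_j]+\epsilon\mathrm G_2\big[\underline\zeta\,\mathrm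 G_2[w_j]\big]$$ and $i$-th velocity component $\delta_{ij}\,\eta+\epsilon\,\mathrm G_2[\underline v_j]\,\mathrm G_2[w_i]$, $1\le i\le d$. **Theorem 3.1 (well-posedness of the linearized system).** Let $s>d/2+1$, $h_{\min}>0$, $0\le\epsilon\le1$, $T>0$, and $I=[0,T/\epsilon]$ ($I=[0,\infty)$ if $\epsilon=0$). Let $(\mathrm G_1,\mathrm G_2)$ be admissible. Let $\underline U=(\underline\zeta,\underline v)\in W^{1,\infty}(I,X^{s-1})\cap L^\infty(I,X^s)$ (identified with its representative that is continuous in time with values in $X^{s-1}$) satisfy $1+\epsilon\underline\zeta(t,x)\ge h_{\min}$ for all $(t,x)\in I\times\mathbb R^d$. Let $R\in L^\infty(I,X^s)$ and $U_0\in X^s$. Then the Cauchy problem $$\partial_t U+\sum_{j=1}^d A_j(\underline U)[\partial_jU]=\epsilon R,\qquad U|_{t=0}=U_0,$$ where $\partial_t$ is a weak derivative in time with values in $X^{s-1}$, has a unique solution $U\in C^0(I,X^s)$. Moreover, for every $t_0$ with $d/2<t_0\le s-1$ and every $t\in I$, $$|U(t)|_{X^s}\le\kappa_0\,e^{\epsilon\lambda_st}\,|U_0|_{X^s}+\epsilon\,\nu_s\int_0^t|R(t')|_{X^s}\,dt',$$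 where $$\kappa_0=C\Big(\tfrac1{h_{\min}},\,|\underline U|_{t=0}|_{X^{t_0}}\Big),\qquad \lambda_s,\nu_s=C\Big(\tfrac1{h_{\min}},\,T,\,|\underline U|_{W^{1,\infty}_tX^{t_0}},\,|\underline U|_{L^\infty_tX^s}\Big).$$ Each $C(\cdot)$ is a positive function, nondecreasing in each of its arguments. Besides the arguments displayed, these functions depend only on $d$, $s$, $t_0$ and an upper bound for $|(G_k,\langle\cdot\rangle\nabla G_k)|_{L^\infty}$, $k\in\{1,2\}$. -/

import Mathlib

open MeasureTheory Set
open scoped ENNReal ContDiff FourierTransform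

noncomputable section

/-- The space `ℝ^d` with its Euclidean norm. -/
abbrev Sp (d : ℕ) : Type := EuclideanSpace ℝ (Fin d)

/-- The Japanese bracket `⟨ξ⟩ = (1 + |ξ|²)^{1/2}`. -/
def japanese {d : ℕ} (ξ : Sp d) : ℝ := Real.sqrt (1 + ‖ξ‖ ^ 2)

theorem japanese_pos {d : ℕ} (ξ : Sp d) : 0 < japanese ξ := by
  unfold japanese; positivity

theorem japanese_continuous {d : ℕ} : Continuous (japanese (d := d)) := by
  unfold japanese; fun_prop

/-! ### Admissible pairs of Fourier multipliers -/

/-- `|(G, ⟨·⟩ ∇G)|_{L^∞} ≤ M`, the gradient being taken in the sense of distributions. -/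
def SymbolBound {d : ℕ} (G : Sp d → ℝ) (M : ℝ) : Prop :=
  (∀ᵐ ξ, |G ξ| ≤ M) ∧
  ∃ g : Sp d → Sp d, AEStronglyMeasurable g volume ∧
    (∀ᵐ ξ, japanese ξ * ‖g ξ‖ ≤ M) ∧
    ∀ φ : Sp d → ℝ, ContDiff ℝ ∞ φ → HasCompactSupport φ → ∀ e : Sp d,
      ∫ ξ, G ξ * fderiv ℝ φ ξ e = - ∫ ξ, inner ℝ (g ξ) e * φ ξ

/-- An admissible pair of symbols.  The unknowns of the system are real valued, so the
multipliers have to map real functions to real functions: the (real) symbols are even. -/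
structure AdmissiblePair (d : ℕ) where
  G₁ : Sp d → ℝ
  G₂ : Sp d → ℝ
  meas₁ : AEStronglyMeasurable G₁ volume
  meas₂ : AEStronglyMeasurable G₂ volume
  bound₁ : ∃ M, SymbolBound G₁ M
  bound₂ : ∃ M, SymbolBound G₂ M
  pos₁ : ∀ ξ, 0 < G₁ ξ
  abs_le : ∀ ξ, |G₂ ξ| ≤ G₁ ξ
  even₁ : ∀ ξ, G₁ (-ξ) = G₁ ξ
  even₂ : ∀ ξ, G₂ (-ξ) = G₂ ξ

/-! ### Functions and states, recorded by their Fourier transforms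

The Fourier transform is Mathlib's, `û(ξ) = ∫ e^{-2πi⟨ξ,x⟩} u(x) dx`, which is an isometry of `L²`
and for which `D = -i∇` is multiplication by `2πξ`; hence `G(D)` is multiplication of the Fourier
transform by `G(2πξ)`. -/

/-- A scalar object on `ℝ^d`, given by its Fourier transform, a measurable function modulo
null sets. -/
abbrev Fn (d : ℕ) : Type := Sp d →ₘ[volume] ℂ

/-- A pair `U = (ζ, v)`, with `v = (v_1, …, v_d)`. -/
abbrev State (d : ℕ) : Type := Fn d × (Fin d → Fn d)

/-- Multiplication of the Fourier transform by `m`. -/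
def fourierMult {d : ℕ} (m : Sp d → ℂ) (hm : AEStronglyMeasurable m volume) (f : Fn d) : Fn d :=
  AEEqFun.mk m hm * f

theorem aesm_symbol {d : ℕ} {G : Sp d → ℝ} (hG : AEStronglyMeasurable G volume) :
    AEStronglyMeasurable (fun ξ : Sp d => ((G ((2 * Real.pi) • ξ) : ℝ) : ℂ)) volume :=
  Complex.continuous_ofReal.comp_aestronglyMeasurable
    (hG.comp_quasiMeasurePreserving
      (Measure.quasiMeasurePreserving_smul volume (by positivity : (2 * Real.pi : ℝ) ≠ 0)))

/-- The Fourier multiplier `G₁(D)`. -/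
def AdmissiblePair.op₁ {d : ℕ} (P : AdmissiblePair d) (f : Fn d) : Fn d :=
  fourierMult (fun ξ => ((P.G₁ ((2 * Real.pi) • ξ) : ℝ) : ℂ)) (aesm_symbol P.meas₁) f

/-- The Fourier multiplier `G₂(D)`. -/
def AdmissiblePair.op₂ {d : ℕ} (P : AdmissiblePair d) (f : Fn d) : Fn d :=
  fourierMult (fun ξ => ((P.G₂ ((2 * Real.pi) • ξ) : ℝ) : ℂ)) (aesm_symbol P.meas₂) f

/-- The partial derivative `∂_j`. -/
def partialD {d : ℕ} (j : Fin d) (f : Fn d) : Fn d :=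
  fourierMult (fun ξ => 2 * Real.pi * Complex.I * ((ξ j : ℝ) : ℂ))
    (Continuous.aestronglyMeasurable (by fun_prop)) f

/-- `∂_j U`. -/
def State.deriv {d : ℕ} (j : Fin d) (U : State d) : State d :=
  (partialD j U.1, fun i => partialD j (U.2 i))

/-- The function `x ↦ f(x)` on physical space (when the Fourier transform is integrable). -/
def Fn.toPhys {d : ℕ} (f : Fn d) : Sp d → ℂ := 𝓕⁻ (f : Sp d → ℂ)

theorem continuous_fourier_any {d : ℕ} (f : Sp d → ℂ) : Continuous (𝓕 f) := by
  by_cases hf : Integrable f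
  · exact VectorFourier.fourierIntegral_continuous Real.continuous_fourierChar
      (innerSL ℝ).continuous₂ hf
  · have h0 : 𝓕 f = fun _ => 0 := by
      funext w
      rw [Real.fourier_eq]
      apply integral_undef
      intro h
      exact hf ((Real.fourierIntegral_convergent_iff w).1 h)
    rw [h0]
    exact continuous_const

/-- The pointwise product on physical space, used for factors that are square integrable with
integrable Fourier transform. -/
def Fn.prod {d : ℕ} (f g : Fn d) : Fn d :=
  AEEqFun.mk (𝓕 (fun x => f.toPhys x * g.toPhys x))
    (continuous_fourier_any _).aestronglyMeasurable

/-- The object with Fourier transform `f` is real valued. -/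
def Fn.IsReal {d : ℕ} (f : Fn d) : Prop := ∀ᵐ ξ, f (-ξ) = star (f ξ)

/-! ### The energy spaces -/

/-- `|f|_{H^s} = |⟨D⟩^s f|_{L²}` for a vector valued `f`, with values in `[0,∞]`. -/
def hsNormVec {d : ℕ} {ι : Type} [Fintype ι] (s : ℝ) (v : ι → Fn d) : ℝ≥0∞ :=
  eLpNorm (fun ξ => (japanese ((2 * Real.pi) • ξ) ^ s) •
    (WithLp.toLp 2 (fun j => v j ξ) : EuclideanSpace ℂ ι)) 2 volume

/-- `|f|_{H^s} = |⟨D⟩^s f|_{L²}`, with values in `[0,∞]`. -/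
def hsNorm {d : ℕ} (s : ℝ) (f : Fn d) : ℝ≥0∞ :=
  eLpNorm (fun ξ => (japanese ((2 * Real.pi) • ξ) ^ s) • f ξ) 2 volume

/-- The energy norm `|U|_{X^s} = |ζ|_{H^s} + |G₁[v]|_{H^s}`, with values in `[0,∞]`. -/
def xNorm {d : ℕ} (P : AdmissiblePair d) (s : ℝ) (U : State d) : ℝ≥0∞ :=
  hsNorm s U.1 + hsNormVec s (fun j => P.op₁ (U.2 j))

section lemmas

variable {d : ℕ}

theorem coeFn_fourierMult (m : Sp d → ℂ) (hm : AEStronglyMeasurable m volume) (f : Fn d) :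
    (fourierMult m hm f : Sp d → ℂ) =ᵐ[volume] fun ξ => m ξ * f ξ := by
  filter_upwards [AEEqFun.coeFn_mul (AEEqFun.mk m hm) f, AEEqFun.coeFn_mk m hm] with ξ h1 h2
  rw [fourierMult, h1, Pi.mul_apply, h2]

theorem continuous_weight (s : ℝ) :
    Continuous (fun ξ : Sp d => japanese ((2 * Real.pi) • ξ) ^ s) :=
  (japanese_continuous.comp (continuous_const_smul _)).rpow_const
    (fun _ => Or.inl (japanese_pos _).ne')

theorem aesm_vec {ι : Type} [Fintype ι] (v : ι → Fn d) :
    AEStronglyMeasurable (fun ξ => (WithLp.toLp 2 (fun j => v j ξ) : EuclideanSpace ℂ ι))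
      volume :=
  ((PiLp.continuous_toLp 2 _).measurable.comp_aemeasurable
    (aemeasurable_pi_lambda _ (fun j => (v j).aestronglyMeasurable.aemeasurable))).aestronglyMeasurable

theorem aesm_hsVec {ι : Type} [Fintype ι] (s : ℝ) (v : ι → Fn d) :
    AEStronglyMeasurable (fun ξ => (japanese ((2 * Real.pi) • ξ) ^ s) •
      (WithLp.toLp 2 (fun j => v j ξ) : EuclideanSpace ℂ ι)) volume :=
  (continuous_weight s).aestronglyMeasurable.smul (aesm_vec v)

theorem aesm_hs (s : ℝ) (f : Fn d) :
    AEStronglyMeasurable (fun ξ => (japanese ((2 * Real.pi) • ξ) ^ s) • f ξ) volume :=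
  (continuous_weight s).aestronglyMeasurable.smul f.aestronglyMeasurable

theorem hsNorm_add (s : ℝ) (f g : Fn d) : hsNorm s (f + g) ≤ hsNorm s f + hsNorm s g := by
  unfold hsNorm
  refine (eLpNorm_congr_ae ?_).trans_le
    (eLpNorm_add_le (aesm_hs s f) (aesm_hs s g) (by norm_num))
  filter_upwards [AEEqFun.coeFn_add f g] with ξ h
  simp [h]

theorem hsNormVec_add {ι : Type} [Fintype ι] (s : ℝ) (f g : ι → Fn d) :
    hsNormVec s (f + g) ≤ hsNormVec s f + hsNormVec s g := by
  unfold hsNormVec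
  refine (eLpNorm_congr_ae ?_).trans_le
    (eLpNorm_add_le (aesm_hsVec s f) (aesm_hsVec s g) (by norm_num))
  filter_upwards [ae_all_iff.2 (fun j => AEEqFun.coeFn_add (f j) (g j))] with ξ h
  ext j
  simp [h]

theorem hsNorm_smul (s c : ℝ) (f : Fn d) : hsNorm s (c • f) = ‖c‖ₑ * hsNorm s f := by
  unfold hsNorm
  rw [← eLpNorm_const_smul]
  refine eLpNorm_congr_ae ?_
  filter_upwards [AEEqFun.coeFn_smul c f] with ξ h
  simp [h, mul_left_comm]

theorem hsNormVec_smul {ι : Type} [Fintype ι] (s c : ℝ) (f : ι → Fn d) :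
    hsNormVec s (c • f) = ‖c‖ₑ * hsNormVec s f := by
  unfold hsNormVec
  rw [← eLpNorm_const_smul]
  refine eLpNorm_congr_ae ?_
  filter_upwards [ae_all_iff.2 (fun j => AEEqFun.coeFn_smul c (f j))] with ξ h
  ext j
  simp [h, mul_left_comm]

theorem hsNorm_eq_zero {s : ℝ} {f : Fn d} (h : hsNorm s f = 0) : f = 0 := by
  unfold hsNorm at h
  rw [eLpNorm_eq_zero_iff (aesm_hs s f) (by norm_num)] at h
  refine AEEqFun.ext ?_
  filter_upwards [h, AEEqFun.coeFn_zero (α := Sp d) (β := ℂ) (μ := volume)] with ξ h1 h2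
  rw [h2]
  simpa [(Real.rpow_pos_of_pos (japanese_pos ((2 * Real.pi) • ξ)) s).ne'] using h1

theorem hsNormVec_eq_zero {ι : Type} [Fintype ι] {s : ℝ} {f : ι → Fn d}
    (h : hsNormVec s f = 0) : f = 0 := by
  unfold hsNormVec at h
  rw [eLpNorm_eq_zero_iff (aesm_hsVec s f) (by norm_num)] at h
  funext j
  refine AEEqFun.ext ?_
  filter_upwards [h, AEEqFun.coeFn_zero (α := Sp d) (β := ℂ) (μ := volume)] with ξ h1 h2
  have h3 := (smul_eq_zero.1 h1).resolve_left
    (Real.rpow_pos_of_pos (japanese_pos ((2 * Real.pi) • ξ)) s).ne'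
  have h4 := congrArg (fun z : EuclideanSpace ℂ ι => z j) h3
  simpa [h2] using h4

theorem AdmissiblePair.op₁_add (P : AdmissiblePair d) (f g : Fn d) :
    P.op₁ (f + g) = P.op₁ f + P.op₁ g := by
  refine AEEqFun.ext ?_
  filter_upwards [coeFn_fourierMult _ (aesm_symbol P.meas₁) f,
    coeFn_fourierMult _ (aesm_symbol P.meas₁) g, coeFn_fourierMult _ (aesm_symbol P.meas₁) (f + g),
    AEEqFun.coeFn_add f g, AEEqFun.coeFn_add (P.op₁ f) (P.op₁ g)] with ξ h1 h2 h3 h4 h5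
  rw [h5, Pi.add_apply]
  unfold AdmissiblePair.op₁
  rw [h1, h2, h3, h4, Pi.add_apply, mul_add]

theorem AdmissiblePair.op₁_smul (P : AdmissiblePair d) (c : ℝ) (f : Fn d) :
    P.op₁ (c • f) = c • P.op₁ f := by
  refine AEEqFun.ext ?_
  filter_upwards [coeFn_fourierMult _ (aesm_symbol P.meas₁) f,
    coeFn_fourierMult _ (aesm_symbol P.meas₁) (c • f),
    AEEqFun.coeFn_smul c f, AEEqFun.coeFn_smul c (P.op₁ f)] with ξ h1 h2 h3 h4
  rw [h4, Pi.smul_apply]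
  unfold AdmissiblePair.op₁
  rw [h1, h2, h3, Pi.smul_apply, mul_smul_comm]

theorem AdmissiblePair.op₁_eq_zero (P : AdmissiblePair d) {f : Fn d} (h : P.op₁ f = 0) :
    f = 0 := by
  refine AEEqFun.ext ?_
  filter_upwards [coeFn_fourierMult _ (aesm_symbol P.meas₁) f,
    AEEqFun.coeFn_zero (α := Sp d) (β := ℂ) (μ := volume)] with ξ h1 h2
  have h3 : (fourierMult _ (aesm_symbol P.meas₁) f : Sp d → ℂ) ξ = 0 := by
    change (P.op₁ f : Sp d → ℂ) ξ = 0
    rw [h, h2]; rfl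
  rw [h1] at h3
  rw [h2]
  exact (mul_eq_zero.1 h3).resolve_left (by exact_mod_cast (P.pos₁ _).ne')

theorem xNorm_add (P : AdmissiblePair d) (s : ℝ) (U V : State d) :
    xNorm P s (U + V) ≤ xNorm P s U + xNorm P s V := by
  unfold xNorm
  have h : (fun j => P.op₁ ((U + V).2 j)) =
      (fun j => P.op₁ (U.2 j)) + (fun j => P.op₁ (V.2 j)) := by
    funext j; exact P.op₁_add _ _
  rw [h]
  calc _ ≤ (hsNorm s U.1 + hsNorm s V.1) + (_ + _) :=
        add_le_add (hsNorm_add s U.1 V.1) (hsNormVec_add s _ _)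
    _ = _ := by ring

theorem xNorm_smul (P : AdmissiblePair d) (s c : ℝ) (U : State d) :
    xNorm P s (c • U) = ‖c‖ₑ * xNorm P s U := by
  unfold xNorm
  have h : (fun j => P.op₁ ((c • U).2 j)) = c • (fun j => P.op₁ (U.2 j)) := by
    funext j; exact P.op₁_smul _ _
  rw [h, hsNormVec_smul, mul_add, ← hsNorm_smul]
  rfl

theorem xNorm_eq_zero (P : AdmissiblePair d) {s : ℝ} {U : State d} (h : xNorm P s U = 0) :
    U = 0 := by
  obtain ⟨h1, h2⟩ := add_eq_zero.1 h
  refine Prod.ext (hsNorm_eq_zero h1) ?_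
  funext j
  exact P.op₁_eq_zero (congrFun (hsNormVec_eq_zero h2) j)

theorem xNorm_zero (P : AdmissiblePair d) (s : ℝ) : xNorm P s (0 : State d) = 0 := by
  have h := xNorm_smul P s 0 (0 : State d)
  have h0 : (0 : ℝ) • (0 : State d) = 0 := zero_smul ℝ (0 : State d)
  rwa [h0, enorm_zero, zero_mul] at h

theorem ae_neg {p : Sp d → Prop} (h : ∀ᵐ ξ, p ξ) : ∀ᵐ ξ, p (-ξ) :=
  (Measure.measurePreserving_neg (volume : Measure (Sp d))).quasiMeasurePreserving.ae h

theorem Fn.IsReal.add {f g : Fn d} (hf : f.IsReal) (hg : g.IsReal) : (f + g).IsReal := by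
  filter_upwards [hf, hg, AEEqFun.coeFn_add f g, ae_neg (AEEqFun.coeFn_add f g)]
    with ξ h1 h2 h3 h4
  rw [h3, h4, Pi.add_apply, Pi.add_apply, h1, h2, star_add]

theorem Fn.IsReal.smul {f : Fn d} (c : ℝ) (hf : f.IsReal) : (c • f).IsReal := by
  filter_upwards [hf, AEEqFun.coeFn_smul c f, ae_neg (AEEqFun.coeFn_smul c f)] with ξ h1 h3 h4
  rw [h3, h4, Pi.smul_apply, Pi.smul_apply, h1]
  simp

theorem Fn.isReal_zero : (0 : Fn d).IsReal := by
  filter_upwards [AEEqFun.coeFn_zero (α := Sp d) (β := ℂ) (μ := volume),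
    ae_neg (AEEqFun.coeFn_zero (α := Sp d) (β := ℂ) (μ := volume))] with ξ h1 h2
  rw [h1, h2]; simp

end lemmas

/-- The energy space `X^s` of real valued `U = (ζ, v)` with `|U|_{X^s} < ∞`.  Since `G₁ > 0`, any
such `U` has a measurable function as Fourier transform.  If `1/G₁` grows at most polynomially, all
these `U` are tempered distributions; if it does not, the tempered ones form an incomplete subspace,
and `X^s` is the Banach space obtained without that restriction. -/
def XSpace {d : ℕ} (P : AdmissiblePair d) (s : ℝ) : Submodule ℝ (State d) where
  carrier := {U | U.1.IsReal ∧ (∀ j, (U.2 j).IsReal) ∧ xNorm P s U < ⊤}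
  add_mem' := fun {U V} hU hV => ⟨hU.1.add hV.1, fun j => (hU.2.1 j).add (hV.2.1 j),
    (xNorm_add P s U V).trans_lt (ENNReal.add_lt_top.2 ⟨hU.2.2, hV.2.2⟩)⟩
  zero_mem' := ⟨Fn.isReal_zero, fun _ => Fn.isReal_zero, by rw [xNorm_zero]; simp⟩
  smul_mem' := fun c U hU => ⟨hU.1.smul c, fun j => (hU.2.1 j).smul c, by
    rw [xNorm_smul]; exact ENNReal.mul_lt_top (by simp) hU.2.2⟩

instance XSpace.instNorm {d : ℕ} (P : AdmissiblePair d) (s : ℝ) : Norm (XSpace P s) :=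
  ⟨fun U => (xNorm P s (U : State d)).toReal⟩

theorem XSpace.xNorm_lt_top {d : ℕ} {P : AdmissiblePair d} {s : ℝ} (U : XSpace P s) :
    xNorm P s (U : State d) < ⊤ := by
  have h := U.2
  exact h.2.2

theorem XSpace.norm_def {d : ℕ} {P : AdmissiblePair d} {s : ℝ} (U : XSpace P s) :
    ‖U‖ = (xNorm P s (U : State d)).toReal := rfl

theorem XSpace.core {d : ℕ} (P : AdmissiblePair d) (s : ℝ) : NormedSpace.Core ℝ (XSpace P s) where
  norm_nonneg _ := ENNReal.toReal_nonneg
  norm_smul c U := by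
    rw [XSpace.norm_def, XSpace.norm_def, Submodule.coe_smul, xNorm_smul, ENNReal.toReal_mul]
    simp
  norm_triangle U V := by
    rw [XSpace.norm_def, XSpace.norm_def, XSpace.norm_def,
      ← ENNReal.toReal_add (XSpace.xNorm_lt_top U).ne (XSpace.xNorm_lt_top V).ne]
    exact ENNReal.toReal_mono (ENNReal.add_lt_top.2 ⟨XSpace.xNorm_lt_top U, XSpace.xNorm_lt_top V⟩).ne (xNorm_add P s _ _)
  norm_eq_zero_iff U := by
    constructor
    · intro h
      rw [XSpace.norm_def, ENNReal.toReal_eq_zero_iff] at h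
      exact Subtype.ext (xNorm_eq_zero P (h.resolve_right (XSpace.xNorm_lt_top U).ne))
    · rintro rfl
      rw [XSpace.norm_def, Submodule.coe_zero, xNorm_zero]; rfl

instance XSpace.instNormedAddCommGroup {d : ℕ} (P : AdmissiblePair d) (s : ℝ) :
    NormedAddCommGroup (XSpace P s) :=
  NormedAddCommGroup.ofCore (XSpace.core P s)

instance XSpace.instNormedSpace {d : ℕ} (P : AdmissiblePair d) (s : ℝ) : NormedSpace ℝ (XSpace P s) :=
  NormedSpace.ofCore (XSpace.core P s)

section complete

variable {d : ℕ}

theorem Fn.IsReal.of_tendsto {s : ℝ} {f : ℕ → Fn d} {g : Fn d} (hf : ∀ n, (f n).IsReal)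
    (h : Filter.Tendsto (fun n => hsNorm s (f n - g)) Filter.atTop (nhds 0)) : g.IsReal := by
  have hm : TendstoInMeasure volume
      (fun n ξ => (japanese ((2 * Real.pi) • ξ) ^ s) • (f n - g : Fn d) ξ)
      Filter.atTop (fun _ => (0 : ℂ)) := by
    refine tendstoInMeasure_of_tendsto_eLpNorm (p := 2) (by norm_num)
      (fun n => aesm_hs s _) aestronglyMeasurable_const ?_
    refine h.congr (fun n => ?_)
    unfold hsNorm
    refine eLpNorm_congr_ae (Filter.Eventually.of_forall fun ξ => ?_)
    simp
  obtain ⟨ns, -, hns⟩ := hm.exists_seq_tendsto_ae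
  have hlim : ∀ᵐ ξ, Filter.Tendsto (fun i => f (ns i) ξ) Filter.atTop (nhds (g ξ)) := by
    filter_upwards [hns, ae_all_iff.2 (fun i => AEEqFun.coeFn_sub (f (ns i)) g)] with ξ h1 h2
    have h3 := h1.const_smul ((japanese ((2 * Real.pi) • ξ) ^ s)⁻¹)
    have h4 : ∀ i, (japanese ((2 * Real.pi) • ξ) ^ s)⁻¹ •
        ((japanese ((2 * Real.pi) • ξ) ^ s) • (f (ns i) - g : Fn d) ξ) = f (ns i) ξ - g ξ := by
      intro i
      rw [inv_smul_smul₀ (Real.rpow_pos_of_pos (japanese_pos _) s).ne', h2 i, Pi.sub_apply]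
    simp only [h4, smul_zero] at h3
    have h5 := h3.add_const (g ξ)
    simpa using h5
  filter_upwards [hlim, ae_neg hlim, ae_all_iff.2 (fun i => hf (ns i))] with ξ h1 h2 h3
  simp only [h3] at h2
  exact tendsto_nhds_unique h2 ((continuous_star.tendsto _).comp h1)

theorem hsNorm_le_hsNormVec {ι : Type} [Fintype ι] (s : ℝ) (v : ι → Fn d) (j : ι) :
    hsNorm s (v j) ≤ hsNormVec s v := by
  unfold hsNorm hsNormVec
  refine eLpNorm_mono (fun ξ => ?_)
  rw [norm_smul, norm_smul]
  refine mul_le_mul_of_nonneg_left ?_ (norm_nonneg _)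
  exact PiLp.norm_apply_le (WithLp.toLp 2 (fun j => v j ξ) : EuclideanSpace ℂ ι) j

theorem XSpace.enorm_eq {P : AdmissiblePair d} {s : ℝ} (U : XSpace P s) :
    ENNReal.ofReal ‖U‖ = xNorm P s (U : State d) :=
  ENNReal.ofReal_toReal (XSpace.xNorm_lt_top U).ne

theorem eLpNorm_vec_sub (P : AdmissiblePair d) (s : ℝ) (U V : State d) :
    eLpNorm ((fun ξ => (japanese ((2 * Real.pi) • ξ) ^ s) •
      (WithLp.toLp 2 (fun j => (P.op₁ (U.2 j)) ξ) : EuclideanSpace ℂ (Fin d))) -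
      (fun ξ => (japanese ((2 * Real.pi) • ξ) ^ s) •
      (WithLp.toLp 2 (fun j => (P.op₁ (V.2 j)) ξ) : EuclideanSpace ℂ (Fin d)))) 2 volume =
    hsNormVec s (fun j => P.op₁ ((U - V).2 j)) := by
  unfold hsNormVec
  refine eLpNorm_congr_ae ?_
  have h0 : ∀ j, P.op₁ ((U - V).2 j) = P.op₁ (U.2 j) - P.op₁ (V.2 j) := by
    intro j
    have h1 : P.op₁ ((U - V).2 j) + P.op₁ (V.2 j) = P.op₁ (U.2 j) := by
      rw [← P.op₁_add]
      congr 1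
      exact sub_add_cancel (U.2 j) (V.2 j)
    exact eq_sub_of_add_eq h1
  filter_upwards [ae_all_iff.2 (fun j => AEEqFun.coeFn_sub (P.op₁ (U.2 j)) (P.op₁ (V.2 j)))]
    with ξ h
  ext j
  have h2 : (P.op₁ ((U - V).2 j) : Sp d → ℂ) ξ =
      (P.op₁ (U.2 j) : Sp d → ℂ) ξ - (P.op₁ (V.2 j) : Sp d → ℂ) ξ := by
    rw [h0 j, h j, Pi.sub_apply]
  simp only [Pi.sub_apply, PiLp.sub_apply, PiLp.smul_apply, h2, smul_sub]

theorem eLpNorm_scal_sub (s : ℝ) (f g : Fn d) :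
    eLpNorm ((fun ξ => (japanese ((2 * Real.pi) • ξ) ^ s) • f ξ) -
      (fun ξ => (japanese ((2 * Real.pi) • ξ) ^ s) • g ξ)) 2 volume = hsNorm s (f - g) := by
  unfold hsNorm
  refine eLpNorm_congr_ae ?_
  filter_upwards [AEEqFun.coeFn_sub f g] with ξ h
  simp [h, mul_sub]

/-- `X^s` is a Banach space (so that Bochner integrals with values in it are meaningful). -/
instance XSpace.instCompleteSpace (P : AdmissiblePair d) (s : ℝ) :
    CompleteSpace (XSpace P s) := by
  refine Metric.complete_of_cauchySeq_tendsto fun u hu => ?_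
  have hM1 : ∀ n, MemLp (fun ξ => (japanese ((2 * Real.pi) • ξ) ^ s) • (u n : State d).1 ξ) 2
      volume := fun n => ⟨aesm_hs s _, (self_le_add_right (hsNorm s (u n : State d).1)
        (hsNormVec s (fun j => P.op₁ ((u n : State d).2 j)))).trans_lt
          (XSpace.xNorm_lt_top (u n))⟩
  have hM2 : ∀ n, MemLp (fun ξ => (japanese ((2 * Real.pi) • ξ) ^ s) •
      (WithLp.toLp 2 (fun j => (P.op₁ ((u n : State d).2 j)) ξ) : EuclideanSpace ℂ (Fin d))) 2
      volume := fun n => ⟨aesm_hsVec s _, (self_le_add_left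
        (hsNormVec s (fun j => P.op₁ ((u n : State d).2 j))) (hsNorm s (u n : State d).1)).trans_lt
          (XSpace.xNorm_lt_top (u n))⟩
  let a : ℕ → Lp ℂ 2 (volume : Measure (Sp d)) := fun n => (hM1 n).toLp _
  let b : ℕ → Lp (EuclideanSpace ℂ (Fin d)) 2 (volume : Measure (Sp d)) := fun n =>
    (hM2 n).toLp _
  have hX : ∀ n m, edist (u n) (u m) = xNorm P s ((u n : State d) - (u m : State d)) := by
    intro n m
    rw [edist_dist, dist_eq_norm, XSpace.enorm_eq]; rfl
  have hu' := EMetric.cauchySeq_iff.1 hu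
  have ha : CauchySeq a := EMetric.cauchySeq_iff.2 fun e he => by
    obtain ⟨N, hN⟩ := hu' e he
    refine ⟨N, fun m hm n hn => lt_of_le_of_lt ?_ (hN m hm n hn)⟩
    rw [hX]
    change edist ((hM1 m).toLp _) ((hM1 n).toLp _) ≤ _
    rw [Lp.edist_toLp_toLp, eLpNorm_scal_sub]
    exact self_le_add_right _ _
  have hb : CauchySeq b := EMetric.cauchySeq_iff.2 fun e he => by
    obtain ⟨N, hN⟩ := hu' e he
    refine ⟨N, fun m hm n hn => lt_of_le_of_lt ?_ (hN m hm n hn)⟩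
    rw [hX]
    change edist ((hM2 m).toLp _) ((hM2 n).toLp _) ≤ _
    rw [Lp.edist_toLp_toLp, eLpNorm_vec_sub]
    exact self_le_add_left _ _
  obtain ⟨A, hA⟩ := cauchySeq_tendsto_of_complete ha
  obtain ⟨B, hB⟩ := cauchySeq_tendsto_of_complete hb
  have hwc : Continuous (fun ξ : Sp d => (japanese ((2 * Real.pi) • ξ) ^ s)⁻¹) :=
    (continuous_weight s).inv₀ (fun ξ => (Real.rpow_pos_of_pos (japanese_pos _) s).ne')
  have hGm : AEStronglyMeasurable (fun ξ : Sp d => (P.G₁ ((2 * Real.pi) • ξ))⁻¹) volume :=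
    ((P.meas₁.comp_quasiMeasurePreserving
      (Measure.quasiMeasurePreserving_smul volume
        (by positivity : (2 * Real.pi : ℝ) ≠ 0))).aemeasurable.inv).aestronglyMeasurable
  have hBm : ∀ j : Fin d, AEStronglyMeasurable (fun ξ => B ξ j) volume := fun j =>
    (PiLp.continuous_apply 2 (fun _ : Fin d => ℂ) j).comp_aestronglyMeasurable
      (Lp.aestronglyMeasurable B)
  have hUm1 : AEStronglyMeasurable
      (fun ξ => (japanese ((2 * Real.pi) • ξ) ^ s)⁻¹ • A ξ) volume :=
    hwc.aestronglyMeasurable.smul (Lp.aestronglyMeasurable A)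
  have hUm2 : ∀ j : Fin d, AEStronglyMeasurable (fun ξ => (P.G₁ ((2 * Real.pi) • ξ))⁻¹ •
      ((japanese ((2 * Real.pi) • ξ) ^ s)⁻¹ • B ξ j)) volume := fun j =>
    hGm.smul (hwc.aestronglyMeasurable.smul (hBm j))
  let U : State d := (AEEqFun.mk _ hUm1, fun j => AEEqFun.mk _ (hUm2 j))
  have e1 : ∀ n, hsNorm s ((u n : State d).1 - U.1) = edist (a n) A := by
    intro n
    rw [Lp.edist_def, ← eLpNorm_scal_sub]
    refine eLpNorm_congr_ae ?_
    filter_upwards [(hM1 n).coeFn_toLp,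
      AEEqFun.coeFn_mk _ hUm1] with ξ h1 h2
    rw [Pi.sub_apply, Pi.sub_apply, h1, h2,
      smul_inv_smul₀ (Real.rpow_pos_of_pos (japanese_pos _) s).ne']
  have e2 : ∀ n, hsNormVec s (fun j => P.op₁ (((u n : State d) - U).2 j)) = edist (b n) B := by
    intro n
    rw [Lp.edist_def, ← eLpNorm_vec_sub]
    refine eLpNorm_congr_ae ?_
    filter_upwards [(hM2 n).coeFn_toLp,
      ae_all_iff.2 (fun j => AEEqFun.coeFn_mk _ (hUm2 j)),
      ae_all_iff.2 (fun j => coeFn_fourierMult _ (aesm_symbol P.meas₁) (U.2 j))] with ξ h1 h2 h3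
    rw [Pi.sub_apply, Pi.sub_apply, h1]
    congr 1
    ext j
    have h4 : (P.op₁ (U.2 j) : Sp d → ℂ) ξ =
        (japanese ((2 * Real.pi) • ξ) ^ s)⁻¹ • B ξ j := by
      refine (h3 j).trans ?_
      change _ * (AEEqFun.mk _ (hUm2 j) : Sp d → ℂ) ξ = _
      rw [h2 j, ← Complex.real_smul, smul_inv_smul₀ (P.pos₁ _).ne']
    rw [PiLp.smul_apply]
    change _ • (P.op₁ (U.2 j) : Sp d → ℂ) ξ = _
    rw [h4, smul_inv_smul₀ (Real.rpow_pos_of_pos (japanese_pos _) s).ne']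
  have hA' := (tendsto_iff_edist_tendsto_0.1 hA)
  have hB' := (tendsto_iff_edist_tendsto_0.1 hB)
  have hlim : Filter.Tendsto (fun n => xNorm P s ((u n : State d) - U)) Filter.atTop (nhds 0) := by
    have h := hA'.add hB'
    rw [add_zero] at h
    refine h.congr fun n => ?_
    rw [← e1, ← e2]; rfl
  have hr1 : U.1.IsReal := Fn.IsReal.of_tendsto (s := s) (f := fun n => (u n : State d).1)
    (fun n => (u n).2.1) (hA'.congr fun n => (e1 n).symm)
  have hr2 : ∀ j, (P.op₁ (U.2 j)).IsReal := by
    intro j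
    refine Fn.IsReal.of_tendsto (s := s) (f := fun n => P.op₁ ((u n : State d).2 j)) ?_ ?_
    · intro n
      have h1 : ((u n : State d).2 j).IsReal := (u n).2.2.1 j
      filter_upwards [h1, coeFn_fourierMult _ (aesm_symbol P.meas₁) ((u n : State d).2 j),
        ae_neg (coeFn_fourierMult _ (aesm_symbol P.meas₁) ((u n : State d).2 j))] with ξ h1 h2 h3
      unfold AdmissiblePair.op₁
      rw [h2, h3, h1, smul_neg, P.even₁]
      simp
    · refine tendsto_of_tendsto_of_tendsto_of_le_of_le tendsto_const_nhds hB'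
        (fun _ => zero_le) (fun n => ?_)
      rw [← e2]
      refine le_trans (le_of_eq ?_) (hsNorm_le_hsNormVec s _ j)
      congr 1
      refine (eq_sub_of_add_eq ?_).symm
      rw [← P.op₁_add]
      congr 1
      exact sub_add_cancel ((u n : State d).2 j) (U.2 j)
  have hr3 : ∀ j, (U.2 j).IsReal := by
    intro j
    filter_upwards [hr2 j, coeFn_fourierMult _ (aesm_symbol P.meas₁) (U.2 j),
      ae_neg (coeFn_fourierMult _ (aesm_symbol P.meas₁) (U.2 j))] with ξ h1 h2 h3
    unfold AdmissiblePair.op₁ at h1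
    rw [h2, h3, smul_neg, P.even₁] at h1
    have hne : ((P.G₁ ((2 * Real.pi) • ξ) : ℝ) : ℂ) ≠ 0 := by exact_mod_cast (P.pos₁ _).ne'
    apply mul_left_cancel₀ hne
    rw [h1]
    simp
  have hfin : xNorm P s U < ⊤ := by
    obtain ⟨n, hn⟩ := (hlim.eventually (gt_mem_nhds (zero_lt_one (α := ℝ≥0∞)))).exists
    have h1 : U = (u n : State d) + (-1 : ℝ) • ((u n : State d) - U) := by
      rw [neg_one_smul ℝ ((u n : State d) - U)]; abel
    rw [h1]
    refine (xNorm_add P s _ _).trans_lt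
      (ENNReal.add_lt_top.2 ⟨XSpace.xNorm_lt_top (u n), ?_⟩)
    rw [xNorm_smul]
    exact ENNReal.mul_lt_top (by simp) (hn.trans ENNReal.one_lt_top)
  refine ⟨⟨U, hr1, hr3, hfin⟩, tendsto_iff_edist_tendsto_0.2 (hlim.congr fun n => ?_)⟩
  rw [edist_dist, dist_eq_norm, XSpace.enorm_eq]; rfl

end complete

/-! ### Functions of time -/

/-- The time interval `[0, T/ε]`, which is `[0, ∞)` when `ε = 0`. -/
def timeInterval (T ε : ℝ) : Set ℝ := {t | 0 ≤ t ∧ ε * t ≤ T}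

/-- `U ∈ L^∞(I, X^s)`. -/
def MemLinf {d : ℕ} (P : AdmissiblePair d) (s : ℝ) (I : Set ℝ) (U : ℝ → State d) : Prop :=
  ∃ u : ℝ → XSpace P s, MemLp u ⊤ (volume.restrict I) ∧
    ∀ᵐ t ∂(volume.restrict I), (u t : State d) = U t

/-- `|U|_{L^∞(I, X^s)}`. -/
def linfNorm {d : ℕ} (P : AdmissiblePair d) (s : ℝ) (I : Set ℝ) (U : ℝ → State d) : ℝ :=
  (essSup (fun t => xNorm P s (U t)) (volume.restrict I)).toReal

/-- `U ∈ C^0(I, X^s)`. -/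
def MemC0 {d : ℕ} (P : AdmissiblePair d) (s : ℝ) (I : Set ℝ) (U : ℝ → State d) : Prop :=
  ∃ u : ℝ → XSpace P s, ContinuousOn u I ∧ ∀ t ∈ I, (u t : State d) = U t

/-- On the interval `I ∋ 0`, the function `U` is (the absolutely continuous representative of) a
locally integrable function with values in `X^s` whose weak derivative `∂_t U` is the locally
integrable function `V` with values in `X^s`. -/
def HasTimeDeriv {d : ℕ} (P : AdmissiblePair d) (s : ℝ) (I : Set ℝ) (U V : ℝ → State d) : Prop :=
  ∃ u v : ℝ → XSpace P s, (∀ t ∈ I, (u t : State d) = U t) ∧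
    (∀ᵐ t ∂(volume.restrict I), (v t : State d) = V t) ∧
    ∀ t ∈ I, IntervalIntegrable v volume 0 t ∧ u t = u 0 + ∫ τ in (0 : ℝ)..t, v τ

/-- `U ∈ W^{1,∞}(I, X^s)` with `∂_t U = V`. -/
def MemW1inf {d : ℕ} (P : AdmissiblePair d) (s : ℝ) (I : Set ℝ) (U V : ℝ → State d) : Prop :=
  MemLinf P s I U ∧ MemLinf P s I V ∧ HasTimeDeriv P s I U V

/-- Non-cavitation: `1 + ε ζ(t,x) ≥ h` for all `(t,x) ∈ I × ℝ^d`. -/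
def NonCavitation {d : ℕ} (ε h : ℝ) (I : Set ℝ) (U : ℝ → State d) : Prop :=
  ∀ t ∈ I, ∀ x : Sp d, h ≤ 1 + ε * ((U t).1.toPhys x).re

/-! ### The linearized system -/

/-- The operator `A_j(U̲)[W]`, for `U̲ = (ζ̲, v̲)` and `W = (η, w)`: its first component is
`ε G₂[G₂[v̲_j] η] + G₁²[w_j] + ε G₂[ζ̲ G₂[w_j]]`, and its `i`-th velocity component is
`δ_{ij} η + ε G₂[v̲_j] G₂[w_i]`. -/
def AdmissiblePair.A {d : ℕ} (P : AdmissiblePair d) (ε : ℝ) (j : Fin d) (Ub W : State d) :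
    State d :=
  (ε • P.op₂ (Fn.prod (P.op₂ (Ub.2 j)) W.1) + P.op₁ (P.op₁ (W.2 j)) +
      ε • P.op₂ (Fn.prod Ub.1 (P.op₂ (W.2 j))),
    fun i => (if i = j then W.1 else 0) + ε • Fn.prod (P.op₂ (Ub.2 j)) (P.op₂ (W.2 i)))

/-- `U ∈ C^0([0,T/ε], X^s)` solves `∂_t U + ∑_j A_j(U̲)[∂_j U] = ε R`, `U|_{t=0} = U₀`. -/
def IsSolution {d : ℕ} (P : AdmissiblePair d) (s T ε : ℝ) (Ub R : ℝ → State d) (U₀ : State d)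
    (U : ℝ → State d) : Prop :=
  MemC0 P s (timeInterval T ε) U ∧
  HasTimeDeriv P (s - 1) (timeInterval T ε) U
    (fun t => ε • R t - ∑ j, P.A ε j (Ub t) (State.deriv j (U t))) ∧
  U 0 = U₀

end

noncomputable section

/-- Convolution of functions with values in `[0,∞]`. -/
def convE {d : ℕ} (u v : Sp d → ℝ≥0∞) (ξ : Sp d) : ℝ≥0∞ := ∫⁻ η, u (ξ - η) * v η

/-- Convolution of complex valued functions. -/
def convF {d : ℕ} (a f : Sp d → ℂ) (ξ : Sp d) : ℂ := ∫ η, a (ξ - η) * f η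

/-- Square integrable functions. -/
abbrev L2Sp (d : ℕ) : Type := Lp ℂ 2 (volume : Measure (Sp d))

/-- Integrable functions. -/
abbrev L1Sp (d : ℕ) : Type := Lp ℂ 1 (volume : Measure (Sp d))

section convolution

variable {d : ℕ}

theorem aemeasurable_convE_integrand {u v : Sp d → ℝ≥0∞} (hu : AEMeasurable u volume)
    (hv : AEMeasurable v volume) :
    AEMeasurable (fun z : Sp d × Sp d => u (z.1 - z.2) * v z.2) (volume.prod volume) :=
  (hu.comp_quasiMeasurePreserving (quasiMeasurePreserving_sub volume volume)).mul
    (hv.comp_quasiMeasurePreserving Measure.quasiMeasurePreserving_snd)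

theorem aemeasurable_convE {u v : Sp d → ℝ≥0∞} (hu : AEMeasurable u volume)
    (hv : AEMeasurable v volume) : AEMeasurable (convE u v) volume :=
  (aemeasurable_convE_integrand hu hv).lintegral_prod_right'

theorem convE_comm (u v : Sp d → ℝ≥0∞) : convE u v = convE v u := by
  funext ξ
  unfold convE
  rw [← lintegral_sub_left_eq_self (fun η => v (ξ - η) * u η) ξ]
  simp [mul_comm]

theorem lintegral_convE {u v : Sp d → ℝ≥0∞} (hu : AEMeasurable u volume)
    (hv : AEMeasurable v volume) : ∫⁻ ξ, convE u v ξ = (∫⁻ ξ, u ξ) * ∫⁻ ξ, v ξ := by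
  unfold convE
  rw [lintegral_lintegral_swap (aemeasurable_convE_integrand hu hv)]
  have h : ∀ η : Sp d, ∫⁻ ξ, u (ξ - η) * v η = (∫⁻ ξ, u ξ) * v η := by
    intro η
    have hu' : AEMeasurable (fun ξ => u (ξ - η)) volume := hu.comp_quasiMeasurePreserving
      (measurePreserving_sub_right volume η).quasiMeasurePreserving
    rw [lintegral_mul_const'' _ hu']
    rw [lintegral_sub_right_eq_self u η]
  simp only [h]
  rw [lintegral_const_mul'' _ hv]

theorem convE_sq_le {u v : Sp d → ℝ≥0∞} (hu : AEMeasurable u volume)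
    (hv : AEMeasurable v volume) (ξ : Sp d) :
    convE u v ξ ^ (2 : ℝ) ≤ (∫⁻ ξ, u ξ) * convE u (fun η => v η ^ (2 : ℝ)) ξ := by
  have hu' : AEMeasurable (fun η => u (ξ - η)) volume :=
    hu.comp_quasiMeasurePreserving (quasiMeasurePreserving_sub_left volume ξ)
  have h := ENNReal.lintegral_mul_le_Lp_mul_Lq volume Real.HolderConjugate.two_two
    (hu'.pow_const (1 / 2 : ℝ)) ((hu'.pow_const (1 / 2 : ℝ)).mul hv)
  have e1 : ∀ η, (u (ξ - η) ^ (1 / 2 : ℝ)) ^ (2 : ℝ) = u (ξ - η) := fun η => by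
    rw [← ENNReal.rpow_mul]; norm_num
  have e2 : ∀ η, u (ξ - η) ^ (1 / 2 : ℝ) * (u (ξ - η) ^ (1 / 2 : ℝ) * v η) =
      u (ξ - η) * v η := fun η => by
    rw [← mul_assoc, ← ENNReal.rpow_add_of_nonneg _ _ (by norm_num) (by norm_num)]; norm_num
  simp only [Pi.mul_apply, e1, e2, ENNReal.mul_rpow_of_nonneg _ _ (zero_le_two (α := ℝ))] at h
  rw [lintegral_sub_left_eq_self (fun η => u η) ξ] at h
  unfold convE
  calc _ ≤ ((∫⁻ η, u η) ^ (1 / 2 : ℝ) *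
        (∫⁻ η, u (ξ - η) * v η ^ (2 : ℝ)) ^ (1 / 2 : ℝ)) ^ (2 : ℝ) :=
        ENNReal.rpow_le_rpow h (by norm_num)
    _ = _ := by
      rw [ENNReal.mul_rpow_of_nonneg _ _ (by norm_num), ← ENNReal.rpow_mul, ← ENNReal.rpow_mul]
      norm_num

theorem eLpNorm_two_eq {α ε : Type*} [MeasurableSpace α] [ENorm ε] {μ : Measure α} (f : α → ε) :
    eLpNorm f 2 μ = (∫⁻ x, ‖f x‖ₑ ^ (2 : ℝ) ∂μ) ^ (1 / 2 : ℝ) := by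
  rw [eLpNorm_eq_lintegral_rpow_enorm_toReal (by norm_num) (by norm_num)]; simp

/-- Young's inequality `L¹ * L² ⊆ L²`. -/
theorem eLpNorm_convE_le {u v : Sp d → ℝ≥0∞} (hu : AEMeasurable u volume)
    (hv : AEMeasurable v volume) :
    eLpNorm (convE u v) 2 volume ≤ eLpNorm u 1 volume * eLpNorm v 2 volume := by
  rw [eLpNorm_one_eq_lintegral_enorm, eLpNorm_two_eq, eLpNorm_two_eq]
  simp only [enorm_eq_self]
  calc _ ≤ (∫⁻ ξ, (∫⁻ ξ, u ξ) * convE u (fun η => v η ^ (2 : ℝ)) ξ) ^ (1 / 2 : ℝ) :=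
        ENNReal.rpow_le_rpow (lintegral_mono (convE_sq_le hu hv)) (by norm_num)
    _ = (((∫⁻ ξ, u ξ) ^ (2 : ℝ)) * ∫⁻ ξ, v ξ ^ (2 : ℝ)) ^ (1 / 2 : ℝ) := by
      rw [lintegral_const_mul'' _ (aemeasurable_convE hu (hv.pow_const 2)),
        lintegral_convE hu (hv.pow_const 2), ← mul_assoc, ENNReal.rpow_two, sq]
    _ = _ := by
      rw [ENNReal.mul_rpow_of_nonneg _ _ (by norm_num), ← ENNReal.rpow_mul]
      norm_num

theorem aesm_convF_integrand {a f : Sp d → ℂ} (ha : AEStronglyMeasurable a volume)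
    (hf : AEStronglyMeasurable f volume) :
    AEStronglyMeasurable (fun z : Sp d × Sp d => a (z.1 - z.2) * f z.2) (volume.prod volume) :=
  (ha.comp_quasiMeasurePreserving (quasiMeasurePreserving_sub volume volume)).mul
    (hf.comp_quasiMeasurePreserving Measure.quasiMeasurePreserving_snd)

theorem aesm_convF {a f : Sp d → ℂ} (ha : AEStronglyMeasurable a volume)
    (hf : AEStronglyMeasurable f volume) : AEStronglyMeasurable (convF a f) volume :=
  (aesm_convF_integrand ha hf).integral_prod_right'

theorem enorm_convF_le (a f : Sp d → ℂ) (ξ : Sp d) :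
    ‖convF a f ξ‖ₑ ≤ convE (fun η => ‖a η‖ₑ) (fun η => ‖f η‖ₑ) ξ := by
  refine (enorm_integral_le_lintegral_enorm _).trans_eq ?_
  simp [convE]

theorem eLpNorm_convF_le {a f : Sp d → ℂ} (ha : AEStronglyMeasurable a volume)
    (hf : AEStronglyMeasurable f volume) :
    eLpNorm (convF a f) 2 volume ≤ eLpNorm a 1 volume * eLpNorm f 2 volume := by
  refine (eLpNorm_mono_enorm_ae (g := convE (fun η => ‖a η‖ₑ) (fun η => ‖f η‖ₑ))
    (.of_forall fun ξ => enorm_convF_le a f ξ)).trans ?_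
  refine (eLpNorm_convE_le ha.enorm hf.enorm).trans_eq ?_
  rw [eLpNorm_one_eq_lintegral_enorm, eLpNorm_two_eq, eLpNorm_one_eq_lintegral_enorm,
    eLpNorm_two_eq]
  simp

theorem eLpNorm_enorm_fn {f : Sp d → ℂ} (p : ℝ≥0∞) :
    eLpNorm (fun ξ => ‖f ξ‖ₑ) p volume = eLpNorm f p volume :=
  eLpNorm_congr_enorm_ae (.of_forall fun _ => by simp)

/-- The convolution integral of an integrable and a square integrable function converges. -/
theorem ae_integrable_convF {a f : Sp d → ℂ} (ha : MemLp a 1 volume) (hf : MemLp f 2 volume) :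
    ∀ᵐ ξ, Integrable (fun η => a (ξ - η) * f η) volume := by
  have h1 := eLpNorm_convE_le (u := fun η => ‖a η‖ₑ) (v := fun η => ‖f η‖ₑ)
    ha.1.enorm hf.1.enorm
  rw [eLpNorm_enorm_fn, eLpNorm_enorm_fn] at h1
  have h2 : eLpNorm (convE (fun η => ‖a η‖ₑ) (fun η => ‖f η‖ₑ)) 2 volume < ⊤ :=
    h1.trans_lt (ENNReal.mul_lt_top ha.2 hf.2)
  rw [eLpNorm_two_eq, ENNReal.rpow_lt_top_iff_of_pos (by norm_num)] at h2
  have h3 := ae_lt_top' ((aemeasurable_convE ha.1.enorm hf.1.enorm).enorm.pow_const 2) h2.ne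
  filter_upwards [h3, (aesm_convF_integrand ha.1 hf.1).prodMk_left] with ξ h4 h5
  refine ⟨h5, ?_⟩
  rw [ENNReal.rpow_lt_top_iff_of_pos (by norm_num), enorm_eq_self] at h4
  refine (le_of_eq ?_).trans_lt h4
  simp [convE]

theorem convF_congr_ae {a a' f f' : Sp d → ℂ} (ha : a =ᵐ[volume] a') (hf : f =ᵐ[volume] f') :
    convF a f = convF a' f' := by
  funext ξ
  refine integral_congr_ae ?_
  filter_upwards [(quasiMeasurePreserving_sub_left volume ξ).ae ha, hf] with η h1 h2
  rw [h1, h2]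

theorem memLp_convF {a f : Sp d → ℂ} (ha : MemLp a 1 volume) (hf : MemLp f 2 volume) :
    MemLp (convF a f) 2 volume :=
  ⟨aesm_convF ha.1 hf.1, (eLpNorm_convF_le ha.1 hf.1).trans_lt (ENNReal.mul_lt_top ha.2 hf.2)⟩

/-- Convolution as a continuous bilinear map `L¹ × L² → L²`. -/
def convL (d : ℕ) : L1Sp d →L[ℂ] L2Sp d →L[ℂ] L2Sp d :=
  LinearMap.mkContinuous₂
    (LinearMap.mk₂ ℂ
      (fun a f => (memLp_convF (Lp.memLp a) (Lp.memLp f)).toLp _)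
      (fun a b f => by
        rw [← MemLp.toLp_add]
        refine MemLp.toLp_congr _ _ ?_
        rw [convF_congr_ae (Lp.coeFn_add a b) (ae_eq_refl f)]
        filter_upwards [ae_integrable_convF (Lp.memLp a) (Lp.memLp f),
          ae_integrable_convF (Lp.memLp b) (Lp.memLp f)] with ξ h1 h2
        simp only [convF, Pi.add_apply, add_mul]
        exact integral_add h1 h2)
      (fun c a f => by
        rw [← MemLp.toLp_const_smul]
        refine MemLp.toLp_congr _ _ ?_
        rw [convF_congr_ae (Lp.coeFn_smul c a) (ae_eq_refl f)]
        refine .of_forall fun ξ => ?_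
        simp only [convF, Pi.smul_apply, smul_mul_assoc]
        exact integral_smul _ _)
      (fun a f g => by
        rw [← MemLp.toLp_add]
        refine MemLp.toLp_congr _ _ ?_
        rw [convF_congr_ae (ae_eq_refl a) (Lp.coeFn_add f g)]
        filter_upwards [ae_integrable_convF (Lp.memLp a) (Lp.memLp f),
          ae_integrable_convF (Lp.memLp a) (Lp.memLp g)] with ξ h1 h2
        simp only [convF, Pi.add_apply, mul_add]
        exact integral_add h1 h2)
      (fun c a f => by
        rw [← MemLp.toLp_const_smul]
        refine MemLp.toLp_congr _ _ ?_
        rw [convF_congr_ae (ae_eq_refl a) (Lp.coeFn_smul c f)]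
        refine .of_forall fun ξ => ?_
        simp only [convF, Pi.smul_apply, mul_smul_comm]
        exact integral_smul _ _)) 1
    (fun a f => by
      rw [LinearMap.mk₂_apply, Lp.norm_toLp, one_mul, Lp.norm_def, Lp.norm_def,
        ← ENNReal.toReal_mul]
      exact ENNReal.toReal_mono (ENNReal.mul_lt_top (Lp.eLpNorm_lt_top a)
        (Lp.eLpNorm_lt_top f)).ne (eLpNorm_convF_le (Lp.memLp a).1 (Lp.memLp f).1))

theorem convL_coeFn (a : L1Sp d) (f : L2Sp d) : (convL d a f : Sp d → ℂ) =ᵐ[volume] convF a f :=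
  MemLp.coeFn_toLp (memLp_convF (Lp.memLp a) (Lp.memLp f))

theorem norm_convL_apply_le (a : L1Sp d) : ‖convL d a‖ ≤ ‖a‖ := by
  refine ((convL d).le_opNorm a).trans ?_
  refine (mul_le_mul_of_nonneg_right (LinearMap.mkContinuous₂_norm_le _ zero_le_one _)
    (norm_nonneg _)).trans_eq (one_mul _)

theorem convF_comm (a f : Sp d → ℂ) : convF a f = convF f a := by
  funext ξ
  unfold convF
  rw [← integral_sub_left_eq_self (fun η => f (ξ - η) * a η) volume ξ]
  simp [mul_comm]

end convolution

section multipliers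

variable {d : ℕ}

/-- A measurable, essentially bounded symbol. -/
def BddSym {d : ℕ} (m : Sp d → ℂ) : Prop :=
  AEStronglyMeasurable m volume ∧ ∃ C : ℝ, ∀ᵐ ξ, ‖m ξ‖ ≤ C

theorem BddSym.memLp_mul {m : Sp d → ℂ} (hm : BddSym m) {f : Sp d → ℂ} (hf : MemLp f 2 volume) :
    MemLp (fun ξ => m ξ * f ξ) 2 volume := by
  obtain ⟨C, hC⟩ := hm.2
  refine hf.of_le_mul (c := C) (hm.1.mul hf.1) ?_
  filter_upwards [hC] with ξ h
  rw [norm_mul]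
  exact mul_le_mul_of_nonneg_right h (norm_nonneg _)

theorem norm_toLp_mul_le {m : Sp d → ℂ} (hm : BddSym m) {C : ℝ} (hC : ∀ᵐ ξ, ‖m ξ‖ ≤ C)
    (f : L2Sp d) : ‖(hm.memLp_mul (Lp.memLp f)).toLp‖ ≤ C * ‖f‖ := by
  refine Lp.norm_le_mul_norm_of_ae_le_mul ?_
  filter_upwards [(hm.memLp_mul (Lp.memLp f)).coeFn_toLp, hC] with ξ h1 h2
  rw [h1, norm_mul]
  exact mul_le_mul_of_nonneg_right h2 (norm_nonneg _)

open Classical in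
/-- The Fourier multiplier with symbol `m`, as a bounded operator. -/
def multOp {d : ℕ} (m : Sp d → ℂ) : L2Sp d →L[ℂ] L2Sp d :=
  if hm : BddSym m then
    LinearMap.mkContinuous
      { toFun := fun f => (hm.memLp_mul (Lp.memLp f)).toLp
        map_add' := fun f g => by
          rw [← MemLp.toLp_add]
          refine MemLp.toLp_congr _ _ ?_
          filter_upwards [Lp.coeFn_add f g] with ξ h
          rw [h, Pi.add_apply, Pi.add_apply, mul_add]
        map_smul' := fun c f => by
          rw [RingHom.id_apply, ← MemLp.toLp_const_smul]
          refine MemLp.toLp_congr _ _ ?_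
          filter_upwards [Lp.coeFn_smul c f] with ξ h
          simp [h, mul_left_comm] } (Classical.choose hm.2)
      (fun f => norm_toLp_mul_le hm (Classical.choose_spec hm.2) f)
  else 0

theorem multOp_coeFn {m : Sp d → ℂ} (hm : BddSym m) (f : L2Sp d) :
    (multOp m f : Sp d → ℂ) =ᵐ[volume] fun ξ => m ξ * f ξ := by
  have h : multOp m f = (hm.memLp_mul (Lp.memLp f)).toLp := by
    simp [multOp, hm]
  rw [h]
  exact (hm.memLp_mul (Lp.memLp f)).coeFn_toLp

theorem norm_multOp_le {m : Sp d → ℂ} {C : ℝ} (hC0 : 0 ≤ C)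
    (hC : ∀ᵐ ξ, ‖m ξ‖ ≤ C) : ‖multOp m‖ ≤ C := by
  by_cases hm : BddSym m
  · refine ContinuousLinearMap.opNorm_le_bound _ hC0 fun f => ?_
    have h : multOp m f = (hm.memLp_mul (Lp.memLp f)).toLp := by
      simp [multOp, hm]
    rw [h]
    exact norm_toLp_mul_le hm hC f
  · simpa [multOp, hm] using hC0

theorem multOp_mul_multOp {m n : Sp d → ℂ} (hm : BddSym m) (hn : BddSym n) {l : Sp d → ℂ}
    (hl : BddSym l) (h : ∀ᵐ ξ, m ξ * n ξ = l ξ) : multOp m * multOp n = multOp l := by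
  ext1 f
  rw [mul_apply_eq_comp]
  refine Lp.ext ?_
  filter_upwards [multOp_coeFn hm (multOp n f), multOp_coeFn hn f, multOp_coeFn hl f, h]
    with ξ h1 h2 h3 h4
  rw [h1, h2, h3, ← h4, mul_assoc]

theorem BddSym.mul {m n : Sp d → ℂ} (hm : BddSym m) (hn : BddSym n) :
    BddSym (fun ξ => m ξ * n ξ) := by
  obtain ⟨C, hC⟩ := hm.2
  obtain ⟨D, hD⟩ := hn.2
  refine ⟨hm.1.mul hn.1, C * D, ?_⟩
  filter_upwards [hC, hD] with ξ h1 h2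
  rw [norm_mul]
  exact mul_le_mul h1 h2 (norm_nonneg _) ((norm_nonneg _).trans h1)

theorem multOp_commute {m n : Sp d → ℂ} (hm : BddSym m) (hn : BddSym n) :
    multOp m * multOp n = multOp n * multOp m := by
  rw [multOp_mul_multOp hm hn (hm.mul hn) (.of_forall fun _ => rfl),
    multOp_mul_multOp hn hm (hm.mul hn) (.of_forall fun _ => mul_comm _ _)]

theorem star_multOp {m n : Sp d → ℂ} (hm : BddSym m) (hn : BddSym n)
    (h : ∀ᵐ ξ, star (m ξ) = n ξ) : star (multOp m) = multOp n := by
  rw [ContinuousLinearMap.star_eq_adjoint]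
  symm
  rw [ContinuousLinearMap.eq_adjoint_iff]
  intro f g
  rw [L2.inner_def, L2.inner_def]
  refine integral_congr_ae ?_
  filter_upwards [multOp_coeFn hm g, multOp_coeFn hn f, h] with ξ h1 h2 h3
  rw [h1, h2, ← h3]
  simp only [RCLike.inner_apply, map_mul, RCLike.star_def, Complex.conj_conj]
  ring

/-- Convolution with a Hermitian function is self-adjoint. -/
theorem star_convL {a : L1Sp d} (ha : ∀ᵐ ξ, a (-ξ) = star (a ξ)) :
    star (convL d a) = convL d a := by
  rw [ContinuousLinearMap.star_eq_adjoint]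
  symm
  rw [ContinuousLinearMap.eq_adjoint_iff]
  intro f g
  rw [L2.inner_def, L2.inner_def]
  have e1 : ∫ ξ, inner ℂ (convL d a f ξ) (g ξ) =
      ∫ ξ, ∫ η, g ξ * (star (a (ξ - η)) * star (f η)) := by
    refine integral_congr_ae ?_
    filter_upwards [convL_coeFn a f] with ξ h
    rw [h, RCLike.inner_apply, convF, ← integral_conj, ← integral_const_mul]
    simp
  have e2 : ∫ ξ, inner ℂ (f ξ) (convL d a g ξ) =
      ∫ η, ∫ ξ, g ξ * (star (a (ξ - η)) * star (f η)) := by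
    refine integral_congr_ae ?_
    filter_upwards [convL_coeFn a g] with η h
    rw [h, RCLike.inner_apply, convF, mul_comm, ← integral_const_mul]
    refine integral_congr_ae ?_
    filter_upwards [(quasiMeasurePreserving_sub_left volume η).ae ha] with ξ h1
    rw [show η - ξ = -(ξ - η) by abel] at h1 ⊢
    rw [neg_neg] at h1
    rw [h1]
    simp only [RCLike.star_def, Complex.conj_conj]
    ring
  rw [e1, e2]
  refine integral_integral_swap ?_
  have hm := (continuous_star.comp_aestronglyMeasurable
    (aesm_convF_integrand (Lp.memLp a).1 (Lp.memLp f).1))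
  have hg : AEStronglyMeasurable (fun z : Sp d × Sp d => g z.1) (volume.prod volume) :=
    (Lp.memLp g).1.comp_quasiMeasurePreserving Measure.quasiMeasurePreserving_fst
  refine ⟨(hg.mul hm).congr (.of_forall fun z => ?_), ?_⟩
  · simp [Function.uncurry]
  have hE : AEMeasurable (fun z : Sp d × Sp d => ‖g z.1‖ₑ * (‖a (z.1 - z.2)‖ₑ * ‖f z.2‖ₑ))
      (volume.prod volume) :=
    hg.enorm.mul (aemeasurable_convE_integrand (Lp.memLp a).1.enorm (Lp.memLp f).1.enorm)
  have h1 : ∫⁻ z : Sp d × Sp d, ‖g z.1‖ₑ * (‖a (z.1 - z.2)‖ₑ * ‖f z.2‖ₑ) ∂(volume.prod volume) =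
      ∫⁻ ξ, ‖g ξ‖ₑ * convE (fun η => ‖a η‖ₑ) (fun η => ‖f η‖ₑ) ξ := by
    rw [lintegral_prod _ hE]
    refine lintegral_congr fun ξ => ?_
    simp only [convE]
    rw [lintegral_const_mul']
    exact enorm_ne_top
  have h2 := ENNReal.lintegral_mul_le_Lp_mul_Lq volume Real.HolderConjugate.two_two
    (Lp.memLp g).1.enorm (aemeasurable_convE (Lp.memLp a).1.enorm (Lp.memLp f).1.enorm)
  have h3 := eLpNorm_convE_le (u := fun η => ‖a η‖ₑ) (v := fun η => ‖f η‖ₑ)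
    (Lp.memLp a).1.enorm (Lp.memLp f).1.enorm
  rw [eLpNorm_enorm_fn, eLpNorm_enorm_fn, eLpNorm_two_eq] at h3
  have h4 := Lp.eLpNorm_lt_top g
  rw [eLpNorm_two_eq] at h4
  change ∫⁻ z : Sp d × Sp d, _ ∂(volume.prod volume) < ⊤
  refine (lintegral_mono_ae (.of_forall fun z => ?_)).trans_lt
    (h1.trans_lt (h2.trans_lt (ENNReal.mul_lt_top h4 (h3.trans_lt
      (ENNReal.mul_lt_top (Lp.eLpNorm_lt_top a) (Lp.eLpNorm_lt_top f))))))
  simp [Function.uncurry, enorm_mul]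

theorem convF_convF_ae {a b f : Sp d → ℂ} (ha : MemLp a 1 volume) (hb : MemLp b 1 volume)
    (hf : MemLp f 2 volume) : 
    ∀ᵐ ξ, convF a (convF b f) ξ = ∫ ζ, ∫ η, a (ξ - η) * (b (η - ζ) * f ζ) := by
  have hb' : MemLp (fun ξ => ‖b ξ‖) 1 volume := hb.norm
  have hf' : MemLp (fun ξ => ‖f ξ‖) 2 volume := hf.norm
  have hE : AEMeasurable (convE (fun η => ‖b η‖ₑ) (fun η => ‖f η‖ₑ)) volume :=
    aemeasurable_convE hb.1.enorm hf.1.enorm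
  have h3 : eLpNorm (convE (fun η => ‖a η‖ₑ) (convE (fun η => ‖b η‖ₑ) (fun η => ‖f η‖ₑ))) 2
      volume < ⊤ := by
    refine (eLpNorm_convE_le ha.1.enorm hE).trans_lt (ENNReal.mul_lt_top ?_
      ((eLpNorm_convE_le hb.1.enorm hf.1.enorm).trans_lt (ENNReal.mul_lt_top ?_ ?_)))
    · rw [eLpNorm_enorm_fn]; exact ha.2
    · rw [eLpNorm_enorm_fn]; exact hb.2
    · rw [eLpNorm_enorm_fn]; exact hf.2
  rw [eLpNorm_two_eq, ENNReal.rpow_lt_top_iff_of_pos (by norm_num)] at h3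
  have h4 := ae_lt_top' ((aemeasurable_convE ha.1.enorm hE).enorm.pow_const 2) h3.ne
  have ha2 : ∀ ξ : Sp d, AEStronglyMeasurable (fun η => a (ξ - η)) volume := fun ξ =>
    ha.1.comp_quasiMeasurePreserving (quasiMeasurePreserving_sub_left volume ξ)
  filter_upwards [h4] with ξ h5
  rw [ENNReal.rpow_lt_top_iff_of_pos (by norm_num), enorm_eq_self] at h5
  have hprod : AEStronglyMeasurable
      (fun z : Sp d × Sp d => a (ξ - z.1) * (b (z.1 - z.2) * f z.2)) (volume.prod volume) :=
    ((ha2 ξ).comp_quasiMeasurePreserving Measure.quasiMeasurePreserving_fst).mul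
      (aesm_convF_integrand hb.1 hf.1)
  have hint : Integrable (fun z : Sp d × Sp d => a (ξ - z.1) * (b (z.1 - z.2) * f z.2))
      (volume.prod volume) := by
    refine ⟨hprod, ?_⟩
    unfold HasFiniteIntegral
    rw [lintegral_prod _ hprod.enorm]
    refine (le_of_eq ?_).trans_lt h5
    unfold convE
    refine lintegral_congr fun η => ?_
    rw [← lintegral_const_mul' _ _ enorm_ne_top]
    simp
  calc convF a (convF b f) ξ = ∫ η, ∫ ζ, a (ξ - η) * (b (η - ζ) * f ζ) := by
        unfold convF
        simp_rw [integral_const_mul]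
    _ = ∫ ζ, ∫ η, a (ξ - η) * (b (η - ζ) * f ζ) := integral_integral_swap hint

theorem convL_commute (a b : L1Sp d) : convL d a * convL d b = convL d b * convL d a := by
  ext1 f
  rw [mul_apply_eq_comp, mul_apply_eq_comp]
  refine Lp.ext ?_
  filter_upwards [convL_coeFn a (convL d b f), convL_coeFn b (convL d a f),
    convF_convF_ae (Lp.memLp a) (Lp.memLp b) (Lp.memLp f),
    convF_convF_ae (Lp.memLp b) (Lp.memLp a) (Lp.memLp f)] with ξ h1 h2 h3 h4
  rw [h1, h2, convF_congr_ae (ae_eq_refl a) (convL_coeFn b f),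
    convF_congr_ae (ae_eq_refl b) (convL_coeFn a f), h3, h4]
  refine integral_congr_ae (.of_forall fun ζ => ?_)
  change ∫ η, a (ξ - η) * (b (η - ζ) * f ζ) = ∫ η, b (ξ - η) * (a (η - ζ) * f ζ)
  rw [← integral_sub_left_eq_self (fun η => b (ξ - η) * (a (η - ζ) * f ζ)) volume (ξ + ζ)]
  refine integral_congr_ae (.of_forall fun η => ?_)
  change a (ξ - η) * (b (η - ζ) * f ζ) =
    b (ξ - (ξ + ζ - η)) * (a (ξ + ζ - η - ζ) * f ζ)
  rw [show ξ - (ξ + ζ - η) = η - ζ by abel, show ξ + ζ - η - ζ = ξ - η by abel]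
  ring

/-- Pointwise bound of the commutator of a multiplier and a convolution. -/
theorem enorm_commutator_le {k q : Sp d → ℂ} (hk : BddSym k) (hq : BddSym q) (a : L1Sp d)
    (f : L2Sp d) :
    ∀ᵐ ξ, ‖((multOp k * convL d a - convL d a * multOp k) (multOp q f)) ξ‖ₑ ≤
      ∫⁻ η, ‖k ξ - k η‖ₑ * ‖q η‖ₑ * (‖a (ξ - η)‖ₑ * ‖f η‖ₑ) := by
  have hqf := hq.memLp_mul (Lp.memLp f)
  have hkqf := hk.memLp_mul hqf
  filter_upwards [Lp.coeFn_sub ((multOp k * convL d a) (multOp q f))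
      ((convL d a * multOp k) (multOp q f)),
    multOp_coeFn hk (convL d a (multOp q f)), convL_coeFn a (multOp q f),
    convL_coeFn a (multOp k (multOp q f)),
    ae_integrable_convF (Lp.memLp a) hqf, ae_integrable_convF (Lp.memLp a) hkqf]
    with ξ h1 h2 h3 h4 h5 h6
  have e : (multOp k (multOp q f) : Sp d → ℂ) =ᵐ[volume] fun ξ => k ξ * (q ξ * f ξ) := by
    filter_upwards [multOp_coeFn hk (multOp q f), multOp_coeFn hq f] with ξ g1 g2
    rw [g1, g2]
  rw [convF_congr_ae (ae_eq_refl a) (multOp_coeFn hq f)] at h3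
  rw [convF_congr_ae (ae_eq_refl a) e] at h4
  rw [sub_apply, h1, Pi.sub_apply, mul_apply_eq_comp,
    mul_apply_eq_comp, h2, h3, h4]
  have : k ξ * convF a (fun ξ => q ξ * f ξ) ξ - convF a (fun ξ => k ξ * (q ξ * f ξ)) ξ =
      ∫ η, (k ξ - k η) * q η * (a (ξ - η) * f η) := by
    unfold convF
    rw [← integral_const_mul, ← integral_sub (h5.const_mul _) h6]
    refine integral_congr_ae (.of_forall fun η => ?_)
    change k ξ * (a (ξ - η) * (q η * f η)) - a (ξ - η) * (k η * (q η * f η)) = _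
    ring
  rw [this]
  refine (enorm_integral_le_lintegral_enorm _).trans_eq ?_
  simp

/-- A commutator bound from a bound of the difference of the symbol. -/
theorem norm_commutator_le {k q : Sp d → ℂ} (hk : BddSym k) (hq : BddSym q) (a : L1Sp d)
    {c : Sp d → ℝ≥0∞} (hc : AEMeasurable c volume)
    (h : ∀ᵐ ξ, ∀ᵐ η, ‖k ξ - k η‖ₑ * ‖q η‖ₑ ≤ c (ξ - η))
    {C : ℝ} (hC0 : 0 ≤ C) (hC : ∫⁻ ξ, c ξ * ‖a ξ‖ₑ ≤ ENNReal.ofReal C) :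
    ‖(multOp k * convL d a - convL d a * multOp k) * multOp q‖ ≤ C := by
  refine ContinuousLinearMap.opNorm_le_bound _ hC0 fun f => ?_
  rw [← ENNReal.ofReal_le_ofReal_iff (by positivity), ENNReal.ofReal_mul hC0, ofReal_norm,
    ofReal_norm, Lp.enorm_def, Lp.enorm_def, mul_apply_eq_comp]
  have h1 := eLpNorm_convE_le (u := fun ξ => c ξ * ‖a ξ‖ₑ) (v := fun η => ‖f η‖ₑ)
    (hc.mul (Lp.memLp a).1.enorm) (Lp.memLp f).1.enorm
  rw [eLpNorm_enorm_fn, eLpNorm_one_eq_lintegral_enorm] at h1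
  simp only [enorm_eq_self] at h1
  refine le_trans ?_ (h1.trans (mul_le_mul_left hC _))
  refine eLpNorm_mono_enorm_ae ?_
  filter_upwards [enorm_commutator_le hk hq a f, h] with ξ h2 h3
  refine h2.trans ?_
  rw [enorm_eq_self]
  refine lintegral_mono_ae ?_
  filter_upwards [h3] with η h4
  rw [mul_assoc (c _)]
  exact mul_le_mul_left h4 _

end multipliers

section symbols

open scoped Convolution

variable {d : ℕ}

theorem SymbolBound.locallyIntegrable {G : Sp d → ℝ} {M : ℝ} (hG : SymbolBound G M)
    (hm : AEStronglyMeasurable G volume) : LocallyIntegrable G volume := by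
  have h : MemLp G ⊤ volume := memLp_top_of_bound hm M (by simpa using hG.1)
  exact h.locallyIntegrable le_top

theorem one_le_japanese (ξ : Sp d) : 1 ≤ japanese ξ := by
  unfold japanese
  rw [Real.one_le_sqrt]
  nlinarith [sq_nonneg ‖ξ‖]

theorem norm_le_japanese (ξ : Sp d) : ‖ξ‖ ≤ japanese ξ := by
  unfold japanese
  refine Real.le_sqrt_of_sq_le ?_
  linarith

/-- Mollifications of the symbol satisfy the derivative bound. -/
theorem SymbolBound.mollify_fderiv_le {G : Sp d → ℝ} {M : ℝ} (hG : SymbolBound G M)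
    (hm : AEStronglyMeasurable G volume) (φ : ContDiffBump (0 : Sp d)) :
    ∃ G' : Sp d → Sp d →L[ℝ] ℝ,
      (∀ x, HasFDerivAt (fun x => (φ.normed volume ⋆[ContinuousLinearMap.lsmul ℝ ℝ, volume] G) x)
        (G' x) x) ∧
      ∀ x (ρ : ℝ), 0 < ρ → ρ + φ.rOut ≤ ‖x‖ → ‖G' x‖ ≤ M / ρ := by
  obtain ⟨hGM, g, hgm, hg, hgG⟩ := hG
  have hM : 0 ≤ M := by
    obtain ⟨ξ, h⟩ := hGM.exists
    exact (abs_nonneg _).trans h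
  have hloc : LocallyIntegrable G volume := SymbolBound.locallyIntegrable ⟨hGM, g, hgm, hg, hgG⟩ hm
  have hcs := φ.hasCompactSupport_normed (μ := (volume : Measure (Sp d)))
  have hcd : ContDiff ℝ ∞ (φ.normed (volume : Measure (Sp d))) := φ.contDiff_normed
  let G' : Sp d → Sp d →L[ℝ] ℝ := fun x =>
    (G ⋆[(ContinuousLinearMap.lsmul ℝ ℝ).precompR (Sp d), volume]
      fderiv ℝ (φ.normed (volume : Measure (Sp d)))) x
  refine ⟨G', fun x => ?_, fun x ρ hρ hx => ?_⟩
  · have h := hcs.hasFDerivAt_convolution_right (ContinuousLinearMap.lsmul ℝ ℝ : ℝ →L[ℝ] ℝ →L[ℝ] ℝ)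
      hloc (hcd.of_le (by simp)) x
    refine h.congr_of_eventuallyEq (.of_forall fun y => ?_)
    change (φ.normed volume ⋆[ContinuousLinearMap.lsmul ℝ ℝ, volume] G) y = _
    rw [convolution_eq_swap]
    unfold convolution
    refine integral_congr_ae (.of_forall fun t => ?_)
    simp [mul_comm]
  · refine ContinuousLinearMap.opNorm_le_bound _ (by positivity) fun e => ?_
    have e1 : G' x e = ∫ t, G t * fderiv ℝ (φ.normed (volume : Measure (Sp d))) (x - t) e := by
      have h := convolution_precompR_apply (μ := (volume : Measure (Sp d)))
        (ContinuousLinearMap.lsmul ℝ ℝ : ℝ →L[ℝ] ℝ →L[ℝ] ℝ) hloc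
        (hcs.fderiv ℝ) (hcd.continuous_fderiv (by simp)) x e
      exact h
    have hψ : ContDiff ℝ ∞ (fun t => φ.normed (volume : Measure (Sp d)) (x - t)) :=
      hcd.comp (contDiff_const.sub contDiff_id)
    have hψc : HasCompactSupport (fun t => φ.normed (volume : Measure (Sp d)) (x - t)) :=
      hcs.comp_homeomorph (Homeomorph.subLeft x)
    have hψd : ∀ t, fderiv ℝ (fun t => φ.normed (volume : Measure (Sp d)) (x - t)) t e =
        - fderiv ℝ (φ.normed (volume : Measure (Sp d))) (x - t) e := by
      intro t
      have h1 := ((hcd.differentiable (by simp)) (x - t)).hasFDerivAt.comp t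
        ((hasFDerivAt_id t).const_sub x)
      have h2 : HasFDerivAt (fun t => φ.normed (volume : Measure (Sp d)) (x - t)) _ t := h1
      rw [h2.fderiv]
      simp
    have e2 : G' x e = ∫ t, inner ℝ (g t) e * φ.normed (volume : Measure (Sp d)) (x - t) := by
      have h := hgG _ hψ hψc e
      simp only [hψd, mul_neg, integral_neg, neg_inj] at h
      rw [e1, h]
    rw [e2]
    have hint : Integrable (fun t => φ.normed (volume : Measure (Sp d)) (x - t)) volume :=
      hψ.continuous.integrable_of_hasCompactSupport hψc
    have h3 : ∫ t, φ.normed (volume : Measure (Sp d)) (x - t) = 1 := by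
      rw [integral_sub_left_eq_self (fun t => φ.normed (volume : Measure (Sp d)) t) volume x]
      exact φ.integral_normed
    calc ‖∫ t, inner ℝ (g t) e * φ.normed (volume : Measure (Sp d)) (x - t)‖
        ≤ ∫ t, (M / ρ * ‖e‖) * φ.normed (volume : Measure (Sp d)) (x - t) := by
          refine norm_integral_le_of_norm_le (hint.const_mul _) ?_
          filter_upwards [hg] with t ht
          rw [norm_mul, Real.norm_of_nonneg (φ.nonneg_normed _)]
          by_cases hz : φ.normed (volume : Measure (Sp d)) (x - t) = 0
          · simp [hz]
          refine mul_le_mul_of_nonneg_right ?_ (φ.nonneg_normed _)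
          refine (norm_inner_le_norm _ _).trans (mul_le_mul_of_nonneg_right ?_ (norm_nonneg _))
          have hs : x - t ∈ Function.support (φ.normed (volume : Measure (Sp d))) := hz
          rw [φ.support_normed_eq, mem_ball_zero_iff] at hs
          have h4 : ρ ≤ ‖t‖ := by
            have := norm_le_norm_add_norm_sub' x t
            linarith
          rw [le_div_iff₀ hρ]
          calc ‖g t‖ * ρ ≤ ‖g t‖ * japanese t :=
                mul_le_mul_of_nonneg_left (h4.trans (norm_le_japanese t)) (norm_nonneg _)
            _ ≤ M := by rw [mul_comm]; exact ht
      _ = M / ρ * ‖e‖ := by rw [integral_const_mul, h3, mul_one]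

/-- The difference bound for symbols of order zero. -/
theorem SymbolBound.exists_full_set {G : Sp d → ℝ} {M : ℝ} (hG : SymbolBound G M)
    (hm : AEStronglyMeasurable G volume) :
    ∃ N : Set (Sp d), (∀ᵐ ξ, ξ ∈ N) ∧
      ∀ ξ ∈ N, ∀ η ∈ N, |G ξ - G η| * ‖η‖ ≤ 4 * M * ‖ξ - η‖ := by
  have hM : 0 ≤ M := by
    obtain ⟨ξ, h⟩ := hG.1.exists
    exact (abs_nonneg _).trans h
  let φ : ℕ → ContDiffBump (0 : Sp d) := fun n =>
    ⟨1 / ((n : ℝ) + 1), 2 / ((n : ℝ) + 1), by positivity, by gcongr; norm_num⟩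
  have hr : Filter.Tendsto (fun n => (φ n).rOut) Filter.atTop (nhds 0) := by
    have h := (tendsto_one_div_add_atTop_nhds_zero_nat (𝕜 := ℝ)).const_mul 2
    rw [mul_zero] at h
    refine h.congr fun n => ?_
    change 2 * (1 / ((n : ℝ) + 1)) = 2 / ((n : ℝ) + 1)
    ring
  have hlim := ContDiffBump.ae_convolution_tendsto_right_of_locallyIntegrable
    (μ := (volume : Measure (Sp d))) (φ := φ) (K := 2) hr
    (.of_forall fun n => le_of_eq (by
      change 2 / ((n : ℝ) + 1) = 2 * (1 / ((n : ℝ) + 1)); ring)) (hG.locallyIntegrable hm)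
  refine ⟨{ξ | |G ξ| ≤ M ∧ Filter.Tendsto (fun i =>
    ((φ i).normed volume ⋆[ContinuousLinearMap.lsmul ℝ ℝ, volume] G) ξ) Filter.atTop
      (nhds (G ξ))}, ?_, ?_⟩
  · filter_upwards [hG.1, hlim] with ξ h1 h2 using ⟨h1, h2⟩
  rintro ξ ⟨hξ1, hξ2⟩ η ⟨hη1, hη2⟩
  rcases le_or_gt (‖η‖ / 2) ‖ξ - η‖ with h | h
  · have h1 : |G ξ - G η| ≤ 2 * M := (abs_sub _ _).trans (by linarith)
    calc _ ≤ 2 * M * ‖η‖ := mul_le_mul_of_nonneg_right h1 (norm_nonneg _)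
      _ ≤ 2 * M * (2 * ‖ξ - η‖) := mul_le_mul_of_nonneg_left (by linarith) (by positivity)
      _ = _ := by ring
  · have hη0 : 0 < ‖η‖ := by
      have := norm_nonneg (ξ - η)
      linarith
    have key : ∀ᶠ n in Filter.atTop,
        ‖((φ n).normed volume ⋆[ContinuousLinearMap.lsmul ℝ ℝ, volume] G) ξ -
          ((φ n).normed volume ⋆[ContinuousLinearMap.lsmul ℝ ℝ, volume] G) η‖ ≤
          M / (‖η‖ / 4) * ‖ξ - η‖ := by
      filter_upwards [hr.eventually (gt_mem_nhds (show (0 : ℝ) < ‖η‖ / 4 by positivity))] with n hn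
      obtain ⟨G', hG1, hG2⟩ := hG.mollify_fderiv_le hm (φ n)
      refine Convex.norm_image_sub_le_of_norm_hasFDerivWithin_le
        (s := Metric.ball η (‖η‖ / 2)) (f' := G')
        (fun x _ => (hG1 x).hasFDerivWithinAt) (fun x hx => ?_) (convex_ball _ _)
        (Metric.mem_ball_self (by positivity)) (by rwa [mem_ball_iff_norm])
      refine hG2 x _ (by positivity) ?_
      rw [mem_ball_iff_norm] at hx
      have := norm_le_norm_add_norm_sub' η x
      rw [norm_sub_rev] at this
      linarith
    have h2 := le_of_tendsto ((hξ2.sub hη2).norm) key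
    rw [Real.norm_eq_abs] at h2
    calc _ ≤ M / (‖η‖ / 4) * ‖ξ - η‖ * ‖η‖ := mul_le_mul_of_nonneg_right h2 (norm_nonneg _)
      _ = _ := by field_simp

end symbols

section weights

variable {d : ℕ}

/-- The weight `⟨2πξ⟩`. -/
def jb {d : ℕ} (ξ : Sp d) : ℝ := japanese ((2 * Real.pi) • ξ)

theorem one_le_jb (ξ : Sp d) : 1 ≤ jb ξ := one_le_japanese _

theorem jb_pos (ξ : Sp d) : 0 < jb ξ := japanese_pos _

theorem continuous_jb : Continuous (jb (d := d)) :=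
  japanese_continuous.comp (continuous_const_smul _)

theorem jb_neg (ξ : Sp d) : jb (-ξ) = jb ξ := by simp [jb, japanese]

theorem two_pi_norm_le_jb (ξ : Sp d) : 2 * Real.pi * ‖ξ‖ ≤ jb ξ := by
  refine le_trans (le_of_eq ?_) (norm_le_japanese ((2 * Real.pi) • ξ))
  rw [norm_smul, Real.norm_of_nonneg (by positivity)]

theorem jb_le_add (ξ η : Sp d) : jb ξ ≤ jb η + 2 * Real.pi * ‖ξ - η‖ := by
  unfold jb japanese
  have h1 : ‖(2 * Real.pi) • ξ‖ ≤ ‖(2 * Real.pi) • η‖ + 2 * Real.pi * ‖ξ - η‖ := by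
    have h : (2 * Real.pi) • ξ = (2 * Real.pi) • η + (2 * Real.pi) • (ξ - η) := by
      rw [smul_sub]; abel
    rw [h]
    refine (norm_add_le _ _).trans_eq ?_
    rw [norm_smul _ (ξ - η), Real.norm_of_nonneg (by positivity : (0 : ℝ) ≤ 2 * Real.pi)]
  set x := ‖(2 * Real.pi) • ξ‖
  set y := ‖(2 * Real.pi) • η‖
  set z := 2 * Real.pi * ‖ξ - η‖
  have hx : 0 ≤ x := norm_nonneg _
  have hy : 0 ≤ y := norm_nonneg _
  have hz : 0 ≤ z := by positivity
  have hs := Real.sq_sqrt (show 0 ≤ 1 + y ^ 2 by positivity)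
  have hys : y ≤ Real.sqrt (1 + y ^ 2) := Real.le_sqrt_of_sq_le (by linarith)
  rw [Real.sqrt_le_left (by positivity)]
  nlinarith [mul_le_mul_of_nonneg_right hys hz]

theorem jb_le_add_jb (ξ η : Sp d) : jb ξ ≤ jb η + jb (ξ - η) :=
  (jb_le_add ξ η).trans (add_le_add_right (two_pi_norm_le_jb _) _)

theorem rpow_add_le {x y r : ℝ} (hx : 0 ≤ x) (hy : 0 ≤ y) (hr : 0 ≤ r) :
    (x + y) ^ r ≤ 2 ^ r * (x ^ r + y ^ r) := by
  have h1 : (x + y) ^ r ≤ (2 * max x y) ^ r :=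
    Real.rpow_le_rpow (by positivity) (by linarith [le_max_left x y, le_max_right x y]) hr
  refine h1.trans ?_
  rw [Real.mul_rpow (by norm_num) (by positivity)]
  refine mul_le_mul_of_nonneg_left ?_ (by positivity)
  rcases max_choice x y with h | h <;> rw [h]
  · linarith [Real.rpow_nonneg hy r]
  · linarith [Real.rpow_nonneg hx r]

theorem jb_rpow_le (r : ℝ) (hr : 0 ≤ r) (ξ η : Sp d) :
    jb ξ ^ r ≤ 2 ^ r * (jb (ξ - η) ^ r + jb η ^ r) := by
  refine (Real.rpow_le_rpow (jb_pos _).le (jb_le_add_jb ξ η) hr).trans ?_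
  rw [add_comm (jb η)]
  exact rpow_add_le (jb_pos _).le (jb_pos _).le hr

theorem rpow_sub_rpow_le {x y s : ℝ} (hy : 0 < y) (hxy : y ≤ x) (hs : 1 ≤ s) :
    x ^ s - y ^ s ≤ s * (x - y) * x ^ (s - 1) := by
  have hx : 0 < x := hy.trans_le hxy
  have h1 := one_add_mul_self_le_rpow_one_add (s := y / x - 1)
    (by have := div_nonneg hy.le hx.le; linarith) hs
  have h2 : (1 + (y / x - 1)) ^ s = y ^ s / x ^ s := by
    rw [add_sub_cancel, Real.div_rpow hy.le hx.le]
  rw [h2, le_div_iff₀ (Real.rpow_pos_of_pos hx s)] at h1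
  have h3 : x ^ s = x * x ^ (s - 1) := by
    rw [mul_comm, ← Real.rpow_add_one hx.ne']; simp
  have h4 : (1 + s * (y / x - 1)) * x ^ s = x ^ s - s * (x - y) * x ^ (s - 1) := by
    rw [h3]; field_simp; ring
  linarith

theorem abs_rpow_sub_rpow_le {x y s : ℝ} (hx : 0 < x) (hy : 0 < y) (hs : 1 ≤ s) :
    |x ^ s - y ^ s| ≤ s * |x - y| * (x ^ (s - 1) + y ^ (s - 1)) := by
  have hx' := Real.rpow_nonneg hx.le (s - 1)
  have hy' := Real.rpow_nonneg hy.le (s - 1)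
  have hs0 : (0 : ℝ) ≤ s := by linarith
  rcases le_total y x with h | h
  · rw [abs_of_nonneg (sub_nonneg.2 (Real.rpow_le_rpow hy.le h hs0)),
      abs_of_nonneg (sub_nonneg.2 h)]
    refine (rpow_sub_rpow_le hy h hs).trans (mul_le_mul_of_nonneg_left (by linarith) ?_)
    exact mul_nonneg hs0 (sub_nonneg.2 h)
  · rw [abs_sub_comm, abs_sub_comm x,
      abs_of_nonneg (sub_nonneg.2 (Real.rpow_le_rpow hx.le h hs0)),
      abs_of_nonneg (sub_nonneg.2 h)]
    refine (rpow_sub_rpow_le hx h hs).trans (mul_le_mul_of_nonneg_left (by linarith) ?_)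
    exact mul_nonneg hs0 (sub_nonneg.2 h)

/-- The commutator bound for the weight `⟨2πξ⟩^s`. -/
theorem abs_jb_rpow_sub_le {s : ℝ} (hs : 1 ≤ s) (ξ η : Sp d) :
    |jb ξ ^ s - jb η ^ s| * jb η ≤
      s * 2 ^ s * (jb (ξ - η) * jb η ^ s + jb (ξ - η) ^ s * jb η) := by
  have h0 := jb_pos η
  have h1 := jb_pos (ξ - η)
  have hd : |jb ξ - jb η| ≤ jb (ξ - η) := by
    rw [abs_le]
    have e1 := jb_le_add_jb ξ η
    have e2 := jb_le_add_jb η ξ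
    rw [← neg_sub ξ η, jb_neg] at e2
    constructor <;> linarith
  have e3 : jb η * jb η ^ (s - 1) = jb η ^ s := by
    rw [mul_comm, ← Real.rpow_add_one h0.ne']; simp
  have e4 : jb (ξ - η) * jb (ξ - η) ^ (s - 1) = jb (ξ - η) ^ s := by
    rw [mul_comm, ← Real.rpow_add_one h1.ne']; simp
  have h2 := jb_rpow_le (s - 1) (by linarith) ξ η
  have h5 : (2 : ℝ) ^ s = 2 * 2 ^ (s - 1) := by
    rw [mul_comm, ← Real.rpow_add_one (by norm_num)]; simp
  have h6 : (1 : ℝ) ≤ 2 ^ (s - 1) := Real.one_le_rpow (by norm_num) (by linarith)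
  have p1 := Real.rpow_nonneg h0.le (s - 1)
  have p2 := Real.rpow_nonneg h1.le (s - 1)
  calc |jb ξ ^ s - jb η ^ s| * jb η
      ≤ s * |jb ξ - jb η| * (jb ξ ^ (s - 1) + jb η ^ (s - 1)) * jb η :=
        mul_le_mul_of_nonneg_right (abs_rpow_sub_rpow_le (jb_pos _) h0 hs) h0.le
    _ ≤ s * jb (ξ - η) * (2 ^ s * (jb (ξ - η) ^ (s - 1) + jb η ^ (s - 1))) * jb η := by
        refine mul_le_mul_of_nonneg_right ?_ h0.le
        refine mul_le_mul (mul_le_mul_of_nonneg_left hd (by linarith)) ?_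
          (add_nonneg (Real.rpow_nonneg (jb_pos _).le _) p1)
          (mul_nonneg (by linarith) h1.le)
        rw [h5]
        nlinarith
    _ = s * 2 ^ s * (jb (ξ - η) * (jb η * jb η ^ (s - 1)) +
          jb (ξ - η) * jb (ξ - η) ^ (s - 1) * jb η) := by ring
    _ = _ := by rw [e3, e4]

/-- The constant of the embedding `H^r ⊆ FL¹`. -/
def sobolevConst (d : ℕ) (r : ℝ) : ℝ≥0∞ := eLpNorm (fun ξ : Sp d => jb ξ ^ (-r)) 2 volume

theorem sobolevConst_lt_top {r : ℝ} (hr : (d : ℝ) / 2 < r) : sobolevConst d r < ⊤ := by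
  unfold sobolevConst
  rw [eLpNorm_two_eq, ENNReal.rpow_lt_top_iff_of_pos (by norm_num)]
  have h := (integrable_rpow_neg_one_add_norm_sq (E := Sp d) (μ := volume) (r := 2 * r)
    (by rw [finrank_euclideanSpace_fin]; linarith))
  refine lt_of_le_of_lt (lintegral_mono fun ξ => ?_) h.2
  have hp : 0 < 1 + ‖ξ‖ ^ 2 := by positivity
  have h1 : Real.sqrt (1 + ‖ξ‖ ^ 2) ≤ jb ξ := by
    unfold jb japanese
    refine Real.sqrt_le_sqrt ?_
    rw [norm_smul, Real.norm_of_nonneg (by positivity : (0 : ℝ) ≤ 2 * Real.pi)]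
    have h2 : ‖ξ‖ ≤ 2 * Real.pi * ‖ξ‖ :=
      le_mul_of_one_le_left (norm_nonneg _) (by linarith [Real.pi_gt_three])
    gcongr
  have h0 : 0 ≤ r := le_trans (by positivity) hr.le
  have h3 : jb ξ ^ (-r) ≤ (1 + ‖ξ‖ ^ 2) ^ (-r / 2) := by
    rw [neg_div, Real.rpow_neg (jb_pos _).le, Real.rpow_neg hp.le]
    refine inv_anti₀ (Real.rpow_pos_of_pos hp _) ?_
    refine le_trans (le_of_eq ?_) (Real.rpow_le_rpow (Real.sqrt_nonneg _) h1 h0)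
    rw [Real.sqrt_eq_rpow, ← Real.rpow_mul hp.le]
    congr 1; ring
  have e1 : (1 + ‖ξ‖ ^ 2) ^ (-(2 * r) / 2) = ((1 + ‖ξ‖ ^ 2) ^ (-r / 2)) ^ 2 := by
    rw [sq (_ ^ (-r / 2)), ← Real.rpow_add hp]; congr 1; ring
  change _ ≤ ‖(1 + ‖ξ‖ ^ 2) ^ (-(2 * r) / 2)‖ₑ
  rw [e1, enorm_pow, ENNReal.rpow_two]
  gcongr
  rw [Real.enorm_eq_ofReal (Real.rpow_nonneg (jb_pos _).le _),
    Real.enorm_eq_ofReal (Real.rpow_nonneg hp.le _)]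
  exact ENNReal.ofReal_le_ofReal h3

theorem lintegral_enorm_le_sobolev {r : ℝ} {f : Sp d → ℂ} (hf : AEStronglyMeasurable f volume) :
    ∫⁻ ξ, ‖f ξ‖ₑ ≤ sobolevConst d r * eLpNorm (fun ξ => (jb ξ ^ r) • f ξ) 2 volume := by
  have hc : ∀ t : ℝ, Continuous (fun ξ : Sp d => jb ξ ^ t) := fun t => continuous_weight t
  have h := ENNReal.lintegral_mul_le_Lp_mul_Lq (volume : Measure (Sp d))
    Real.HolderConjugate.two_two (f := fun ξ => ‖jb ξ ^ (-r)‖ₑ) (g := fun ξ => ‖jb ξ ^ r • f ξ‖ₑ)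
    (hc (-r)).aestronglyMeasurable.enorm ((hc r).aestronglyMeasurable.smul hf).enorm
  rw [sobolevConst, eLpNorm_two_eq, eLpNorm_two_eq]
  refine le_trans (le_of_eq (lintegral_congr fun ξ => ?_)) h
  rw [Pi.mul_apply, enorm_smul, ← mul_assoc, ← enorm_mul, ← Real.rpow_add (jb_pos _)]
  simp

end weights

section fourier

variable {d : ℕ}

theorem integral_fourier_mul_flip {u v : Sp d → ℂ} (hu : Integrable u volume)
    (hv : Integrable v volume) : ∫ x, 𝓕 u x * v x = ∫ x, u x * 𝓕 v x := by
  have h := VectorFourier.integral_fourierIntegral_smul_eq_flip (L := innerₗ (Sp d))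
    (μ := volume) (ν := volume) Real.continuous_fourierChar continuous_inner hu hv
  rw [flip_innerₗ] at h
  exact h

theorem integral_fourierInv_mul_flip {u v : Sp d → ℂ} (hu : Integrable u volume)
    (hv : Integrable v volume) : ∫ x, 𝓕⁻ u x * v x = ∫ x, u x * 𝓕⁻ v x := by
  rw [← integral_neg_eq_self]
  have h := integral_fourier_mul_flip hu hv.comp_neg
  simp_rw [Real.fourierInv_eq_fourier_neg u, neg_neg]
  rw [h]
  simp_rw [Real.fourierInv_eq_fourier_comp_neg v]

theorem continuous_fourierInv_any (f : Sp d → ℂ) : Continuous (𝓕⁻ f) := by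
  rw [Real.fourierInv_eq_fourier_comp_neg]
  exact continuous_fourier_any _

/-- The `L²` inverse Fourier transform of an integrable function is given by the integral. -/
theorem fourierInv_toLp_coeFn {f : Sp d → ℂ} (h1 : MemLp f 1 volume) (h2 : MemLp f 2 volume) :
    ((𝓕⁻ (h2.toLp f) : L2Sp d) : Sp d → ℂ) =ᵐ[volume] 𝓕⁻ f := by
  refine ae_eq_of_integral_contDiff_smul_eq
    ((Lp.memLp (𝓕⁻ (h2.toLp f) : L2Sp d)).locallyIntegrable (by norm_num))
    (continuous_fourierInv_any f).locallyIntegrable fun g hg hgc => ?_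
  have hφ1 : ContDiff ℝ ∞ (fun x => (g x : ℂ)) := Complex.ofRealCLM.contDiff.comp hg
  have hφ2 : HasCompactSupport (fun x => (g x : ℂ)) :=
    hgc.comp_left (g := fun y : ℝ => (y : ℂ)) (by simp)
  let φ : SchwartzMap (Sp d) ℂ := hφ2.toSchwartzMap hφ1
  have hφ : ∀ x, φ x = (g x : ℂ) := fun x => rfl
  have e1 : ∫ x, g x • (𝓕⁻ (h2.toLp f) : L2Sp d) x =
      (Lp.toTemperedDistribution (𝓕⁻ (h2.toLp f) : L2Sp d)) φ := by
    rw [Lp.toTemperedDistribution_apply]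
    simp [hφ]
  rw [e1, ← Lp.fourierInv_toTemperedDistribution_eq, TemperedDistribution.fourierInv_apply,
    Lp.toTemperedDistribution_apply]
  have e2 : ∫ x, (𝓕⁻ φ) x • (h2.toLp f : Sp d → ℂ) x = ∫ x, 𝓕⁻ (φ : Sp d → ℂ) x * f x := by
    refine integral_congr_ae ?_
    filter_upwards [h2.coeFn_toLp] with x hx
    rw [hx, SchwartzMap.fourierInv_coe, smul_eq_mul]
  rw [e2, integral_fourierInv_mul_flip φ.integrable (memLp_one_iff_integrable.1 h1)]
  simp [hφ]

theorem memLp_fourierInv {f : Sp d → ℂ} (h1 : MemLp f 1 volume) (h2 : MemLp f 2 volume) :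
    MemLp (𝓕⁻ f) 2 volume :=
  (memLp_congr_ae (fourierInv_toLp_coeFn h1 h2)).1 (Lp.memLp _)

theorem memLp_one_convF {f g : Sp d → ℂ} (hf : MemLp f 1 volume) (hg : MemLp g 1 volume) :
    MemLp (convF f g) 1 volume := by
  rw [memLp_one_iff_integrable] at *
  refine (hg.integrable_convolution (ContinuousLinearMap.mul ℂ ℂ) hf).congr
    (.of_forall fun ξ => ?_)
  simp [convolution, convF, mul_comm]

theorem fourierInv_convF {f g : Sp d → ℂ} (hf : MemLp f 1 volume) (hg : MemLp g 1 volume)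
    (x : Sp d) : 𝓕⁻ (convF f g) x = 𝓕⁻ f x * 𝓕⁻ g x := by
  rw [memLp_one_iff_integrable] at *
  simp only [Real.fourierInv_eq_fourier_neg]
  have h := Real.fourier_mul_convolution_eq hg hf (-x)
  rw [mul_comm (𝓕 f (-x)), ← h]
  have e : convF f g = convolution g f (ContinuousLinearMap.mul ℂ ℂ) volume := by
    funext ξ
    simp [convolution, convF, mul_comm]
  rw [e]

/-- Fourier transform of a pointwise product. -/
theorem fourier_mul_fourierInv_ae {f g : Sp d → ℂ} (hf1 : MemLp f 1 volume)
    (hf2 : MemLp f 2 volume) (hg1 : MemLp g 1 volume) (hg2 : MemLp g 2 volume) :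
    𝓕 (fun x => 𝓕⁻ f x * 𝓕⁻ g x) =ᵐ[volume] convF f g := by
  have hint : Integrable (fun x => 𝓕⁻ f x * 𝓕⁻ g x) volume :=
    (memLp_fourierInv hf1 hf2).integrable_mul (memLp_fourierInv hg1 hg2)
  have hc := memLp_one_convF hf1 hg1
  refine ae_eq_of_integral_contDiff_smul_eq (continuous_fourier_any _).locallyIntegrable
    ((memLp_one_iff_integrable.1 hc).locallyIntegrable) fun φ hφ hφc => ?_
  have hφ1 : ContDiff ℝ ∞ (fun x => (φ x : ℂ)) := Complex.ofRealCLM.contDiff.comp hφ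
  have hφ2 : HasCompactSupport (fun x => (φ x : ℂ)) :=
    hφc.comp_left (g := fun y : ℝ => (y : ℂ)) (by simp)
  let ψ : SchwartzMap (Sp d) ℂ := hφ2.toSchwartzMap hφ1
  have hψ : ∀ x, ψ x = (φ x : ℂ) := fun x => rfl
  have e1 : ∫ x, φ x • 𝓕 (fun x => 𝓕⁻ f x * 𝓕⁻ g x) x =
      ∫ x, ψ x * 𝓕 (fun x => 𝓕⁻ f x * 𝓕⁻ g x) x := by simp [hψ]
  have e2 : ∫ x, φ x • convF f g x = ∫ x, ψ x * convF f g x := by simp [hψ]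
  have hF : Integrable (𝓕 ψ : SchwartzMap (Sp d) ℂ) volume := (𝓕 ψ).integrable
  rw [SchwartzMap.fourier_coe] at hF
  have e3 : 𝓕⁻ (𝓕 (ψ : Sp d → ℂ)) = ψ := by
    rw [← SchwartzMap.fourier_coe, ← SchwartzMap.fourierInv_coe]
    simp
  rw [e1, e2, ← integral_fourier_mul_flip ψ.integrable hint]
  simp_rw [← fourierInv_convF hf1 hg1]
  rw [← integral_fourierInv_mul_flip hF (memLp_one_iff_integrable.1 hc), e3]

/-- Multiplication by a real function bounded below, on the Fourier side. -/
theorem convL_lower_bound {b : L1Sp d} {ε h : ℝ}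
    (hb : ∀ x, h ≤ 1 + ε * (𝓕⁻ (b : Sp d → ℂ) x).re) (u : L2Sp d) :
    h * ‖u‖ ^ 2 ≤ ‖u‖ ^ 2 + ε * (inner ℂ (convL d b u) u).re := by
  have hcl : IsClosed {u : L2Sp d | h * ‖u‖ ^ 2 ≤ ‖u‖ ^ 2 + ε * (inner ℂ (convL d b u) u).re} := by
    refine isClosed_le (by fun_prop) ?_
    refine (continuous_norm.pow 2).add (continuous_const.mul (Complex.continuous_re.comp ?_))
    exact (convL d b).continuous.inner continuous_id
  refine (SchwartzMap.denseRange_toLpCLM (E := Sp d) (F := ℂ) (p := 2) (μ := volume)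
    (by norm_num)).induction_on (p := fun u : L2Sp d =>
      h * ‖u‖ ^ 2 ≤ ‖u‖ ^ 2 + ε * (inner ℂ (convL d b u) u).re) u hcl fun φ => ?_
  set u : L2Sp d := SchwartzMap.toLpCLM ℝ ℂ 2 volume φ with hu
  have hφ2 : MemLp φ 2 volume := φ.memLp 2 volume
  have hφ1 : MemLp φ 1 volume := φ.memLp 1 volume
  have hu' : u = hφ2.toLp φ := rfl
  have hcu : convL d b u = (memLp_convF (Lp.memLp b) hφ2).toLp (convF b φ) := by
    refine Lp.ext ?_
    filter_upwards [convL_coeFn b u, (memLp_convF (Lp.memLp b) hφ2).coeFn_toLp] with ξ h1 h2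
    rw [h1, h2, hu', convF_congr_ae (ae_eq_refl b) hφ2.coeFn_toLp]
  have hi : ∀ f g : L2Sp d, inner ℂ f g = inner ℂ (𝓕⁻ f) (𝓕⁻ g) := fun f g => by
    rw [← Lp.inner_fourier_eq (𝓕⁻ f), FourierTransform.fourier_fourierInv_eq,
      FourierTransform.fourier_fourierInv_eq]
  have hn : ∀ f : L2Sp d, ‖f‖ ^ 2 = ∫ x, ‖(𝓕⁻ f : L2Sp d) x‖ ^ 2 := fun f => by
    rw [← inner_self_eq_norm_sq (𝕜 := ℂ), hi, L2.inner_def, ← integral_re]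
    · refine integral_congr_ae (.of_forall fun x => ?_)
      change RCLike.re (inner ℂ ((𝓕⁻ f : L2Sp d) x) ((𝓕⁻ f : L2Sp d) x)) = _
      rw [inner_self_eq_norm_sq (𝕜 := ℂ)]
    · exact L2.integrable_inner _ _
  have e1 := fourierInv_toLp_coeFn hφ1 hφ2
  have e2 := fourierInv_toLp_coeFn (memLp_one_convF (Lp.memLp b) hφ1)
    (memLp_convF (Lp.memLp b) hφ2)
  have hn2 : Integrable (fun x => ‖(𝓕⁻ u : L2Sp d) x‖ ^ 2) volume := by
    have := (Lp.memLp (𝓕⁻ u : L2Sp d)).integrable_norm_pow (by norm_num)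
    simpa using this
  have hI : Integrable (fun x => inner ℂ ((𝓕⁻ (convL d b u) : L2Sp d) x)
    ((𝓕⁻ u : L2Sp d) x)) volume := L2.integrable_inner _ _
  rw [hi (convL d b u) u, L2.inner_def, hn]
  rw [show (∫ x, inner ℂ ((𝓕⁻ (convL d b u) : L2Sp d) x) ((𝓕⁻ u : L2Sp d) x)).re =
    ∫ x, (inner ℂ ((𝓕⁻ (convL d b u) : L2Sp d) x) ((𝓕⁻ u : L2Sp d) x)).re from
      (integral_re (𝕜 := ℂ) hI).symm]
  have hI' : Integrable (fun x => ε * (inner ℂ ((𝓕⁻ (convL d b u) : L2Sp d) x)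
    ((𝓕⁻ u : L2Sp d) x)).re) volume := hI.re.const_mul _
  rw [← integral_const_mul, ← integral_const_mul, ← integral_add hn2 hI']
  refine integral_mono_ae (hn2.const_mul _) (hn2.add hI') ?_
  rw [hcu, hu']
  filter_upwards [e1, e2] with x h1 h2
  rw [h1, h2, fourierInv_convF (Lp.memLp b) hφ1, RCLike.inner_apply]
  have h3 : (𝓕⁻ (φ : Sp d → ℂ) x * (starRingEnd ℂ) (𝓕⁻ (b : Sp d → ℂ) x * 𝓕⁻ (φ : Sp d → ℂ) x)).re
      = (𝓕⁻ (b : Sp d → ℂ) x).re * ‖𝓕⁻ (φ : Sp d → ℂ) x‖ ^ 2 := by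
    rw [← Complex.normSq_eq_norm_sq]
    simp only [Complex.normSq_apply, map_mul, Complex.mul_re, Complex.mul_im, Complex.conj_re,
      Complex.conj_im]
    ring
  change _ ≤ _ + ε * (𝓕⁻ (φ : Sp d → ℂ) x *
    (starRingEnd ℂ) (𝓕⁻ (b : Sp d → ℂ) x * 𝓕⁻ (φ : Sp d → ℂ) x)).re
  rw [h3]
  have := mul_le_mul_of_nonneg_right (hb x) (sq_nonneg ‖𝓕⁻ (φ : Sp d → ℂ) x‖)
  nlinarith

end fourier

section fnLemmas

variable {d : ℕ}

theorem hsNorm_eq (r : ℝ) (f : Fn d) :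
    hsNorm r f = eLpNorm (fun ξ => (jb ξ ^ r) • f ξ) 2 volume := rfl

theorem hsNormVec_eq {ι : Type} [Fintype ι] (r : ℝ) (v : ι → Fn d) :
    hsNormVec r v = eLpNorm (fun ξ => (jb ξ ^ r) •
      (WithLp.toLp 2 (fun j => v j ξ) : EuclideanSpace ℂ ι)) 2 volume := rfl

theorem eLpNorm_one_le_hsNorm (r : ℝ) (f : Fn d) :
    eLpNorm f 1 volume ≤ sobolevConst d r * hsNorm r f := by
  rw [eLpNorm_one_eq_lintegral_enorm]
  exact lintegral_enorm_le_sobolev f.aestronglyMeasurable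

theorem hsNorm_mult_le {m : Sp d → ℂ} (hm : AEStronglyMeasurable m volume) {r r' C : ℝ}
    (hC0 : 0 ≤ C) (hC : ∀ᵐ ξ, ‖m ξ‖ * jb ξ ^ r ≤ C * jb ξ ^ r') (f : Fn d) :
    hsNorm r (fourierMult m hm f) ≤ ENNReal.ofReal C * hsNorm r' f := by
  rw [hsNorm_eq, hsNorm_eq, ← Real.enorm_eq_ofReal hC0, ← eLpNorm_const_smul]
  refine eLpNorm_mono_ae ?_
  filter_upwards [hC, coeFn_fourierMult m hm f] with ξ h1 h2
  rw [h2, Pi.smul_apply, norm_smul, norm_smul, norm_smul, norm_mul, Real.norm_of_nonneg hC0,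
    Real.norm_of_nonneg (Real.rpow_nonneg (jb_pos ξ).le _),
    Real.norm_of_nonneg (Real.rpow_nonneg (jb_pos ξ).le _)]
  nlinarith [mul_le_mul_of_nonneg_right h1 (norm_nonneg (f ξ))]

theorem hsNormVec_mult_le {ι : Type} [Fintype ι] {m : Sp d → ℂ}
    (hm : AEStronglyMeasurable m volume) {r r' C : ℝ}
    (hC0 : 0 ≤ C) (hC : ∀ᵐ ξ, ‖m ξ‖ * jb ξ ^ r ≤ C * jb ξ ^ r') (v : ι → Fn d) :
    hsNormVec r (fun j => fourierMult m hm (v j)) ≤ ENNReal.ofReal C * hsNormVec r' v := by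
  rw [hsNormVec_eq, hsNormVec_eq, ← Real.enorm_eq_ofReal hC0, ← eLpNorm_const_smul]
  refine eLpNorm_mono_ae ?_
  filter_upwards [hC, ae_all_iff.2 (fun j => coeFn_fourierMult m hm (v j))] with ξ h1 h2
  have h3 : (WithLp.toLp 2 (fun j => (fourierMult m hm (v j) : Fn d) ξ) : EuclideanSpace ℂ ι) =
      m ξ • (WithLp.toLp 2 (fun j => v j ξ) : EuclideanSpace ℂ ι) := by
    ext j; simp [h2]
  rw [h3, Pi.smul_apply, norm_smul, norm_smul, norm_smul, norm_smul, Real.norm_of_nonneg hC0,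
    Real.norm_of_nonneg (Real.rpow_nonneg (jb_pos ξ).le _),
    Real.norm_of_nonneg (Real.rpow_nonneg (jb_pos ξ).le _)]
  nlinarith [mul_le_mul_of_nonneg_right h1
    (norm_nonneg (WithLp.toLp 2 (fun j => v j ξ) : EuclideanSpace ℂ ι))]

theorem jb_rpow_mono {r r' : ℝ} (h : r ≤ r') (ξ : Sp d) : jb ξ ^ r ≤ jb ξ ^ r' :=
  Real.rpow_le_rpow_of_exponent_le (one_le_jb ξ) h

theorem hsNorm_mono {r r' : ℝ} (h : r ≤ r') (f : Fn d) : hsNorm r f ≤ hsNorm r' f := by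
  rw [hsNorm_eq, hsNorm_eq]
  refine eLpNorm_mono fun ξ => ?_
  rw [norm_smul, norm_smul, Real.norm_of_nonneg (Real.rpow_nonneg (jb_pos ξ).le _),
    Real.norm_of_nonneg (Real.rpow_nonneg (jb_pos ξ).le _)]
  exact mul_le_mul_of_nonneg_right (jb_rpow_mono h ξ) (norm_nonneg _)

theorem hsNormVec_mono {ι : Type} [Fintype ι] {r r' : ℝ} (h : r ≤ r') (v : ι → Fn d) :
    hsNormVec r v ≤ hsNormVec r' v := by
  rw [hsNormVec_eq, hsNormVec_eq]
  refine eLpNorm_mono fun ξ => ?_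
  rw [norm_smul, norm_smul, Real.norm_of_nonneg (Real.rpow_nonneg (jb_pos ξ).le _),
    Real.norm_of_nonneg (Real.rpow_nonneg (jb_pos ξ).le _)]
  exact mul_le_mul_of_nonneg_right (jb_rpow_mono h ξ) (norm_nonneg _)

theorem xNorm_mono (P : AdmissiblePair d) {r r' : ℝ} (h : r ≤ r') (U : State d) :
    xNorm P r U ≤ xNorm P r' U :=
  add_le_add (hsNorm_mono h _) (hsNormVec_mono h _)

theorem hsNorm_zero_eq (f : Fn d) : hsNorm 0 f = eLpNorm f 2 volume := by
  simp [hsNorm]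

theorem eLpNorm_two_le_hsNorm {r : ℝ} (hr : 0 ≤ r) (f : Fn d) :
    eLpNorm f 2 volume ≤ hsNorm r f := by
  rw [← hsNorm_zero_eq]; exact hsNorm_mono hr f

theorem memLp_two_of_hsNorm {r : ℝ} (hr : 0 ≤ r) {f : Fn d} (hf : hsNorm r f < ⊤) :
    MemLp f 2 volume :=
  ⟨f.aestronglyMeasurable, (eLpNorm_two_le_hsNorm hr f).trans_lt hf⟩

theorem memLp_one_of_hsNorm {r : ℝ} (hr : (d : ℝ) / 2 < r) {f : Fn d} (hf : hsNorm r f < ⊤) :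
    MemLp f 1 volume :=
  ⟨f.aestronglyMeasurable, (eLpNorm_one_le_hsNorm r f).trans_lt
    (ENNReal.mul_lt_top (sobolevConst_lt_top hr) hf)⟩

theorem hsNormVec_le_sum {ι : Type} [Fintype ι] (r : ℝ) (v : ι → Fn d) :
    hsNormVec r v ≤ ∑ j, hsNorm r (v j) := by
  classical
  rw [hsNormVec_eq]
  have h : (fun ξ => (jb ξ ^ r) • (WithLp.toLp 2 (fun j => v j ξ) : EuclideanSpace ℂ ι)) =
      ∑ j, fun ξ => (EuclideanSpace.single j ((jb ξ ^ r) • v j ξ) : EuclideanSpace ℂ ι) := by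
    funext ξ
    ext i
    rw [Finset.sum_apply, WithLp.ofLp_sum, Finset.sum_apply]
    simp
  rw [h]
  have hc : ∀ j : ι, Continuous (fun z : ℂ => (EuclideanSpace.single j z : EuclideanSpace ℂ ι)) :=
    fun j => (PiLp.continuous_toLp 2 (fun _ : ι => ℂ)).comp
      (continuous_pi fun i => by
        by_cases h : i = j
        · subst h; simpa using continuous_id'
        · simpa [Pi.single_apply, h] using continuous_const)
  refine (eLpNorm_sum_le (fun j _ => (hc j).comp_aestronglyMeasurable (aesm_hs r (v j)))
    (by norm_num)).trans (Finset.sum_le_sum fun j _ => le_of_eq ?_)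
  refine eLpNorm_congr_norm_ae (.of_forall fun ξ => ?_)
  simp

theorem fourierMult_add {m : Sp d → ℂ} (hm : AEStronglyMeasurable m volume) (f g : Fn d) :
    fourierMult m hm (f + g) = fourierMult m hm f + fourierMult m hm g := by
  refine AEEqFun.ext ?_
  filter_upwards [coeFn_fourierMult _ hm f, coeFn_fourierMult _ hm g,
    coeFn_fourierMult _ hm (f + g), AEEqFun.coeFn_add f g,
    AEEqFun.coeFn_add (fourierMult m hm f) (fourierMult m hm g)] with ξ h1 h2 h3 h4 h5
  rw [h5, Pi.add_apply, h1, h2, h3, h4, Pi.add_apply, mul_add]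

theorem eLpNorm_two_const_mul (c : ℝ≥0∞) {u : Sp d → ℝ≥0∞} (hu : AEMeasurable u volume) :
    eLpNorm (fun ξ => c * u ξ) 2 volume = c * eLpNorm u 2 volume := by
  rw [eLpNorm_two_eq, eLpNorm_two_eq]
  simp only [enorm_eq_self, ENNReal.mul_rpow_of_nonneg _ _ (zero_le_two (α := ℝ))]
  rw [lintegral_const_mul'' _ (hu.pow_const _), ENNReal.mul_rpow_of_nonneg _ _ (by norm_num),
    ← ENNReal.rpow_mul]
  norm_num

theorem fourierMult_smul {m : Sp d → ℂ} (hm : AEStronglyMeasurable m volume) (c : ℝ) (f : Fn d) :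
    fourierMult m hm (c • f) = c • fourierMult m hm f := by
  refine AEEqFun.ext ?_
  filter_upwards [coeFn_fourierMult _ hm f, coeFn_fourierMult _ hm (c • f),
    AEEqFun.coeFn_smul c f, AEEqFun.coeFn_smul c (fourierMult m hm f)] with ξ h1 h2 h3 h4
  rw [h4, Pi.smul_apply, h1, h2, h3, Pi.smul_apply, mul_smul_comm]

theorem fourierMult_comm {m n : Sp d → ℂ} (hm : AEStronglyMeasurable m volume)
    (hn : AEStronglyMeasurable n volume) (f : Fn d) :
    fourierMult m hm (fourierMult n hn f) = fourierMult n hn (fourierMult m hm f) :=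
  mul_left_comm _ _ _

theorem Fn.IsReal.fourierMult {m : Sp d → ℂ} (hm : AEStronglyMeasurable m volume)
    (hs : ∀ ξ, m (-ξ) = star (m ξ)) {f : Fn d} (hf : f.IsReal) : (fourierMult m hm f).IsReal := by
  filter_upwards [hf, coeFn_fourierMult m hm f, ae_neg (coeFn_fourierMult m hm f)] with ξ h1 h2 h3
  rw [h2, h3, h1, hs, star_mul']

end fnLemmas

section symbolFns

variable {d : ℕ}

/-- The symbol of `G₁` on the Fourier side. -/
def AdmissiblePair.sG₁ (P : AdmissiblePair d) (ξ : Sp d) : ℂ := ((P.G₁ ((2 * Real.pi) • ξ) : ℝ) : ℂ)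

/-- The symbol of `G₂` on the Fourier side. -/
def AdmissiblePair.sG₂ (P : AdmissiblePair d) (ξ : Sp d) : ℂ := ((P.G₂ ((2 * Real.pi) • ξ) : ℝ) : ℂ)

/-- The quotient `G₂ / G₁` of the symbols. -/
def AdmissiblePair.sm (P : AdmissiblePair d) (ξ : Sp d) : ℂ :=
  ((P.G₂ ((2 * Real.pi) • ξ) / P.G₁ ((2 * Real.pi) • ξ) : ℝ) : ℂ)

theorem ae_two_pi_smul {p : Sp d → Prop} (h : ∀ᵐ ξ, p ξ) : ∀ᵐ ξ, p ((2 * Real.pi) • ξ) :=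
  (Measure.quasiMeasurePreserving_smul (volume : Measure (Sp d))
    (by positivity : (2 * Real.pi : ℝ) ≠ 0)).ae h

variable (P : AdmissiblePair d)

theorem AdmissiblePair.norm_sG₁_le {M : ℝ} (h : SymbolBound P.G₁ M) :
    ∀ᵐ ξ, ‖P.sG₁ ξ‖ ≤ M := by
  filter_upwards [ae_two_pi_smul h.1] with ξ hξ
  simpa [AdmissiblePair.sG₁] using hξ

theorem AdmissiblePair.norm_sG₂_le {M : ℝ} (h : SymbolBound P.G₂ M) :
    ∀ᵐ ξ, ‖P.sG₂ ξ‖ ≤ M := by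
  filter_upwards [ae_two_pi_smul h.1] with ξ hξ
  simpa [AdmissiblePair.sG₂] using hξ

theorem AdmissiblePair.norm_sm_le (ξ : Sp d) : ‖P.sm ξ‖ ≤ 1 := by
  have h := P.abs_le ((2 * Real.pi) • ξ)
  have h0 := P.pos₁ ((2 * Real.pi) • ξ)
  simp only [AdmissiblePair.sm, Complex.norm_real, Real.norm_eq_abs, abs_div, abs_of_pos h0]
  exact (div_le_one h0).2 h

theorem AdmissiblePair.aesm_sm : AEStronglyMeasurable P.sm volume := by
  have hq := Measure.quasiMeasurePreserving_smul (volume : Measure (Sp d))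
    (by positivity : (2 * Real.pi : ℝ) ≠ 0)
  refine Complex.continuous_ofReal.comp_aestronglyMeasurable ?_
  exact ((P.meas₂.comp_quasiMeasurePreserving hq).aemeasurable.div
    (P.meas₁.comp_quasiMeasurePreserving hq).aemeasurable).aestronglyMeasurable

theorem AdmissiblePair.bddSym_sG₁ : BddSym P.sG₁ :=
  ⟨aesm_symbol P.meas₁, let ⟨M, hM⟩ := P.bound₁; ⟨M, P.norm_sG₁_le hM⟩⟩

theorem AdmissiblePair.bddSym_sG₂ : BddSym P.sG₂ :=
  ⟨aesm_symbol P.meas₂, let ⟨M, hM⟩ := P.bound₂; ⟨M, P.norm_sG₂_le hM⟩⟩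

theorem AdmissiblePair.bddSym_sm : BddSym P.sm :=
  ⟨P.aesm_sm, 1, .of_forall P.norm_sm_le⟩

theorem AdmissiblePair.sm_mul_sG₁ (ξ : Sp d) : P.sm ξ * P.sG₁ ξ = P.sG₂ ξ := by
  have h0 := (P.pos₁ ((2 * Real.pi) • ξ)).ne'
  unfold AdmissiblePair.sm AdmissiblePair.sG₁ AdmissiblePair.sG₂
  rw [← Complex.ofReal_mul, div_mul_cancel₀ _ h0]

theorem AdmissiblePair.coeFn_op₁ (f : Fn d) :
    (P.op₁ f : Sp d → ℂ) =ᵐ[volume] fun ξ => P.sG₁ ξ * f ξ := coeFn_fourierMult _ _ f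

theorem AdmissiblePair.coeFn_op₂ (f : Fn d) :
    (P.op₂ f : Sp d → ℂ) =ᵐ[volume] fun ξ => P.sG₂ ξ * f ξ := coeFn_fourierMult _ _ f

theorem AdmissiblePair.op₂_add (f g : Fn d) : P.op₂ (f + g) = P.op₂ f + P.op₂ g :=
  fourierMult_add _ f g

theorem AdmissiblePair.op₂_smul (c : ℝ) (f : Fn d) : P.op₂ (c • f) = c • P.op₂ f :=
  fourierMult_smul _ c f

theorem AdmissiblePair.coeFn_op₂' (f : Fn d) :
    (P.op₂ f : Sp d → ℂ) =ᵐ[volume] fun ξ => P.sm ξ * (P.op₁ f) ξ := by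
  filter_upwards [P.coeFn_op₁ f, P.coeFn_op₂ f] with ξ h1 h2
  rw [h1, h2, ← P.sm_mul_sG₁, mul_assoc]

theorem AdmissiblePair.hsNorm_op₂_le (r : ℝ) (f : Fn d) :
    hsNorm r (P.op₂ f) ≤ hsNorm r (P.op₁ f) := by
  rw [hsNorm_eq, hsNorm_eq]
  refine eLpNorm_mono_ae ?_
  filter_upwards [P.coeFn_op₂' f] with ξ h
  rw [h, norm_smul, norm_smul, norm_mul]
  refine mul_le_mul_of_nonneg_left ?_ (norm_nonneg _)
  exact mul_le_of_le_one_left (norm_nonneg _) (P.norm_sm_le ξ)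

theorem AdmissiblePair.hsNorm_op₁_le' {M : ℝ} (hM0 : 0 ≤ M) (hM : SymbolBound P.G₁ M) (r : ℝ)
    (f : Fn d) : hsNorm r (P.op₁ f) ≤ ENNReal.ofReal M * hsNorm r f := by
  refine hsNorm_mult_le _ hM0 ?_ f
  filter_upwards [P.norm_sG₁_le hM] with ξ h
  exact mul_le_mul_of_nonneg_right h (Real.rpow_nonneg (jb_pos ξ).le _)

theorem AdmissiblePair.isReal_op₁ {f : Fn d} (hf : f.IsReal) : (P.op₁ f).IsReal :=
  hf.fourierMult _ fun ξ => by simp [P.even₁]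

theorem AdmissiblePair.isReal_op₂ {f : Fn d} (hf : f.IsReal) : (P.op₂ f).IsReal :=
  hf.fourierMult _ fun ξ => by simp [P.even₂]

theorem SymbolBound.nonneg {G : Sp d → ℝ} {M : ℝ} (h : SymbolBound G M) : 0 ≤ M := by
  obtain ⟨ξ, h⟩ := h.1.exists
  exact (abs_nonneg _).trans h

end symbolFns

section products

variable {d : ℕ}

theorem Fn.prod_coeFn {f g : Fn d} (hf1 : MemLp f 1 volume) (hf2 : MemLp f 2 volume)
    (hg1 : MemLp g 1 volume) (hg2 : MemLp g 2 volume) :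
    (Fn.prod f g : Sp d → ℂ) =ᵐ[volume] convF f g :=
  (AEEqFun.coeFn_mk _ _).trans (fourier_mul_fourierInv_ae hf1 hf2 hg1 hg2)

/-- The constant in the product estimate of `H^r`. -/
def prodConst (d : ℕ) (r : ℝ) : ℝ≥0∞ := ENNReal.ofReal (2 ^ r) * (2 * sobolevConst d r)

theorem prodConst_lt_top {r : ℝ} (hr : (d : ℝ) / 2 < r) : prodConst d r < ⊤ :=
  ENNReal.mul_lt_top ENNReal.ofReal_lt_top
    (ENNReal.mul_lt_top (by norm_num) (sobolevConst_lt_top hr))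

variable {r : ℝ} (hr : (d : ℝ) / 2 < r)

include hr in
theorem Fn.hsNorm_prod_le {f g : Fn d} (hf : hsNorm r f < ⊤) (hg : hsNorm r g < ⊤) :
    hsNorm r (Fn.prod f g) ≤ prodConst d r * (hsNorm r f * hsNorm r g) := by
  have hr0 : 0 ≤ r := le_trans (by positivity) hr.le
  have hf1 := memLp_one_of_hsNorm hr hf
  have hg1 := memLp_one_of_hsNorm hr hg
  have hf2 := memLp_two_of_hsNorm hr0 hf
  have hg2 := memLp_two_of_hsNorm hr0 hg
  set u : Sp d → ℝ≥0∞ := fun ξ => ‖f ξ‖ₑ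
  set v : Sp d → ℝ≥0∞ := fun ξ => ‖g ξ‖ₑ
  set u' : Sp d → ℝ≥0∞ := fun ξ => ‖(jb ξ ^ r) • f ξ‖ₑ
  set v' : Sp d → ℝ≥0∞ := fun ξ => ‖(jb ξ ^ r) • g ξ‖ₑ
  have hu : AEMeasurable u volume := hf1.1.enorm
  have hv : AEMeasurable v volume := hg1.1.enorm
  have hu' : AEMeasurable u' volume := (aesm_hs r f).enorm
  have hv' : AEMeasurable v' volume := (aesm_hs r g).enorm
  have nu' : eLpNorm u' 2 volume = hsNorm r f := by rw [eLpNorm_enorm_fn]; rfl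
  have nv' : eLpNorm v' 2 volume = hsNorm r g := by rw [eLpNorm_enorm_fn]; rfl
  have nu : eLpNorm u 1 volume ≤ sobolevConst d r * hsNorm r f := by
    rw [eLpNorm_enorm_fn]; exact eLpNorm_one_le_hsNorm r f
  have nv : eLpNorm v 1 volume ≤ sobolevConst d r * hsNorm r g := by
    rw [eLpNorm_enorm_fn]; exact eLpNorm_one_le_hsNorm r g
  have key : ∀ᵐ ξ, ‖(jb ξ ^ r) • (Fn.prod f g) ξ‖ₑ ≤
      ‖ENNReal.ofReal (2 ^ r) * (convE u' v + convE u v') ξ‖ₑ := by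
    filter_upwards [Fn.prod_coeFn hf1 hf2 hg1 hg2] with ξ h
    rw [h, enorm_smul, Pi.add_apply, enorm_eq_self]
    refine (mul_le_mul_right (enorm_convF_le f g ξ) _).trans ?_
    unfold convE
    rw [← lintegral_const_mul' _ _ enorm_ne_top, ← lintegral_add_left',
      ← lintegral_const_mul' _ _ ENNReal.ofReal_ne_top]
    · refine lintegral_mono fun η => ?_
      have h1 : ‖jb ξ ^ r‖ₑ ≤ ENNReal.ofReal (2 ^ r) * (‖jb (ξ - η) ^ r‖ₑ + ‖jb η ^ r‖ₑ) := by
        have p1 := Real.rpow_nonneg (jb_pos ξ).le r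
        have p2 := Real.rpow_nonneg (jb_pos (ξ - η)).le r
        have p3 := Real.rpow_nonneg (jb_pos η).le r
        rw [Real.enorm_eq_ofReal p1, Real.enorm_eq_ofReal p2, Real.enorm_eq_ofReal p3,
          ← ENNReal.ofReal_add p2 p3, ← ENNReal.ofReal_mul (by positivity)]
        exact ENNReal.ofReal_le_ofReal (jb_rpow_le r hr0 ξ η)
      calc ‖jb ξ ^ r‖ₑ * (‖f (ξ - η)‖ₑ * ‖g η‖ₑ)
          ≤ ENNReal.ofReal (2 ^ r) * (‖jb (ξ - η) ^ r‖ₑ + ‖jb η ^ r‖ₑ) *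
            (‖f (ξ - η)‖ₑ * ‖g η‖ₑ) := mul_le_mul_left h1 _
        _ = _ := by
          simp only [u, v, u', v', enorm_smul]
          ring
    · exact (hu'.comp_quasiMeasurePreserving (quasiMeasurePreserving_sub_left volume ξ)).mul hv
  rw [hsNorm_eq]
  refine (eLpNorm_mono_enorm_ae key).trans ?_
  rw [eLpNorm_two_const_mul _ ((aemeasurable_convE hu' hv).add (aemeasurable_convE hu hv'))]
  rw [prodConst, mul_assoc]
  refine mul_le_mul_right ?_ _
  refine (eLpNorm_add_le (aemeasurable_convE hu' hv).aestronglyMeasurable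
    (aemeasurable_convE hu hv').aestronglyMeasurable (by norm_num)).trans ?_
  have k1 : eLpNorm (convE u' v) 2 volume ≤ sobolevConst d r * (hsNorm r f * hsNorm r g) := by
    rw [convE_comm]
    refine (eLpNorm_convE_le hv hu').trans ?_
    rw [nu']
    refine (mul_le_mul_left nv _).trans_eq ?_
    ring
  have k2 : eLpNorm (convE u v') 2 volume ≤ sobolevConst d r * (hsNorm r f * hsNorm r g) := by
    refine (eLpNorm_convE_le hu hv').trans ?_
    rw [nv']
    refine (mul_le_mul_left nu _).trans_eq ?_
    ring
  refine (add_le_add k1 k2).trans_eq ?_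
  ring

include hr in
theorem Fn.prod_coeFn_hs {f g : Fn d} (hf : hsNorm r f < ⊤) (hg : hsNorm r g < ⊤) :
    (Fn.prod f g : Sp d → ℂ) =ᵐ[volume] convF f g :=
  have hr0 : 0 ≤ r := le_trans (by positivity) hr.le
  Fn.prod_coeFn (memLp_one_of_hsNorm hr hf) (memLp_two_of_hsNorm hr0 hf)
    (memLp_one_of_hsNorm hr hg) (memLp_two_of_hsNorm hr0 hg)

include hr in
theorem Fn.prod_add_right {f g h : Fn d} (hf : hsNorm r f < ⊤) (hg : hsNorm r g < ⊤)
    (hh : hsNorm r h < ⊤) : Fn.prod f (g + h) = Fn.prod f g + Fn.prod f h := by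
  have hr0 : 0 ≤ r := le_trans (by positivity) hr.le
  have hgh : hsNorm r (g + h) < ⊤ :=
    (hsNorm_add r g h).trans_lt (ENNReal.add_lt_top.2 ⟨hg, hh⟩)
  refine AEEqFun.ext ?_
  filter_upwards [Fn.prod_coeFn_hs hr hf hg, Fn.prod_coeFn_hs hr hf hh,
    Fn.prod_coeFn_hs hr hf hgh, AEEqFun.coeFn_add (Fn.prod f g) (Fn.prod f h),
    ae_integrable_convF (memLp_one_of_hsNorm hr hf) (memLp_two_of_hsNorm hr0 hg),
    ae_integrable_convF (memLp_one_of_hsNorm hr hf) (memLp_two_of_hsNorm hr0 hh)]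
    with ξ h1 h2 h3 h4 h5 h6
  rw [h3, h4, Pi.add_apply, h1, h2, convF_congr_ae (ae_eq_refl f) (AEEqFun.coeFn_add g h)]
  simp only [convF, Pi.add_apply, mul_add]
  exact integral_add h5 h6

include hr in
theorem Fn.prod_comm {f g : Fn d} (hf : hsNorm r f < ⊤) (hg : hsNorm r g < ⊤) :
    Fn.prod f g = Fn.prod g f := by
  refine AEEqFun.ext ?_
  filter_upwards [Fn.prod_coeFn_hs hr hf hg, Fn.prod_coeFn_hs hr hg hf] with ξ h1 h2
  rw [h1, h2, convF_comm]

include hr in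
theorem Fn.prod_add_left {f g h : Fn d} (hf : hsNorm r f < ⊤) (hg : hsNorm r g < ⊤)
    (hh : hsNorm r h < ⊤) : Fn.prod (f + g) h = Fn.prod f h + Fn.prod g h := by
  have hfg : hsNorm r (f + g) < ⊤ :=
    (hsNorm_add r f g).trans_lt (ENNReal.add_lt_top.2 ⟨hf, hg⟩)
  rw [Fn.prod_comm hr hfg hh, Fn.prod_add_right hr hh hf hg, Fn.prod_comm hr hf hh,
    Fn.prod_comm hr hg hh]

include hr in
theorem Fn.prod_smul_right (c : ℝ) {f g : Fn d} (hf : hsNorm r f < ⊤) (hg : hsNorm r g < ⊤) :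
    Fn.prod f (c • g) = c • Fn.prod f g := by
  have hcg : hsNorm r (c • g) < ⊤ := by
    rw [hsNorm_smul]; exact ENNReal.mul_lt_top (by simp) hg
  refine AEEqFun.ext ?_
  filter_upwards [Fn.prod_coeFn_hs hr hf hg, Fn.prod_coeFn_hs hr hf hcg,
    AEEqFun.coeFn_smul c (Fn.prod f g)] with ξ h1 h2 h3
  rw [h2, h3, Pi.smul_apply, h1, convF_congr_ae (ae_eq_refl f) (AEEqFun.coeFn_smul c g)]
  simp only [convF, Pi.smul_apply, mul_smul_comm]
  exact integral_smul _ _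

include hr in
theorem Fn.prod_smul_left (c : ℝ) {f g : Fn d} (hf : hsNorm r f < ⊤) (hg : hsNorm r g < ⊤) :
    Fn.prod (c • f) g = c • Fn.prod f g := by
  have hcf : hsNorm r (c • f) < ⊤ := by
    rw [hsNorm_smul]; exact ENNReal.mul_lt_top (by simp) hf
  rw [Fn.prod_comm hr hcf hg, Fn.prod_smul_right hr c hg hf, Fn.prod_comm hr hf hg]

include hr in
theorem Fn.IsReal.prod {f g : Fn d} (hf : hsNorm r f < ⊤) (hg : hsNorm r g < ⊤)
    (hf' : f.IsReal) (hg' : g.IsReal) : (Fn.prod f g).IsReal := by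
  filter_upwards [Fn.prod_coeFn_hs hr hf hg, ae_neg (Fn.prod_coeFn_hs hr hf hg)] with ξ h1 h2
  rw [h1, h2]
  unfold convF
  rw [RCLike.star_def, ← integral_conj, ← integral_neg_eq_self]
  refine integral_congr_ae ?_
  filter_upwards [hg', (quasiMeasurePreserving_sub_left volume ξ).ae hf'] with η e1 e2
  rw [show -ξ - -η = -(ξ - η) by abel, e1, e2, map_mul]
  rfl

end products

section stateMaps

variable {d : ℕ} (P : AdmissiblePair d)

theorem XSpace.hsNorm_fst {r : ℝ} (U : XSpace P r) : hsNorm r (U : State d).1 < ⊤ :=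
  (self_le_add_right _ _).trans_lt (XSpace.xNorm_lt_top U)

theorem XSpace.hsNorm_snd {r : ℝ} (U : XSpace P r) (j : Fin d) :
    hsNorm r (P.op₁ ((U : State d).2 j)) < ⊤ :=
  ((hsNorm_le_hsNormVec r (fun j => P.op₁ ((U : State d).2 j)) j).trans
    (self_le_add_left _ _)).trans_lt (XSpace.xNorm_lt_top U)

theorem hsNorm_fst_le (r : ℝ) (U : State d) : hsNorm r U.1 ≤ xNorm P r U := self_le_add_right _ _

theorem hsNorm_snd_le (r : ℝ) (U : State d) (j : Fin d) :
    hsNorm r (P.op₁ (U.2 j)) ≤ xNorm P r U :=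
  (hsNorm_le_hsNormVec r (fun j => P.op₁ (U.2 j)) j).trans (self_le_add_left _ _)

theorem XSpace.hsNorm_op₂ {r : ℝ} (U : XSpace P r) (j : Fin d) :
    hsNorm r (P.op₂ ((U : State d).2 j)) < ⊤ :=
  (P.hsNorm_op₂_le r _).trans_lt (XSpace.hsNorm_snd P U j)

theorem XSpace.norm_le_of_xNorm_le {r : ℝ} (U : XSpace P r) {C : ℝ} (hC : 0 ≤ C)
    (h : xNorm P r (U : State d) ≤ ENNReal.ofReal C) : ‖U‖ ≤ C := by
  rw [XSpace.norm_def]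
  exact ENNReal.toReal_le_of_le_ofReal hC h

theorem XSpace.mem_iff {r : ℝ} {U : State d} :
    U ∈ XSpace P r ↔ U.1.IsReal ∧ (∀ j, (U.2 j).IsReal) ∧ xNorm P r U < ⊤ := Iff.rfl

theorem XSpace.isReal_fst {r : ℝ} (U : XSpace P r) : (U : State d).1.IsReal :=
  ((XSpace.mem_iff P).1 U.2).1

theorem XSpace.isReal_snd {r : ℝ} (U : XSpace P r) (j : Fin d) : ((U : State d).2 j).IsReal :=
  ((XSpace.mem_iff P).1 U.2).2.1 j

/-- A real linear map from `X^r` to functions, bounded into `L^p`. -/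
def XSpace.toLpL {r : ℝ} {p : ℝ≥0∞} [Fact (1 ≤ p)] (l : State d →ₗ[ℝ] Fn d) (C : ℝ≥0∞)
    (hC : C < ⊤) (h : ∀ U : State d, eLpNorm (l U) p volume ≤ C * xNorm P r U) :
    XSpace P r →L[ℝ] Lp ℂ p (volume : Measure (Sp d)) :=
  LinearMap.mkContinuous
    { toFun := fun U => ⟨l U, Lp.mem_Lp_iff_eLpNorm_lt_top.2
        ((h U).trans_lt (ENNReal.mul_lt_top hC (XSpace.xNorm_lt_top U)))⟩
      map_add' := fun U V => Subtype.ext (l.map_add U V)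
      map_smul' := fun c U => Subtype.ext (l.map_smul c U) } C.toReal
    (fun U => by
      rw [Lp.norm_def, XSpace.norm_def, ← ENNReal.toReal_mul]
      exact ENNReal.toReal_mono (ENNReal.mul_lt_top hC (XSpace.xNorm_lt_top U)).ne (h U))

/-- The first component, as a linear map. -/
def State.fstL (d : ℕ) : State d →ₗ[ℝ] Fn d := LinearMap.fst ℝ _ _

/-- The component `v_j`, as a linear map. -/
def State.sndL (j : Fin d) : State d →ₗ[ℝ] Fn d :=
  LinearMap.proj (R := ℝ) (φ := fun _ : Fin d => Fn d) j ∘ₗ LinearMap.snd ℝ _ _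

/-- Multiplication by a symbol, as a linear map. -/
def fourierMultL (m : Sp d → ℂ) (hm : AEStronglyMeasurable m volume) : Fn d →ₗ[ℝ] Fn d where
  toFun := fourierMult m hm
  map_add' := fourierMult_add hm
  map_smul' := fourierMult_smul hm

/-- `G₁(D)`, as a linear map. -/
def AdmissiblePair.op₁L : Fn d →ₗ[ℝ] Fn d := fourierMultL _ (aesm_symbol P.meas₁)

/-- `G₂(D)`, as a linear map. -/
def AdmissiblePair.op₂L : Fn d →ₗ[ℝ] Fn d := fourierMultL _ (aesm_symbol P.meas₂)

/-- A bounded linear map between energy spaces. -/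
def XSpace.mkL {r r' : ℝ} (L : State d →ₗ[ℝ] State d) (C : ℝ≥0∞) (hC : C < ⊤)
    (h1 : ∀ U : XSpace P r', (L U).1.IsReal ∧ ∀ j, ((L U).2 j).IsReal)
    (h2 : ∀ U : State d, xNorm P r (L U) ≤ C * xNorm P r' U) : XSpace P r' →L[ℝ] XSpace P r :=
  LinearMap.mkContinuous
    (LinearMap.codRestrict (XSpace P r) (L.domRestrict (XSpace P r')) fun U =>
      (XSpace.mem_iff P).2 ⟨(h1 U).1, (h1 U).2, (h2 U).trans_lt
        (ENNReal.mul_lt_top hC (XSpace.xNorm_lt_top U))⟩) C.toReal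
    (fun U => by
      rw [XSpace.norm_def, XSpace.norm_def, ← ENNReal.toReal_mul]
      exact ENNReal.toReal_mono (ENNReal.mul_lt_top hC (XSpace.xNorm_lt_top U)).ne (h2 U))

variable {r : ℝ}

/-- `ζ` as an element of `L²` (on the Fourier side). -/
def zH (hr : 0 ≤ r) : XSpace P r →L[ℝ] L2Sp d :=
  XSpace.toLpL P (State.fstL d) 1 ENNReal.one_lt_top fun _ => by
    rw [one_mul]
    exact (eLpNorm_two_le_hsNorm hr _).trans (hsNorm_fst_le P r _)

/-- `G₁ v_j` as an element of `L²` (on the Fourier side). -/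
def vH (hr : 0 ≤ r) (j : Fin d) : XSpace P r →L[ℝ] L2Sp d :=
  XSpace.toLpL P (P.op₁L ∘ₗ State.sndL j) 1 ENNReal.one_lt_top fun _ => by
    rw [one_mul]
    exact (eLpNorm_two_le_hsNorm hr _).trans (hsNorm_snd_le P r _ j)

/-- `ζ` as an element of `FL¹`. -/
def bL (hr : (d : ℝ) / 2 < r) : XSpace P r →L[ℝ] L1Sp d :=
  XSpace.toLpL P (State.fstL d) (sobolevConst d r) (sobolevConst_lt_top hr) fun _ =>
    (eLpNorm_one_le_hsNorm r _).trans (mul_le_mul_right (hsNorm_fst_le P r _) _)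

/-- `G₂ v_j` as an element of `FL¹`. -/
def aL (hr : (d : ℝ) / 2 < r) (j : Fin d) : XSpace P r →L[ℝ] L1Sp d :=
  XSpace.toLpL P (P.op₂L ∘ₗ State.sndL j) (sobolevConst d r) (sobolevConst_lt_top hr) fun _ =>
    (eLpNorm_one_le_hsNorm r _).trans
      (mul_le_mul_right ((P.hsNorm_op₂_le r _).trans (hsNorm_snd_le P r _ j)) _)

theorem zH_coeFn (hr : 0 ≤ r) (U : XSpace P r) :
    (zH P hr U : Sp d → ℂ) = ((U : State d).1 : Sp d → ℂ) := rfl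

theorem vH_coeFn (hr : 0 ≤ r) (j : Fin d) (U : XSpace P r) :
    (vH P hr j U : Sp d → ℂ) = (P.op₁ ((U : State d).2 j) : Sp d → ℂ) := rfl

theorem XSpace.le_of_le {r' : ℝ} (h : r ≤ r') : XSpace P r' ≤ XSpace P r := fun U hU =>
  (XSpace.mem_iff P).2 ⟨((XSpace.mem_iff P).1 hU).1, ((XSpace.mem_iff P).1 hU).2.1,
    (xNorm_mono P h U).trans_lt ((XSpace.mem_iff P).1 hU).2.2⟩

theorem XSpace.norm_inclusion_le {r' : ℝ} (h : r ≤ r') (U : XSpace P r') :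
    ‖Submodule.inclusion (XSpace.le_of_le P h) U‖ ≤ 1 * ‖U‖ := by
  rw [one_mul, XSpace.norm_def, XSpace.norm_def, Submodule.coe_inclusion]
  exact ENNReal.toReal_mono (XSpace.xNorm_lt_top U).ne (xNorm_mono P h U.1)

/-- The inclusion of `X^{r'}` into `X^r`. -/
def inclX {r' : ℝ} (h : r ≤ r') : XSpace P r' →L[ℝ] XSpace P r :=
  LinearMap.mkContinuous (Submodule.inclusion (XSpace.le_of_le P h)) 1 (XSpace.norm_inclusion_le P h)

theorem inclX_coe {r' : ℝ} (h : r ≤ r') (U : XSpace P r') :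
    (inclX P h U : State d) = (U : State d) := by
  rw [inclX, LinearMap.mkContinuous_apply, Submodule.coe_inclusion]

theorem norm_inclX_le {r' : ℝ} (h : r ≤ r') (U : XSpace P r') : ‖inclX P h U‖ ≤ ‖U‖ := by
  rw [XSpace.norm_def, XSpace.norm_def, inclX_coe]
  exact ENNReal.toReal_mono (XSpace.xNorm_lt_top U).ne (xNorm_mono P h _)

theorem inclX_injective {r' : ℝ} (h : r ≤ r') : Function.Injective (inclX P h) := by
  intro U V hUV
  refine Subtype.ext ?_
  rw [← inclX_coe P h U, ← inclX_coe P h V, hUV]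

/-- Multiplication of all components by a symbol. -/
def State.mult (m : Sp d → ℂ) (hm : AEStronglyMeasurable m volume) (U : State d) : State d :=
  (fourierMult m hm U.1, fun j => fourierMult m hm (U.2 j))

theorem xNorm_mult_le {m : Sp d → ℂ} (hm : AEStronglyMeasurable m volume) {r' C : ℝ}
    (hC0 : 0 ≤ C) (hC : ∀ᵐ ξ, ‖m ξ‖ * jb ξ ^ r ≤ C * jb ξ ^ r') (U : State d) :
    xNorm P r (State.mult m hm U) ≤ ENNReal.ofReal C * xNorm P r' U := by
  unfold xNorm
  rw [mul_add]
  refine add_le_add (hsNorm_mult_le hm hC0 hC _) ?_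
  have e : (fun j => P.op₁ ((State.mult m hm U).2 j)) =
      fun j => fourierMult m hm (P.op₁ (U.2 j)) := by
    funext j
    exact fourierMult_comm _ _ _
  rw [e]
  exact hsNormVec_mult_le hm hC0 hC _

/-- Multiplication of all components by a symbol, as a linear map. -/
def State.multL (m : Sp d → ℂ) (hm : AEStronglyMeasurable m volume) : State d →ₗ[ℝ] State d where
  toFun := State.mult m hm
  map_add' _ _ := Prod.ext (fourierMult_add hm _ _) (funext fun _ => fourierMult_add hm _ _)
  map_smul' _ _ := Prod.ext (fourierMult_smul hm _ _) (funext fun _ => fourierMult_smul hm _ _)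

/-- A Fourier multiplier with Hermitian symbol from `X^{r'}` to `X^r`. -/
def multX (m : Sp d → ℂ) (hm : AEStronglyMeasurable m volume) (hs : ∀ ξ, m (-ξ) = star (m ξ))
    {r' C : ℝ} (hC0 : 0 ≤ C) (hC : ∀ᵐ ξ, ‖m ξ‖ * jb ξ ^ r ≤ C * jb ξ ^ r') :
    XSpace P r' →L[ℝ] XSpace P r :=
  XSpace.mkL P (State.multL m hm) (ENNReal.ofReal C) ENNReal.ofReal_lt_top
    (fun U => ⟨(XSpace.isReal_fst P U).fourierMult hm hs,
      fun j => (XSpace.isReal_snd P U j).fourierMult hm hs⟩)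
    (xNorm_mult_le P hm hC0 hC)

theorem multX_coe (m : Sp d → ℂ) (hm : AEStronglyMeasurable m volume)
    (hs : ∀ ξ, m (-ξ) = star (m ξ))
    {r' C : ℝ} (hC0 : 0 ≤ C) (hC : ∀ᵐ ξ, ‖m ξ‖ * jb ξ ^ r ≤ C * jb ξ ^ r') (U : XSpace P r') :
    (multX P m hm hs hC0 hC U : State d) = State.mult m hm U := rfl

end stateMaps

section bilinear

variable {d : ℕ} (P : AdmissiblePair d) {r : ℝ}

/-- The part of `A_j(U̲)[W]` which is bilinear in `(U̲, W)`. -/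
def AdmissiblePair.bilA (j : Fin d) (Ub W : State d) : State d :=
  (P.op₂ (Fn.prod (P.op₂ (Ub.2 j)) W.1) + P.op₂ (Fn.prod Ub.1 (P.op₂ (W.2 j))),
    fun i => Fn.prod (P.op₂ (Ub.2 j)) (P.op₂ (W.2 i)))

/-- The part of `A_j(U̲)[W]` which does not depend on `U̲`. -/
def AdmissiblePair.linA (j : Fin d) (W : State d) : State d :=
  (P.op₁ (P.op₁ (W.2 j)), fun i => if i = j then W.1 else 0)

theorem AdmissiblePair.A_eq (ε : ℝ) (j : Fin d) (Ub W : State d) :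
    P.A ε j Ub W = P.linA j W + ε • P.bilA j Ub W := by
  refine Prod.ext ?_ rfl
  change ε • P.op₂ (Fn.prod (P.op₂ (Ub.2 j)) W.1) + P.op₁ (P.op₁ (W.2 j)) +
      ε • P.op₂ (Fn.prod Ub.1 (P.op₂ (W.2 j))) = P.op₁ (P.op₁ (W.2 j)) +
      ε • (P.op₂ (Fn.prod (P.op₂ (Ub.2 j)) W.1) + P.op₂ (Fn.prod Ub.1 (P.op₂ (W.2 j))))
  rw [smul_add]
  abel

theorem hsNorm_op₂_le_mul {M : ℝ} (hM0 : 0 ≤ M) (hM : SymbolBound P.G₂ M) (r : ℝ)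
    (f : Fn d) : hsNorm r (P.op₂ f) ≤ ENNReal.ofReal M * hsNorm r f := by
  refine hsNorm_mult_le _ hM0 ?_ f
  filter_upwards [P.norm_sG₂_le hM] with ξ h
  exact mul_le_mul_of_nonneg_right h (Real.rpow_nonneg (jb_pos ξ).le _)

theorem xNorm_le_sum (U : State d) :
    xNorm P r U ≤ hsNorm r U.1 + ∑ j, hsNorm r (P.op₁ (U.2 j)) := by
  unfold xNorm
  gcongr
  exact hsNormVec_le_sum r _

theorem exists_bilA_bound (hr : (d : ℝ) / 2 < r) :
    ∃ K : ℝ≥0∞, K < ⊤ ∧ ∀ (j : Fin d) (Ub W : XSpace P r),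
      xNorm P r (P.bilA j Ub W) ≤ K * xNorm P r (Ub : State d) * xNorm P r (W : State d) := by
  obtain ⟨M₁, hM₁⟩ := P.bound₁
  obtain ⟨M₂, hM₂⟩ := P.bound₂
  refine ⟨(ENNReal.ofReal M₂ * 2 + d * ENNReal.ofReal M₁) * prodConst d r,
    ENNReal.mul_lt_top (ENNReal.add_lt_top.2 ⟨ENNReal.mul_lt_top ENNReal.ofReal_lt_top (by norm_num),
      ENNReal.mul_lt_top (by simp) ENNReal.ofReal_lt_top⟩) (prodConst_lt_top hr), ?_⟩
  intro j Ub W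
  have hA := XSpace.hsNorm_op₂ P Ub j
  have hA' := (P.hsNorm_op₂_le r _).trans (hsNorm_snd_le P r (Ub : State d) j)
  have hW' := fun i => (P.hsNorm_op₂_le r _).trans (hsNorm_snd_le P r (W : State d) i)
  set X := xNorm P r (Ub : State d)
  set Y := xNorm P r (W : State d)
  have p1 : hsNorm r (Fn.prod (P.op₂ ((Ub : State d).2 j)) (W : State d).1) ≤
      prodConst d r * (X * Y) :=
    (Fn.hsNorm_prod_le hr hA (XSpace.hsNorm_fst P W)).trans
      (mul_le_mul_right (mul_le_mul' hA' (hsNorm_fst_le P r _)) _)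
  have p2 : hsNorm r (Fn.prod (Ub : State d).1 (P.op₂ ((W : State d).2 j))) ≤
      prodConst d r * (X * Y) :=
    (Fn.hsNorm_prod_le hr (XSpace.hsNorm_fst P Ub) (XSpace.hsNorm_op₂ P W j)).trans
      (mul_le_mul_right (mul_le_mul' (hsNorm_fst_le P r _) (hW' j)) _)
  have p3 : ∀ i, hsNorm r (Fn.prod (P.op₂ ((Ub : State d).2 j)) (P.op₂ ((W : State d).2 i))) ≤
      prodConst d r * (X * Y) := fun i =>
    (Fn.hsNorm_prod_le hr hA (XSpace.hsNorm_op₂ P W i)).trans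
      (mul_le_mul_right (mul_le_mul' hA' (hW' i)) _)
  refine (xNorm_le_sum P _).trans ?_
  calc _ ≤ (ENNReal.ofReal M₂ * (prodConst d r * (X * Y)) +
        ENNReal.ofReal M₂ * (prodConst d r * (X * Y))) +
        ∑ i : Fin d, ENNReal.ofReal M₁ * (prodConst d r * (X * Y)) := by
        refine add_le_add ((hsNorm_add r _ _).trans (add_le_add ?_ ?_))
          (Finset.sum_le_sum fun i _ => ?_)
        · exact (hsNorm_op₂_le_mul P hM₂.nonneg hM₂ r _).trans (mul_le_mul_right p1 _)
        · exact (hsNorm_op₂_le_mul P hM₂.nonneg hM₂ r _).trans (mul_le_mul_right p2 _)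
        · exact (P.hsNorm_op₁_le' hM₁.nonneg hM₁ r _).trans (mul_le_mul_right (p3 i) _)
    _ = _ := by
        rw [Finset.sum_const, Finset.card_univ, Fintype.card_fin, nsmul_eq_mul]
        ring

theorem bilA_mem (hr : (d : ℝ) / 2 < r) (j : Fin d) (Ub W : XSpace P r) :
    P.bilA j Ub W ∈ XSpace P r := by
  obtain ⟨K, hK, h⟩ := exists_bilA_bound P hr
  refine (XSpace.mem_iff P).2 ⟨?_, fun i => ?_, (h j Ub W).trans_lt (ENNReal.mul_lt_top (ENNReal.mul_lt_top hK
    (XSpace.xNorm_lt_top Ub)) (XSpace.xNorm_lt_top W))⟩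
  · exact (P.isReal_op₂ (Fn.IsReal.prod hr (XSpace.hsNorm_op₂ P Ub j) (XSpace.hsNorm_fst P W)
      (P.isReal_op₂ (XSpace.isReal_snd P Ub j)) (XSpace.isReal_fst P W))).add
      (P.isReal_op₂ (Fn.IsReal.prod hr (XSpace.hsNorm_fst P Ub) (XSpace.hsNorm_op₂ P W j)
        (XSpace.isReal_fst P Ub) (P.isReal_op₂ (XSpace.isReal_snd P W j))))
  · exact Fn.IsReal.prod hr (XSpace.hsNorm_op₂ P Ub j) (XSpace.hsNorm_op₂ P W i)
      (P.isReal_op₂ (XSpace.isReal_snd P Ub j)) (P.isReal_op₂ (XSpace.isReal_snd P W i))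

section
variable (hr : (d : ℝ) / 2 < r) (j : Fin d)
include hr

theorem bilA_add_left (U V W : XSpace P r) :
    P.bilA j ((U : State d) + V) W = P.bilA j U W + P.bilA j V W := by
  have h : P.op₂ ((U : State d).2 j + (V : State d).2 j) =
      P.op₂ ((U : State d).2 j) + P.op₂ ((V : State d).2 j) := P.op₂_add _ _
  refine Prod.ext ?_ (funext fun i => ?_)
  · change P.op₂ (Fn.prod (P.op₂ ((U : State d).2 j + (V : State d).2 j)) (W : State d).1) +
      P.op₂ (Fn.prod ((U : State d).1 + (V : State d).1) (P.op₂ ((W : State d).2 j))) =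
        (P.op₂ _ + P.op₂ _) + (P.op₂ _ + P.op₂ _)
    rw [h, Fn.prod_add_left hr (XSpace.hsNorm_op₂ P U j) (XSpace.hsNorm_op₂ P V j)
      (XSpace.hsNorm_fst P W), Fn.prod_add_left hr (XSpace.hsNorm_fst P U)
      (XSpace.hsNorm_fst P V) (XSpace.hsNorm_op₂ P W j), P.op₂_add, P.op₂_add]
    exact add_add_add_comm _ _ _ _
  · change Fn.prod (P.op₂ ((U : State d).2 j + (V : State d).2 j)) (P.op₂ ((W : State d).2 i)) =
      Fn.prod _ _ + Fn.prod _ _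
    rw [h, Fn.prod_add_left hr (XSpace.hsNorm_op₂ P U j) (XSpace.hsNorm_op₂ P V j)
      (XSpace.hsNorm_op₂ P W i)]

theorem bilA_smul_left (c : ℝ) (U W : XSpace P r) :
    P.bilA j (c • (U : State d)) W = c • P.bilA j U W := by
  have h : P.op₂ (c • (U : State d).2 j) = c • P.op₂ ((U : State d).2 j) := P.op₂_smul _ _
  refine Prod.ext ?_ (funext fun i => ?_)
  · change P.op₂ (Fn.prod (P.op₂ (c • (U : State d).2 j)) (W : State d).1) +
      P.op₂ (Fn.prod (c • (U : State d).1) (P.op₂ ((W : State d).2 j))) =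
        c • (P.op₂ _ + P.op₂ _)
    rw [h, Fn.prod_smul_left hr c (XSpace.hsNorm_op₂ P U j) (XSpace.hsNorm_fst P W),
      Fn.prod_smul_left hr c (XSpace.hsNorm_fst P U) (XSpace.hsNorm_op₂ P W j),
      P.op₂_smul, P.op₂_smul, smul_add]
  · change Fn.prod (P.op₂ (c • (U : State d).2 j)) (P.op₂ ((W : State d).2 i)) = c • Fn.prod _ _
    rw [h, Fn.prod_smul_left hr c (XSpace.hsNorm_op₂ P U j) (XSpace.hsNorm_op₂ P W i)]

theorem bilA_add_right (U W Z : XSpace P r) :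
    P.bilA j U ((W : State d) + Z) = P.bilA j U W + P.bilA j U Z := by
  have h : ∀ i, P.op₂ ((W : State d).2 i + (Z : State d).2 i) =
      P.op₂ ((W : State d).2 i) + P.op₂ ((Z : State d).2 i) := fun i => P.op₂_add _ _
  refine Prod.ext ?_ (funext fun i => ?_)
  · change P.op₂ (Fn.prod (P.op₂ ((U : State d).2 j)) ((W : State d).1 + (Z : State d).1)) +
      P.op₂ (Fn.prod (U : State d).1 (P.op₂ ((W : State d).2 j + (Z : State d).2 j))) =
        (P.op₂ _ + P.op₂ _) + (P.op₂ _ + P.op₂ _)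
    rw [h, Fn.prod_add_right hr (XSpace.hsNorm_op₂ P U j) (XSpace.hsNorm_fst P W)
      (XSpace.hsNorm_fst P Z), Fn.prod_add_right hr (XSpace.hsNorm_fst P U)
      (XSpace.hsNorm_op₂ P W j) (XSpace.hsNorm_op₂ P Z j), P.op₂_add, P.op₂_add]
    exact add_add_add_comm _ _ _ _
  · change Fn.prod (P.op₂ ((U : State d).2 j)) (P.op₂ ((W : State d).2 i + (Z : State d).2 i)) =
      Fn.prod _ _ + Fn.prod _ _
    rw [h, Fn.prod_add_right hr (XSpace.hsNorm_op₂ P U j) (XSpace.hsNorm_op₂ P W i)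
      (XSpace.hsNorm_op₂ P Z i)]

theorem bilA_smul_right (c : ℝ) (U W : XSpace P r) :
    P.bilA j U (c • (W : State d)) = c • P.bilA j U W := by
  have h : ∀ i, P.op₂ (c • (W : State d).2 i) = c • P.op₂ ((W : State d).2 i) :=
    fun i => P.op₂_smul _ _
  refine Prod.ext ?_ (funext fun i => ?_)
  · change P.op₂ (Fn.prod (P.op₂ ((U : State d).2 j)) (c • (W : State d).1)) +
      P.op₂ (Fn.prod (U : State d).1 (P.op₂ (c • (W : State d).2 j))) =
        c • (P.op₂ _ + P.op₂ _)
    rw [h, Fn.prod_smul_right hr c (XSpace.hsNorm_op₂ P U j) (XSpace.hsNorm_fst P W),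
      Fn.prod_smul_right hr c (XSpace.hsNorm_fst P U) (XSpace.hsNorm_op₂ P W j),
      P.op₂_smul, P.op₂_smul, smul_add]
  · change Fn.prod (P.op₂ ((U : State d).2 j)) (P.op₂ (c • (W : State d).2 i)) = c • Fn.prod _ _
    rw [h, Fn.prod_smul_right hr c (XSpace.hsNorm_op₂ P U j) (XSpace.hsNorm_op₂ P W i)]

end

/-- The bilinear part of `A_j` as a continuous bilinear map on `X^r`, `r > d/2`. -/
def bilX (hr : (d : ℝ) / 2 < r) (j : Fin d) : XSpace P r →L[ℝ] XSpace P r →L[ℝ] XSpace P r :=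
  LinearMap.mkContinuous₂
    (LinearMap.mk₂ ℝ (fun Ub W => (⟨P.bilA j Ub W, bilA_mem P hr j Ub W⟩ : XSpace P r))
      (fun U V W => Subtype.ext (bilA_add_left P hr j U V W))
      (fun c U W => Subtype.ext (bilA_smul_left P hr j c U W))
      (fun U W Z => Subtype.ext (bilA_add_right P hr j U W Z))
      (fun c U W => Subtype.ext (bilA_smul_right P hr j c U W)))
    (Classical.choose (exists_bilA_bound P hr)).toReal
    (fun U W => by
      have h := Classical.choose_spec (exists_bilA_bound P hr)
      rw [LinearMap.mk₂_apply, XSpace.norm_def, XSpace.norm_def, XSpace.norm_def,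
        ← ENNReal.toReal_mul, ← ENNReal.toReal_mul]
      exact ENNReal.toReal_mono (ENNReal.mul_lt_top (ENNReal.mul_lt_top h.1
        (XSpace.xNorm_lt_top U)) (XSpace.xNorm_lt_top W)).ne (h.2 j U W))

theorem exists_linA_bound (r : ℝ) :
    ∃ K : ℝ≥0∞, K < ⊤ ∧ ∀ (j : Fin d) (W : State d),
      xNorm P r (P.linA j W) ≤ K * xNorm P r (W : State d) := by
  obtain ⟨M₁, hM₁⟩ := P.bound₁
  refine ⟨ENNReal.ofReal M₁ + d * ENNReal.ofReal M₁,
    ENNReal.add_lt_top.2 ⟨ENNReal.ofReal_lt_top,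
      ENNReal.mul_lt_top (by simp) ENNReal.ofReal_lt_top⟩, ?_⟩
  intro j W
  refine (xNorm_le_sum P _).trans ?_
  set Y := xNorm P r (W : State d)
  calc _ ≤ ENNReal.ofReal M₁ * Y + ∑ i : Fin d, ENNReal.ofReal M₁ * Y := by
        refine add_le_add ?_ (Finset.sum_le_sum fun i _ => ?_)
        · exact (P.hsNorm_op₁_le' hM₁.nonneg hM₁ r _).trans
            (mul_le_mul_right (hsNorm_snd_le P r W j) _)
        · refine (P.hsNorm_op₁_le' hM₁.nonneg hM₁ r _).trans (mul_le_mul_right ?_ _)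
          by_cases h : i = j
          · simp only [AdmissiblePair.linA, h, if_true]
            exact hsNorm_fst_le P r W
          · simp only [AdmissiblePair.linA, h, if_false]
            have h0 : hsNorm r (0 : Fn d) = 0 := by
              have := hsNorm_smul r 0 (0 : Fn d)
              rwa [enorm_zero, zero_mul, zero_smul ℝ (0 : Fn d)] at this
            rw [h0]; exact zero_le
    _ = _ := by
        rw [Finset.sum_const, Finset.card_univ, Fintype.card_fin, nsmul_eq_mul]
        ring

/-- The linear part of `A_j`, as a linear map. -/
def AdmissiblePair.linAL (j : Fin d) : State d →ₗ[ℝ] State d where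
  toFun := P.linA j
  map_add' U V := Prod.ext
    (by
      change P.op₁ (P.op₁ (U.2 j + V.2 j)) = P.op₁ (P.op₁ (U.2 j)) + P.op₁ (P.op₁ (V.2 j))
      rw [P.op₁_add, P.op₁_add])
    (funext fun i => by
      change (if i = j then U.1 + V.1 else 0) =
        (if i = j then U.1 else 0) + (if i = j then V.1 else 0)
      split_ifs
      · rfl
      · rw [add_zero])
  map_smul' c U := Prod.ext
    (by
      change P.op₁ (P.op₁ (c • U.2 j)) = c • P.op₁ (P.op₁ (U.2 j))
      rw [P.op₁_smul, P.op₁_smul])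
    (funext fun i => by
      change (if i = j then c • U.1 else 0) = c • (if i = j then U.1 else 0)
      split_ifs
      · rfl
      · exact (smul_zero (A := Fn d) c).symm)

/-- The linear part of `A_j` as a continuous linear map on `X^r`. -/
def linX (r : ℝ) (j : Fin d) : XSpace P r →L[ℝ] XSpace P r :=
  XSpace.mkL P (P.linAL j) (Classical.choose (exists_linA_bound P r))
    (Classical.choose_spec (exists_linA_bound P r)).1
    (fun W => ⟨P.isReal_op₁ (P.isReal_op₁ (XSpace.isReal_snd P W j)), fun i => by
      by_cases h : i = j
      · simp only [AdmissiblePair.linAL, AdmissiblePair.linA, LinearMap.coe_mk, AddHom.coe_mk,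
          h, if_true]
        exact XSpace.isReal_fst P W
      · simp only [AdmissiblePair.linAL, AdmissiblePair.linA, LinearMap.coe_mk, AddHom.coe_mk,
          h, if_false]
        exact Fn.isReal_zero⟩)
    ((Classical.choose_spec (exists_linA_bound P r)).2 j)

/-- `W ↦ A_j(U̲)[W]` on `X^r`, `r > d/2`. -/
def AX (hr : (d : ℝ) / 2 < r) (ε : ℝ) (j : Fin d) (Ub : XSpace P r) : XSpace P r →L[ℝ] XSpace P r :=
  linX P r j + ε • bilX P hr j Ub

theorem AX_coe (hr : (d : ℝ) / 2 < r) (ε : ℝ) (j : Fin d) (Ub W : XSpace P r) :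
    (AX P hr ε j Ub W : State d) = P.A ε j Ub W := by
  rw [P.A_eq]; rfl

theorem zH_bilX (hr : (d : ℝ) / 2 < r) (h0 : 0 ≤ r) (j : Fin d) (Ub W : XSpace P r) :
    zH P h0 (bilX P hr j Ub W) = multOp P.sG₂ (convL d (aL P hr j Ub) (zH P h0 W) +
      convL d (bL P hr Ub) (multOp P.sm (vH P h0 j W))) := by
  refine Lp.ext ?_
  change ((P.bilA j Ub W).1 : Sp d → ℂ) =ᵐ[volume] _
  filter_upwards [AEEqFun.coeFn_add (P.op₂ (Fn.prod (P.op₂ ((Ub : State d).2 j)) (W : State d).1))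
      (P.op₂ (Fn.prod (Ub : State d).1 (P.op₂ ((W : State d).2 j)))),
    P.coeFn_op₂ (Fn.prod (P.op₂ ((Ub : State d).2 j)) (W : State d).1),
    P.coeFn_op₂ (Fn.prod (Ub : State d).1 (P.op₂ ((W : State d).2 j))),
    Fn.prod_coeFn_hs hr (XSpace.hsNorm_op₂ P Ub j) (XSpace.hsNorm_fst P W),
    Fn.prod_coeFn_hs hr (XSpace.hsNorm_fst P Ub) (XSpace.hsNorm_op₂ P W j),
    multOp_coeFn P.bddSym_sG₂ (convL d (aL P hr j Ub) (zH P h0 W) +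
      convL d (bL P hr Ub) (multOp P.sm (vH P h0 j W))),
    Lp.coeFn_add (convL d (aL P hr j Ub) (zH P h0 W))
      (convL d (bL P hr Ub) (multOp P.sm (vH P h0 j W))),
    convL_coeFn (aL P hr j Ub) (zH P h0 W),
    convL_coeFn (bL P hr Ub) (multOp P.sm (vH P h0 j W))] with ξ h1 h2 h3 h4 h5 h6 h7 h8 h9
  have e : (multOp P.sm (vH P h0 j W) : Sp d → ℂ) =ᵐ[volume] P.op₂ ((W : State d).2 j) := by
    filter_upwards [multOp_coeFn P.bddSym_sm (vH P h0 j W), P.coeFn_op₂' ((W : State d).2 j)]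
      with ξ k1 k2
    rw [k1, k2, vH_coeFn]
  rw [convF_congr_ae (ae_eq_refl _) e] at h9
  rw [h6, h7, Pi.add_apply, h8, h9]
  change (P.op₂ _ + P.op₂ _ : Fn d) ξ = _
  rw [h1, Pi.add_apply, h2, h3, h4, h5, mul_add]
  rfl

theorem vH_bilX (hr : (d : ℝ) / 2 < r) (h0 : 0 ≤ r) (i j : Fin d) (Ub W : XSpace P r) :
    vH P h0 i (bilX P hr j Ub W) = multOp P.sG₁ (convL d (aL P hr j Ub)
      (multOp P.sm (vH P h0 i W))) := by
  refine Lp.ext ?_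
  change (P.op₁ ((P.bilA j Ub W).2 i) : Sp d → ℂ) =ᵐ[volume] _
  filter_upwards [P.coeFn_op₁ ((P.bilA j Ub W).2 i),
    Fn.prod_coeFn_hs hr (XSpace.hsNorm_op₂ P Ub j) (XSpace.hsNorm_op₂ P W i),
    multOp_coeFn P.bddSym_sG₁ (convL d (aL P hr j Ub) (multOp P.sm (vH P h0 i W))),
    convL_coeFn (aL P hr j Ub) (multOp P.sm (vH P h0 i W))] with ξ h1 h2 h3 h4
  have e : (multOp P.sm (vH P h0 i W) : Sp d → ℂ) =ᵐ[volume] P.op₂ ((W : State d).2 i) := by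
    filter_upwards [multOp_coeFn P.bddSym_sm (vH P h0 i W), P.coeFn_op₂' ((W : State d).2 i)]
      with ξ k1 k2
    rw [k1, k2, vH_coeFn]
  rw [convF_congr_ae (ae_eq_refl _) e] at h4
  rw [h3, h4, h1]
  change _ * (Fn.prod _ _ : Fn d) ξ = _
  rw [h2]
  rfl

theorem zH_linX (h0 : 0 ≤ r) (j : Fin d) (W : XSpace P r) :
    zH P h0 (linX P r j W) = multOp P.sG₁ (vH P h0 j W) := by
  refine Lp.ext ?_
  filter_upwards [P.coeFn_op₁ (P.op₁ ((W : State d).2 j)),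
    multOp_coeFn P.bddSym_sG₁ (vH P h0 j W)] with ξ h1 h2
  rw [h2]
  exact h1

theorem vH_linX (h0 : 0 ≤ r) (i j : Fin d) (W : XSpace P r) :
    vH P h0 i (linX P r j W) = if i = j then multOp P.sG₁ (zH P h0 W) else 0 := by
  refine Lp.ext ?_
  change (P.op₁ ((P.linA j W).2 i) : Sp d → ℂ) =ᵐ[volume] _
  by_cases h : i = j
  · simp only [AdmissiblePair.linA, h, if_true]
    filter_upwards [P.coeFn_op₁ ((W : State d).1), multOp_coeFn P.bddSym_sG₁ (zH P h0 W)]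
      with ξ h1 h2
    rw [h1, h2]
    rfl
  · simp only [AdmissiblePair.linA, h, if_false]
    filter_upwards [P.coeFn_op₁ (0 : Fn d), Lp.coeFn_zero ℂ 2 (volume : Measure (Sp d)),
      AEEqFun.coeFn_zero (α := Sp d) (β := ℂ) (μ := volume)] with ξ h1 h2 h3
    rw [h1, h2, h3]
    simp

end bilinear

section frozen

variable {H : Type*} [NormedAddCommGroup H] [InnerProductSpace ℂ H]

theorem abs_re_inner_apply_le (T : H →L[ℂ] H) {C : ℝ} (hT : ‖T‖ ≤ C) (x y : H) :
    |(inner ℂ x (T y)).re| ≤ C * (‖x‖ * ‖y‖) := by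
  refine (Complex.abs_re_le_norm _).trans ((norm_inner_le_norm _ _).trans ?_)
  calc ‖x‖ * ‖T y‖ ≤ ‖x‖ * (C * ‖y‖) := by
        gcongr
        exact T.le_of_opNorm_le hT y
    _ = _ := by ring

/-- The symmetrizer `1 + ε m B m`. -/
def symmetrizer (m B : H →L[ℂ] H) (ε : ℝ) : H →L[ℂ] H := 1 + (ε : ℂ) • (m * B * m)

theorem symmetrizer_apply (m B : H →L[ℂ] H) (ε : ℝ) (x : H) :
    symmetrizer m B ε x = x + (ε : ℂ) • m (B (m x)) := rfl

theorem re_inner_smul_right' (ε : ℝ) (x y : H) :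
    (inner ℂ x ((ε : ℂ) • y)).re = ε * (inner ℂ x y).re := by
  rw [inner_smul_right, Complex.re_ofReal_mul]

theorem re_inner_smul_left' (ε : ℝ) (x y : H) :
    (inner ℂ ((ε : ℂ) • x) y).re = ε * (inner ℂ x y).re := by
  rw [inner_smul_left, Complex.conj_ofReal, Complex.re_ofReal_mul]

variable [CompleteSpace H]

theorem inner_apply_of_star_eq {T : H →L[ℂ] H} (hT : star T = T) (x y : H) :
    inner ℂ (T x) y = inner ℂ x (T y) := by
  rw [← ContinuousLinearMap.adjoint_inner_right, ← ContinuousLinearMap.star_eq_adjoint, hT]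

theorem two_mul_re_inner (T : H →L[ℂ] H) (x : H) :
    2 * (inner ℂ x (T x)).re = (inner ℂ x ((T + star T) x)).re := by
  have h : (inner ℂ x ((star T) x)).re = (inner ℂ x (T x)).re := by
    rw [ContinuousLinearMap.star_eq_adjoint, ContinuousLinearMap.adjoint_inner_right]
    exact inner_re_symm (𝕜 := ℂ) _ _
  rw [add_apply, inner_add_right, Complex.add_re, h]
  ring

/-- The operators of the system at a frozen time, with a common bound `Λ` for the operators and
their commutators. -/
structure FrozenOps {ι : Type*} (A D : ι → H →L[ℂ] H) (B G m : H →L[ℂ] H) (Λ : ℝ) : Prop where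
  one_le : 1 ≤ Λ
  star_A : ∀ j, star (A j) = A j
  star_B : star B = B
  star_G : star G = G
  star_m : star m = m
  star_D : ∀ j, star (D j) = -D j
  comm_mG : m * G = G * m
  comm_mD : ∀ j, m * D j = D j * m
  comm_GD : ∀ j, G * D j = D j * G
  comm_AB : ∀ j, A j * B = B * A j
  norm_A : ∀ j, ‖A j‖ ≤ Λ
  norm_B : ‖B‖ ≤ Λ
  norm_G : ‖G‖ ≤ Λ
  norm_m : ‖m‖ ≤ 1
  norm_DA : ∀ j, ‖D j * A j - A j * D j‖ ≤ Λ
  norm_DB : ∀ j, ‖D j * B - B * D j‖ ≤ Λ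
  norm_GAD : ∀ j, ‖(G * A j - A j * G) * D j‖ ≤ Λ
  norm_mGAD : ∀ j, ‖(m * G * A j - A j * (m * G)) * D j‖ ≤ Λ
  norm_mGBD : ∀ j, ‖(m * G * B - B * (m * G)) * D j‖ ≤ Λ

namespace FrozenOps

variable {ι : Type*} {A D : ι → H →L[ℂ] H} {B G m : H →L[ℂ] H} {Λ : ℝ}
  (F : FrozenOps A D B G m Λ)
include F

theorem pos : 0 < Λ := zero_lt_one.trans_le F.one_le

theorem norm_mG : ‖m * G‖ ≤ Λ :=
  (norm_mul_le _ _).trans ((mul_le_mul F.norm_m F.norm_G (norm_nonneg _) zero_le_one).trans_eq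
    (one_mul _))

theorem star_mG : star (m * G) = m * G := by
  rw [star_mul, F.star_m, F.star_G, F.comm_mG]

theorem comm_mGD (j : ι) : m * G * D j = D j * (m * G) := by
  rw [mul_assoc, F.comm_GD, ← mul_assoc, F.comm_mD, mul_assoc]

theorem re_inner_mGAD (j : ι) (f : H) :
    |(inner ℂ f ((m * G * A j * D j) f)).re| ≤ Λ ^ 2 * ‖f‖ ^ 2 := by
  have e : m * G * A j * D j + star (m * G * A j * D j) =
      (m * G * A j - A j * (m * G)) * D j - (D j * A j - A j * D j) * (m * G) := by
    rw [star_mul, star_mul, F.star_mG, F.star_A, F.star_D, sub_mul, sub_mul, mul_assoc (A j) (D j),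
      ← F.comm_mGD]
    noncomm_ring
  have hn : ‖m * G * A j * D j + star (m * G * A j * D j)‖ ≤ Λ + Λ * Λ := by
    rw [e]
    refine (norm_sub_le _ _).trans (add_le_add (F.norm_mGAD j) ((norm_mul_le _ _).trans ?_))
    exact mul_le_mul (F.norm_DA j) F.norm_mG (norm_nonneg _) F.pos.le
  have h := abs_re_inner_apply_le _ hn f f
  rw [← two_mul_re_inner, abs_mul, abs_two] at h
  nlinarith [F.one_le, sq_nonneg ‖f‖, mul_nonneg (sq_nonneg ‖f‖)
    (mul_nonneg F.pos.le (sub_nonneg.2 F.one_le))]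

theorem re_inner_ADmG (j : ι) (f : H) :
    |(inner ℂ f ((A j * D j * (m * G)) f)).re| ≤ Λ ^ 2 * ‖f‖ ^ 2 := by
  have e : A j * D j * (m * G) + star (A j * D j * (m * G)) =
      m * G * (A j * D j - D j * A j) - (m * G * A j - A j * (m * G)) * D j := by
    rw [star_mul (A j * D j), star_mul (A j), F.star_mG, F.star_A, F.star_D, sub_mul,
      mul_assoc (A j) (D j), ← F.comm_mGD]
    noncomm_ring
  have hn : ‖A j * D j * (m * G) + star (A j * D j * (m * G))‖ ≤ Λ * Λ + Λ := by
    rw [e]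
    refine (norm_sub_le _ _).trans (add_le_add ((norm_mul_le _ _).trans ?_) (F.norm_mGAD j))
    rw [norm_sub_rev (A j * D j)]
    exact mul_le_mul F.norm_mG (F.norm_DA j) (norm_nonneg _) F.pos.le
  have h := abs_re_inner_apply_le _ hn f f
  rw [← two_mul_re_inner, abs_mul, abs_two] at h
  nlinarith [F.one_le, sq_nonneg ‖f‖, mul_nonneg (sq_nonneg ‖f‖)
    (mul_nonneg F.pos.le (sub_nonneg.2 F.one_le))]

theorem re_inner_GADm (j : ι) (f : H) :
    |(inner ℂ f ((G * A j * D j * m) f)).re| ≤ 2 * Λ ^ 2 * ‖f‖ ^ 2 := by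
  have e : G * A j * D j * m = (G * A j - A j * G) * D j * m + A j * D j * (m * G) := by
    have : A j * D j * (m * G) = A j * G * D j * m := by
      rw [F.comm_mG, mul_assoc (A j) (D j), ← mul_assoc (D j), ← F.comm_GD]
      simp only [mul_assoc]
    rw [this]; noncomm_ring
  have h1 : ‖(G * A j - A j * G) * D j * m‖ ≤ Λ * 1 :=
    (norm_mul_le _ _).trans (mul_le_mul (F.norm_GAD j) F.norm_m (norm_nonneg _) F.pos.le)
  have h2 := abs_re_inner_apply_le _ h1 f f
  have h3 := F.re_inner_ADmG j f
  rw [e, add_apply, inner_add_right, Complex.add_re]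
  refine (abs_add_le _ _).trans ?_
  nlinarith [F.one_le, sq_nonneg ‖f‖, mul_nonneg (sq_nonneg ‖f‖)
    (mul_nonneg F.pos.le (sub_nonneg.2 F.one_le))]

theorem re_inner_BmGAD (j : ι) (f : H) :
    |(inner ℂ f ((B * (m * G) * A j * D j) f)).re| ≤ 3 * Λ ^ 3 * ‖f‖ ^ 2 := by
  set g := m * G with hg
  have e : B * g * A j * D j + star (B * g * A j * D j) =
      -(g * ((D j * A j - A j * D j) * B)) - g * (A j * (D j * B - B * D j))
        - (g * B - B * g) * D j * A j + (g * B - B * g) * (D j * A j - A j * D j)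
        + star ((g * A j - A j * g) * D j) * B + g * (B * A j - A j * B) * D j := by
    have hgD : g * D j = D j * g := F.comm_mGD j
    have hsg : star g = g := F.star_mG
    simp only [star_mul, star_sub, hsg, F.star_A, F.star_D, F.star_B]
    have h1 : g * (D j * A j * B) = D j * (g * (A j * B)) := by
      rw [mul_assoc (D j), ← mul_assoc, hgD, mul_assoc]
    simp only [← mul_assoc] at h1
    simp only [mul_sub, sub_mul, neg_mul, neg_sub, ← mul_assoc, ← h1]
    abel
  have hAB : B * A j - A j * B = 0 := by rw [F.comm_AB, sub_self]
  rw [hAB, mul_zero, zero_mul, add_zero] at e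
  have hgn : ‖g‖ ≤ Λ := F.norm_mG
  have hn : ‖B * g * A j * D j + star (B * g * A j * D j)‖ ≤ 6 * Λ ^ 3 := by
    have p := F.pos.le
    have h1 : ‖g * ((D j * A j - A j * D j) * B)‖ ≤ Λ * (Λ * Λ) :=
      (norm_mul_le _ _).trans (mul_le_mul hgn ((norm_mul_le _ _).trans
        (mul_le_mul (F.norm_DA j) F.norm_B (norm_nonneg _) p)) (norm_nonneg _) p)
    have h2 : ‖g * (A j * (D j * B - B * D j))‖ ≤ Λ * (Λ * Λ) :=
      (norm_mul_le _ _).trans (mul_le_mul hgn ((norm_mul_le _ _).trans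
        (mul_le_mul (F.norm_A j) (F.norm_DB j) (norm_nonneg _) p)) (norm_nonneg _) p)
    have h3 : ‖(g * B - B * g) * D j * A j‖ ≤ Λ * Λ :=
      (norm_mul_le _ _).trans (mul_le_mul (F.norm_mGBD j) (F.norm_A j) (norm_nonneg _) p)
    have h4 : ‖(g * B - B * g) * (D j * A j - A j * D j)‖ ≤ (Λ * Λ + Λ * Λ) * Λ := by
      refine (norm_mul_le _ _).trans (mul_le_mul ((norm_sub_le _ _).trans (add_le_add
        ((norm_mul_le _ _).trans (mul_le_mul hgn F.norm_B (norm_nonneg _) p))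
        ((norm_mul_le _ _).trans (mul_le_mul F.norm_B hgn (norm_nonneg _) p))))
        (F.norm_DA j) (norm_nonneg _) (by positivity))
    have h5 : ‖star ((g * A j - A j * g) * D j) * B‖ ≤ Λ * Λ := by
      refine (norm_mul_le _ _).trans (mul_le_mul ?_ F.norm_B (norm_nonneg _) p)
      rw [norm_star]
      exact F.norm_mGAD j
    rw [e]
    have t1 := norm_add_le (-(g * ((D j * A j - A j * D j) * B)) - g * (A j * (D j * B - B * D j))
        - (g * B - B * g) * D j * A j + (g * B - B * g) * (D j * A j - A j * D j))
        (star ((g * A j - A j * g) * D j) * B)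
    have t2 := norm_add_le (-(g * ((D j * A j - A j * D j) * B)) -
      g * (A j * (D j * B - B * D j)) - (g * B - B * g) * D j * A j)
      ((g * B - B * g) * (D j * A j - A j * D j))
    have t3 := norm_sub_le (-(g * ((D j * A j - A j * D j) * B)) -
      g * (A j * (D j * B - B * D j))) ((g * B - B * g) * D j * A j)
    have t4 := norm_sub_le (-(g * ((D j * A j - A j * D j) * B)))
      (g * (A j * (D j * B - B * D j)))
    rw [norm_neg] at t4
    have : Λ * Λ ≤ Λ ^ 3 := by nlinarith [F.one_le, mul_nonneg p p]
    nlinarith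
  have h := abs_re_inner_apply_le _ hn f f
  rw [← two_mul_re_inner, abs_mul, abs_two] at h
  nlinarith

theorem neg : FrozenOps A (fun j => -D j) B G m Λ where
  one_le := F.one_le
  star_A := F.star_A
  star_B := F.star_B
  star_G := F.star_G
  star_m := F.star_m
  star_D j := by rw [star_neg, F.star_D]
  comm_mG := F.comm_mG
  comm_mD j := by rw [mul_neg, neg_mul, F.comm_mD]
  comm_GD j := by rw [mul_neg, neg_mul, F.comm_GD]
  comm_AB := F.comm_AB
  norm_A := F.norm_A
  norm_B := F.norm_B
  norm_G := F.norm_G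
  norm_m := F.norm_m
  norm_DA j := by
    rw [mul_neg, neg_mul, sub_neg_eq_add, neg_add_eq_sub, norm_sub_rev]; exact F.norm_DA j
  norm_DB j := by
    rw [mul_neg, neg_mul, sub_neg_eq_add, neg_add_eq_sub, norm_sub_rev]; exact F.norm_DB j
  norm_GAD j := by rw [mul_neg, norm_neg]; exact F.norm_GAD j
  norm_mGAD j := by rw [mul_neg, norm_neg]; exact F.norm_mGAD j
  norm_mGBD j := by rw [mul_neg, norm_neg]; exact F.norm_mGBD j

theorem norm_symmetrizer_le {ε : ℝ} (h0 : 0 ≤ ε) (h1 : ε ≤ 1) (x : H) :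
    ‖symmetrizer m B ε x‖ ≤ 2 * Λ * ‖x‖ := by
  have p := F.pos.le
  have h : ‖m (B (m x))‖ ≤ Λ * ‖x‖ := by
    calc ‖m (B (m x))‖ ≤ 1 * ‖B (m x)‖ := m.le_of_opNorm_le F.norm_m _
      _ ≤ 1 * (Λ * (1 * ‖x‖)) := by
          gcongr
          exact (B.le_of_opNorm_le F.norm_B _).trans
            (mul_le_mul_of_nonneg_left (m.le_of_opNorm_le F.norm_m _) p)
      _ = _ := by ring
  rw [symmetrizer_apply]
  refine (norm_add_le _ _).trans ?_
  rw [norm_smul, Complex.norm_real, Real.norm_of_nonneg h0]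
  nlinarith [F.one_le, norm_nonneg x, norm_nonneg (m (B (m x)))]

theorem re_inner_symmetrizer {ε : ℝ} (h0 : 0 ≤ ε) (j : ι) (f g : H) :
    |(inner ℂ f ((G * symmetrizer m B ε * D j) g)).re +
      (inner ℂ (symmetrizer m B ε g) ((G * D j) f)).re| ≤ ε * (Λ ^ 2 * (‖f‖ * ‖g‖)) := by
  have p := F.pos.le
  have hS : star (symmetrizer m B ε) = symmetrizer m B ε := by
    rw [symmetrizer, star_add, star_one, star_smul, star_mul, star_mul, F.star_m, F.star_B,
      mul_assoc]
    simp
  have e1 : (inner ℂ (symmetrizer m B ε g) ((G * D j) f)).re =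
      -(inner ℂ f ((G * D j * symmetrizer m B ε) g)).re := by
    have h1 : star (G * D j) = -(G * D j) := by
      rw [star_mul, F.star_G, F.star_D, neg_mul, F.comm_GD]
    rw [← ContinuousLinearMap.adjoint_inner_left, ← ContinuousLinearMap.star_eq_adjoint, h1,
      neg_apply, inner_neg_left, Complex.neg_re]
    congr 1
    exact inner_re_symm (𝕜 := ℂ) _ _
  have e2 : G * symmetrizer m B ε * D j = G * D j * symmetrizer m B ε +
      (ε : ℂ) • -(m * G * ((D j * B - B * D j) * m)) := by
    have h1 : G * (m * B * m) * D j = m * G * (B * D j * m) := by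
      rw [F.comm_mG, mul_assoc (B : H →L[ℂ] H), ← F.comm_mD]; simp only [mul_assoc]
    have h2 : G * D j * (m * B * m) = m * G * (D j * B * m) := by
      rw [F.comm_mG, mul_assoc G m, ← mul_assoc m, ← mul_assoc m, F.comm_mD]
      simp only [mul_assoc]
    simp only [symmetrizer, mul_add, add_mul, mul_one, mul_smul_comm, smul_mul_assoc]
    rw [h1, h2, sub_mul, mul_sub, neg_sub, smul_sub]
    abel
  have hn : ‖m * G * ((D j * B - B * D j) * m)‖ ≤ Λ * (Λ * 1) :=
    (norm_mul_le _ _).trans (mul_le_mul F.norm_mG ((norm_mul_le _ _).trans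
      (mul_le_mul (F.norm_DB j) F.norm_m (norm_nonneg _) p)) (norm_nonneg _) p)
  rw [e1, e2, add_apply, inner_add_right, Complex.add_re, add_assoc, add_comm, add_assoc,
    neg_add_cancel, add_zero]
  change |(inner ℂ f ((ε : ℂ) • (-(m * G * ((D j * B - B * D j) * m))) g)).re| ≤ _
  rw [re_inner_smul_right', abs_mul, abs_of_nonneg h0]
  refine mul_le_mul_of_nonneg_left ((abs_re_inner_apply_le _ (C := Λ ^ 2) ?_ _ _)) h0
  rw [norm_neg]
  exact hn.trans_eq (by ring)

theorem re_inner_symmetrizer_GADm {ε : ℝ} (h0 : 0 ≤ ε) (h1 : ε ≤ 1) (j : ι) (f : H) :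
    |(inner ℂ (symmetrizer m B ε f) ((G * A j * D j * m) f)).re| ≤ 5 * Λ ^ 3 * ‖f‖ ^ 2 := by
  have p := F.pos.le
  have e : inner ℂ (m (B (m f))) ((G * A j * D j * m) f) =
      inner ℂ (m f) ((B * (m * G) * A j * D j) (m f)) := by
    rw [inner_apply_of_star_eq F.star_m, ← inner_apply_of_star_eq F.star_m,
      inner_apply_of_star_eq F.star_m, inner_apply_of_star_eq F.star_B]
    rfl
  have h2 := F.re_inner_GADm j f
  have h3 := F.re_inner_BmGAD j (m f)
  have hm : ‖m f‖ ≤ ‖f‖ := (m.le_of_opNorm_le F.norm_m f).trans_eq (one_mul _)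
  rw [symmetrizer_apply, inner_add_left, Complex.add_re, re_inner_smul_left', e]
  refine (abs_add_le _ _).trans ?_
  rw [abs_mul, abs_of_nonneg h0]
  have h4 : ‖m f‖ ^ 2 ≤ ‖f‖ ^ 2 := by gcongr
  have h5 : ε * |(inner ℂ (m f) ((B * (m * G) * A j * D j) (m f))).re| ≤ 3 * Λ ^ 3 * ‖f‖ ^ 2 :=
    (mul_le_mul h1 (h3.trans (mul_le_mul_of_nonneg_left h4 (by positivity))) (abs_nonneg _)
      zero_le_one).trans_eq (one_mul _)
  have h6 : Λ ^ 2 ≤ Λ ^ 3 := pow_le_pow_right₀ F.one_le (by norm_num)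
  nlinarith [sq_nonneg ‖f‖]

/-- The energy estimate at a frozen time. -/
theorem energy_le [Fintype ι] [DecidableEq ι] {W : H →L[ℂ] H} (hWG : W * G = G * W)
    (hWm : W * m = m * W) (hWD : ∀ j, W * D j = D j * W) {ε x y κ : ℝ} (h0 : 0 ≤ ε) (h1 : ε ≤ 1)
    (hx : 0 ≤ x) (hy : 0 ≤ y) (hκ : 0 ≤ κ) {z z' ρ : H} {V V' σ : ι → H}
    (hz : ‖W z‖ ≤ x) (hV : ∀ i, ‖W (V i)‖ ≤ x) (hρ : ‖W ρ‖ ≤ y) (hσ : ∀ i, ‖W (σ i)‖ ≤ y)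
    (hAz : ∀ j, ‖(W * A j - A j * W) (D j z)‖ ≤ κ)
    (hAV : ∀ i j, ‖(W * A j - A j * W) (D j (m (V i)))‖ ≤ κ)
    (hBV : ∀ j, ‖(W * B - B * W) (D j (m (V j)))‖ ≤ κ)
    (ez : z' = ρ - ∑ j, (G (D j (V j)) +
      (ε : ℂ) • m (G (A j (D j z) + B (m (D j (V j)))))))
    (eV : ∀ i, V' i = σ i - ∑ j, ((if i = j then G (D j z) else 0) +
      (ε : ℂ) • G (A j (m (D j (V i)))))) :
    (inner ℂ (W z) (W z')).re + ∑ i, (inner ℂ (symmetrizer m B ε (W (V i))) (W (V' i))).re ≤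
      10 * (Fintype.card ι + 1) ^ 2 * Λ ^ 3 * (ε * x ^ 2 + ε * κ * x + x * y) := by
  have p := F.pos.le
  have cWG : ∀ u, W (G u) = G (W u) := fun u => congrArg (fun T : H →L[ℂ] H => T u) hWG
  have cWm : ∀ u, W (m u) = m (W u) := fun u => congrArg (fun T : H →L[ℂ] H => T u) hWm
  have cWD : ∀ j u, W (D j u) = D j (W u) :=
    fun j u => congrArg (fun T : H →L[ℂ] H => T u) (hWD j)
  have cmD : ∀ j u, m (D j u) = D j (m u) :=
    fun j u => congrArg (fun T : H →L[ℂ] H => T u) (F.comm_mD j)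
  have cmG : ∀ u, m (G u) = G (m u) := fun u => congrArg (fun T : H →L[ℂ] H => T u) F.comm_mG
  have cWA : ∀ j u, W (A j u) = A j (W u) + (W * A j - A j * W) u := fun j u => by
    rw [sub_apply]; exact (add_sub_cancel _ _).symm
  have cWB : ∀ u, W (B u) = B (W u) + (W * B - B * W) u := fun u => by
    rw [sub_apply]; exact (add_sub_cancel _ _).symm
  set f := W z with hf
  set c : ι → H := fun j => m (G ((W * A j - A j * W) (D j z) + (W * B - B * W) (D j (m (V j)))))
    with hc
  set e : ι → ι → H := fun i j => G ((W * A j - A j * W) (D j (m (V i)))) with he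
  have hWz : W z' = W ρ - ∑ j, ((G * symmetrizer m B ε * D j) (W (V j)) +
      (ε : ℂ) • (m * G * A j * D j) f + (ε : ℂ) • c j) := by
    rw [ez, map_sub, map_sum]
    congr 1
    refine Finset.sum_congr rfl fun j _ => ?_
    change _ = G (symmetrizer m B ε (D j (W (V j)))) + (ε : ℂ) • m (G (A j (D j (W z)))) + _
    rw [symmetrizer_apply]
    simp only [hc, map_add, map_smul, cWG, cWm, cWA, cWB, cWD, smul_add, cmD, cmG]
    abel
  have hWV : ∀ i, W (V' i) = W (σ i) - ((G * D i) f + ∑ j,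
      ((ε : ℂ) • (G * A j * D j * m) (W (V i)) + (ε : ℂ) • e i j)) := by
    intro i
    rw [eV i, map_sub, map_sum, Finset.sum_congr rfl (fun j _ => map_add W _ _),
      Finset.sum_add_distrib]
    congr 2
    · rw [Finset.sum_eq_single i]
      · rw [if_pos rfl, cWG, cWD]; rfl
      · intro j _ hj
        rw [if_neg hj.symm, map_zero]
      · simp
    · refine Finset.sum_congr rfl fun j _ => ?_
      change _ = (ε : ℂ) • G (A j (D j (m (W (V i))))) + _
      simp only [he, map_add, map_smul, cWG, cWm, cWA, cWD, smul_add, cmD]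
  have key : (inner ℂ f (W z')).re +
      ∑ i, (inner ℂ (symmetrizer m B ε (W (V i))) (W (V' i))).re =
      ((inner ℂ f (W ρ)).re + ∑ i, (inner ℂ (symmetrizer m B ε (W (V i))) (W (σ i))).re) -
      ∑ j, (((inner ℂ f ((G * symmetrizer m B ε * D j) (W (V j)))).re +
        (inner ℂ (symmetrizer m B ε (W (V j))) ((G * D j) f)).re) +
        ε * (inner ℂ f ((m * G * A j * D j) f)).re + ε * (inner ℂ f (c j)).re) -
      ∑ i, ∑ j, (ε * (inner ℂ (symmetrizer m B ε (W (V i)))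
          ((G * A j * D j * m) (W (V i)))).re +
        ε * (inner ℂ (symmetrizer m B ε (W (V i))) (e i j)).re) := by
    rw [hWz]
    simp only [hWV, inner_sub_right, inner_add_right, inner_sum, Complex.sub_re, Complex.add_re,
      Complex.re_sum, re_inner_smul_right', Finset.sum_add_distrib, Finset.sum_sub_distrib]
    ring
  have hS : ∀ i, ‖symmetrizer m B ε (W (V i))‖ ≤ 2 * Λ * x := fun i =>
    (F.norm_symmetrizer_le h0 h1 _).trans (by gcongr; exact hV i)
  have re_le : ∀ u v : H, |(inner ℂ u v).re| ≤ ‖u‖ * ‖v‖ := fun u v =>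
    (Complex.abs_re_le_norm _).trans (norm_inner_le_norm _ _)
  have hcn : ∀ j, ‖c j‖ ≤ 2 * Λ * κ := fun j => by
    calc ‖c j‖ ≤ 1 * ‖G ((W * A j - A j * W) (D j z) + (W * B - B * W) (D j (m (V j))))‖ :=
          m.le_of_opNorm_le F.norm_m _
      _ ≤ 1 * (Λ * (κ + κ)) := by
          gcongr
          exact (G.le_of_opNorm_le F.norm_G _).trans (mul_le_mul_of_nonneg_left
            ((norm_add_le _ _).trans (add_le_add (hAz j) (hBV j))) p)
      _ = _ := by ring
  have hen : ∀ i j, ‖e i j‖ ≤ Λ * κ := fun i j =>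
    (G.le_of_opNorm_le F.norm_G _).trans (mul_le_mul_of_nonneg_left (hAV i j) p)
  have hΛ2 : Λ ^ 2 ≤ Λ ^ 3 := pow_le_pow_right₀ F.one_le (by norm_num)
  have hΛ1 : Λ ≤ Λ ^ 3 := le_self_pow₀ F.one_le (by norm_num)
  have t1 : (inner ℂ f (W ρ)).re ≤ Λ ^ 3 * (x * y) := by
    refine (le_abs_self _).trans ((re_le _ _).trans ?_)
    calc ‖f‖ * ‖W ρ‖ ≤ 1 * (x * y) := by rw [one_mul]; gcongr
      _ ≤ _ := by gcongr; exact one_le_pow₀ F.one_le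
  have t2 : ∀ i, (inner ℂ (symmetrizer m B ε (W (V i))) (W (σ i))).re ≤
      2 * Λ ^ 3 * (x * y) := fun i => by
    refine (le_abs_self _).trans ((re_le _ _).trans ?_)
    calc _ ≤ (2 * Λ * x) * y := by gcongr; exacts [hS i, hσ i]
      _ = 2 * Λ * (x * y) := by ring
      _ ≤ _ := by gcongr
  have t3 : ∀ j, -(((inner ℂ f ((G * symmetrizer m B ε * D j) (W (V j)))).re +
        (inner ℂ (symmetrizer m B ε (W (V j))) ((G * D j) f)).re) +
        ε * (inner ℂ f ((m * G * A j * D j) f)).re + ε * (inner ℂ f (c j)).re) ≤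
      2 * Λ ^ 3 * (ε * x ^ 2 + ε * κ * x) := fun j => by
    have k1 := (neg_le_abs _).trans (F.re_inner_symmetrizer h0 j f (W (V j)))
    have k2 := (neg_le_abs _).trans (F.re_inner_mGAD j f)
    have k3 := (neg_le_abs _).trans (re_le f (c j))
    have q1 : Λ ^ 2 * (‖f‖ * ‖W (V j)‖) ≤ Λ ^ 3 * (x * x) := by gcongr; exact hV j
    have q2 : Λ ^ 2 * ‖f‖ ^ 2 ≤ Λ ^ 3 * x ^ 2 := by gcongr
    have q3 : ‖f‖ * ‖c j‖ ≤ 2 * Λ ^ 3 * (κ * x) :=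
      calc _ ≤ x * (2 * Λ * κ) := by gcongr; exact hcn j
        _ = 2 * Λ * (κ * x) := by ring
        _ ≤ _ := by gcongr
    have r1 := mul_le_mul_of_nonneg_left q1 h0
    have r2 := mul_le_mul_of_nonneg_left (k2.trans q2) h0
    have r3 := mul_le_mul_of_nonneg_left (k3.trans q3) h0
    linarith
  have t4 : ∀ i j, -(ε * (inner ℂ (symmetrizer m B ε (W (V i)))
          ((G * A j * D j * m) (W (V i)))).re +
        ε * (inner ℂ (symmetrizer m B ε (W (V i))) (e i j)).re) ≤
      5 * Λ ^ 3 * (ε * x ^ 2 + ε * κ * x) := fun i j => by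
    have k2 := (neg_le_abs _).trans (F.re_inner_symmetrizer_GADm h0 h1 j (W (V i)))
    have k3 := (neg_le_abs _).trans (re_le (symmetrizer m B ε (W (V i))) (e i j))
    have q2 : 5 * Λ ^ 3 * ‖W (V i)‖ ^ 2 ≤ 5 * Λ ^ 3 * x ^ 2 := by gcongr; exact hV i
    have q3 : ‖symmetrizer m B ε (W (V i))‖ * ‖e i j‖ ≤ 5 * Λ ^ 3 * (κ * x) :=
      calc _ ≤ (2 * Λ * x) * (Λ * κ) := by gcongr; exacts [hS i, hen i j]
        _ = 2 * Λ ^ 2 * (κ * x) := by ring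
        _ ≤ 5 * Λ ^ 3 * (κ * x) := by gcongr; norm_num
    have r2 := mul_le_mul_of_nonneg_left (k2.trans q2) h0
    have r3 := mul_le_mul_of_nonneg_left (k3.trans q3) h0
    linarith
  have s2 := Finset.sum_le_sum fun i (_ : i ∈ Finset.univ) => t2 i
  have s3 := Finset.sum_le_sum fun j (_ : j ∈ Finset.univ) => t3 j
  have s4 := Finset.sum_le_sum fun i (_ : i ∈ Finset.univ) =>
    Finset.sum_le_sum fun j (_ : j ∈ Finset.univ) => t4 i j
  simp only [Finset.sum_neg_distrib, Finset.sum_const, Finset.card_univ, nsmul_eq_mul] at s2 s3 s4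
  rw [key]
  set n : ℝ := ((Fintype.card ι : ℕ) : ℝ) with hn
  have hn0 : 0 ≤ n := by positivity
  have a1 : 0 ≤ Λ ^ 3 * (ε * x ^ 2 + ε * κ * x) := by positivity
  have a2 : 0 ≤ Λ ^ 3 * (x * y) := by positivity
  have b1 : n * (2 * Λ ^ 3 * (ε * x ^ 2 + ε * κ * x)) +
      n * (n * (5 * Λ ^ 3 * (ε * x ^ 2 + ε * κ * x))) ≤
      10 * (n + 1) ^ 2 * (Λ ^ 3 * (ε * x ^ 2 + ε * κ * x)) := by
    have := mul_nonneg hn0 a1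
    have := mul_nonneg hn0 this
    nlinarith
  have b2 : Λ ^ 3 * (x * y) + n * (2 * Λ ^ 3 * (x * y)) ≤
      10 * (n + 1) ^ 2 * (Λ ^ 3 * (x * y)) := by
    have := mul_nonneg hn0 a2
    have := mul_nonneg hn0 this
    nlinarith
  linarith

/-- The two-sided energy estimate at a frozen time. -/
theorem abs_energy_le [Fintype ι] [DecidableEq ι] {W : H →L[ℂ] H} (hWG : W * G = G * W)
    (hWm : W * m = m * W) (hWD : ∀ j, W * D j = D j * W) {ε x y κ : ℝ} (h0 : 0 ≤ ε) (h1 : ε ≤ 1)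
    (hx : 0 ≤ x) (hy : 0 ≤ y) (hκ : 0 ≤ κ) {z z' ρ : H} {V V' σ : ι → H}
    (hz : ‖W z‖ ≤ x) (hV : ∀ i, ‖W (V i)‖ ≤ x) (hρ : ‖W ρ‖ ≤ y) (hσ : ∀ i, ‖W (σ i)‖ ≤ y)
    (hAz : ∀ j, ‖(W * A j - A j * W) (D j z)‖ ≤ κ)
    (hAV : ∀ i j, ‖(W * A j - A j * W) (D j (m (V i)))‖ ≤ κ)
    (hBV : ∀ j, ‖(W * B - B * W) (D j (m (V j)))‖ ≤ κ)
    (ez : z' = ρ - ∑ j, (G (D j (V j)) +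
      (ε : ℂ) • m (G (A j (D j z) + B (m (D j (V j)))))))
    (eV : ∀ i, V' i = σ i - ∑ j, ((if i = j then G (D j z) else 0) +
      (ε : ℂ) • G (A j (m (D j (V i)))))) :
    |(inner ℂ (W z) (W z')).re + ∑ i, (inner ℂ (symmetrizer m B ε (W (V i))) (W (V' i))).re| ≤
      10 * (Fintype.card ι + 1) ^ 2 * Λ ^ 3 * (ε * x ^ 2 + ε * κ * x + x * y) := by
  have h2 := F.energy_le hWG hWm hWD h0 h1 hx hy hκ hz hV hρ hσ hAz hAV hBV ez eV
  have h3 := F.neg.energy_le hWG hWm (fun j => by rw [mul_neg, neg_mul, hWD]) h0 h1 hx hy hκ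
    (z' := -z') (ρ := -ρ) (V' := fun i => -V' i) (σ := fun i => -σ i) hz hV
    (by rwa [map_neg, norm_neg]) (fun i => by rw [map_neg, norm_neg]; exact hσ i)
    (fun j => by rw [neg_apply, map_neg, norm_neg]; exact hAz j)
    (fun i j => by rw [neg_apply, map_neg, norm_neg]; exact hAV i j)
    (fun j => by rw [neg_apply, map_neg, norm_neg]; exact hBV j)
    (by
      rw [ez, neg_sub, sub_eq_neg_add, neg_add_eq_sub, sub_eq_add_neg, add_comm, sub_eq_add_neg,
        ← Finset.sum_neg_distrib]
      congr 1
      refine Finset.sum_congr rfl fun j _ => ?_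
      simp only [neg_apply, map_neg, ← neg_add, smul_neg, neg_neg])
    (fun i => by
      rw [eV i, neg_sub, sub_eq_neg_add, neg_add_eq_sub, sub_eq_add_neg, add_comm, sub_eq_add_neg,
        ← Finset.sum_neg_distrib]
      congr 1
      refine Finset.sum_congr rfl fun j _ => ?_
      split_ifs <;> simp only [neg_apply, map_neg, ← neg_add, smul_neg, neg_neg, zero_add])
  refine abs_le'.2 ⟨h2, le_trans (le_of_eq ?_) h3⟩
  simp only [map_neg, inner_neg_right, Complex.neg_re, Finset.sum_neg_distrib]
  ring

end FrozenOps

end frozen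

section weights

variable {d : ℕ}

/-- The truncation of the `j`-th coordinate to `[-n, n]`. -/
def clampCoord (n : ℕ) (j : Fin d) (ξ : Sp d) : ℝ := max (-(n : ℝ)) (min (n : ℝ) (ξ j))

theorem continuous_clampCoord (n : ℕ) (j : Fin d) : Continuous (clampCoord n j) := by
  unfold clampCoord; fun_prop

theorem clampCoord_neg (n : ℕ) (j : Fin d) (ξ : Sp d) :
    clampCoord n j (-ξ) = -clampCoord n j ξ := by
  unfold clampCoord
  have h : (-ξ) j = -ξ j := rfl
  have h0 : (0 : ℝ) ≤ n := n.cast_nonneg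
  rw [h]
  rcases le_total (ξ j) n with h1 | h1 <;> rcases le_total (-(n : ℝ)) (ξ j) with h2 | h2 <;>
    simp only [max_def, min_def] <;> split_ifs <;> linarith

theorem abs_coord_le (j : Fin d) (ξ : Sp d) : |ξ j| ≤ ‖ξ‖ := PiLp.norm_apply_le ξ j

theorem abs_clampCoord_sub_le (n : ℕ) (j : Fin d) (ξ η : Sp d) :
    |clampCoord n j ξ - clampCoord n j η| ≤ ‖ξ - η‖ := by
  refine le_trans ?_ (abs_coord_le j (ξ - η))
  have h : (ξ - η) j = ξ j - η j := rfl
  rw [h]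
  unfold clampCoord
  refine (abs_max_sub_max_le_max _ _ _ _).trans ?_
  rw [sub_self, abs_zero]
  refine max_le (abs_nonneg _) ((abs_min_sub_min_le_max _ _ _ _).trans ?_)
  rw [sub_self, abs_zero]
  exact max_le (abs_nonneg _) le_rfl

theorem abs_clampCoord_le_norm (n : ℕ) (j : Fin d) (ξ : Sp d) : |clampCoord n j ξ| ≤ ‖ξ‖ := by
  have h := abs_clampCoord_sub_le n j ξ 0
  have h0 : clampCoord n j (0 : Sp d) = 0 := by
    have := clampCoord_neg n j (0 : Sp d)
    rw [neg_zero] at this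
    linarith
  rwa [h0, sub_zero, sub_zero] at h

theorem abs_clampCoord_le (n : ℕ) (j : Fin d) (ξ : Sp d) : |clampCoord n j ξ| ≤ n := by
  have h0 : (0 : ℝ) ≤ n := n.cast_nonneg
  unfold clampCoord
  exact abs_le.2 ⟨le_max_left _ _, max_le (by linarith) (min_le_left _ _)⟩

/-- The symbol of the truncated derivative. -/
def derivSym (n : ℕ) (j : Fin d) (ξ : Sp d) : ℂ :=
  2 * Real.pi * Complex.I * ((clampCoord n j ξ : ℝ) : ℂ)

theorem continuous_derivSym (n : ℕ) (j : Fin d) : Continuous (derivSym n j) := by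
  have := continuous_clampCoord n j
  unfold derivSym; fun_prop

theorem norm_derivSym (n : ℕ) (j : Fin d) (ξ : Sp d) :
    ‖derivSym n j ξ‖ = 2 * Real.pi * |clampCoord n j ξ| := by
  simp [derivSym, abs_of_pos Real.pi_pos]

theorem norm_derivSym_le_jb (n : ℕ) (j : Fin d) (ξ : Sp d) : ‖derivSym n j ξ‖ ≤ jb ξ := by
  rw [norm_derivSym]
  refine le_trans ?_ (two_pi_norm_le_jb ξ)
  have := abs_clampCoord_le_norm n j ξ
  have := Real.pi_pos
  gcongr

theorem norm_derivSym_le (n : ℕ) (j : Fin d) (ξ : Sp d) : ‖derivSym n j ξ‖ ≤ 2 * Real.pi * n := by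
  rw [norm_derivSym]
  have := abs_clampCoord_le n j ξ
  have := Real.pi_pos
  gcongr

theorem norm_derivSym_sub_le (n : ℕ) (j : Fin d) (ξ η : Sp d) :
    ‖derivSym n j ξ - derivSym n j η‖ ≤ jb (ξ - η) := by
  have e : derivSym n j ξ - derivSym n j η =
      2 * Real.pi * Complex.I * ((clampCoord n j ξ - clampCoord n j η : ℝ) : ℂ) := by
    unfold derivSym; push_cast; ring
  have h : ‖derivSym n j ξ - derivSym n j η‖ =
      2 * Real.pi * |clampCoord n j ξ - clampCoord n j η| := by
    rw [e, norm_mul, Complex.norm_real, Real.norm_eq_abs]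
    simp [abs_of_pos Real.pi_pos]
  rw [h]
  refine le_trans ?_ (two_pi_norm_le_jb _)
  have := abs_clampCoord_sub_le n j ξ η
  have := Real.pi_pos
  gcongr

theorem derivSym_neg (n : ℕ) (j : Fin d) (ξ : Sp d) :
    derivSym n j (-ξ) = star (derivSym n j ξ) := by
  simp [derivSym, clampCoord_neg]

theorem bddSym_derivSym (n : ℕ) (j : Fin d) : BddSym (derivSym n j) :=
  ⟨(continuous_derivSym n j).aestronglyMeasurable, _, .of_forall (norm_derivSym_le n j)⟩

/-- The truncated weight `min (⟨D⟩^σ) k`. -/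
def wt (σ : ℝ) (k : ℕ) (ξ : Sp d) : ℂ := ((min (jb ξ ^ σ) k : ℝ) : ℂ)

theorem continuous_wt (σ : ℝ) (k : ℕ) : Continuous (wt (d := d) σ k) := by
  have h : Continuous fun ξ : Sp d => jb ξ ^ σ := continuous_weight σ
  unfold wt; fun_prop

theorem norm_wt (σ : ℝ) (k : ℕ) (ξ : Sp d) : ‖wt σ k ξ‖ = min (jb ξ ^ σ) k := by
  rw [wt, Complex.norm_real, Real.norm_of_nonneg]
  exact le_min (Real.rpow_nonneg (jb_pos ξ).le _) k.cast_nonneg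

theorem bddSym_wt (σ : ℝ) (k : ℕ) : BddSym (wt (d := d) σ k) :=
  ⟨(continuous_wt σ k).aestronglyMeasurable, k, .of_forall fun ξ => by
    rw [norm_wt]; exact min_le_right _ _⟩

theorem norm_wt_sub_le (σ : ℝ) (k : ℕ) (ξ η : Sp d) :
    ‖wt σ k ξ - wt σ k η‖ ≤ |jb ξ ^ σ - jb η ^ σ| := by
  rw [wt, wt, ← Complex.ofReal_sub, Complex.norm_real, Real.norm_eq_abs]
  refine (abs_min_sub_min_le_max _ _ _ _).trans ?_
  rw [sub_self, abs_zero]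
  exact max_le le_rfl (abs_nonneg _)

theorem enorm_multOp_wt_le (σ : ℝ) (k : ℕ) (f : L2Sp d) :
    ‖multOp (wt σ k) f‖ₑ ≤ hsNorm σ f.1 := by
  rw [Lp.enorm_def, hsNorm_eq]
  refine eLpNorm_mono_ae ?_
  filter_upwards [multOp_coeFn (bddSym_wt σ k) f] with ξ h
  rw [h, norm_mul, norm_smul, norm_wt, Real.norm_of_nonneg (Real.rpow_nonneg (jb_pos ξ).le _)]
  exact mul_le_mul_of_nonneg_right (min_le_left _ _) (norm_nonneg _)

theorem lintegral_jb_enorm_le (s : ℝ) (f : Fn d) :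
    ∫⁻ ξ, ENNReal.ofReal (jb ξ) * ‖f ξ‖ₑ ≤ sobolevConst d (s - 1) * hsNorm s f := by
  have h := lintegral_enorm_le_sobolev (r := s - 1) (f := fun ξ : Sp d => jb ξ • f ξ)
    (continuous_jb.aestronglyMeasurable.smul f.aestronglyMeasurable)
  have e1 : ∀ ξ : Sp d, ‖jb ξ • f ξ‖ₑ = ENNReal.ofReal (jb ξ) * ‖f ξ‖ₑ := fun ξ => by
    rw [enorm_smul, Real.enorm_eq_ofReal (jb_pos ξ).le]
  have e2 : (fun ξ : Sp d => (jb ξ ^ (s - 1)) • jb ξ • f ξ) = fun ξ => (jb ξ ^ s) • f ξ := by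
    funext ξ
    rw [smul_smul, ← Real.rpow_add_one (jb_pos ξ).ne', sub_add_cancel]
  simp only [e1] at h
  rw [e2] at h
  exact h

theorem enorm_weight_commutator_le {s : ℝ} (hs : 1 ≤ s) (k n : ℕ) (j : Fin d) (a : L1Sp d)
    (f : L2Sp d) :
    ‖(multOp (wt s k) * convL d a - convL d a * multOp (wt s k) : L2Sp d →L[ℂ] L2Sp d)
      (multOp (derivSym n j) f)‖ₑ ≤
      ENNReal.ofReal (s * 2 ^ s) * (2 * sobolevConst d (s - 1)) * (hsNorm s a.1 * hsNorm s f.1) := by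
  set c := s * 2 ^ s with hc
  have hc0 : 0 ≤ c := by positivity
  have mjb : AEMeasurable (fun ξ : Sp d => ENNReal.ofReal (jb ξ)) volume :=
    continuous_jb.measurable.ennreal_ofReal.aemeasurable
  have mjs : AEMeasurable (fun ξ : Sp d => ENNReal.ofReal (jb ξ ^ s)) volume :=
    (continuous_weight s).measurable.ennreal_ofReal.aemeasurable
  have ma : AEMeasurable (fun ξ => ‖a ξ‖ₑ) volume := (Lp.memLp a).1.enorm
  have mf : AEMeasurable (fun ξ => ‖f ξ‖ₑ) volume := (Lp.memLp f).1.enorm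
  set u₁ : Sp d → ℝ≥0∞ := fun ξ => ENNReal.ofReal c * (ENNReal.ofReal (jb ξ) * ‖a ξ‖ₑ) with hu₁
  set v₁ : Sp d → ℝ≥0∞ := fun ξ => ENNReal.ofReal (jb ξ ^ s) * ‖f ξ‖ₑ with hv₁
  set u₂ : Sp d → ℝ≥0∞ := fun ξ => ENNReal.ofReal (jb ξ ^ s) * ‖a ξ‖ₑ with hu₂
  set v₂ : Sp d → ℝ≥0∞ := fun ξ => ENNReal.ofReal c * (ENNReal.ofReal (jb ξ) * ‖f ξ‖ₑ) with hv₂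
  have mu₁ : AEMeasurable u₁ volume := (mjb.mul ma).const_mul _
  have mv₁ : AEMeasurable v₁ volume := mjs.mul mf
  have mu₂ : AEMeasurable u₂ volume := mjs.mul ma
  have mv₂ : AEMeasurable v₂ volume := (mjb.mul mf).const_mul _
  have hw : ∀ g : Fn d, eLpNorm (fun ξ => ENNReal.ofReal (jb ξ ^ s) * ‖g ξ‖ₑ) 2 volume =
      hsNorm s g := fun g => by
    rw [hsNorm_eq]
    refine eLpNorm_congr_enorm_ae (.of_forall fun ξ => ?_)
    rw [enorm_eq_self, enorm_smul, Real.enorm_eq_ofReal (Real.rpow_nonneg (jb_pos ξ).le _)]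
  have hw1 : ∀ g : Fn d, eLpNorm (fun ξ => ENNReal.ofReal c * (ENNReal.ofReal (jb ξ) * ‖g ξ‖ₑ)) 1
      volume ≤ ENNReal.ofReal c * (sobolevConst d (s - 1) * hsNorm s g) := fun g => by
    rw [eLpNorm_one_eq_lintegral_enorm]
    simp only [enorm_eq_self]
    rw [lintegral_const_mul' _ _ ENNReal.ofReal_ne_top]
    exact mul_le_mul_right (lintegral_jb_enorm_le s g) _
  have y1 := eLpNorm_convE_le mu₁ mv₁
  have y2 := eLpNorm_convE_le mv₂ mu₂
  rw [Lp.enorm_def]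
  have hpt : ∀ᵐ ξ, ‖((multOp (wt s k) * convL d a - convL d a * multOp (wt s k) : L2Sp d →L[ℂ] L2Sp d)
      (multOp (derivSym n j) f)) ξ‖ₑ ≤ ‖(convE u₁ v₁ + convE v₂ u₂) ξ‖ₑ := by
    filter_upwards [enorm_commutator_le (bddSym_wt s k) (bddSym_derivSym n j) a f] with ξ h
    refine h.trans ?_
    rw [enorm_eq_self, Pi.add_apply, convE_comm v₂ u₂, convE, convE, ← lintegral_add_left']
    · refine lintegral_mono fun η => ?_
      have h1 : ‖wt s k ξ - wt s k η‖ₑ * ‖derivSym n j η‖ₑ ≤ ENNReal.ofReal c *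
          (ENNReal.ofReal (jb (ξ - η)) * ENNReal.ofReal (jb η ^ s) +
          ENNReal.ofReal (jb (ξ - η) ^ s) * ENNReal.ofReal (jb η)) := by
        rw [← ofReal_norm, ← ofReal_norm, ← ENNReal.ofReal_mul (norm_nonneg _),
          ← ENNReal.ofReal_mul (jb_pos _).le,
          ← ENNReal.ofReal_mul (Real.rpow_nonneg (jb_pos _).le _),
          ← ENNReal.ofReal_add (mul_nonneg (jb_pos _).le (Real.rpow_nonneg (jb_pos _).le _))
            (mul_nonneg (Real.rpow_nonneg (jb_pos _).le _) (jb_pos _).le),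
          ← ENNReal.ofReal_mul hc0]
        refine ENNReal.ofReal_le_ofReal (le_trans ?_ (abs_jb_rpow_sub_le hs ξ η))
        exact mul_le_mul (norm_wt_sub_le s k ξ η) (norm_derivSym_le_jb n j η) (norm_nonneg _)
          (abs_nonneg _)
      refine (mul_le_mul_left h1 _).trans_eq ?_
      simp only [hu₁, hu₂, hv₁, hv₂]
      ring
    · exact (mu₁.comp_quasiMeasurePreserving
        (quasiMeasurePreserving_sub_left_of_right_invariant volume ξ)).mul mv₁
  refine (eLpNorm_mono_enorm_ae hpt).trans ((eLpNorm_add_le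
    (aemeasurable_convE mu₁ mv₁).aestronglyMeasurable
    (aemeasurable_convE mv₂ mu₂).aestronglyMeasurable (by norm_num)).trans ?_)
  refine (add_le_add (y1.trans (mul_le_mul' (hw1 a.1) (hw f.1).le))
    (y2.trans (mul_le_mul' (hw1 f.1) (hw a.1).le))).trans_eq ?_
  ring

theorem weight_zero_commutator {k : ℕ} (hk : 1 ≤ k) (a : L1Sp d) :
    multOp (wt 0 k) * convL d a - convL d a * multOp (wt 0 k) = 0 := by
  have h : multOp (wt (d := d) 0 k) = 1 := by
    ext1 f
    refine Lp.ext ?_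
    filter_upwards [multOp_coeFn (bddSym_wt 0 k) f] with ξ h
    rw [h, wt, Real.rpow_zero, min_eq_left (by exact_mod_cast hk)]
    simp
  rw [h, one_mul, mul_one, sub_self]

theorem multOp_one : multOp (fun _ : Sp d => (1 : ℂ)) = 1 := by
  ext1 f
  refine Lp.ext ?_
  have hb : BddSym (fun _ : Sp d => (1 : ℂ)) :=
    ⟨aestronglyMeasurable_const, 1, .of_forall fun _ => by simp⟩
  filter_upwards [multOp_coeFn hb f] with ξ h
  rw [h, one_mul]; rfl

theorem norm_symbol_commutator_le {G : Sp d → ℝ} {M : ℝ} (hG : SymbolBound G M)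
    (hm : AEStronglyMeasurable G volume) (n : ℕ) (j : Fin d) (a : L1Sp d) {α : ℝ} (hα0 : 0 ≤ α)
    (hα : ∫⁻ ξ, ENNReal.ofReal (jb ξ) * ‖a ξ‖ₑ ≤ ENNReal.ofReal α)
    (hb : BddSym fun ξ : Sp d => ((G ((2 * Real.pi) • ξ) : ℝ) : ℂ)) :
    ‖(multOp (fun ξ => ((G ((2 * Real.pi) • ξ) : ℝ) : ℂ)) * convL d a -
      convL d a * multOp (fun ξ => ((G ((2 * Real.pi) • ξ) : ℝ) : ℂ))) *
      multOp (derivSym n j)‖ ≤ 4 * M * α := by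
  obtain ⟨N, hN, hGN⟩ := hG.exists_full_set hm
  have hM := hG.nonneg
  have hN' := ae_two_pi_smul hN
  refine norm_commutator_le hb (bddSym_derivSym n j) a
    (c := fun ξ => ENNReal.ofReal (4 * M) * ENNReal.ofReal (jb ξ))
    (continuous_jb.measurable.ennreal_ofReal.aemeasurable.const_mul _) ?_ (by positivity) ?_
  · filter_upwards [hN'] with ξ h1
    filter_upwards [hN'] with η h2
    rw [← ofReal_norm, ← ofReal_norm, ← ENNReal.ofReal_mul (norm_nonneg _),
      ← ENNReal.ofReal_mul (by positivity)]
    refine ENNReal.ofReal_le_ofReal ?_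
    have h3 := hGN _ h1 _ h2
    rw [← Complex.ofReal_sub, Complex.norm_real, Real.norm_eq_abs]
    have h4 : ‖derivSym n j η‖ ≤ ‖(2 * Real.pi) • η‖ := by
      rw [norm_derivSym, norm_smul, Real.norm_of_nonneg (by positivity)]
      exact mul_le_mul_of_nonneg_left (abs_clampCoord_le_norm n j η) (by positivity)
    refine (mul_le_mul_of_nonneg_left h4 (abs_nonneg _)).trans (h3.trans ?_)
    refine mul_le_mul_of_nonneg_left ?_ (by positivity)
    rw [← smul_sub, norm_smul, Real.norm_of_nonneg (by positivity)]
    exact two_pi_norm_le_jb _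
  · simp only [mul_assoc]
    rw [lintegral_const_mul' _ _ ENNReal.ofReal_ne_top,
      ENNReal.ofReal_mul (by positivity : (0 : ℝ) ≤ 4), mul_assoc,
      ENNReal.ofReal_mul (by positivity : (0 : ℝ) ≤ 4), ENNReal.ofReal_mul hM]
    gcongr

theorem norm_deriv_commutator_le (n : ℕ) (j : Fin d) (a : L1Sp d) {α : ℝ} (hα0 : 0 ≤ α)
    (hα : ∫⁻ ξ, ENNReal.ofReal (jb ξ) * ‖a ξ‖ₑ ≤ ENNReal.ofReal α) :
    ‖multOp (derivSym n j) * convL d a - convL d a * multOp (derivSym n j)‖ ≤ α := by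
  have hb : BddSym (fun _ : Sp d => (1 : ℂ)) :=
    ⟨aestronglyMeasurable_const, 1, .of_forall fun _ => by simp⟩
  have h := norm_commutator_le (bddSym_derivSym n j) hb a
    (c := fun ξ => ENNReal.ofReal (jb ξ))
    continuous_jb.measurable.ennreal_ofReal.aemeasurable (.of_forall fun ξ => .of_forall fun η => by
      rw [enorm_one, mul_one, ← ofReal_norm]
      exact ENNReal.ofReal_le_ofReal (norm_derivSym_sub_le n j ξ η)) hα0 hα
  rwa [multOp_one, mul_one] at h

theorem norm_le_of_lintegral_jb (a : L1Sp d) {α : ℝ} (hα0 : 0 ≤ α)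
    (hα : ∫⁻ ξ, ENNReal.ofReal (jb ξ) * ‖a ξ‖ₑ ≤ ENNReal.ofReal α) : ‖a‖ ≤ α := by
  rw [Lp.norm_def]
  refine ENNReal.toReal_le_of_le_ofReal hα0 (le_trans ?_ hα)
  rw [eLpNorm_one_eq_lintegral_enorm]
  refine lintegral_mono fun ξ => ?_
  rw [← one_mul ‖a ξ‖ₑ, ← mul_assoc, mul_one]
  refine mul_le_mul_left ?_ _
  rw [← ENNReal.ofReal_one]
  exact ENNReal.ofReal_le_ofReal (one_le_jb ξ)

theorem frozenOps (P : AdmissiblePair d) {M α : ℝ} (h₁ : SymbolBound P.G₁ M)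
    (h₂ : SymbolBound P.G₂ M) (n : ℕ) (a : Fin d → L1Sp d) (b : L1Sp d) (hα0 : 0 ≤ α)
    (ha : ∀ j, ∫⁻ ξ, ENNReal.ofReal (jb ξ) * ‖a j ξ‖ₑ ≤ ENNReal.ofReal α)
    (hb : ∫⁻ ξ, ENNReal.ofReal (jb ξ) * ‖b ξ‖ₑ ≤ ENNReal.ofReal α)
    (ra : ∀ j, ∀ᵐ ξ, a j (-ξ) = star (a j ξ)) (rb : ∀ᵐ ξ, b (-ξ) = star (b ξ)) :
    FrozenOps (fun j => convL d (a j)) (fun j => multOp (derivSym n j)) (convL d b)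
      (multOp P.sG₁) (multOp P.sm) ((1 + 4 * M) * (1 + α)) := by
  have hM := h₁.nonneg
  have hMα : 0 ≤ M * α := mul_nonneg hM hα0
  have eG : multOp P.sm * multOp P.sG₁ = multOp P.sG₂ :=
    multOp_mul_multOp P.bddSym_sm P.bddSym_sG₁ P.bddSym_sG₂ (.of_forall P.sm_mul_sG₁)
  refine ⟨by nlinarith, fun j => star_convL (ra j), star_convL rb,
    star_multOp P.bddSym_sG₁ P.bddSym_sG₁ (.of_forall fun ξ => by simp [AdmissiblePair.sG₁]),
    star_multOp P.bddSym_sm P.bddSym_sm (.of_forall fun ξ => by simp [AdmissiblePair.sm]), ?_,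
    multOp_commute P.bddSym_sm P.bddSym_sG₁, fun j => multOp_commute P.bddSym_sm
      (bddSym_derivSym n j), fun j => multOp_commute P.bddSym_sG₁ (bddSym_derivSym n j),
    fun j => convL_commute _ _, ?_, ?_, ?_, norm_multOp_le zero_le_one (.of_forall P.norm_sm_le),
    ?_, ?_, ?_, ?_, ?_⟩
  · intro j
    have hbn : BddSym (fun ξ => -derivSym n j ξ) :=
      ⟨(bddSym_derivSym n j).1.neg, _, .of_forall fun ξ => by
        rw [norm_neg]; exact norm_derivSym_le n j ξ⟩
    rw [star_multOp (bddSym_derivSym n j) hbn (.of_forall fun ξ => by simp [derivSym])]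
    ext1 f
    refine Lp.ext ?_
    filter_upwards [multOp_coeFn hbn f, multOp_coeFn (bddSym_derivSym n j) f,
      Lp.coeFn_neg (multOp (derivSym n j) f)] with ξ k1 k2 k3
    rw [k1, neg_apply, k3, Pi.neg_apply, k2, neg_mul]
  · intro j
    refine (norm_convL_apply_le _).trans ((norm_le_of_lintegral_jb _ hα0 (ha j)).trans ?_)
    nlinarith
  · refine (norm_convL_apply_le _).trans ((norm_le_of_lintegral_jb _ hα0 hb).trans ?_)
    nlinarith
  · refine (norm_multOp_le hM (P.norm_sG₁_le h₁)).trans ?_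
    nlinarith
  · intro j
    refine (norm_deriv_commutator_le n j _ hα0 (ha j)).trans ?_
    nlinarith
  · intro j
    refine (norm_deriv_commutator_le n j _ hα0 hb).trans ?_
    nlinarith
  · intro j
    refine (norm_symbol_commutator_le h₁ P.meas₁ n j _ hα0 (ha j) P.bddSym_sG₁).trans ?_
    nlinarith
  · intro j
    rw [eG]
    refine (norm_symbol_commutator_le h₂ P.meas₂ n j _ hα0 (ha j) P.bddSym_sG₂).trans ?_
    nlinarith
  · intro j
    rw [eG]
    refine (norm_symbol_commutator_le h₂ P.meas₂ n j _ hα0 hb P.bddSym_sG₂).trans ?_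
    nlinarith

end weights

section paths

variable {Y Z : Type*} [NormedAddCommGroup Y] [NormedSpace ℝ Y]
  [NormedAddCommGroup Z] [NormedSpace ℝ Z]

/-- On `[0, L]`, the function `u` is a primitive of the essentially bounded function `v`. -/
structure PathOn (L : ℝ) (u v : ℝ → Y) : Prop where
  nonneg : 0 ≤ L
  integrable : IntervalIntegrable v volume 0 L
  bound : ∃ K : ℝ, ∀ᵐ t, t ∈ Icc 0 L → ‖v t‖ ≤ K
  eq : ∀ t ∈ Icc 0 L, u t = u 0 + ∫ τ in (0 : ℝ)..t, v τ

namespace PathOn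

variable {L : ℝ} {u v : ℝ → Y}

theorem integrable_sub (h : PathOn L u v) {a b : ℝ} (ha : a ∈ Icc 0 L) (hb : b ∈ Icc 0 L) :
    IntervalIntegrable v volume a b :=
  h.integrable.mono_set (by
    rw [uIcc_of_le h.nonneg]
    exact (convex_Icc 0 L).ordConnected.uIcc_subset ha hb)

theorem lipschitz (h : PathOn L u v) : ∃ K, LipschitzOnWith K u (Icc 0 L) := by
  obtain ⟨K, hK⟩ := h.bound
  refine ⟨K.toNNReal, LipschitzOnWith.of_dist_le_mul fun x hx y hy => ?_⟩
  have h0 : (0 : ℝ) ∈ Icc 0 L := ⟨le_rfl, h.nonneg⟩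
  have e : u x - u y = ∫ τ in y..x, v τ := by
    rw [h.eq x hx, h.eq y hy, add_sub_add_left_eq_sub, intervalIntegral.integral_interval_sub_left
      (h.integrable_sub h0 hx) (h.integrable_sub h0 hy)]
  rw [dist_eq_norm, e, Real.dist_eq]
  have := intervalIntegral.norm_integral_le_of_norm_le_const_ae (f := v) (a := y) (b := x)
    (C := K.toNNReal) (by
      filter_upwards [hK] with t ht hty
      refine (ht ?_).trans (Real.le_coe_toNNReal K)
      exact (convex_Icc 0 L).ordConnected.uIcc_subset hy hx (uIoc_subset_uIcc hty))
  exact this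

theorem continuousOn (h : PathOn L u v) : ContinuousOn u (Icc 0 L) :=
  let ⟨_, hK⟩ := h.lipschitz
  hK.continuousOn

theorem ae_hasDerivAt [CompleteSpace Y] (h : PathOn L u v) : ∀ᵐ t, t ∈ Ioo 0 L → HasDerivAt u (v t) t := by
  filter_upwards [h.integrable.ae_hasDerivAt_integral] with t ht htL
  rw [uIcc_of_le h.nonneg] at ht
  have h1 := (ht (Ioo_subset_Icc_self htL) 0 ⟨le_rfl, h.nonneg⟩).const_add (u 0)
  refine h1.congr_of_eventuallyEq ?_
  filter_upwards [isOpen_Ioo.mem_nhds htL] with τ hτ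
  exact h.eq τ (Ioo_subset_Icc_self hτ)

theorem map [CompleteSpace Y] [CompleteSpace Z] (h : PathOn L u v) (T : Y →L[ℝ] Z) : PathOn L (fun t => T (u t)) fun t => T (v t) := by
  refine ⟨h.nonneg, ⟨T.integrable_comp h.integrable.1, T.integrable_comp h.integrable.2⟩, ?_, fun t ht => ?_⟩
  · obtain ⟨K, hK⟩ := h.bound
    refine ⟨‖T‖ * K, ?_⟩
    filter_upwards [hK] with t ht htL
    exact (T.le_opNorm _).trans (mul_le_mul_of_nonneg_left (ht htL) (norm_nonneg _))
  · rw [h.eq t ht, map_add, T.intervalIntegral_comp_comm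
      (h.integrable_sub ⟨le_rfl, h.nonneg⟩ ht)]

end PathOn

theorem le_add_integral_of_deriv_le {e g : ℝ → ℝ} {L : ℝ} (hL : 0 ≤ L) {K : NNReal}
    (he : LipschitzOnWith K e (Icc 0 L)) (hg : IntervalIntegrable g volume 0 L)
    (h : ∀ᵐ t, t ∈ Ioo 0 L → ∃ e', HasDerivAt e e' t ∧ e' ≤ g t) {t : ℝ} (ht : t ∈ Icc 0 L) :
    e t ≤ e 0 + ∫ τ in (0 : ℝ)..t, g τ := by
  have he' : LipschitzOnWith K e (uIcc 0 t) := he.mono (by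
    rw [uIcc_of_le ht.1]; exact Icc_subset_Icc_right ht.2)
  have hac := he'.absolutelyContinuousOnInterval
  have h1 := hac.integral_deriv_eq_sub
  have h2 : ∫ τ in (0 : ℝ)..t, deriv e τ ≤ ∫ τ in (0 : ℝ)..t, g τ := by
    refine intervalIntegral.integral_mono_ae_restrict ht.1 hac.intervalIntegrable_deriv
      (hg.mono_set (by rw [uIcc_of_le ht.1, uIcc_of_le hL]; exact Icc_subset_Icc_right ht.2)) ?_
    have hne : ∀ᵐ τ : ℝ, τ ≠ 0 ∧ τ ≠ t := by
      have h₁ : ∀ᵐ x : ℝ, x ≠ 0 := by simp [ae_iff, measure_singleton]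
      have h₂ : ∀ᵐ x : ℝ, x ≠ t := by simp [ae_iff, measure_singleton]
      filter_upwards [h₁, h₂] with x a b using ⟨a, b⟩
    rw [Filter.EventuallyLE, ae_restrict_iff' measurableSet_Icc]
    filter_upwards [h, hne] with τ k1 k2 k3
    obtain ⟨e', k4, k5⟩ := k1 ⟨lt_of_le_of_ne k3.1 (Ne.symm k2.1),
      (lt_of_le_of_ne k3.2 k2.2).trans_le ht.2⟩
    rwa [k4.deriv]
  linarith

theorem abs_sub_le_of_deriv_le {e : ℝ → ℝ} {L C : ℝ} {K : NNReal}
    (he : LipschitzOnWith K e (Icc 0 L))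
    (h : ∀ᵐ t, t ∈ Ioo 0 L → ∃ e', HasDerivAt e e' t ∧ |e'| ≤ C) {a b : ℝ} (ha : a ∈ Icc 0 L)
    (hb : b ∈ Icc 0 L) : |e a - e b| ≤ C * |a - b| := by
  have hsub : uIcc b a ⊆ Icc 0 L := (convex_Icc 0 L).ordConnected.uIcc_subset hb ha
  rw [← (he.mono hsub).absolutelyContinuousOnInterval.integral_deriv_eq_sub, ← Real.norm_eq_abs]
  refine intervalIntegral.norm_integral_le_of_norm_le_const_ae ?_
  have hne : ∀ᵐ τ : ℝ, τ ≠ 0 ∧ τ ≠ L := by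
    have h₁ : ∀ᵐ x : ℝ, x ≠ 0 := by simp [ae_iff, measure_singleton]
    have h₂ : ∀ᵐ x : ℝ, x ≠ L := by simp [ae_iff, measure_singleton]
    filter_upwards [h₁, h₂] with x a b using ⟨a, b⟩
  filter_upwards [h, hne] with τ k1 k2 k3
  have k4 := hsub (uIoc_subset_uIcc k3)
  obtain ⟨e', k5, k6⟩ := k1 ⟨lt_of_le_of_ne k4.1 (Ne.symm k2.1), lt_of_le_of_ne k4.2 k2.2⟩
  rwa [k5.deriv, Real.norm_eq_abs]

theorem lipschitzOn_comp_of_contDiff {L : ℝ} {u : ℝ → Y} {K : NNReal}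
    (hu : LipschitzOnWith K u (Icc 0 L)) {Φ : Y → ℝ} (hΦ : ContDiff ℝ 1 Φ) :
    ∃ K', LipschitzOnWith K' (fun t => Φ (u t)) (Icc 0 L) := by
  have hc : IsCompact (u '' Icc 0 L) := isCompact_Icc.image_of_continuousOn hu.continuousOn
  obtain ⟨K', hK'⟩ := (hΦ.locallyLipschitz.locallyLipschitzOn
    (s := u '' Icc 0 L)).exists_lipschitzOnWith_of_compact hc
  exact ⟨K' * K, hK'.comp hu (mapsTo_image _ _)⟩

end paths

section staticEstimate

variable {d : ℕ} (P : AdmissiblePair d) {r : ℝ}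

/-- The truncated derivative `∂_j` on `X^r`. -/
def DX (n : ℕ) (j : Fin d) : XSpace P r →L[ℝ] XSpace P r :=
  multX P (derivSym n j) (bddSym_derivSym n j).1 (derivSym_neg n j)
    (C := 2 * Real.pi * n) (by positivity) (.of_forall fun ξ =>
      mul_le_mul_of_nonneg_right (norm_derivSym_le n j ξ) (Real.rpow_nonneg (jb_pos ξ).le _))

theorem zH_multX {m : Sp d → ℂ} (hb : BddSym m) (hs : ∀ ξ, m (-ξ) = star (m ξ))
    {r' C : ℝ} (hC0 : 0 ≤ C) (hC : ∀ᵐ ξ, ‖m ξ‖ * jb ξ ^ r ≤ C * jb ξ ^ r') (h0 : 0 ≤ r)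
    (h0' : 0 ≤ r') (U : XSpace P r') :
    zH P h0 (multX P m hb.1 hs hC0 hC U) = multOp m (zH P h0' U) := by
  refine Lp.ext ?_
  filter_upwards [coeFn_fourierMult m hb.1 (U : State d).1, multOp_coeFn hb (zH P h0' U)]
    with ξ h1 h2
  rw [h2]
  exact h1

theorem vH_multX {m : Sp d → ℂ} (hb : BddSym m) (hs : ∀ ξ, m (-ξ) = star (m ξ))
    {r' C : ℝ} (hC0 : 0 ≤ C) (hC : ∀ᵐ ξ, ‖m ξ‖ * jb ξ ^ r ≤ C * jb ξ ^ r') (h0 : 0 ≤ r)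
    (h0' : 0 ≤ r') (i : Fin d) (U : XSpace P r') :
    vH P h0 i (multX P m hb.1 hs hC0 hC U) = multOp m (vH P h0' i U) := by
  refine Lp.ext ?_
  have e : P.op₁ (fourierMult m hb.1 ((U : State d).2 i)) =
      fourierMult m hb.1 (P.op₁ ((U : State d).2 i)) := fourierMult_comm _ _ _
  filter_upwards [coeFn_fourierMult m hb.1 (P.op₁ ((U : State d).2 i)),
    multOp_coeFn hb (vH P h0' i U)] with ξ h1 h2
  rw [h2]
  change (P.op₁ (fourierMult m hb.1 ((U : State d).2 i)) : Sp d → ℂ) ξ = _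
  rw [e]
  exact h1

theorem zH_DX (h0 : 0 ≤ r) (n : ℕ) (j : Fin d) (U : XSpace P r) :
    zH P h0 (DX P n j U) = multOp (derivSym n j) (zH P h0 U) :=
  zH_multX P (bddSym_derivSym n j) _ _ _ h0 h0 U

theorem vH_DX (h0 : 0 ≤ r) (n : ℕ) (i j : Fin d) (U : XSpace P r) :
    vH P h0 i (DX P n j U) = multOp (derivSym n j) (vH P h0 i U) :=
  vH_multX P (bddSym_derivSym n j) _ _ _ h0 h0 i U

/-- The constant in the energy estimate, when `|U̲|_{X^s} ≤ β`. -/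
def energyConst (d : ℕ) (s M β : ℝ) : ℝ :=
  10 * (d + 1) ^ 2 * ((1 + 4 * M) * (1 + (sobolevConst d (s - 1)).toReal * β)) ^ 3 *
    (1 + s * 2 ^ s * (2 * (sobolevConst d (s - 1)).toReal) * β)

/-- The operator `S(U̲)`. -/
def SX (hr : (d : ℝ) / 2 < r) (ε : ℝ) (ub : XSpace P r) : L2Sp d →L[ℂ] L2Sp d :=
  symmetrizer (multOp P.sm) (convL d (bL P hr ub)) ε

theorem isReal_aL (hr : (d : ℝ) / 2 < r) (j : Fin d) (U : XSpace P r) :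
    ∀ᵐ ξ, aL P hr j U (-ξ) = star (aL P hr j U ξ) :=
  P.isReal_op₂ (XSpace.isReal_snd P U j)

theorem isReal_bL (hr : (d : ℝ) / 2 < r) (U : XSpace P r) :
    ∀ᵐ ξ, bL P hr U (-ξ) = star (bL P hr U ξ) :=
  XSpace.isReal_fst P U

theorem lintegral_jb_le_of_hsNorm {s β : ℝ} (hs : (d : ℝ) / 2 + 1 < s) {f : Fn d}
    (h : hsNorm s f ≤ ENNReal.ofReal β) : ∫⁻ ξ, ENNReal.ofReal (jb ξ) * ‖f ξ‖ₑ ≤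
      ENNReal.ofReal ((sobolevConst d (s - 1)).toReal * β) := by
  have hK : sobolevConst d (s - 1) < ⊤ := sobolevConst_lt_top (by linarith)
  rw [ENNReal.ofReal_mul ENNReal.toReal_nonneg, ENNReal.ofReal_toReal hK.ne]
  exact (lintegral_jb_enorm_le s f).trans (mul_le_mul_right h _)

theorem frozenOps_X {M s β : ℝ} (h₁ : SymbolBound P.G₁ M) (h₂ : SymbolBound P.G₂ M)
    (hs : (d : ℝ) / 2 + 1 < s) (hr : (d : ℝ) / 2 < r) (n : ℕ) (hβ : 0 ≤ β) {ub : XSpace P r}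
    (hub : xNorm P s (ub : State d) ≤ ENNReal.ofReal β) :
    FrozenOps (fun j => convL d (aL P hr j ub)) (fun j => multOp (derivSym n j))
      (convL d (bL P hr ub)) (multOp P.sG₁) (multOp P.sm)
      ((1 + 4 * M) * (1 + (sobolevConst d (s - 1)).toReal * β)) :=
  frozenOps P h₁ h₂ n _ _ (by positivity)
    (fun j => lintegral_jb_le_of_hsNorm hs
      (((P.hsNorm_op₂_le s _).trans (hsNorm_snd_le P s (ub : State d) j)).trans hub))
    (lintegral_jb_le_of_hsNorm hs ((hsNorm_fst_le P s _).trans hub))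
    (fun j => isReal_aL P hr j ub) (isReal_bL P hr ub)

theorem norm_commutator_weight_le {s σ β x : ℝ} (hd : (d : ℝ) / 2 + 1 < s)
    (hσ : σ = 0 ∨ σ = s) {k : ℕ} (hk : 1 ≤ k) (n : ℕ) (j : Fin d) (hβ : 0 ≤ β) (hx : 0 ≤ x)
    {a : L1Sp d} (ha : hsNorm s a.1 ≤ ENNReal.ofReal β) {f : L2Sp d}
    (hf : hsNorm σ f.1 ≤ ENNReal.ofReal x) :
    ‖(multOp (wt σ k) * convL d a - convL d a * multOp (wt σ k) : L2Sp d →L[ℂ] L2Sp d)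
      (multOp (derivSym n j) f)‖ ≤ s * 2 ^ s * (2 * (sobolevConst d (s - 1)).toReal) * β * x := by
  have hs1 : 1 ≤ s := by have : (0 : ℝ) ≤ (d : ℝ) / 2 := by positivity
                         linarith
  have hc : (0 : ℝ) ≤ s * 2 ^ s * (2 * (sobolevConst d (s - 1)).toReal) * β * x := by positivity
  rcases hσ with rfl | rfl
  · rw [weight_zero_commutator hk, zero_apply, norm_zero]
    exact hc
  · have hK : sobolevConst d (σ - 1) < ⊤ := sobolevConst_lt_top (by linarith)
    rw [← ENNReal.ofReal_le_ofReal_iff hc, ofReal_norm]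
    refine (enorm_weight_commutator_le hs1 k n j a f).trans ?_
    rw [mul_assoc _ β x, ENNReal.ofReal_mul (p := σ * 2 ^ σ * _) (by positivity),
      ENNReal.ofReal_mul hβ, ENNReal.ofReal_mul (p := σ * 2 ^ σ) (by positivity),
      ENNReal.ofReal_mul (by positivity : (0 : ℝ) ≤ 2),
      ENNReal.ofReal_toReal hK.ne, ENNReal.ofReal_ofNat]
    gcongr

theorem norm_multOp_wt_le {σ x : ℝ} (hx : 0 ≤ x) (k : ℕ) {f : L2Sp d}
    (hf : hsNorm σ f.1 ≤ ENNReal.ofReal x) : ‖multOp (wt σ k) f‖ ≤ x := by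
  rw [← ENNReal.ofReal_le_ofReal_iff hx, ofReal_norm]
  exact (enorm_multOp_wt_le σ k f).trans hf

theorem hsNorm_multOp_sm_le (σ : ℝ) (f : L2Sp d) :
    hsNorm σ (multOp P.sm f).1 ≤ hsNorm σ f.1 := by
  rw [hsNorm_eq, hsNorm_eq]
  refine eLpNorm_mono_ae ?_
  filter_upwards [multOp_coeFn P.bddSym_sm f] with ξ h
  have h' : ((multOp P.sm f).1 : Sp d → ℂ) ξ = P.sm ξ * f ξ := h
  rw [h', norm_smul, norm_smul, norm_mul]
  exact mul_le_mul_of_nonneg_left (mul_le_of_le_one_left (norm_nonneg _) (P.norm_sm_le ξ))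
    (norm_nonneg _)

theorem hsNorm_zH_le (h0 : 0 ≤ r) (σ : ℝ) (U : XSpace P r) :
    hsNorm σ (zH P h0 U).1 ≤ xNorm P σ (U : State d) := hsNorm_fst_le P σ _

theorem hsNorm_vH_le (h0 : 0 ≤ r) (σ : ℝ) (i : Fin d) (U : XSpace P r) :
    hsNorm σ (vH P h0 i U).1 ≤ xNorm P σ (U : State d) := hsNorm_snd_le P σ _ i

theorem hsNorm_aL_le (hr : (d : ℝ) / 2 < r) (σ : ℝ) (i : Fin d) (U : XSpace P r) :
    hsNorm σ (aL P hr i U).1 ≤ xNorm P σ (U : State d) :=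
  (P.hsNorm_op₂_le σ _).trans (hsNorm_snd_le P σ _ i)

theorem hsNorm_bL_le (hr : (d : ℝ) / 2 < r) (σ : ℝ) (U : XSpace P r) :
    hsNorm σ (bL P hr U).1 ≤ xNorm P σ (U : State d) := hsNorm_fst_le P σ _

theorem ofReal_smul_L2 (ε : ℝ) (f : L2Sp d) : ε • f = (ε : ℂ) • f := (Complex.coe_smul ε f).symm

theorem zH_AX_DX (hr : (d : ℝ) / 2 < r) (h0 : 0 ≤ r) (ε : ℝ) (n : ℕ) (j : Fin d)
    (ub u : XSpace P r) : zH P h0 (AX P hr ε j ub (DX P n j u)) =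
      multOp P.sG₁ (multOp (derivSym n j) (vH P h0 j u)) + (ε : ℂ) • multOp P.sm (multOp P.sG₁
        (convL d (aL P hr j ub) (multOp (derivSym n j) (zH P h0 u)) +
          convL d (bL P hr ub) (multOp P.sm (multOp (derivSym n j) (vH P h0 j u))))) := by
  rw [AX, add_apply, map_add, zH_linX, vH_DX, smul_apply, map_smul, zH_bilX, zH_DX, vH_DX,
    ofReal_smul_L2, ← multOp_mul_multOp P.bddSym_sm P.bddSym_sG₁ P.bddSym_sG₂
      (.of_forall P.sm_mul_sG₁), mul_apply_eq_comp]

theorem vH_AX_DX (hr : (d : ℝ) / 2 < r) (h0 : 0 ≤ r) (ε : ℝ) (n : ℕ) (i j : Fin d)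
    (ub u : XSpace P r) : vH P h0 i (AX P hr ε j ub (DX P n j u)) =
      (if i = j then multOp P.sG₁ (multOp (derivSym n j) (zH P h0 u)) else 0) +
      (ε : ℂ) • multOp P.sG₁ (convL d (aL P hr j ub) (multOp P.sm
        (multOp (derivSym n j) (vH P h0 i u)))) := by
  rw [AX, add_apply, map_add, vH_linX, smul_apply, map_smul, vH_bilX, zH_DX, vH_DX,
    ofReal_smul_L2]

theorem abs_static_energy_le {M s σ β ε x y : ℝ} (h₁ : SymbolBound P.G₁ M) (h₂ : SymbolBound P.G₂ M)
    (hs : (d : ℝ) / 2 + 1 < s) (hr : (d : ℝ) / 2 < r) (h0 : 0 ≤ r) (hσ : σ = 0 ∨ σ = s) {k : ℕ}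
    (hk : 1 ≤ k) (n : ℕ) (hβ : 0 ≤ β) (hε0 : 0 ≤ ε) (hε1 : ε ≤ 1) (hx : 0 ≤ x) (hy : 0 ≤ y)
    {ub u v ρ : XSpace P r} (hub : xNorm P s (ub : State d) ≤ ENNReal.ofReal β)
    (hu : xNorm P σ (u : State d) ≤ ENNReal.ofReal x)
    (hρ : ‖multOp (wt σ k) (zH P h0 ρ)‖ ≤ y) (hρ' : ∀ i, ‖multOp (wt σ k) (vH P h0 i ρ)‖ ≤ y)
    (hv : v = ρ - ∑ j, AX P hr ε j ub (DX P n j u)) :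
    |(inner ℂ (multOp (wt σ k) (zH P h0 u)) (multOp (wt σ k) (zH P h0 v))).re +
      ∑ i, (inner ℂ (SX P hr ε ub (multOp (wt σ k) (vH P h0 i u)))
        (multOp (wt σ k) (vH P h0 i v))).re| ≤ energyConst d s M β * (ε * x ^ 2 + x * y) := by
  have F := frozenOps_X P h₁ h₂ hs hr n hβ hub
  have hs1 : 1 ≤ s := by have : (0 : ℝ) ≤ (d : ℝ) / 2 := by positivity
                         linarith
  have hbw := bddSym_wt (d := d) σ k
  have hz := (hsNorm_zH_le P h0 σ u).trans hu
  have hvi := fun i => (hsNorm_vH_le P h0 σ i u).trans hu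
  have ha := fun j => (hsNorm_aL_le P hr s j ub).trans hub
  have hb := (hsNorm_bL_le P hr s ub).trans hub
  have ez : zH P h0 v = zH P h0 ρ - ∑ j, (multOp P.sG₁ (multOp (derivSym n j) (vH P h0 j u)) +
      (ε : ℂ) • multOp P.sm (multOp P.sG₁
        (convL d (aL P hr j ub) (multOp (derivSym n j) (zH P h0 u)) +
          convL d (bL P hr ub) (multOp P.sm (multOp (derivSym n j) (vH P h0 j u)))))) := by
    rw [hv, map_sub, map_sum, Finset.sum_congr rfl fun j _ => zH_AX_DX P hr h0 ε n j ub u]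
  have eV : ∀ i, vH P h0 i v = vH P h0 i ρ - ∑ j,
      ((if i = j then multOp P.sG₁ (multOp (derivSym n j) (zH P h0 u)) else 0) +
      (ε : ℂ) • multOp P.sG₁ (convL d (aL P hr j ub) (multOp P.sm
        (multOp (derivSym n j) (vH P h0 i u))))) := fun i => by
    rw [hv, map_sub, map_sum, Finset.sum_congr rfl fun j _ => vH_AX_DX P hr h0 ε n i j ub u]
  have key := F.abs_energy_le (W := multOp (wt σ k)) (multOp_commute hbw P.bddSym_sG₁)
    (multOp_commute hbw P.bddSym_sm) (fun j => multOp_commute hbw (bddSym_derivSym n j))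
    hε0 hε1 hx hy (κ := s * 2 ^ s * (2 * (sobolevConst d (s - 1)).toReal) * β * x)
    (by positivity) (norm_multOp_wt_le hx k hz) (fun i => norm_multOp_wt_le hx k (hvi i))
    hρ hρ'
    (fun j => norm_commutator_weight_le hs hσ hk n j hβ hx (ha j) hz)
    (fun i j => norm_commutator_weight_le hs hσ hk n j hβ hx (ha j)
      ((hsNorm_multOp_sm_le P σ _).trans (hvi i)))
    (fun j => norm_commutator_weight_le hs hσ hk n j hβ hx hb
      ((hsNorm_multOp_sm_le P σ _).trans (hvi j))) ez eV
  refine key.trans ?_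
  have p1 := mul_nonneg hx hy
  have c0 : 0 ≤ s * 2 ^ s * (2 * (sobolevConst d (s - 1)).toReal) := by positivity
  have p2 : 0 ≤ s * 2 ^ s * (2 * (sobolevConst d (s - 1)).toReal) * β * (x * y) := by positivity
  have e0 : 0 ≤ 10 * ((d : ℝ) + 1) ^ 2 *
      ((1 + 4 * M) * (1 + (sobolevConst d (s - 1)).toReal * β)) ^ 3 :=
    mul_nonneg (by positivity) (pow_nonneg F.pos.le 3)
  rw [Fintype.card_fin, energyConst]
  refine (mul_le_mul_of_nonneg_left ?_ e0).trans_eq (mul_assoc _ _ _).symm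
  generalize s * 2 ^ s * (2 * (sobolevConst d (s - 1)).toReal) = c at *
  nlinarith

end staticEstimate

section energyFunctional

variable {d : ℕ} (P : AdmissiblePair d) {r : ℝ}

theorem star_symmetrizer {H : Type*} [NormedAddCommGroup H] [InnerProductSpace ℂ H]
    [CompleteSpace H] {m B : H →L[ℂ] H} (hm : star m = m) (hB : star B = B) (ε : ℝ) :
    star (symmetrizer m B ε) = symmetrizer m B ε := by
  rw [symmetrizer, star_add, star_one, star_smul, star_mul, star_mul, hm, hB, mul_assoc]
  simp

theorem star_sm : star (multOp P.sm) = multOp P.sm :=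
  star_multOp P.bddSym_sm P.bddSym_sm (.of_forall fun ξ => by simp [AdmissiblePair.sm])

theorem star_SX (hr : (d : ℝ) / 2 < r) (ε : ℝ) (ub : XSpace P r) :
    star (SX P hr ε ub) = SX P hr ε ub :=
  star_symmetrizer (star_sm P) (star_convL (isReal_bL P hr ub)) ε

/-- The weighted first component. -/
def wzH (h0 : 0 ≤ r) (σ : ℝ) (k : ℕ) : XSpace P r →L[ℝ] L2Sp d :=
  ((multOp (wt σ k)).restrictScalars ℝ).comp (zH P h0)

/-- The weighted `i`-th velocity component. -/
def wvH (h0 : 0 ≤ r) (σ : ℝ) (k : ℕ) (i : Fin d) : XSpace P r →L[ℝ] L2Sp d :=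
  ((multOp (wt σ k)).restrictScalars ℝ).comp (vH P h0 i)

/-- The convolution operator `m B(b) m`, depending linearly on `b`. -/
def mBm (hr : (d : ℝ) / 2 < r) : XSpace P r →L[ℝ] L2Sp d →L[ℝ] L2Sp d :=
  ((ContinuousLinearMap.compL ℝ (L2Sp d) (L2Sp d) (L2Sp d) ((multOp P.sm).restrictScalars ℝ)).comp
    ((ContinuousLinearMap.compL ℝ (L2Sp d) (L2Sp d) (L2Sp d)).flip
      ((multOp P.sm).restrictScalars ℝ))).comp
    (((convL d).bilinearRestrictScalars ℝ).comp (bL P hr))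

theorem mBm_apply (hr : (d : ℝ) / 2 < r) (b : XSpace P r) (f : L2Sp d) :
    mBm P hr b f = multOp P.sm (convL d (bL P hr b) (multOp P.sm f)) := rfl

theorem SX_apply (hr : (d : ℝ) / 2 < r) (ε : ℝ) (ub : XSpace P r) (f : L2Sp d) :
    SX P hr ε ub f = f + ε • mBm P hr ub f := by
  rw [ofReal_smul_L2, mBm_apply]; rfl

theorem norm_mBm_le (hr : (d : ℝ) / 2 < r) (b : XSpace P r) (f : L2Sp d) :
    ‖mBm P hr b f‖ ≤ ‖bL P hr b‖ * ‖f‖ := by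
  have hm : ∀ g : L2Sp d, ‖multOp P.sm g‖ ≤ ‖g‖ := fun g =>
    (ContinuousLinearMap.le_of_opNorm_le _ (norm_multOp_le zero_le_one
      (.of_forall P.norm_sm_le)) g).trans_eq (one_mul _)
  rw [mBm_apply]
  refine (hm _).trans ((ContinuousLinearMap.le_of_opNorm_le _ (norm_convL_apply_le _) _).trans ?_)
  exact mul_le_mul_of_nonneg_left (hm f) (norm_nonneg _)

/-- The weighted energy of `u`, symmetrized by means of `ub`. -/
def energyX (hr : (d : ℝ) / 2 < r) (h0 : 0 ≤ r) (σ : ℝ) (k : ℕ) (ε : ℝ) (ub u : XSpace P r) : ℝ :=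
  (inner ℂ (wzH P h0 σ k u) (wzH P h0 σ k u)).re +
    ∑ i, (inner ℂ (wvH P h0 σ k i u + ε • mBm P hr ub (wvH P h0 σ k i u)) (wvH P h0 σ k i u)).re

theorem contDiff_energyX (hr : (d : ℝ) / 2 < r) (h0 : 0 ≤ r) (σ : ℝ) (k : ℕ) (ε : ℝ) :
    ContDiff ℝ 1 fun p : XSpace P r × XSpace P r => energyX P hr h0 σ k ε p.1 p.2 := by
  have hF : ∀ i, ContDiff ℝ 1 fun p : XSpace P r × XSpace P r => wvH P h0 σ k i p.2 :=
    fun i => (wvH P h0 σ k i).contDiff.comp contDiff_snd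
  have hz : ContDiff ℝ 1 fun p : XSpace P r × XSpace P r => wzH P h0 σ k p.2 :=
    (wzH P h0 σ k).contDiff.comp contDiff_snd
  have hB : ContDiff ℝ 1 fun p : XSpace P r × XSpace P r => mBm P hr p.1 :=
    (mBm P hr).contDiff.comp contDiff_fst
  refine ContDiff.add (Complex.reCLM.contDiff.comp (hz.inner ℂ hz)) (ContDiff.sum fun i _ => ?_)
  exact Complex.reCLM.contDiff.comp
    (((hF i).add (((hB.clm_apply (hF i))).const_smul ε)).inner ℂ (hF i))

theorem hasDerivAt_energyX (hr : (d : ℝ) / 2 < r) (h0 : 0 ≤ r) (σ : ℝ) (k : ℕ) (ε : ℝ)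
    {ub u : ℝ → XSpace P r} {b' v : XSpace P r} {t : ℝ} (hub : HasDerivAt ub b' t)
    (hu : HasDerivAt u v t) :
    HasDerivAt (fun τ => energyX P hr h0 σ k ε (ub τ) (u τ))
      (2 * ((inner ℂ (wzH P h0 σ k (u t)) (wzH P h0 σ k v)).re +
        ∑ i, (inner ℂ (SX P hr ε (ub t) (wvH P h0 σ k i (u t))) (wvH P h0 σ k i v)).re) +
        ε * ∑ i, (inner ℂ (mBm P hr b' (wvH P h0 σ k i (u t))) (wvH P h0 σ k i (u t))).re) t := by
  have hz : HasDerivAt (fun τ => wzH P h0 σ k (u τ)) (wzH P h0 σ k v) t :=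
    (wzH P h0 σ k).hasFDerivAt.comp_hasDerivAt t hu
  have hF : ∀ i, HasDerivAt (fun τ => wvH P h0 σ k i (u τ)) (wvH P h0 σ k i v) t :=
    fun i => (wvH P h0 σ k i).hasFDerivAt.comp_hasDerivAt t hu
  have hB : HasDerivAt (fun τ => mBm P hr (ub τ)) (mBm P hr b') t :=
    (mBm P hr).hasFDerivAt.comp_hasDerivAt t hub
  have h1 := Complex.reCLM.hasFDerivAt.comp_hasDerivAt t (hz.inner ℂ hz)
  have h2 := fun i => Complex.reCLM.hasFDerivAt.comp_hasDerivAt t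
    (((hF i).add ((hB.clm_apply (hF i)).const_smul ε)).inner ℂ (hF i))
  have h3 := h1.add (HasDerivAt.fun_sum fun i (_ : i ∈ Finset.univ) => h2 i)
  refine h3.congr_deriv ?_
  have sym : ∀ x y : L2Sp d, (inner ℂ x y).re = (inner ℂ y x).re :=
    fun x y => inner_re_symm (𝕜 := ℂ) _ _
  have e2 : ∀ i, (inner ℂ (wvH P h0 σ k i (u t) + ε • mBm P hr (ub t) (wvH P h0 σ k i (u t)))
      (wvH P h0 σ k i v) + inner ℂ (wvH P h0 σ k i v + ε • (mBm P hr b' (wvH P h0 σ k i (u t)) +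
        mBm P hr (ub t) (wvH P h0 σ k i v))) (wvH P h0 σ k i (u t))).re =
      2 * (inner ℂ (SX P hr ε (ub t) (wvH P h0 σ k i (u t))) (wvH P h0 σ k i v)).re +
      ε * (inner ℂ (mBm P hr b' (wvH P h0 σ k i (u t))) (wvH P h0 σ k i (u t))).re := fun i => by
    have e3 : wvH P h0 σ k i v + ε • (mBm P hr b' (wvH P h0 σ k i (u t)) +
        mBm P hr (ub t) (wvH P h0 σ k i v)) = SX P hr ε (ub t) (wvH P h0 σ k i v) +
        (ε : ℂ) • mBm P hr b' (wvH P h0 σ k i (u t)) := by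
      rw [SX_apply, smul_add, ofReal_smul_L2 ε (mBm P hr b' _)]; abel
    rw [e3, ← SX_apply, inner_add_left, Complex.add_re, Complex.add_re, re_inner_smul_left',
      inner_apply_of_star_eq (star_SX P hr ε (ub t)), inner_apply_of_star_eq
        (star_SX P hr ε (ub t)), sym (wvH P h0 σ k i v), ← inner_apply_of_star_eq
        (star_SX P hr ε (ub t))]
    ring
  have e1 := sym (wzH P h0 σ k v) (wzH P h0 σ k (u t))
  simp only [Complex.reCLM_apply, Complex.add_re, Pi.add_apply, Pi.smul_apply] at e2 ⊢
  rw [Finset.sum_congr rfl fun i _ => e2 i, e1, Finset.sum_add_distrib, ← Finset.mul_sum,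
    ← Finset.mul_sum]
  ring

theorem norm_multOp_sm_le (f : L2Sp d) : ‖multOp P.sm f‖ ≤ ‖f‖ :=
  (ContinuousLinearMap.le_of_opNorm_le _ (norm_multOp_le zero_le_one
    (.of_forall P.norm_sm_le)) f).trans_eq (one_mul _)

theorem re_inner_self_L2 (f : L2Sp d) : (inner ℂ f f).re = ‖f‖ ^ 2 :=
  inner_self_eq_norm_sq (𝕜 := ℂ) f

theorem energyX_lower (hr : (d : ℝ) / 2 < r) (h0 : 0 ≤ r) (σ : ℝ) (k : ℕ) {ε h : ℝ}
    {ub : XSpace P r} (hub : ∀ x, h ≤ 1 + ε * ((ub : State d).1.toPhys x).re) (u : XSpace P r) :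
    min 1 h * (‖wzH P h0 σ k u‖ ^ 2 + ∑ i, ‖wvH P h0 σ k i u‖ ^ 2) ≤
      energyX P hr h0 σ k ε ub u := by
  have key : ∀ f : L2Sp d, min 1 h * ‖f‖ ^ 2 ≤ (inner ℂ (f + ε • mBm P hr ub f) f).re := fun f => by
    have h1 := convL_lower_bound (b := bL P hr ub) (ε := ε) (h := h) hub (multOp P.sm f)
    have h2 : ‖multOp P.sm f‖ ^ 2 ≤ ‖f‖ ^ 2 := by
      gcongr; exact norm_multOp_sm_le P f
    rw [inner_add_left, Complex.add_re, ofReal_smul_L2, re_inner_smul_left', mBm_apply,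
      inner_apply_of_star_eq (star_sm P), re_inner_self_L2]
    nlinarith [min_le_left 1 h, min_le_right 1 h, sq_nonneg ‖multOp P.sm f‖,
      mul_nonneg (sub_nonneg.2 (min_le_left 1 h)) (sub_nonneg.2 h2),
      mul_nonneg (sub_nonneg.2 (min_le_right 1 h)) (sq_nonneg ‖multOp P.sm f‖)]
  rw [energyX, mul_add, Finset.mul_sum, re_inner_self_L2]
  refine add_le_add ?_ (Finset.sum_le_sum fun i _ => key _)
  exact mul_le_of_le_one_left (sq_nonneg _) (min_le_left 1 h)

theorem energyX_upper (hr : (d : ℝ) / 2 < r) (h0 : 0 ≤ r) (σ : ℝ) (k : ℕ) {ε x β : ℝ}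
    (hε0 : 0 ≤ ε) (hε1 : ε ≤ 1) (hx : 0 ≤ x) (hβ : 0 ≤ β) {ub u : XSpace P r}
    (hub : ‖bL P hr ub‖ ≤ β) (hu : xNorm P σ (u : State d) ≤ ENNReal.ofReal x) :
    energyX P hr h0 σ k ε ub u ≤ (d + 1) * (1 + β) * x ^ 2 := by
  have hz : ‖wzH P h0 σ k u‖ ≤ x := norm_multOp_wt_le hx k ((hsNorm_zH_le P h0 σ u).trans hu)
  have hv : ∀ i, ‖wvH P h0 σ k i u‖ ≤ x := fun i =>
    norm_multOp_wt_le hx k ((hsNorm_vH_le P h0 σ i u).trans hu)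
  have key : ∀ i, (inner ℂ (wvH P h0 σ k i u + ε • mBm P hr ub (wvH P h0 σ k i u))
      (wvH P h0 σ k i u)).re ≤ (1 + β) * x ^ 2 := fun i => by
    set f := wvH P h0 σ k i u
    have h1 : ‖f + ε • mBm P hr ub f‖ ≤ (1 + β) * x := by
      refine (norm_add_le _ _).trans ?_
      rw [norm_smul, Real.norm_of_nonneg hε0]
      have h2 : ‖mBm P hr ub f‖ ≤ β * x := (norm_mBm_le P hr ub f).trans
        (mul_le_mul hub (hv i) (norm_nonneg _) hβ)
      have h3 : ε * ‖mBm P hr ub f‖ ≤ 1 * (β * x) :=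
        mul_le_mul hε1 h2 (norm_nonneg _) zero_le_one
      linarith [hv i]
    refine (Complex.re_le_norm _).trans ((norm_inner_le_norm _ _).trans ?_)
    exact (mul_le_mul h1 (hv i) (norm_nonneg _) (by positivity)).trans_eq (by ring)
  have hs := Finset.sum_le_sum fun i (_ : i ∈ Finset.univ) => key i
  rw [Finset.sum_const, Finset.card_univ, Fintype.card_fin, nsmul_eq_mul] at hs
  rw [energyX, re_inner_self_L2]
  have h4 : ‖wzH P h0 σ k u‖ ^ 2 ≤ (1 + β) * x ^ 2 := by
    have : ‖wzH P h0 σ k u‖ ^ 2 ≤ x ^ 2 := by gcongr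
    nlinarith [sq_nonneg x, mul_nonneg hβ (sq_nonneg x)]
  linarith

theorem hsNorm_le_of_wt {σ C : ℝ} {f : L2Sp d} (h : ∀ k : ℕ, 1 ≤ k → ‖multOp (wt σ k) f‖ ≤ C) :
    hsNorm σ f.1 ≤ ENNReal.ofReal C := by
  have hlim : ∀ᵐ ξ : Sp d, Filter.Tendsto (fun k : ℕ => (multOp (wt σ k) f : Sp d → ℂ) ξ)
      Filter.atTop (nhds ((jb ξ ^ σ) • f ξ)) := by
    filter_upwards [ae_all_iff.2 fun k : ℕ => multOp_coeFn (bddSym_wt (d := d) σ k) f] with ξ hξ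
    refine tendsto_const_nhds.congr' ?_
    filter_upwards [Filter.eventually_ge_atTop ⌈jb ξ ^ σ⌉₊] with k hk
    rw [hξ k, wt, min_eq_left (Nat.ceil_le.1 hk)]
    exact Complex.real_smul
  have h1 := Lp.eLpNorm_lim_le_liminf_eLpNorm (p := 2)
    (fun k : ℕ => (Lp.memLp (multOp (wt σ k) f)).1) _ hlim
  rw [hsNorm_eq]
  refine h1.trans (Filter.liminf_le_of_frequently_le' (Filter.Eventually.frequently ?_))
  filter_upwards [Filter.eventually_ge_atTop 1] with k hk
  rw [← Lp.enorm_def, ← ofReal_norm]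
  exact ENNReal.ofReal_le_ofReal (h k hk)

theorem xNorm_le_of_wt (h0 : 0 ≤ r) {σ C : ℝ} (hC : 0 ≤ C) {u : XSpace P r}
    (hz : ∀ k : ℕ, 1 ≤ k → ‖wzH P h0 σ k u‖ ≤ C)
    (hv : ∀ (k : ℕ) (i : Fin d), 1 ≤ k → ‖wvH P h0 σ k i u‖ ≤ C) :
    xNorm P σ (u : State d) ≤ ENNReal.ofReal ((d + 1) * C) := by
  refine (xNorm_le_sum P (u : State d)).trans ?_
  have e : ENNReal.ofReal ((d + 1) * C) = ENNReal.ofReal C + ∑ _i : Fin d, ENNReal.ofReal C := by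
    rw [Finset.sum_const, Finset.card_univ, Fintype.card_fin, nsmul_eq_mul, add_mul, one_mul,
      ENNReal.ofReal_add (by positivity) hC, ENNReal.ofReal_mul (by positivity),
      ENNReal.ofReal_natCast, add_comm]
  rw [e]
  exact add_le_add (hsNorm_le_of_wt (f := zH P h0 u) hz)
    (Finset.sum_le_sum fun i _ => hsNorm_le_of_wt (f := vH P h0 i u) fun k hk => hv k i hk)

end energyFunctional

section gronwall

theorem sqrt_le_of_le_add_mul_sqrt {K A B : ℝ} (hK : 0 ≤ K) (hA : 0 ≤ A) (hB : 0 ≤ B)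
    (h : K ≤ A + B * √K) : √K ≤ √A + B := by
  by_contra! hlt
  have h1 := Real.sq_sqrt hK
  have h2 := Real.sq_sqrt hA
  have h3 := Real.sqrt_nonneg A
  have h4 := Real.sqrt_nonneg K
  nlinarith

/-- A quadratic Gronwall inequality which asks for an integral inequality only for continuous
majorants. -/
theorem gronwall_sqrt {X y : ℝ → ℝ} {a Λ ε L B : ℝ} (ha : 0 ≤ a) (hΛ : 0 ≤ Λ) (hε : 0 ≤ ε)
    (hX0 : ∀ t, 0 ≤ X t) (hXB : ∀ t ∈ Icc 0 L, X t ≤ B) (hy0 : ∀ t, 0 ≤ y t)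
    (hy : IntervalIntegrable y volume 0 L)
    (h : ∀ L' ∈ Icc 0 L, ∀ x : ℝ → ℝ, Continuous x → (∀ t, 0 ≤ x t) →
      (∀ t ∈ Icc 0 L', X t ≤ x t) → ∀ t ∈ Icc 0 L',
        X t ^ 2 ≤ a + ∫ τ in (0 : ℝ)..t, Λ * (ε * x τ ^ 2 + x τ * y τ)) {t : ℝ} (ht : t ∈ Icc 0 L) :
    X t ≤ Real.exp (ε * Λ * t) * (√(2 * a) + 2 * Λ * ∫ τ in (0 : ℝ)..t, y τ) := by
  set μ := ε * Λ with hμ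
  have hμ0 : 0 ≤ μ := mul_nonneg hε hΛ
  have hy' : ∀ τ ∈ Icc 0 t, IntervalIntegrable y volume 0 τ := fun τ hτ => hy.mono_set (by
    rw [uIcc_of_le hτ.1, uIcc_of_le (ht.1.trans ht.2)]
    exact Icc_subset_Icc_right (hτ.2.trans ht.2))
  set J := ∫ τ in (0 : ℝ)..t, y τ with hJ
  have hJ0 : 0 ≤ J := intervalIntegral.integral_nonneg ht.1 fun τ _ => hy0 τ
  set S : Set ℝ := (fun τ => X τ ^ 2 * Real.exp (-(2 * μ * τ))) '' Icc 0 t with hS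
  have hne : S.Nonempty := ⟨_, mem_image_of_mem _ ⟨ht.1, le_rfl⟩⟩
  have hbdd : BddAbove S := by
    refine ⟨B ^ 2, ?_⟩
    rintro _ ⟨τ, hτ, rfl⟩
    have h1 := hXB τ ⟨hτ.1, hτ.2.trans ht.2⟩
    have h2 : Real.exp (-(2 * μ * τ)) ≤ 1 := Real.exp_le_one_iff.2
      (neg_nonpos.2 (mul_nonneg (by positivity) hτ.1))
    calc X τ ^ 2 * Real.exp (-(2 * μ * τ)) ≤ B ^ 2 * 1 := by
          have := hX0 τ
          gcongr
      _ = _ := mul_one _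
  set K := sSup S with hK
  have hK0 : 0 ≤ K := by
    refine le_trans ?_ (le_csSup hbdd (mem_image_of_mem _ (⟨ht.1, le_rfl⟩ : t ∈ Icc 0 t)))
    positivity
  have hXK : ∀ τ ∈ Icc 0 t, X τ ≤ √K * Real.exp (μ * τ) := fun τ hτ => by
    have h1 : X τ ^ 2 * Real.exp (-(2 * μ * τ)) ≤ K := le_csSup hbdd (mem_image_of_mem _ hτ)
    have e : Real.exp (-(2 * μ * τ)) * Real.exp (μ * τ) ^ 2 = 1 := by
      rw [← Real.exp_nat_mul, ← Real.exp_add]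
      simp; ring
    have h2 : X τ ^ 2 ≤ (√K * Real.exp (μ * τ)) ^ 2 := by
      rw [mul_pow, Real.sq_sqrt hK0]
      calc X τ ^ 2 = X τ ^ 2 * Real.exp (-(2 * μ * τ)) * Real.exp (μ * τ) ^ 2 := by
            rw [mul_assoc, e, mul_one]
        _ ≤ _ := by gcongr
    exact abs_le_of_sq_le_sq' h2 (by positivity) |>.2
  have hmain : ∀ τ ∈ Icc 0 t, X τ ^ 2 * Real.exp (-(2 * μ * τ)) ≤ a + K / 2 + Λ * √K * J := by
    intro τ hτ
    have h1 := h t ht (fun τ => √K * Real.exp (μ * τ)) (by fun_prop) (fun τ => by positivity) hXK τ hτ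
    have i1 : ∫ σ in (0 : ℝ)..τ, Λ * (ε * (√K * Real.exp (μ * σ)) ^ 2) =
        K / 2 * Real.exp (2 * μ * τ) - K / 2 := by
      have e1 : ∀ σ ∈ uIcc 0 τ, HasDerivAt (fun σ => K / 2 * Real.exp (2 * μ * σ))
          (Λ * (ε * (√K * Real.exp (μ * σ)) ^ 2)) σ := fun σ _ => by
        have h2 := (((hasDerivAt_id σ).const_mul (2 * μ)).exp).const_mul (K / 2)
        refine h2.congr_deriv ?_
        rw [mul_pow, Real.sq_sqrt hK0, ← Real.exp_nat_mul]
        simp only [id, Nat.cast_ofNat, hμ]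
        ring_nf
      rw [intervalIntegral.integral_eq_sub_of_hasDerivAt e1
        (Continuous.intervalIntegrable (by fun_prop) _ _)]
      simp
    have hint : IntervalIntegrable (fun σ => Λ * (√K * Real.exp (μ * σ) * y σ)) volume 0 τ :=
      ((hy' τ hτ).continuousOn_mul (Continuous.continuousOn (by fun_prop))).const_mul Λ
    have i2 : ∫ σ in (0 : ℝ)..τ, Λ * (√K * Real.exp (μ * σ) * y σ) ≤
        Λ * √K * Real.exp (2 * μ * τ) * J := by
      have h3 : ∫ σ in (0 : ℝ)..τ, Λ * (√K * Real.exp (μ * σ) * y σ) ≤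
          ∫ σ in (0 : ℝ)..τ, Λ * √K * Real.exp (2 * μ * τ) * y σ := by
        refine intervalIntegral.integral_mono_on hτ.1 hint ((hy' τ hτ).const_mul _) fun σ hσ => ?_
        have h4 : Real.exp (μ * σ) ≤ Real.exp (2 * μ * τ) := Real.exp_le_exp.2 (by
          have := mul_le_mul_of_nonneg_left hσ.2 hμ0
          have := mul_nonneg hμ0 hτ.1
          linarith)
        have := hy0 σ
        calc Λ * (√K * Real.exp (μ * σ) * y σ) ≤ Λ * (√K * Real.exp (2 * μ * τ) * y σ) := by
              gcongr
          _ = _ := by ring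
      refine h3.trans ?_
      rw [intervalIntegral.integral_const_mul]
      refine mul_le_mul_of_nonneg_left ?_ (by positivity)
      exact intervalIntegral.integral_mono_interval le_rfl hτ.1 hτ.2
        (Filter.Eventually.of_forall fun σ => hy0 σ) (hy' t ⟨ht.1, le_rfl⟩)
    have i3 : ∫ σ in (0 : ℝ)..τ, Λ * (ε * (√K * Real.exp (μ * σ)) ^ 2 +
        √K * Real.exp (μ * σ) * y σ) = (K / 2 * Real.exp (2 * μ * τ) - K / 2) +
        ∫ σ in (0 : ℝ)..τ, Λ * (√K * Real.exp (μ * σ) * y σ) := by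
      rw [← i1, ← intervalIntegral.integral_add (Continuous.intervalIntegrable (by fun_prop) _ _)
        hint]
      simp only [mul_add]
    rw [i3] at h1
    set E := Real.exp (2 * μ * τ) with hE
    have hE1 : 1 ≤ E := Real.one_le_exp (mul_nonneg (by positivity) hτ.1)
    have hEE : E * Real.exp (-(2 * μ * τ)) = 1 := by rw [hE, ← Real.exp_add]; simp
    have h5 : X τ ^ 2 ≤ (a + K / 2 + Λ * √K * J) * E := by
      have : 0 ≤ a * (E - 1) := mul_nonneg ha (by linarith)
      nlinarith
    calc X τ ^ 2 * Real.exp (-(2 * μ * τ)) ≤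
          (a + K / 2 + Λ * √K * J) * E * Real.exp (-(2 * μ * τ)) := by gcongr
      _ = _ := by rw [mul_assoc, hEE, mul_one]
  have hKle : K ≤ a + K / 2 + Λ * √K * J := csSup_le hne (by
    rintro _ ⟨τ, hτ, rfl⟩
    exact hmain τ hτ)
  have hsq : √K ≤ √(2 * a) + 2 * Λ * J :=
    sqrt_le_of_le_add_mul_sqrt hK0 (by positivity) (by positivity) (by linarith)
  refine (hXK t ⟨ht.1, le_rfl⟩).trans ?_
  rw [mul_comm]
  gcongr

end gronwall

section energyEstimate

variable {d : ℕ} (P : AdmissiblePair d) {r : ℝ}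

theorem PathOn.mono {Y : Type*} [NormedAddCommGroup Y] [NormedSpace ℝ Y] {L L' : ℝ} {u v : ℝ → Y}
    (h : PathOn L u v) (hL' : L' ∈ Icc 0 L) : PathOn L' u v := by
  refine ⟨hL'.1, h.integrable_sub ⟨le_rfl, h.nonneg⟩ hL', ?_, fun t ht =>
    h.eq t ⟨ht.1, ht.2.trans hL'.2⟩⟩
  obtain ⟨K, hK⟩ := h.bound
  exact ⟨K, hK.mono fun t ht h' => ht ⟨h'.1, h'.2.trans hL'.2⟩⟩

theorem norm_bL_le (hr : (d : ℝ) / 2 < r) {t₀ γ : ℝ} (ht₀ : (d : ℝ) / 2 < t₀) (hγ : 0 ≤ γ)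
    {b : XSpace P r} (hb : xNorm P t₀ (b : State d) ≤ ENNReal.ofReal γ) :
    ‖bL P hr b‖ ≤ (sobolevConst d t₀).toReal * γ := by
  rw [Lp.norm_def]
  refine ENNReal.toReal_le_of_le_ofReal (by positivity) ?_
  rw [ENNReal.ofReal_mul ENNReal.toReal_nonneg, ENNReal.ofReal_toReal (sobolevConst_lt_top ht₀).ne]
  exact (eLpNorm_one_le_hsNorm t₀ (b : State d).1).trans
    (mul_le_mul_right ((hsNorm_fst_le P t₀ _).trans hb) _)

/-- The growth rate of the energy when `|U̲|_{X^s} ≤ β` and `|∂_t U̲|_{X^{t₀}} ≤ γ`. -/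
def energyRate (d : ℕ) (s t₀ M β γ : ℝ) : ℝ :=
  2 * energyConst d s M β + d * (sobolevConst d t₀).toReal * γ

theorem energyConst_nonneg {s M β : ℝ} (hs : 0 ≤ s) (hM : 0 ≤ M) (hβ : 0 ≤ β) :
    0 ≤ energyConst d s M β := by unfold energyConst; positivity

theorem energyRate_nonneg {s t₀ M β γ : ℝ} (hs : 0 ≤ s) (hM : 0 ≤ M) (hβ : 0 ≤ β) (hγ : 0 ≤ γ) :
    0 ≤ energyRate d s t₀ M β γ := by
  have := energyConst_nonneg (d := d) hs hM hβ
  unfold energyRate; positivity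

theorem abs_deriv_energyX_le {M s σ t₀ β γ ε x y : ℝ} (h₁ : SymbolBound P.G₁ M)
    (h₂ : SymbolBound P.G₂ M) (hs : (d : ℝ) / 2 + 1 < s) (hr : (d : ℝ) / 2 < r) (h0 : 0 ≤ r)
    (ht₀ : (d : ℝ) / 2 < t₀) (hσ : σ = 0 ∨ σ = s) {k : ℕ} (hk : 1 ≤ k) (n : ℕ) (hβ : 0 ≤ β)
    (hγ : 0 ≤ γ) (hε0 : 0 ≤ ε) (hε1 : ε ≤ 1) (hx : 0 ≤ x) (hy : 0 ≤ y) {ub b' u v ρ : XSpace P r}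
    (hub : xNorm P s (ub : State d) ≤ ENNReal.ofReal β)
    (hb' : xNorm P t₀ (b' : State d) ≤ ENNReal.ofReal γ)
    (hu : xNorm P σ (u : State d) ≤ ENNReal.ofReal x)
    (hv : v = ρ - ∑ j, AX P hr ε j ub (DX P n j u))
    (hρ : ‖wzH P h0 σ k ρ‖ ≤ y ∧ ∀ i, ‖wvH P h0 σ k i ρ‖ ≤ y) :
    |2 * ((inner ℂ (wzH P h0 σ k u) (wzH P h0 σ k v)).re +
        ∑ i, (inner ℂ (SX P hr ε ub (wvH P h0 σ k i u)) (wvH P h0 σ k i v)).re) +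
        ε * ∑ i, (inner ℂ (mBm P hr b' (wvH P h0 σ k i u)) (wvH P h0 σ k i u)).re| ≤
      energyRate d s t₀ M β γ * (ε * x ^ 2 + x * y) := by
  have e1 := abs_static_energy_le P h₁ h₂ hs hr h0 hσ hk n hβ hε0 hε1 hx hy hub hu hρ.1 hρ.2 hv
  have e2 : ∀ i, |(inner ℂ (mBm P hr b' (wvH P h0 σ k i u)) (wvH P h0 σ k i u)).re| ≤
      (sobolevConst d t₀).toReal * γ * x ^ 2 := fun i => by
    have hw : ‖wvH P h0 σ k i u‖ ≤ x :=
      norm_multOp_wt_le hx k ((hsNorm_vH_le P h0 σ i u).trans hu)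
    refine (Complex.abs_re_le_norm _).trans ((norm_inner_le_norm _ _).trans ?_)
    have h3 := (norm_mBm_le P hr b' (wvH P h0 σ k i u)).trans
      (mul_le_mul (norm_bL_le P hr ht₀ hγ hb') hw (norm_nonneg _) (by positivity))
    exact (mul_le_mul h3 hw (norm_nonneg _) (by positivity)).trans_eq (by ring)
  have e3 := (Finset.abs_sum_le_sum_abs (fun i => (inner ℂ (mBm P hr b' (wvH P h0 σ k i u))
    (wvH P h0 σ k i u)).re) Finset.univ).trans (Finset.sum_le_sum fun i _ => e2 i)
  rw [Finset.sum_const, Finset.card_univ, Fintype.card_fin, nsmul_eq_mul] at e3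
  have e5 : 0 ≤ d * (sobolevConst d t₀).toReal * γ * (x * y) := by positivity
  refine (abs_add_le _ _).trans ?_
  rw [abs_mul, abs_mul, abs_of_nonneg hε0, abs_of_pos (zero_lt_two (α := ℝ))]
  have e4 := add_le_add (mul_le_mul_of_nonneg_left e1 zero_le_two) (mul_le_mul_of_nonneg_left e3 hε0)
  refine e4.trans ?_
  unfold energyRate
  generalize energyConst d s M β = c at *
  nlinarith

theorem weighted_energy_bound {M s σ t₀ β β₀ γ ε h L x₀ : ℝ} (h₁ : SymbolBound P.G₁ M)
    (h₂ : SymbolBound P.G₂ M) (hs : (d : ℝ) / 2 + 1 < s) (hr : (d : ℝ) / 2 < r) (h0 : 0 ≤ r)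
    (ht₀ : (d : ℝ) / 2 < t₀) (hσ : σ = 0 ∨ σ = s) {k : ℕ} (hk : 1 ≤ k) (n : ℕ) (hβ : 0 ≤ β)
    (hγ : 0 ≤ γ) (hε0 : 0 ≤ ε) (hε1 : ε ≤ 1) {ub bd u v ρ : ℝ → XSpace P r}
    (pub : PathOn L ub bd) (pu : PathOn L u v)
    (hub : ∀ᵐ t, t ∈ Icc 0 L → xNorm P s (ub t : State d) ≤ ENNReal.ofReal β)
    (hbd : ∀ᵐ t, t ∈ Icc 0 L → xNorm P t₀ (bd t : State d) ≤ ENNReal.ofReal γ)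
    (hnc : ∀ t ∈ Icc 0 L, ∀ x, h ≤ 1 + ε * ((ub t : State d).1.toPhys x).re)
    (hβ₀ : ‖bL P hr (ub 0)‖ ≤ β₀) {x y : ℝ → ℝ} (hx : ∀ t, 0 ≤ x t) (hy : ∀ t, 0 ≤ y t)
    (hu : ∀ t ∈ Icc 0 L, xNorm P σ (u t : State d) ≤ ENNReal.ofReal (x t))
    (hx₀0 : 0 ≤ x₀) (hx₀ : xNorm P σ (u 0 : State d) ≤ ENNReal.ofReal x₀)
    (hxi : Continuous x) (hyi : IntervalIntegrable y volume 0 L)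
    (hv : ∀ᵐ t, t ∈ Icc 0 L → v t = ρ t - ∑ j, AX P hr ε j (ub t) (DX P n j (u t)))
    (hρ : ∀ᵐ t, t ∈ Icc 0 L → ‖wzH P h0 σ k (ρ t)‖ ≤ y t ∧ ∀ i, ‖wvH P h0 σ k i (ρ t)‖ ≤ y t)
    {t : ℝ} (ht : t ∈ Icc 0 L) :
    min 1 h * (‖wzH P h0 σ k (u t)‖ ^ 2 + ∑ i, ‖wvH P h0 σ k i (u t)‖ ^ 2) ≤
      (d + 1) * (1 + β₀) * x₀ ^ 2 +
        ∫ τ in (0 : ℝ)..t, energyRate d s t₀ M β γ * (ε * x τ ^ 2 + x τ * y τ) := by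
  refine (energyX_lower P hr h0 σ k (hnc t ht) (u t)).trans ?_
  have hβ₀0 : 0 ≤ β₀ := (norm_nonneg _).trans hβ₀
  refine le_trans ?_ (add_le_add_left (energyX_upper P hr h0 σ k hε0 hε1 hx₀0 hβ₀0 hβ₀ hx₀) _)
  obtain ⟨K₁, hK₁⟩ := pub.lipschitz
  obtain ⟨K₂, hK₂⟩ := pu.lipschitz
  obtain ⟨K, hK⟩ := lipschitzOn_comp_of_contDiff (hK₁.prodMk hK₂)
    (contDiff_energyX P hr h0 σ k ε)
  refine le_add_integral_of_deriv_le pub.nonneg hK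
    ((((Continuous.intervalIntegrable (by fun_prop) 0 L).add
      (hyi.continuousOn_mul hxi.continuousOn))).const_mul _) ?_ ht
  have hs0 : 0 ≤ s := by have : (0 : ℝ) ≤ (d : ℝ) / 2 := by positivity
                         linarith
  filter_upwards [pub.ae_hasDerivAt, pu.ae_hasDerivAt, hub, hbd, hv, hρ]
    with τ k1 k2 k3 k4 k5 k6 hτ
  have hτ' := Ioo_subset_Icc_self hτ
  refine ⟨_, hasDerivAt_energyX P hr h0 σ k ε (k1 hτ) (k2 hτ), ?_⟩
  exact le_of_abs_le (abs_deriv_energyX_le P h₁ h₂ hs hr h0 ht₀ hσ hk n hβ hγ hε0 hε1 (hx τ) (hy τ)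
    (k3 hτ') (k4 hτ') (hu τ hτ') (k5 hτ') (k6 hτ'))

theorem abs_weighted_energy_sub_le {M s σ t₀ β γ ε L x y : ℝ} (h₁ : SymbolBound P.G₁ M)
    (h₂ : SymbolBound P.G₂ M) (hs : (d : ℝ) / 2 + 1 < s) (hr : (d : ℝ) / 2 < r) (h0 : 0 ≤ r)
    (ht₀ : (d : ℝ) / 2 < t₀) (hσ : σ = 0 ∨ σ = s) {k : ℕ} (hk : 1 ≤ k) (n : ℕ) (hβ : 0 ≤ β)
    (hγ : 0 ≤ γ) (hε0 : 0 ≤ ε) (hε1 : ε ≤ 1) {ub bd u v ρ : ℝ → XSpace P r}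
    (pub : PathOn L ub bd) (pu : PathOn L u v)
    (hub : ∀ᵐ t, t ∈ Icc 0 L → xNorm P s (ub t : State d) ≤ ENNReal.ofReal β)
    (hbd : ∀ᵐ t, t ∈ Icc 0 L → xNorm P t₀ (bd t : State d) ≤ ENNReal.ofReal γ)
    (hx : 0 ≤ x) (hy : 0 ≤ y)
    (hu : ∀ t ∈ Icc 0 L, xNorm P σ (u t : State d) ≤ ENNReal.ofReal x)
    (hv : ∀ᵐ t, t ∈ Icc 0 L → v t = ρ t - ∑ j, AX P hr ε j (ub t) (DX P n j (u t)))
    (hρ : ∀ᵐ t, t ∈ Icc 0 L → ‖wzH P h0 σ k (ρ t)‖ ≤ y ∧ ∀ i, ‖wvH P h0 σ k i (ρ t)‖ ≤ y)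
    {t τ : ℝ} (ht : t ∈ Icc 0 L) (hτ : τ ∈ Icc 0 L) :
    |energyX P hr h0 σ k ε (ub t) (u t) - energyX P hr h0 σ k ε (ub τ) (u τ)| ≤
      energyRate d s t₀ M β γ * (ε * x ^ 2 + x * y) * |t - τ| := by
  obtain ⟨K₁, hK₁⟩ := pub.lipschitz
  obtain ⟨K₂, hK₂⟩ := pu.lipschitz
  obtain ⟨K, hK⟩ := lipschitzOn_comp_of_contDiff (hK₁.prodMk hK₂)
    (contDiff_energyX P hr h0 σ k ε)
  refine abs_sub_le_of_deriv_le hK ?_ ht hτ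
  filter_upwards [pub.ae_hasDerivAt, pu.ae_hasDerivAt, hub, hbd, hv, hρ]
    with τ k1 k2 k3 k4 k5 k6 hτ
  have hτ' := Ioo_subset_Icc_self hτ
  exact ⟨_, hasDerivAt_energyX P hr h0 σ k ε (k1 hτ) (k2 hτ),
    abs_deriv_energyX_le P h₁ h₂ hs hr h0 ht₀ hσ hk n hβ hγ hε0 hε1 hx hy
      (k3 hτ') (k4 hτ') (hu τ hτ') (k5 hτ') (k6 hτ')⟩

end energyEstimate

section energyEstimate

variable {d : ℕ} (P : AdmissiblePair d) {r : ℝ}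

/-- The energy estimate for (regularizations of) the linearized system, in `X^σ` with `σ ∈ {0, s}`.
The equation may involve, for each `l`, a truncated derivative and a forcing term which is
bounded by `y` up to a term tending to zero with `l` in each truncated norm. -/
theorem energy_bound {M s σ t₀ β β₀ γ ε h L x₀ B : ℝ} (h₁ : SymbolBound P.G₁ M)
    (h₂ : SymbolBound P.G₂ M) (hs : (d : ℝ) / 2 + 1 < s) (hr : (d : ℝ) / 2 < r) (h0 : 0 ≤ r)
    (ht₀ : (d : ℝ) / 2 < t₀) (hσ : σ = 0 ∨ σ = s) (hh : 0 < h) (hβ : 0 ≤ β)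
    (hγ : 0 ≤ γ) (hε0 : 0 ≤ ε) (hε1 : ε ≤ 1) {ub bd u v : ℝ → XSpace P r}
    (pub : PathOn L ub bd) (pu : PathOn L u v)
    (hub : ∀ᵐ t, t ∈ Icc 0 L → xNorm P s (ub t : State d) ≤ ENNReal.ofReal β)
    (hbd : ∀ᵐ t, t ∈ Icc 0 L → xNorm P t₀ (bd t : State d) ≤ ENNReal.ofReal γ)
    (hnc : ∀ t ∈ Icc 0 L, ∀ x, h ≤ 1 + ε * ((ub t : State d).1.toPhys x).re)
    (hβ₀ : ‖bL P hr (ub 0)‖ ≤ β₀) {y : ℝ → ℝ} (hy : ∀ t, 0 ≤ y t)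
    (hyi : IntervalIntegrable y volume 0 L)
    (hB : ∀ t ∈ Icc 0 L, xNorm P σ (u t : State d) ≤ ENNReal.ofReal B)
    (hx₀0 : 0 ≤ x₀) (hx₀ : xNorm P σ (u 0 : State d) ≤ ENNReal.ofReal x₀)
    (N : ℕ → ℕ) (ρ : ℕ → ℝ → XSpace P r) (f : ℕ → ℕ → ℝ) (hf0 : ∀ k l, 0 ≤ f k l)
    (hf : ∀ k, Filter.Tendsto (f k) Filter.atTop (nhds 0))
    (hv : ∀ l, ∀ᵐ t, t ∈ Icc 0 L → v t = ρ l t - ∑ j, AX P hr ε j (ub t) (DX P (N l) j (u t)))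
    (hρ : ∀ k l, ∀ᵐ t, t ∈ Icc 0 L → ‖wzH P h0 σ k (ρ l t)‖ ≤ y t + f k l ∧
      ∀ i, ‖wvH P h0 σ k i (ρ l t)‖ ≤ y t + f k l) {t : ℝ} (ht : t ∈ Icc 0 L) :
    (xNorm P σ (u t : State d)).toReal ≤
      Real.exp (ε * ((d + 1) ^ 2 * energyRate d s t₀ M β γ * (min 1 h)⁻¹) * t) *
        (√(2 * ((d + 1) ^ 3 * (1 + β₀) * (min 1 h)⁻¹ * x₀ ^ 2)) +
          2 * ((d + 1) ^ 2 * energyRate d s t₀ M β γ * (min 1 h)⁻¹) *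
            ∫ τ in (0 : ℝ)..t, y τ) := by
  have hs0 : 0 ≤ s := by have : (0 : ℝ) ≤ (d : ℝ) / 2 := by positivity
                         linarith
  have hC := energyRate_nonneg (d := d) (t₀ := t₀) hs0 h₁.nonneg hβ hγ
  set C := energyRate d s t₀ M β γ with hCdef
  have hc : 0 < min 1 h := lt_min one_pos hh
  set c := min 1 h with hcdef
  have hβ₀0 : 0 ≤ β₀ := (norm_nonneg _).trans hβ₀
  have hXB : ∀ t ∈ Icc 0 L, (xNorm P σ (u t : State d)).toReal ≤ max B 0 := fun t ht =>
    ENNReal.toReal_le_of_le_ofReal (le_max_right _ _)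
      ((hB t ht).trans (ENNReal.ofReal_le_ofReal (le_max_left _ _)))
  refine gronwall_sqrt (X := fun t => (xNorm P σ (u t : State d)).toReal)
    (a := (d + 1) ^ 3 * (1 + β₀) * c⁻¹ * x₀ ^ 2) (by positivity) (by positivity) hε0
    (fun t => ENNReal.toReal_nonneg) hXB hy hyi ?_ ht
  intro L' hL' x hxc hx0 hXx τ hτ
  have hsub : ∀ {p : ℝ → Prop}, (∀ᵐ t, t ∈ Icc 0 L → p t) → ∀ᵐ t, t ∈ Icc 0 L' → p t :=
    fun hp => hp.mono fun t h1 h2 => h1 ⟨h2.1, h2.2.trans hL'.2⟩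
  have hyi' : IntervalIntegrable y volume 0 L' := hyi.mono_set (by
    rw [uIcc_of_le hL'.1, uIcc_of_le pu.nonneg]
    exact Icc_subset_Icc_right hL'.2)
  have hyτ : IntervalIntegrable y volume 0 τ := hyi'.mono_set (by
    rw [uIcc_of_le hτ.1, uIcc_of_le hL'.1]
    exact Icc_subset_Icc_right hτ.2)
  have hux : ∀ t ∈ Icc 0 L', xNorm P σ (u t : State d) ≤ ENNReal.ofReal (x t) := fun t ht => by
    have hfin : xNorm P σ (u t : State d) ≠ ⊤ :=
      ((hB t ⟨ht.1, ht.2.trans hL'.2⟩).trans_lt ENNReal.ofReal_lt_top).ne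
    rw [← ENNReal.ofReal_toReal hfin]
    exact ENNReal.ofReal_le_ofReal (hXx t ht)
  set Q := (d + 1) * (1 + β₀) * x₀ ^ 2 + ∫ σ in (0 : ℝ)..τ, C * (ε * x σ ^ 2 + x σ * y σ) with hQ
  have i1 : IntervalIntegrable (fun σ => C * (ε * x σ ^ 2 + x σ * y σ)) volume 0 τ :=
    ((Continuous.intervalIntegrable (by fun_prop) 0 τ).add
      (hyτ.continuousOn_mul hxc.continuousOn)).const_mul _
  have i2 : IntervalIntegrable (fun σ => C * x σ) volume 0 τ :=
    Continuous.intervalIntegrable (by fun_prop) 0 τ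
  have hQ0 : 0 ≤ Q := add_nonneg (by positivity) (intervalIntegral.integral_nonneg hτ.1
    fun σ _ => by have := hx0 σ; have := hy σ; positivity)
  have hk : ∀ k : ℕ, 1 ≤ k →
      c * (‖wzH P h0 σ k (u τ)‖ ^ 2 + ∑ i, ‖wvH P h0 σ k i (u τ)‖ ^ 2) ≤ Q := fun k hk => by
    have hl : ∀ l, c * (‖wzH P h0 σ k (u τ)‖ ^ 2 + ∑ i, ‖wvH P h0 σ k i (u τ)‖ ^ 2) ≤
        Q + f k l * ∫ σ in (0 : ℝ)..τ, C * x σ := fun l => by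
      have h3 := weighted_energy_bound P h₁ h₂ hs hr h0 ht₀ hσ hk (N l) hβ hγ hε0 hε1
        (pub.mono hL') (pu.mono hL') (hsub hub) (hsub hbd)
        (fun t ht => hnc t ⟨ht.1, ht.2.trans hL'.2⟩) hβ₀ hx0
        (y := fun t => y t + f k l) (fun t => add_nonneg (hy t) (hf0 k l)) hux hx₀0 hx₀ hxc
        (hyi'.add intervalIntegrable_const) (hsub (hv l)) (hsub (hρ k l)) hτ
      refine h3.trans_eq ?_
      rw [hQ, add_assoc, ← intervalIntegral.integral_const_mul, ← intervalIntegral.integral_add i1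
        (i2.const_mul _)]
      congr 2
      funext σ
      ring
    have h4 : Filter.Tendsto (fun l => Q + f k l * ∫ σ in (0 : ℝ)..τ, C * x σ) Filter.atTop
        (nhds Q) := by
      simpa using ((hf k).mul_const (∫ σ in (0 : ℝ)..τ, C * x σ)).const_add Q
    exact ge_of_tendsto' h4 hl
  have hsum0 : ∀ k, 0 ≤ ∑ i, ‖wvH P h0 σ k i (u τ)‖ ^ 2 :=
    fun k => Finset.sum_nonneg fun i _ => sq_nonneg _
  have hz : ∀ k : ℕ, 1 ≤ k → ‖wzH P h0 σ k (u τ)‖ ≤ √(c⁻¹ * Q) := fun k hk1 => by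
    refine Real.le_sqrt_of_sq_le ?_
    rw [le_inv_mul_iff₀ hc]
    nlinarith [hk k hk1, hsum0 k]
  have hvi : ∀ (k : ℕ) (i : Fin d), 1 ≤ k → ‖wvH P h0 σ k i (u τ)‖ ≤ √(c⁻¹ * Q) :=
    fun k i hk1 => by
    refine Real.le_sqrt_of_sq_le ?_
    rw [le_inv_mul_iff₀ hc]
    have h5 := Finset.single_le_sum (f := fun i => ‖wvH P h0 σ k i (u τ)‖ ^ 2)
      (fun i _ => sq_nonneg _) (Finset.mem_univ i)
    nlinarith [hk k hk1, sq_nonneg ‖wzH P h0 σ k (u τ)‖]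
  have hfin := ENNReal.toReal_le_of_le_ofReal (by positivity)
    (xNorm_le_of_wt P h0 (Real.sqrt_nonneg _) hz hvi)
  calc (xNorm P σ (u τ : State d)).toReal ^ 2 ≤ ((d + 1) * √(c⁻¹ * Q)) ^ 2 := by gcongr
    _ = (d + 1) ^ 2 * c⁻¹ * Q := by
        rw [mul_pow, Real.sq_sqrt (by positivity)]; ring
    _ = (d + 1) ^ 3 * (1 + β₀) * c⁻¹ * x₀ ^ 2 +
        ((d + 1) ^ 2 * c⁻¹) * ∫ σ in (0 : ℝ)..τ, C * (ε * x σ ^ 2 + x σ * y σ) := by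
        rw [hQ]; ring
    _ = _ := by
        rw [← intervalIntegral.integral_const_mul]
        congr 2
        funext σ
        ring

end energyEstimate

section ode

variable {Y : Type*} [NormedAddCommGroup Y] [NormedSpace ℝ Y] [CompleteSpace Y]

/-- The Cauchy–Lipschitz theorem for a vector field which is only measurable in time. -/
theorem exists_integral_curve {F : ℝ → Y → Y} {K C L : ℝ} (hL : 0 ≤ L) (hK : 0 ≤ K)
    (hF : ∀ t y z, ‖F t y - F t z‖ ≤ K * ‖y - z‖) (hC : ∀ t, ‖F t 0‖ ≤ C)
    (hm : ∀ u : ℝ → Y, Continuous u → AEStronglyMeasurable (fun t => F t (u t)) volume) (u₀ : Y) :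
    ∃ u : ℝ → Y, Continuous u ∧ ∀ t ∈ Icc 0 L, u t = u₀ + ∫ τ in (0 : ℝ)..t, F τ (u τ) := by
  set μ := 2 * K + 1 with hμ
  have hμ0 : 0 < μ := by positivity
  let E : C(Icc 0 L, Y) → ℝ → Y := fun g τ => Real.exp (μ * τ) • g (projIcc 0 L hL τ)
  have hE : ∀ g, Continuous (E g) := fun g =>
    (Continuous.rexp (by fun_prop)).smul (g.continuous.comp continuous_projIcc)
  have hint : ∀ (u : ℝ → Y), Continuous u → ∀ a b,
      IntervalIntegrable (fun τ => F τ (u τ)) volume a b := fun u hu a b => by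
    have h1 : IntervalIntegrable (fun τ => K * ‖u τ‖ + C) volume a b :=
      Continuous.intervalIntegrable (by fun_prop) a b
    refine h1.mono_fun (hm u hu).restrict (.of_forall fun τ => ?_)
    have h2 := hF τ (u τ) 0
    have h3 := norm_add_le (F τ (u τ) - F τ 0) (F τ 0)
    rw [sub_add_cancel] at h3
    rw [sub_zero] at h2
    refine le_trans ?_ (le_abs_self _)
    linarith [hC τ]
  let Φ : C(Icc 0 L, Y) → C(Icc 0 L, Y) := fun g =>
    ⟨fun t => Real.exp (-(μ * t)) • (u₀ + ∫ τ in (0 : ℝ)..t, F τ (E g τ)), by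
      have h1 : Continuous fun t : ℝ => ∫ τ in (0 : ℝ)..t, F τ (E g τ) :=
        intervalIntegral.continuous_primitive (hint _ (hE g)) 0
      fun_prop⟩
  have hΦ : ContractingWith (1 / 2) Φ := by
    refine ⟨by rw [← NNReal.coe_lt_coe]; norm_num, LipschitzWith.of_dist_le_mul fun g g' => ?_⟩
    rw [ContinuousMap.dist_le (by positivity)]
    intro t
    have ht := t.2
    rw [dist_eq_norm]
    change ‖Real.exp (-(μ * t)) • (u₀ + ∫ τ in (0 : ℝ)..t, F τ (E g τ)) -
      Real.exp (-(μ * t)) • (u₀ + ∫ τ in (0 : ℝ)..t, F τ (E g' τ))‖ ≤ _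
    rw [← smul_sub, add_sub_add_left_eq_sub,
      ← intervalIntegral.integral_sub (hint _ (hE g) _ _) (hint _ (hE g') _ _), norm_smul,
      Real.norm_of_nonneg (Real.exp_pos _).le]
    have h1 : ‖∫ τ in (0 : ℝ)..t, (F τ (E g τ) - F τ (E g' τ))‖ ≤
        ∫ τ in (0 : ℝ)..t, K * dist g g' * Real.exp (μ * τ) := by
      refine intervalIntegral.norm_integral_le_of_norm_le ht.1 (.of_forall fun τ _ => ?_)
        (Continuous.intervalIntegrable (by fun_prop) _ _)
      refine (hF _ _ _).trans ?_
      rw [← smul_sub, norm_smul, Real.norm_of_nonneg (Real.exp_pos _).le, ← dist_eq_norm, mul_assoc,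
        mul_comm (dist g g')]
      gcongr
      exact ContinuousMap.dist_apply_le_dist _
    have h2 : ∫ τ in (0 : ℝ)..t, K * dist g g' * Real.exp (μ * τ) =
        K * dist g g' / μ * Real.exp (μ * t) - K * dist g g' / μ := by
      have h3 : ∀ σ ∈ uIcc 0 (t : ℝ), HasDerivAt (fun σ => K * dist g g' / μ * Real.exp (μ * σ))
          (K * dist g g' * Real.exp (μ * σ)) σ := fun σ _ => by
        refine ((((hasDerivAt_id σ).const_mul μ).exp).const_mul (K * dist g g' / μ)).congr_deriv ?_
        simp only [id]
        field_simp
      rw [intervalIntegral.integral_eq_sub_of_hasDerivAt h3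
        (Continuous.intervalIntegrable (by fun_prop) _ _)]
      simp
    have h4 : K * dist g g' / μ ≤ 1 / 2 * dist g g' := by
      rw [div_le_iff₀ hμ0, hμ]
      nlinarith [dist_nonneg (x := g) (y := g')]
    have h5 : 0 ≤ K * dist g g' / μ := by positivity
    calc Real.exp (-(μ * t)) * ‖∫ τ in (0 : ℝ)..t, (F τ (E g τ) - F τ (E g' τ))‖ ≤
          Real.exp (-(μ * t)) * (K * dist g g' / μ * Real.exp (μ * t)) := by
          gcongr
          rw [h2] at h1
          linarith
      _ = K * dist g g' / μ := by
          rw [mul_left_comm, ← Real.exp_add]; simp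
      _ ≤ _ := by simpa using h4
  have hfix := hΦ.fixedPoint_isFixedPt
  set g := hΦ.fixedPoint
  refine ⟨E g, hE g, fun t ht => ?_⟩
  have h1 := congrArg (fun φ : C(Icc 0 L, Y) => φ ⟨t, ht⟩) hfix
  change Real.exp (-(μ * t)) • (u₀ + ∫ τ in (0 : ℝ)..t, F τ (E g τ)) = g ⟨t, ht⟩ at h1
  change Real.exp (μ * t) • g (projIcc 0 L hL t) = _
  rw [projIcc_of_mem hL ht, ← h1, smul_smul, ← Real.exp_add]
  simp

end ode

theorem exists_bounded_representative {Y : Type*} [NormedAddCommGroup Y] {I : Set ℝ} {u : ℝ → Y}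
    (hu : MemLp u ⊤ (volume.restrict I)) : ∃ u' : ℝ → Y, StronglyMeasurable u' ∧
      (∃ C : ℝ, 0 ≤ C ∧ ∀ t, ‖u' t‖ ≤ C) ∧ ∀ᵐ t ∂volume.restrict I, u' t = u t := by
  set g := hu.1.mk u
  have hg : StronglyMeasurable g := hu.1.stronglyMeasurable_mk
  set C := (eLpNorm u ⊤ (volume.restrict I)).toReal
  have hS : MeasurableSet {t | ‖g t‖ ≤ C} := hg.norm.measurable measurableSet_Iic
  refine ⟨indicator {t | ‖g t‖ ≤ C} g, hg.indicator hS, ⟨C, ENNReal.toReal_nonneg, fun t => ?_⟩, ?_⟩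
  · by_cases ht : t ∈ {t | ‖g t‖ ≤ C}
    · rw [indicator_of_mem ht]; exact ht
    · rw [indicator_of_notMem ht, norm_zero]; exact ENNReal.toReal_nonneg
  · have hb : ∀ᵐ t ∂volume.restrict I, ‖u t‖ₑ ≤ eLpNorm u ⊤ (volume.restrict I) := by
      rw [eLpNorm_exponent_top]
      exact enorm_ae_le_eLpNormEssSup u _
    filter_upwards [hb, hu.1.ae_eq_mk] with t h1 h2
    have h3 : t ∈ {t | ‖g t‖ ≤ C} := by
      change ‖g t‖ ≤ C
      rw [show g t = u t from h2.symm, ← toReal_enorm]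
      exact ENNReal.toReal_mono hu.2.ne h1
    rw [indicator_of_mem h3]
    exact h2.symm

section unboundedDerivative

variable {d : ℕ} (P : AdmissiblePair d) {r s : ℝ}

theorem two_pi_abs_coord_le_jb (j : Fin d) (ξ : Sp d) : 2 * Real.pi * |ξ j| ≤ jb ξ := by
  refine le_trans ?_ (two_pi_norm_le_jb ξ)
  have := abs_coord_le j ξ
  have := Real.pi_pos
  gcongr

theorem norm_coordSym (j : Fin d) (ξ : Sp d) :
    ‖2 * Real.pi * Complex.I * ((ξ j : ℝ) : ℂ)‖ = 2 * Real.pi * |ξ j| := by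
  simp [abs_of_pos Real.pi_pos]

/-- The derivative `∂_j` from `X^s` to `X^r`, `r ≤ s - 1`. -/
def derivX (h : r + 1 ≤ s) (j : Fin d) : XSpace P s →L[ℝ] XSpace P r :=
  multX P (fun ξ => 2 * Real.pi * Complex.I * ((ξ j : ℝ) : ℂ))
    (Continuous.aestronglyMeasurable (by fun_prop)) (fun ξ => by simp) (C := 1) zero_le_one
    (.of_forall fun ξ => by
      rw [norm_coordSym, one_mul]
      refine (mul_le_mul_of_nonneg_right (two_pi_abs_coord_le_jb j ξ)
        (Real.rpow_nonneg (jb_pos ξ).le r)).trans ?_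
      rw [mul_comm, ← Real.rpow_add_one (jb_pos ξ).ne']
      exact Real.rpow_le_rpow_of_exponent_le (one_le_jb ξ) h)

theorem derivX_coe (h : r + 1 ≤ s) (j : Fin d) (U : XSpace P s) :
    (derivX P h j U : State d) = State.deriv j U := by
  rw [derivX, multX_coe]; rfl

theorem coordSym_sub_bound (h : r + 1 ≤ s) (n : ℕ) (j : Fin d) (ξ : Sp d) :
    ‖derivSym n j ξ - 2 * Real.pi * Complex.I * ((ξ j : ℝ) : ℂ)‖ * jb ξ ^ r ≤
      ((n : ℝ) + 1) ^ (-(s - 1 - r)) * jb ξ ^ s := by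
  have hn : (0 : ℝ) ≤ n := n.cast_nonneg
  have hJ := jb_pos ξ
  by_cases hc : |ξ j| ≤ n
  · have : clampCoord n j ξ = ξ j := by
      unfold clampCoord
      rw [min_eq_right (abs_le.1 hc).2, max_eq_right (abs_le.1 hc).1]
    rw [derivSym, this, sub_self, norm_zero, zero_mul]
    positivity
  · have hc' := not_le.1 hc
    have h1 : ‖derivSym n j ξ - 2 * Real.pi * Complex.I * ((ξ j : ℝ) : ℂ)‖ ≤ jb ξ := by
      rw [derivSym, ← mul_sub, ← Complex.ofReal_sub, norm_mul, Complex.norm_real, Real.norm_eq_abs]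
      refine le_trans ?_ (two_pi_abs_coord_le_jb j ξ)
      have e : ‖(2 * Real.pi * Complex.I : ℂ)‖ = 2 * Real.pi := by
        simp [abs_of_pos Real.pi_pos]
      rw [e]
      have : |clampCoord n j ξ - ξ j| ≤ |ξ j| := by
        unfold clampCoord
        rcases le_total 0 (ξ j) with h0 | h0
        · rw [abs_of_nonneg h0] at hc' ⊢
          rw [min_eq_left hc'.le, max_eq_right (by linarith), abs_le]
          constructor <;> linarith
        · rw [abs_of_nonpos h0] at hc' ⊢
          rw [min_eq_right (by linarith), max_eq_left (by linarith), abs_le]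
          constructor <;> linarith
      have := Real.pi_pos
      gcongr
    have h2 : (n : ℝ) + 1 ≤ jb ξ := by
      rcases Nat.eq_zero_or_pos n with rfl | hn1
      · simpa using one_le_jb ξ
      · have h3 := two_pi_abs_coord_le_jb j ξ
        have h4 : (1 : ℝ) ≤ n := by exact_mod_cast hn1
        nlinarith [Real.pi_gt_three]
    calc _ ≤ jb ξ * jb ξ ^ r := by gcongr
      _ = jb ξ ^ (-(s - 1 - r)) * jb ξ ^ s := by
          rw [← Real.rpow_add hJ, mul_comm, ← Real.rpow_add_one hJ.ne']
          congr 1; ring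
      _ ≤ _ := by
          refine mul_le_mul_of_nonneg_right ?_ (Real.rpow_nonneg hJ.le _)
          exact Real.rpow_le_rpow_of_nonpos (by positivity) h2 (by linarith)

theorem fourierMult_sub_symbol {m m' : Sp d → ℂ} (hm : AEStronglyMeasurable m volume)
    (hm' : AEStronglyMeasurable m' volume) (f : Fn d) :
    fourierMult (m - m') (hm.sub hm') f = fourierMult m hm f - fourierMult m' hm' f := by
  refine AEEqFun.ext ?_
  filter_upwards [coeFn_fourierMult _ (hm.sub hm') f, coeFn_fourierMult m hm f,
    coeFn_fourierMult m' hm' f, AEEqFun.coeFn_sub (fourierMult m hm f) (fourierMult m' hm' f)]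
    with ξ h1 h2 h3 h4
  rw [h1, h4, Pi.sub_apply, Pi.sub_apply, h2, h3, sub_mul]

theorem norm_DX_sub_derivX_le (h : r + 1 ≤ s) (n : ℕ) (j : Fin d) (U : XSpace P s) :
    ‖DX P n j (inclX P (by linarith) U) - derivX P h j U‖ ≤
      ((n : ℝ) + 1) ^ (-(s - 1 - r)) * ‖U‖ := by
  have hm : AEStronglyMeasurable (fun ξ : Sp d => 2 * Real.pi * Complex.I * ((ξ j : ℝ) : ℂ)) volume :=
    Continuous.aestronglyMeasurable (by fun_prop)
  have hm' := (bddSym_derivSym n j).1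
  have e : ((DX P n j (inclX P (by linarith) U) - derivX P h j U : XSpace P r) : State d) =
      State.mult _ (hm'.sub hm) (U : State d) := by
    rw [Submodule.coe_sub, derivX_coe, DX, multX_coe, inclX_coe]
    refine Prod.ext ?_ (funext fun i => ?_)
    · exact (fourierMult_sub_symbol hm' hm _).symm
    · exact (fourierMult_sub_symbol hm' hm _).symm
  refine XSpace.norm_le_of_xNorm_le P _ (by positivity) ?_
  rw [e, ENNReal.ofReal_mul (by positivity), XSpace.enorm_eq]
  exact xNorm_mult_le P _ (by positivity) (.of_forall fun ξ => coordSym_sub_bound h n j ξ) _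

/-- Interpolation between `X^0` and `X^s`. -/
theorem exists_xNorm_interpolation (h0 : 0 ≤ r) (hrs : r < s) {η : ℝ} (hη : 0 < η) :
    ∃ C : ℝ, 0 ≤ C ∧ ∀ U : State d, xNorm P r U ≤
      ENNReal.ofReal η * xNorm P s U + ENNReal.ofReal C * xNorm P 0 U := by
  set A : ℝ := η ^ (-(s - r)⁻¹) with hA
  have hA0 : 0 < A := Real.rpow_pos_of_pos hη _
  have hAη : A ^ (r - s) = η := by
    have : s - r ≠ 0 := by linarith
    rw [hA, ← Real.rpow_mul hη.le, show -(s - r)⁻¹ * (r - s) = 1 by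
      rw [← neg_sub s r]; field_simp, Real.rpow_one]
  have hJm : Measurable (jb (d := d)) := continuous_jb.measurable
  have hm₁ : AEStronglyMeasurable (indicator {ξ : Sp d | jb ξ ≤ A} (1 : Sp d → ℂ)) volume :=
    aestronglyMeasurable_one.indicator (hJm measurableSet_Iic)
  have hm₂ : AEStronglyMeasurable (indicator {ξ : Sp d | jb ξ ≤ A}ᶜ (1 : Sp d → ℂ)) volume :=
    aestronglyMeasurable_one.indicator (hJm measurableSet_Iic).compl
  have hsum : ∀ f : Fn d, f = fourierMult _ hm₂ f + fourierMult _ hm₁ f := fun f => by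
    refine AEEqFun.ext ?_
    filter_upwards [coeFn_fourierMult _ hm₁ f, coeFn_fourierMult _ hm₂ f,
      AEEqFun.coeFn_add (fourierMult _ hm₂ f) (fourierMult _ hm₁ f)] with ξ h1 h2 h3
    rw [h3, Pi.add_apply, h1, h2, ← add_mul, ← Pi.add_apply, indicator_compl_add_self,
      Pi.one_apply, one_mul]
  refine ⟨A ^ r, by positivity, fun U => ?_⟩
  have e : U = State.mult _ hm₂ U + State.mult _ hm₁ U :=
    Prod.ext (hsum _) (funext fun i => hsum _)
  conv_lhs => rw [e]
  refine (xNorm_add P r _ _).trans (add_le_add ?_ ?_)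
  · refine xNorm_mult_le P hm₂ hη.le (.of_forall fun ξ => ?_) U
    have hJ := jb_pos ξ
    by_cases hξ : jb ξ ≤ A
    · rw [indicator_of_notMem (by simpa using hξ), norm_zero, zero_mul]
      positivity
    · rw [indicator_of_mem (by simpa using hξ), Pi.one_apply, norm_one, one_mul, ← hAη]
      calc jb ξ ^ r = jb ξ ^ (r - s) * jb ξ ^ s := by rw [← Real.rpow_add hJ]; simp
        _ ≤ _ := mul_le_mul_of_nonneg_right (Real.rpow_le_rpow_of_nonpos hA0 (not_le.1 hξ).le
            (by linarith)) (by positivity)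
  · refine xNorm_mult_le P hm₁ (by positivity) (.of_forall fun ξ => ?_) U
    have hJ := jb_pos ξ
    rw [Real.rpow_zero, mul_one]
    by_cases hξ : jb ξ ≤ A
    · rw [indicator_of_mem (by simpa using hξ), Pi.one_apply, norm_one, one_mul]
      exact Real.rpow_le_rpow hJ.le hξ h0
    · rw [indicator_of_notMem (by simpa using hξ), norm_zero, zero_mul]
      positivity

end unboundedDerivative

section linearized

variable {d : ℕ} (P : AdmissiblePair d) {r s : ℝ}

/-- The standing assumptions on the background state `ub`, with time derivative `bd`. -/
structure Background (s t₀ M β γ β₀ ε h L : ℝ) (ub bd : ℝ → XSpace P r) : Prop where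
  h₁ : SymbolBound P.G₁ M
  h₂ : SymbolBound P.G₂ M
  hs : (d : ℝ) / 2 + 1 < s
  hr : (d : ℝ) / 2 < r
  hrs : r + 1 < s
  ht₀ : (d : ℝ) / 2 < t₀
  hh : 0 < h
  hβ : 0 ≤ β
  hγ : 0 ≤ γ
  hε0 : 0 ≤ ε
  hε1 : ε ≤ 1
  path : PathOn L ub bd
  hub : ∀ᵐ t, t ∈ Icc 0 L → xNorm P s (ub t : State d) ≤ ENNReal.ofReal β
  hbd : ∀ᵐ t, t ∈ Icc 0 L → xNorm P t₀ (bd t : State d) ≤ ENNReal.ofReal γ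
  hnc : ∀ t ∈ Icc 0 L, ∀ x, h ≤ 1 + ε * ((ub t : State d).1.toPhys x).re
  hβ₀ : ‖bL P hr (ub 0)‖ ≤ β₀

theorem nonneg_of_half_lt {r : ℝ} (hr : (d : ℝ) / 2 < r) : 0 ≤ r :=
  (by positivity : (0 : ℝ) ≤ (d : ℝ) / 2).trans hr.le

/-- The right-hand side of the linearized system, solved for the time derivative. -/
def linRHS (hr : (d : ℝ) / 2 < r) (hrs : r + 1 ≤ s) (ε : ℝ) (ub : XSpace P r) (R u : XSpace P s) :
    XSpace P r :=
  ε • inclX P (by linarith) R - ∑ j, AX P hr ε j ub (derivX P hrs j u)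

/-- On `[0, L]`, the bounded function `u` with values in `X^s` solves the linearized system. -/
structure LinSol (hr : (d : ℝ) / 2 < r) (hrs : r + 1 < s) (ε L : ℝ) (ub : ℝ → XSpace P r)
    (R u : ℝ → XSpace P s) : Prop where
  bound : ∃ B : ℝ, ∀ t ∈ Icc 0 L, ‖u t‖ ≤ B
  path : PathOn L (fun t => inclX P (by linarith : r ≤ s) (u t))
    fun t => linRHS P hr hrs.le ε (ub t) (R t) (u t)

variable {P} {t₀ M β γ β₀ ε h L : ℝ} {ub bd : ℝ → XSpace P r}

theorem exists_norm_AX_le (P : AdmissiblePair d) (hr : (d : ℝ) / 2 < r) (ε C : ℝ) :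
    ∃ K : ℝ, 0 ≤ K ∧ ∀ b : XSpace P r, ‖b‖ ≤ C → ∀ (W : Fin d → XSpace P r) (y : ℝ),
      (∀ j, ‖W j‖ ≤ y) → ‖∑ j, AX P hr ε j b (W j)‖ ≤ K * y := by
  refine ⟨∑ j, (‖linX P r j‖ + |ε| * (‖bilX P hr j‖ * max C 0)), by positivity,
    fun b hb W y hW => ?_⟩
  rw [Finset.sum_mul]
  refine (norm_sum_le _ _).trans (Finset.sum_le_sum fun j _ => ?_)
  have h1 : ‖AX P hr ε j b‖ ≤ ‖linX P r j‖ + |ε| * (‖bilX P hr j‖ * max C 0) := by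
    refine (norm_add_le _ _).trans (add_le_add le_rfl ?_)
    rw [norm_smul, Real.norm_eq_abs]
    refine mul_le_mul_of_nonneg_left (((bilX P hr j).le_opNorm _).trans ?_) (abs_nonneg _)
    exact mul_le_mul_of_nonneg_left (hb.trans (le_max_left _ _)) (norm_nonneg _)
  exact ((AX P hr ε j b).le_opNorm _).trans (mul_le_mul h1 (hW j) (norm_nonneg _)
    (by positivity))

theorem Background.exists_norm_AX_le (B : Background P s t₀ M β γ β₀ ε h L ub bd) :
    ∃ K : ℝ, 0 ≤ K ∧ ∀ t ∈ Icc 0 L, ∀ (W : Fin d → XSpace P r) (y : ℝ), (∀ j, ‖W j‖ ≤ y) →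
      ‖∑ j, AX P B.hr ε j (ub t) (W j)‖ ≤ K * y := by
  obtain ⟨C, hC⟩ :=
    (isCompact_Icc.image_of_continuousOn B.path.continuousOn).isBounded.exists_norm_le
  obtain ⟨K, hK0, hK⟩ := _root_.exists_norm_AX_le P B.hr ε C
  exact ⟨K, hK0, fun t ht => hK _ (hC _ (mem_image_of_mem _ ht))⟩

theorem xNorm_inclX {r' : ℝ} (hr : r ≤ r') (σ : ℝ) (U : XSpace P r') :
    xNorm P σ (inclX P hr U : State d) = xNorm P σ (U : State d) := by rw [inclX_coe]

theorem norm_wzH_inclX_le (h0 : 0 ≤ r) (hrs : r ≤ s) (k : ℕ) (U : XSpace P s) :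
    ‖wzH P h0 s k (inclX P hrs U)‖ ≤ ‖U‖ :=
  norm_multOp_wt_le (norm_nonneg _) k ((hsNorm_zH_le P h0 s _).trans (by
    rw [xNorm_inclX, XSpace.enorm_eq]))

theorem norm_wvH_inclX_le (h0 : 0 ≤ r) (hrs : r ≤ s) (k : ℕ) (i : Fin d) (U : XSpace P s) :
    ‖wvH P h0 s k i (inclX P hrs U)‖ ≤ ‖U‖ :=
  norm_multOp_wt_le (norm_nonneg _) k ((hsNorm_vH_le P h0 s i _).trans (by
    rw [xNorm_inclX, XSpace.enorm_eq]))

theorem tendsto_add_one_rpow_neg {θ : ℝ} (hθ : 0 < θ) :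
    Filter.Tendsto (fun n : ℕ => ((n : ℝ) + 1) ^ (-θ)) Filter.atTop (nhds 0) :=
  (tendsto_rpow_neg_atTop hθ).comp
    (Filter.tendsto_atTop_add_const_right _ 1 tendsto_natCast_atTop_atTop)

/-- A solution satisfies the equations with truncated derivatives, up to a small error. -/
theorem LinSol.exists_truncation (B : Background P s t₀ M β γ β₀ ε h L ub bd)
    {R u : ℝ → XSpace P s} (S : LinSol P B.hr B.hrs ε L ub R u) :
    ∃ (f : ℕ → ℕ → ℝ) (ρ : ℕ → ℝ → XSpace P r), (∀ k l, 0 ≤ f k l) ∧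
      (∀ k, Filter.Tendsto (f k) Filter.atTop (nhds 0)) ∧
      (∀ l, ∀ᵐ t, t ∈ Icc 0 L → linRHS P B.hr B.hrs.le ε (ub t) (R t) (u t) = ρ l t -
        ∑ j, AX P B.hr ε j (ub t) (DX P l j (inclX P (by linarith [B.hrs]) (u t)))) ∧
      ∀ k l, ∀ᵐ t, t ∈ Icc 0 L →
        ‖wzH P (nonneg_of_half_lt B.hr) s k (ρ l t)‖ ≤ ε * ‖R t‖ + f k l ∧
        ∀ i, ‖wvH P (nonneg_of_half_lt B.hr) s k i (ρ l t)‖ ≤ ε * ‖R t‖ + f k l := by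
  have hrs : r ≤ s := by linarith [B.hrs]
  have h0 := nonneg_of_half_lt B.hr
  obtain ⟨K, hK0, hK⟩ := B.exists_norm_AX_le
  obtain ⟨Bd, hBd⟩ := S.bound
  have hBd0 : 0 ≤ Bd := (norm_nonneg _).trans (hBd 0 ⟨le_rfl, B.path.nonneg⟩)
  set e : ℕ → ℝ → XSpace P r := fun l t => ∑ j, AX P B.hr ε j (ub t)
    (DX P l j (inclX P hrs (u t)) - derivX P B.hrs.le j (u t)) with he
  have hbound : ∀ l, ∀ t ∈ Icc 0 L, ‖e l t‖ ≤ K * (((l : ℝ) + 1) ^ (-(s - 1 - r)) * Bd) :=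
    fun l t ht => hK t ht _ _ fun j => (norm_DX_sub_derivX_le P B.hrs.le l j (u t)).trans
      (mul_le_mul_of_nonneg_left (hBd t ht) (by positivity))
  refine ⟨fun k l => (‖wzH P h0 s k‖ + ∑ i, ‖wvH P h0 s k i‖) *
    (K * (((l : ℝ) + 1) ^ (-(s - 1 - r)) * Bd)), fun l t => ε • inclX P hrs (R t) + e l t,
    fun k l => by positivity, fun k => ?_, fun l => .of_forall fun t _ => ?_,
    fun k l => .of_forall fun t ht => ⟨?_, fun i => ?_⟩⟩
  · have := ((tendsto_add_one_rpow_neg (θ := s - 1 - r) (by linarith [B.hrs])).mul_const Bd).const_mul K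
    simpa using this.const_mul (‖wzH P h0 s k‖ + ∑ i, ‖wvH P h0 s k i‖)
  · simp only [he, linRHS, map_sub, Finset.sum_sub_distrib]
    abel
  · rw [map_add, map_smul]
    refine (norm_add_le _ _).trans (add_le_add ?_ (((wzH P h0 s k).le_opNorm _).trans ?_))
    · rw [norm_smul, Real.norm_of_nonneg B.hε0]
      exact mul_le_mul_of_nonneg_left (norm_wzH_inclX_le h0 hrs k (R t)) B.hε0
    · exact mul_le_mul (le_add_of_nonneg_right (by positivity)) (hbound l t ht) (norm_nonneg _)
        (by positivity)
  · rw [map_add, map_smul]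
    refine (norm_add_le _ _).trans (add_le_add ?_ (((wvH P h0 s k i).le_opNorm _).trans ?_))
    · rw [norm_smul, Real.norm_of_nonneg B.hε0]
      exact mul_le_mul_of_nonneg_left (norm_wvH_inclX_le h0 hrs k i (R t)) B.hε0
    · refine mul_le_mul ?_ (hbound l t ht) (norm_nonneg _) (by positivity)
      exact (Finset.single_le_sum (f := fun i => ‖wvH P h0 s k i‖) (fun i _ => norm_nonneg _)
        (Finset.mem_univ i)).trans (le_add_of_nonneg_left (norm_nonneg _))

/-- The energy estimate in `X^s` for solutions of the linearized system. -/
theorem LinSol.norm_le (B : Background P s t₀ M β γ β₀ ε h L ub bd) {R u : ℝ → XSpace P s}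
    (S : LinSol P B.hr B.hrs ε L ub R u) (hR : IntervalIntegrable (fun t => ‖R t‖) volume 0 L)
    {t : ℝ} (ht : t ∈ Icc 0 L) :
    ‖u t‖ ≤ Real.exp (ε * ((d + 1) ^ 2 * energyRate d s t₀ M β γ * (min 1 h)⁻¹) * t) *
        (√(2 * ((d + 1) ^ 3 * (1 + β₀) * (min 1 h)⁻¹ * ‖u 0‖ ^ 2)) +
          2 * ((d + 1) ^ 2 * energyRate d s t₀ M β γ * (min 1 h)⁻¹) *
            ∫ τ in (0 : ℝ)..t, ε * ‖R τ‖) := by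
  obtain ⟨f, ρ, hf0, hf, hv, hρ⟩ := LinSol.exists_truncation B S
  obtain ⟨Bd, hBd⟩ := S.bound
  have key := energy_bound P B.h₁ B.h₂ B.hs B.hr (nonneg_of_half_lt B.hr) B.ht₀ (.inr rfl) B.hh B.hβ
    B.hγ B.hε0 B.hε1 B.path S.path B.hub B.hbd B.hnc B.hβ₀
    (fun t => mul_nonneg B.hε0 (norm_nonneg (R t))) (hR.const_mul ε) (B := Bd)
    (fun t ht => by
      rw [xNorm_inclX, ← XSpace.enorm_eq]
      exact ENNReal.ofReal_le_ofReal (hBd t ht)) (norm_nonneg (u 0))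
    (by rw [xNorm_inclX, XSpace.enorm_eq]) id ρ f hf0 hf hv hρ ht
  rwa [xNorm_inclX, ← XSpace.norm_def] at key

theorem PathOn.sub {Y : Type*} [NormedAddCommGroup Y] [NormedSpace ℝ Y] {u v u' v' : ℝ → Y}
    (p : PathOn L u v) (p' : PathOn L u' v') :
    PathOn L (fun t => u t - u' t) fun t => v t - v' t := by
  obtain ⟨K, hK⟩ := p.bound
  obtain ⟨K', hK'⟩ := p'.bound
  refine ⟨p.nonneg, p.integrable.sub p'.integrable, ⟨K + K', ?_⟩, fun t ht => ?_⟩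
  · filter_upwards [hK, hK'] with t h1 h2 ht
    exact (norm_sub_le _ _).trans (add_le_add (h1 ht) (h2 ht))
  · have h0 : (0 : ℝ) ∈ Icc 0 L := ⟨le_rfl, p.nonneg⟩
    rw [intervalIntegral.integral_sub (p.integrable_sub h0 ht) (p'.integrable_sub h0 ht),
      p.eq t ht, p'.eq t ht]
    abel

theorem LinSol.sub {hr : (d : ℝ) / 2 < r} {hrs : r + 1 < s} {R u u' : ℝ → XSpace P s}
    (S : LinSol P hr hrs ε L ub R u) (S' : LinSol P hr hrs ε L ub R u') :
    LinSol P hr hrs ε L ub (fun _ => 0) fun t => u t - u' t := by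
  have e : ∀ t, linRHS P hr hrs.le ε (ub t) 0 (u t - u' t) = linRHS P hr hrs.le ε (ub t) (R t) (u t) -
      linRHS P hr hrs.le ε (ub t) (R t) (u' t) := fun t => by
    simp only [linRHS, map_sub, map_zero, smul_zero, Finset.sum_sub_distrib]
    abel
  obtain ⟨B, hB⟩ := S.bound
  obtain ⟨B', hB'⟩ := S'.bound
  refine ⟨⟨B + B', fun t ht => (norm_sub_le _ _).trans (add_le_add (hB t ht) (hB' t ht))⟩, ?_⟩
  simp only [e, map_sub]
  exact S.path.sub S'.path

theorem LinSol.eq_of_eq_zero (B : Background P s t₀ M β γ β₀ ε h L ub bd)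
    {R u u' : ℝ → XSpace P s} (S : LinSol P B.hr B.hrs ε L ub R u)
    (S' : LinSol P B.hr B.hrs ε L ub R u') (h0 : u 0 = u' 0) {t : ℝ} (ht : t ∈ Icc 0 L) :
    u t = u' t := by
  have key := LinSol.norm_le B (S.sub S') (by simp) ht
  simpa [h0, sub_eq_zero] using key

/-- The truncated energies of a solution are Lipschitz continuous in time, uniformly with respect to
the truncation. -/
theorem LinSol.exists_energy_lipschitz (B : Background P s t₀ M β γ β₀ ε h L ub bd)
    {R u : ℝ → XSpace P s} (S : LinSol P B.hr B.hrs ε L ub R u) {C : ℝ} (hC : ∀ t, ‖R t‖ ≤ C) :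
    ∃ K : ℝ, ∀ k : ℕ, 1 ≤ k → ∀ t ∈ Icc 0 L, ∀ τ ∈ Icc 0 L,
      |energyX P B.hr (nonneg_of_half_lt B.hr) s k ε (ub t) (inclX P (by linarith [B.hrs]) (u t)) -
        energyX P B.hr (nonneg_of_half_lt B.hr) s k ε (ub τ)
          (inclX P (by linarith [B.hrs]) (u τ))| ≤ K * |t - τ| := by
  obtain ⟨f, ρ, hf0, hf, hv, hρ⟩ := LinSol.exists_truncation B S
  obtain ⟨Bd, hBd⟩ := S.bound
  have hBd0 : 0 ≤ Bd := (norm_nonneg _).trans (hBd 0 ⟨le_rfl, B.path.nonneg⟩)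
  have hC0 : 0 ≤ C := (norm_nonneg _).trans (hC 0)
  have hε := B.hε0
  refine ⟨energyRate d s t₀ M β γ * (ε * Bd ^ 2 + Bd * (ε * C)), fun k hk t ht τ hτ => ?_⟩
  have h1 : Filter.Tendsto (fun l => energyRate d s t₀ M β γ * (ε * Bd ^ 2 +
      Bd * (ε * C + f k l)) * |t - τ|) Filter.atTop
      (nhds (energyRate d s t₀ M β γ * (ε * Bd ^ 2 + Bd * (ε * C)) * |t - τ|)) := by
    simpa using (((((hf k).const_add (ε * C)).const_mul Bd).const_add (ε * Bd ^ 2)).const_mul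
      (energyRate d s t₀ M β γ)).mul_const |t - τ|
  refine ge_of_tendsto' h1 fun l => ?_
  refine abs_weighted_energy_sub_le P B.h₁ B.h₂ B.hs B.hr (nonneg_of_half_lt B.hr) B.ht₀ (.inr rfl)
    hk l B.hβ B.hγ B.hε0 B.hε1 B.path S.path B.hub B.hbd hBd0
    (add_nonneg (mul_nonneg hε hC0) (hf0 k l)) (fun t ht => ?_) (hv l) ?_ ht hτ
  · rw [xNorm_inclX, ← XSpace.enorm_eq]
    exact ENNReal.ofReal_le_ofReal (hBd t ht)
  · filter_upwards [hρ k l] with t h2 ht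
    have h3 : ε * ‖R t‖ + f k l ≤ ε * C + f k l :=
      add_le_add (mul_le_mul_of_nonneg_left (hC t) hε) le_rfl
    exact ⟨(h2 ht).1.trans h3, fun i => ((h2 ht).2 i).trans h3⟩

end linearized

section existence

variable {d : ℕ} {P : AdmissiblePair d} {r s : ℝ}

theorem PathOn.of_tendsto {Y : Type*} [NormedAddCommGroup Y] [NormedSpace ℝ Y] {L K : ℝ}
    {u v : ℕ → ℝ → Y} {u' v' : ℝ → Y} (h : ∀ n, PathOn L (u n) (v n))
    (hK : ∀ n, ∀ᵐ t, t ∈ Icc 0 L → ‖v n t‖ ≤ K)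
    (hu : ∀ t ∈ Icc 0 L, Filter.Tendsto (fun n => u n t) Filter.atTop (nhds (u' t)))
    (hv : ∀ᵐ t, t ∈ Icc 0 L → Filter.Tendsto (fun n => v n t) Filter.atTop (nhds (v' t))) :
    PathOn L u' v' := by
  have hL := (h 0).nonneg
  have hb : ∀ᵐ t, t ∈ Icc 0 L → ‖v' t‖ ≤ K := by
    filter_upwards [hv, ae_all_iff.2 hK] with t h1 h2 ht
    exact le_of_tendsto' (h1 ht).norm fun n => h2 n ht
  have hsub : ∀ t ∈ Icc 0 L, uIoc 0 t ⊆ Icc 0 L := fun t ht => by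
    rw [uIoc_of_le ht.1]
    exact Ioc_subset_Icc_self.trans (Icc_subset_Icc_right ht.2)
  have hLmem : L ∈ Icc 0 L := ⟨hL, le_rfl⟩
  have hm : AEStronglyMeasurable v' (volume.restrict (uIoc 0 L)) := by
    refine aestronglyMeasurable_of_tendsto_ae Filter.atTop
      (fun n => (intervalIntegrable_iff.1 (h n).integrable).aestronglyMeasurable) ?_
    rw [ae_restrict_iff' measurableSet_uIoc]
    exact hv.mono fun t h1 ht => h1 (hsub L hLmem ht)
  refine ⟨hL, ?_, ⟨K, hb⟩, fun t ht => ?_⟩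
  · refine (intervalIntegrable_const (c := K)).mono_fun hm ?_
    rw [Filter.EventuallyLE, ae_restrict_iff' measurableSet_uIoc]
    exact hb.mono fun t h1 ht => (h1 (hsub L hLmem ht)).trans (le_abs_self K)
  · have h1 : Filter.Tendsto (fun n => ∫ τ in (0 : ℝ)..t, v n τ) Filter.atTop
        (nhds (∫ τ in (0 : ℝ)..t, v' τ)) := by
      refine intervalIntegral.tendsto_integral_filter_of_dominated_convergence (fun _ => K)
        (.of_forall fun n => (intervalIntegrable_iff.1
          ((h n).integrable_sub ⟨le_rfl, hL⟩ ht)).aestronglyMeasurable)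
        (.of_forall fun n => (hK n).mono fun τ h1 hτ => h1 (hsub t ht hτ)) intervalIntegrable_const
        (hv.mono fun τ h1 hτ => h1 (hsub t ht hτ))
    refine tendsto_nhds_unique (hu t ht) (((hu 0 ⟨le_rfl, hL⟩).add h1).congr fun n => ?_)
    exact ((h n).eq t ht).symm

theorem PathOn.congr_deriv {Y : Type*} [NormedAddCommGroup Y] [NormedSpace ℝ Y] {L : ℝ}
    {u v v' : ℝ → Y} (h : PathOn L u v) (hv : ∀ᵐ t, t ∈ Icc 0 L → v t = v' t) : PathOn L u v' := by
  have hsub : ∀ t ∈ Icc 0 L, uIoc 0 t ⊆ Icc 0 L := fun t ht => by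
    rw [uIoc_of_le ht.1]
    exact Ioc_subset_Icc_self.trans (Icc_subset_Icc_right ht.2)
  refine ⟨h.nonneg, h.integrable.congr_ae ?_, ?_, fun t ht => ?_⟩
  · rw [Filter.EventuallyEq, ae_restrict_iff' measurableSet_uIoc]
    exact hv.mono fun t h1 ht => h1 (hsub L ⟨h.nonneg, le_rfl⟩ ht)
  · obtain ⟨K, hK⟩ := h.bound
    refine ⟨K, ?_⟩
    filter_upwards [hK, hv] with t h1 h2 ht
    rw [← h2 ht]
    exact h1 ht
  · rw [h.eq t ht, intervalIntegral.integral_congr_ae (hv.mono fun τ h1 hτ => h1 (hsub t ht hτ))]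

theorem inclX_AX {r' : ℝ} (h : r ≤ r') (hr : (d : ℝ) / 2 < r) (hr' : (d : ℝ) / 2 < r') (ε : ℝ)
    (j : Fin d) (b W : XSpace P r') :
    inclX P h (AX P hr' ε j b W) = AX P hr ε j (inclX P h b) (inclX P h W) := by
  refine Subtype.ext ?_
  rw [inclX_coe, AX_coe, AX_coe, inclX_coe, inclX_coe]

theorem inclX_DX {r' : ℝ} (h : r ≤ r') (n : ℕ) (j : Fin d) (W : XSpace P r') :
    inclX P h (DX P n j W) = DX P n j (inclX P h W) := by
  refine Subtype.ext ?_
  rw [inclX_coe, DX, multX_coe, DX, multX_coe, inclX_coe]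

theorem derivX_eq_comp_inclX (hrs : r + 1 ≤ s) (j : Fin d) (W : XSpace P s) :
    derivX P hrs j W = derivX P (r := r) (le_refl _) j (inclX P hrs W) := by
  refine Subtype.ext ?_
  rw [derivX_coe, derivX_coe, inclX_coe]

/-- On bounded sets of `X^s`, the topologies of `X^r` and `X^0` coincide for `r < s`. -/
theorem tendsto_inclX_of_bounded (h0 : 0 ≤ r) (hrs : r < s) (hs : 0 ≤ s) {α : Type*} {l : Filter α}
    {W : α → XSpace P s} {B : ℝ} (hB : ∀ᶠ a in l, ‖W a‖ ≤ B)
    (hW : Filter.Tendsto (fun a => inclX P hs (W a)) l (nhds 0)) :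
    Filter.Tendsto (fun a => inclX P hrs.le (W a)) l (nhds 0) := by
  rw [Metric.tendsto_nhds]
  intro δ hδ
  have hB1 : 0 < |B| + 1 := by positivity
  obtain ⟨C, hC0, hC⟩ := exists_xNorm_interpolation P h0 hrs (η := δ / 2 / (|B| + 1)) (by positivity)
  have h1 := (Metric.tendsto_nhds.1 hW) (δ / 2 / (C + 1)) (by positivity)
  filter_upwards [hB, h1] with a h2 h3
  rw [dist_zero_right] at h3 ⊢
  have h4 : ‖inclX P hrs.le (W a)‖ ≤ δ / 2 / (|B| + 1) * ‖W a‖ + C * ‖inclX P hs (W a)‖ := by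
    refine XSpace.norm_le_of_xNorm_le P _ (by positivity) ?_
    rw [ENNReal.ofReal_add (by positivity) (by positivity), ENNReal.ofReal_mul (by positivity),
      ENNReal.ofReal_mul hC0, XSpace.enorm_eq, XSpace.enorm_eq, inclX_coe, inclX_coe]
    exact hC _
  have h5 : δ / 2 / (|B| + 1) * ‖W a‖ ≤ δ / 2 := by
    rw [div_mul_eq_mul_div, div_le_iff₀ hB1]
    exact mul_le_mul_of_nonneg_left (h2.trans ((le_abs_self B).trans (by linarith))) (by positivity)
  have h6 : C * ‖inclX P hs (W a)‖ < δ / 2 := by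
    rw [lt_div_iff₀ (by positivity)] at h3
    nlinarith [norm_nonneg (inclX P hs (W a))]
  linarith

variable {t₀ M β γ β₀ ε h L : ℝ} {ub bd : ℝ → XSpace P r}

theorem stronglyMeasurable_clm₂ {X Y Z : Type*} [NormedAddCommGroup X] [NormedSpace ℝ X]
    [NormedAddCommGroup Y] [NormedSpace ℝ Y] [NormedAddCommGroup Z] [NormedSpace ℝ Z]
    (T : X →L[ℝ] Y →L[ℝ] Z) {f : ℝ → X} {g : ℝ → Y} (hf : StronglyMeasurable f)
    (hg : StronglyMeasurable g) : StronglyMeasurable fun t => T (f t) (g t) :=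
  T.continuous₂.comp_stronglyMeasurable (hf.prodMk hg)

theorem stronglyMeasurable_AX (hr : (d : ℝ) / 2 < r) (ε : ℝ) (j : Fin d) {b w : ℝ → XSpace P r}
    (hb : StronglyMeasurable b) (hw : Continuous w) :
    StronglyMeasurable fun t => AX P hr ε j (b t) (w t) := by
  have h2 : StronglyMeasurable fun t => bilX P hr j (b t) (w t) :=
    stronglyMeasurable_clm₂ (bilX P hr j) hb hw.stronglyMeasurable
  have h3 : StronglyMeasurable fun t => linX P r j (w t) :=
    ((linX P r j).continuous.comp hw).stronglyMeasurable
  have e : (fun t => AX P hr ε j (b t) (w t)) =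
      (fun t => linX P r j (w t)) + ε • fun t => bilX P hr j (b t) (w t) := by
    funext t
    rw [AX, add_apply, smul_apply, Pi.add_apply, Pi.smul_apply]
  rw [e]
  exact h3.add (h2.const_smul ε)

/-- The solution of the system with truncated derivatives. -/
theorem exists_truncated_solution (B : Background P s t₀ M β γ β₀ ε h L ub bd)
    {us R : ℝ → XSpace P s} (hus : StronglyMeasurable us) {Cu : ℝ} (hCu : ∀ t, ‖us t‖ ≤ Cu)
    (hub : ∀ᵐ t, t ∈ Icc 0 L → inclX P (by linarith [B.hrs]) (us t) = ub t)
    (hR : StronglyMeasurable R) {CR : ℝ} (hCR : ∀ t, ‖R t‖ ≤ CR) (U₀ : XSpace P s) (n : ℕ) :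
    ∃ u : ℝ → XSpace P s, ContinuousOn u (Icc 0 L) ∧ u 0 = U₀ ∧
      PathOn L (fun t => inclX P (by linarith [B.hrs] : r ≤ s) (u t)) fun t =>
        ε • inclX P (by linarith [B.hrs]) (R t) -
          ∑ j, AX P B.hr ε j (ub t) (DX P n j (inclX P (by linarith [B.hrs]) (u t))) := by
  have hrs : r ≤ s := by linarith [B.hrs]
  have hs : (d : ℝ) / 2 < s := by linarith [B.hs]
  obtain ⟨K, hK0, hK⟩ := exists_norm_AX_le P hs ε Cu
  have hD : ∀ (y : XSpace P s) j, ‖DX P n j y‖ ≤ (∑ j, ‖DX P (r := s) n j‖) * ‖y‖ := fun y j =>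
    ((DX P n j).le_opNorm y).trans (mul_le_mul_of_nonneg_right
      (Finset.single_le_sum (f := fun j => ‖DX P (r := s) n j‖) (fun i _ => norm_nonneg _)
        (Finset.mem_univ j)) (norm_nonneg y))
  set F : ℝ → XSpace P s → XSpace P s := fun t y =>
    ε • R t - ∑ j, AX P hs ε j (us t) (DX P n j y) with hF
  have hm : ∀ u : ℝ → XSpace P s, Continuous u → StronglyMeasurable fun t => F t (u t) := by
    intro u hu
    refine (hR.const_smul ε).sub (Finset.stronglyMeasurable_fun_sum _ fun j _ => ?_)
    have h1 : Continuous fun t => DX P n j (u t) := (DX P n j).continuous.comp hu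
    exact stronglyMeasurable_AX hs ε j hus h1
  have hLip : ∀ t y z, ‖F t y - F t z‖ ≤ K * (∑ j, ‖DX P (r := s) n j‖) * ‖y - z‖ := by
    intro t y z
    have e : F t y - F t z = -∑ j, AX P hs ε j (us t) (DX P n j (y - z)) := by
      simp only [hF, map_sub, Finset.sum_sub_distrib]
      abel
    rw [e, norm_neg, mul_assoc]
    exact hK _ (hCu t) _ _ (hD (y - z))
  have hF0 : ∀ t, ‖F t 0‖ ≤ |ε| * CR := fun t => by
    simp only [hF, map_zero, Finset.sum_const_zero, sub_zero, norm_smul, Real.norm_eq_abs]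
    exact mul_le_mul_of_nonneg_left (hCR t) (abs_nonneg ε)
  obtain ⟨u, huc, hu⟩ := exists_integral_curve B.path.nonneg (by positivity) hLip hF0
    (fun u hu => (hm u hu).aestronglyMeasurable) U₀
  have hL := B.path.nonneg
  have hu0 : u 0 = U₀ := by simpa using hu 0 ⟨le_rfl, hL⟩
  refine ⟨u, huc.continuousOn, hu0, ?_⟩
  obtain ⟨Bd, hBd⟩ := (isCompact_Icc.image_of_continuousOn
    (huc.continuousOn (s := Icc 0 L))).isBounded.exists_norm_le
  have hFb : ∀ t ∈ Icc 0 L, ‖F t (u t)‖ ≤ K * (∑ j, ‖DX P (r := s) n j‖) * Bd + |ε| * CR := by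
    intro t ht
    have h1 := hLip t (u t) 0
    have h2 := norm_add_le (F t (u t) - F t 0) (F t 0)
    rw [sub_add_cancel] at h2
    rw [sub_zero] at h1
    have h3 : K * (∑ j, ‖DX P (r := s) n j‖) * ‖u t‖ ≤ K * (∑ j, ‖DX P (r := s) n j‖) * Bd :=
      mul_le_mul_of_nonneg_left (hBd _ (mem_image_of_mem _ ht)) (by positivity)
    linarith [hF0 t]
  have p : PathOn L u fun t => F t (u t) := by
    refine ⟨hL, ?_, ⟨_, .of_forall hFb⟩, fun t ht => by rw [hu t ht, hu0]⟩
    refine (intervalIntegrable_const (c := K * (∑ j, ‖DX P (r := s) n j‖) * Bd + |ε| * CR)).mono_fun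
      (hm u huc).aestronglyMeasurable ?_
    rw [Filter.EventuallyLE, ae_restrict_iff' measurableSet_uIoc]
    refine .of_forall fun t ht => (hFb t ?_).trans (le_abs_self _)
    rw [uIoc_of_le hL] at ht
    exact Ioc_subset_Icc_self ht
  refine (p.map (inclX P hrs)).congr_deriv ?_
  filter_upwards [hub] with t ht htL
  simp only [hF, map_sub, map_smul, map_sum, inclX_AX hrs B.hr hs, inclX_DX, ht htL]

end existence

section existence

variable {d : ℕ} {P : AdmissiblePair d} {r s : ℝ}

theorem norm_wzH_zero_le (h0 : 0 ≤ r) (k : ℕ) (x : XSpace P r) : ‖wzH P h0 0 k x‖ ≤ ‖x‖ :=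
  norm_multOp_wt_le (norm_nonneg _) k ((hsNorm_zH_le P h0 0 _).trans (by
    rw [XSpace.enorm_eq]; exact xNorm_mono P h0 _))

theorem norm_wvH_zero_le (h0 : 0 ≤ r) (k : ℕ) (i : Fin d) (x : XSpace P r) :
    ‖wvH P h0 0 k i x‖ ≤ ‖x‖ :=
  norm_multOp_wt_le (norm_nonneg _) k ((hsNorm_vH_le P h0 0 i _).trans (by
    rw [XSpace.enorm_eq]; exact xNorm_mono P h0 _))

/-- Bounded sets of `X^s` are closed in `X^0`. -/
theorem exists_inclX_eq_of_tendsto (hs : 0 ≤ s) {W : ℕ → XSpace P s} {G : ℝ}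
    (hG : ∀ n, ‖W n‖ ≤ G) {w : XSpace P 0}
    (hw : Filter.Tendsto (fun n => inclX P hs (W n)) Filter.atTop (nhds w)) :
    ∃ W' : XSpace P s, inclX P hs W' = w ∧ ‖W'‖ ≤ (d + 1) * G := by
  have hG0 : 0 ≤ G := (norm_nonneg _).trans (hG 0)
  have h1 : xNorm P s (w : State d) ≤ ENNReal.ofReal ((d + 1) * G) :=
    xNorm_le_of_wt P le_rfl hG0
      (fun k _ => le_of_tendsto' (((wzH P le_rfl s k).continuous.tendsto w).comp hw).norm
        fun n => (norm_wzH_inclX_le le_rfl hs k (W n)).trans (hG n))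
      (fun k i _ => le_of_tendsto' (((wvH P le_rfl s k i).continuous.tendsto w).comp hw).norm
        fun n => (norm_wvH_inclX_le le_rfl hs k i (W n)).trans (hG n))
  refine ⟨⟨w, (XSpace.mem_iff P).2 ⟨XSpace.isReal_fst P w, XSpace.isReal_snd P w,
    h1.trans_lt ENNReal.ofReal_lt_top⟩⟩, Subtype.ext ?_,
    XSpace.norm_le_of_xNorm_le P _ (by positivity) h1⟩
  rw [inclX_coe]

theorem integral_le_of_norm_le_const {f : ℝ → ℝ} {C L t : ℝ} (hC : 0 ≤ C) (hf : ∀ τ, ‖f τ‖ ≤ C)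
    (ht : t ∈ Icc 0 L) : ∫ τ in (0 : ℝ)..t, f τ ≤ C * L := by
  refine (le_abs_self _).trans ((intervalIntegral.norm_integral_le_of_norm_le_const
    fun τ _ => hf τ).trans ?_)
  rw [sub_zero, abs_of_nonneg ht.1]
  exact mul_le_mul_of_nonneg_left ht.2 hC

variable {t₀ M β γ β₀ ε h L : ℝ} {ub bd : ℝ → XSpace P r}

theorem Background.rate_nonneg (B : Background P s t₀ M β γ β₀ ε h L ub bd) :
    0 ≤ (d + 1) ^ 2 * energyRate d s t₀ M β γ * (min 1 h)⁻¹ := by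
  have hs : 0 ≤ s := nonneg_of_half_lt (by linarith [B.hs] : (d : ℝ) / 2 < s)
  have := energyRate_nonneg (d := d) (t₀ := t₀) hs B.h₁.nonneg B.hβ B.hγ
  have := lt_min one_pos B.hh
  positivity

/-- Solutions of the systems with truncated derivatives are bounded in `X^s`, uniformly with respect
to the truncation. -/
theorem exists_truncated_bound (B : Background P s t₀ M β γ β₀ ε h L ub bd)
    {R : ℝ → XSpace P s} (hR : StronglyMeasurable R) {CR : ℝ} (hCR : ∀ t, ‖R t‖ ≤ CR)
    (U₀ : XSpace P s) : ∃ G : ℝ, 0 ≤ G ∧ ∀ (n : ℕ) (u : ℝ → XSpace P s),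
      ContinuousOn u (Icc 0 L) → u 0 = U₀ →
      PathOn L (fun t => inclX P (by linarith [B.hrs] : r ≤ s) (u t)) (fun t =>
        ε • inclX P (by linarith [B.hrs]) (R t) -
          ∑ j, AX P B.hr ε j (ub t) (DX P n j (inclX P (by linarith [B.hrs]) (u t)))) →
      ∀ t ∈ Icc 0 L, ‖u t‖ ≤ G := by
  have hrs : r ≤ s := by linarith [B.hrs]
  have h0 := nonneg_of_half_lt B.hr
  have hΛ := B.rate_nonneg
  have hε := B.hε0
  have hL := B.path.nonneg
  set Λ := (d + 1) ^ 2 * energyRate d s t₀ M β γ * (min 1 h)⁻¹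
  set a := √(2 * ((d + 1) ^ 3 * (1 + β₀) * (min 1 h)⁻¹ * ‖U₀‖ ^ 2))
  have hCR0 : 0 ≤ CR := (norm_nonneg _).trans (hCR 0)
  refine ⟨Real.exp (ε * Λ * L) * (a + 2 * Λ * (ε * CR * L)), by positivity,
    fun n u huc hu0 pu t ht => ?_⟩
  obtain ⟨Bd, hBd⟩ := (isCompact_Icc.image_of_continuousOn huc).isBounded.exists_norm_le
  have hRi : IntervalIntegrable (fun t => ε * ‖R t‖) volume 0 L :=
    (intervalIntegrable_const (c := ε * CR)).mono_fun
      (hR.norm.const_mul ε).aestronglyMeasurable (.of_forall fun t => by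
        change ‖ε * ‖R t‖‖ ≤ ‖ε * CR‖
        rw [norm_mul, norm_mul, norm_norm, Real.norm_of_nonneg hCR0]
        exact mul_le_mul_of_nonneg_left (hCR t) (norm_nonneg _))
  have key := energy_bound P B.h₁ B.h₂ B.hs B.hr h0 B.ht₀ (.inr rfl) B.hh B.hβ
    B.hγ B.hε0 B.hε1 B.path pu B.hub B.hbd B.hnc B.hβ₀
    (fun t => mul_nonneg B.hε0 (norm_nonneg (R t))) hRi (B := Bd)
    (fun t ht => by
      rw [xNorm_inclX, ← XSpace.enorm_eq]
      exact ENNReal.ofReal_le_ofReal (hBd _ (mem_image_of_mem _ ht))) (norm_nonneg U₀)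
    (by rw [xNorm_inclX, XSpace.enorm_eq, hu0]) (fun _ => n)
    (fun _ t => ε • inclX P hrs (R t)) (fun _ _ => 0) (fun _ _ => le_rfl)
    (fun _ => tendsto_const_nhds) (fun _ => .of_forall fun t _ => rfl)
    (fun k _ => .of_forall fun t _ => by
      rw [map_smul, norm_smul, Real.norm_of_nonneg hε, add_zero]
      refine ⟨mul_le_mul_of_nonneg_left (norm_wzH_inclX_le h0 hrs k (R t)) hε, fun i => ?_⟩
      rw [map_smul, norm_smul, Real.norm_of_nonneg hε]
      exact mul_le_mul_of_nonneg_left (norm_wvH_inclX_le h0 hrs k i (R t)) hε) ht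
  rw [xNorm_inclX, ← XSpace.norm_def] at key
  have hI : ∫ τ in (0 : ℝ)..t, ε * ‖R τ‖ ≤ ε * CR * L :=
    integral_le_of_norm_le_const (by positivity) (fun τ => by
      rw [Real.norm_of_nonneg (by positivity)]
      exact mul_le_mul_of_nonneg_left (hCR τ) hε) ht
  have hI0 : 0 ≤ ∫ τ in (0 : ℝ)..t, ε * ‖R τ‖ :=
    intervalIntegral.integral_nonneg ht.1 fun τ _ => by positivity
  refine key.trans ?_
  have := ht.2
  gcongr

/-- Differences of solutions of the systems with truncated derivatives. -/
theorem exists_truncated_sub_bound (B : Background P s t₀ M β γ β₀ ε h L ub bd)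
    {R : ℝ → XSpace P s} {G : ℝ} (hG : 0 ≤ G) (hs0 : 0 ≤ s) : ∃ D : ℝ, 0 ≤ D ∧
      ∀ (n m : ℕ) (u w : ℝ → XSpace P s), u 0 = w 0 →
      PathOn L (fun t => inclX P (by linarith [B.hrs] : r ≤ s) (u t)) (fun t =>
        ε • inclX P (by linarith [B.hrs]) (R t) -
          ∑ j, AX P B.hr ε j (ub t) (DX P n j (inclX P (by linarith [B.hrs]) (u t)))) →
      PathOn L (fun t => inclX P (by linarith [B.hrs] : r ≤ s) (w t)) (fun t =>
        ε • inclX P (by linarith [B.hrs]) (R t) -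
          ∑ j, AX P B.hr ε j (ub t) (DX P m j (inclX P (by linarith [B.hrs]) (w t)))) →
      (∀ t ∈ Icc 0 L, ‖u t‖ ≤ G) → (∀ t ∈ Icc 0 L, ‖w t‖ ≤ G) →
      ∀ t ∈ Icc 0 L, ‖inclX P hs0 (u t) - inclX P hs0 (w t)‖ ≤
        D * (((n : ℝ) + 1) ^ (-(s - 1 - r)) + ((m : ℝ) + 1) ^ (-(s - 1 - r))) := by
  have hrs : r ≤ s := by linarith [B.hrs]
  have h0 := nonneg_of_half_lt B.hr
  have hΛ := B.rate_nonneg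
  have hε := B.hε0
  have hL := B.path.nonneg
  set Λ := (d + 1) ^ 2 * energyRate d s t₀ M β γ * (min 1 h)⁻¹ with hΛdef
  obtain ⟨K, hK0, hK⟩ := B.exists_norm_AX_le
  refine ⟨Real.exp (ε * Λ * L) * (2 * Λ * (K * G * L)), by positivity,
    fun n m u w huw pu pw hu hw t ht => ?_⟩
  set a := ((n : ℝ) + 1) ^ (-(s - 1 - r)) + ((m : ℝ) + 1) ^ (-(s - 1 - r)) with ha
  have ha0 : 0 ≤ a := by positivity
  set e : ℝ → XSpace P r := fun t => -∑ j, AX P B.hr ε j (ub t)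
    (DX P n j (inclX P hrs (w t)) - DX P m j (inclX P hrs (w t))) with he
  have hbound : ∀ t ∈ Icc 0 L, ‖e t‖ ≤ K * (a * G) := fun t ht => by
    rw [he, norm_neg]
    refine hK t ht _ _ fun j => ?_
    have h1 := norm_DX_sub_derivX_le P B.hrs.le n j (w t)
    have h2 := norm_DX_sub_derivX_le P B.hrs.le m j (w t)
    have h3 := norm_sub_le (DX P n j (inclX P hrs (w t)) - derivX P B.hrs.le j (w t))
      (DX P m j (inclX P hrs (w t)) - derivX P B.hrs.le j (w t))
    rw [sub_sub_sub_cancel_right] at h3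
    refine h3.trans ((add_le_add h1 h2).trans ?_)
    rw [← add_mul]
    exact mul_le_mul_of_nonneg_left (hw t ht) ha0
  have key := energy_bound P B.h₁ B.h₂ B.hs B.hr h0 B.ht₀ (σ := 0) (.inl rfl) B.hh B.hβ
    B.hγ B.hε0 B.hε1 B.path (pu.sub pw) B.hub B.hbd B.hnc B.hβ₀ (y := fun _ => K * (a * G))
    (fun t => by positivity) intervalIntegrable_const (B := G + G)
    (fun t ht => by
      rw [← map_sub, xNorm_inclX]
      refine (xNorm_mono P hs0 _).trans ?_
      rw [← XSpace.enorm_eq]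
      exact ENNReal.ofReal_le_ofReal ((norm_sub_le _ _).trans (add_le_add (hu t ht) (hw t ht))))
    le_rfl (by rw [huw, sub_self, Submodule.coe_zero, xNorm_zero]; exact zero_le)
    (fun _ => n) (fun _ => e) (fun _ _ => 0) (fun _ _ => le_rfl)
    (fun _ => tendsto_const_nhds)
    (fun _ => .of_forall fun t _ => by
      simp only [he, map_sub, Finset.sum_sub_distrib]
      abel)
    (fun k _ => .of_forall fun t ht => by
      rw [add_zero]
      exact ⟨(norm_wzH_zero_le h0 k _).trans (hbound t ht),
        fun i => (norm_wvH_zero_le h0 k i _).trans (hbound t ht)⟩) ht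
  have hI : ∫ _τ in (0 : ℝ)..t, K * (a * G) ≤ K * (a * G) * L :=
    integral_le_of_norm_le_const (by positivity) (fun τ => by
      rw [Real.norm_of_nonneg (by positivity)]) ht
  rw [← map_sub, xNorm_inclX] at key
  rw [← map_sub, XSpace.norm_def, xNorm_inclX]
  refine key.trans ?_
  rw [← hΛdef]
  have h4 : √(2 * (((d : ℝ) + 1) ^ 3 * (1 + β₀) * (min 1 h)⁻¹ * 0 ^ 2)) = 0 := by simp
  rw [h4, zero_add, mul_assoc (Real.exp (ε * Λ * L))]
  have h5 : Real.exp (ε * Λ * t) ≤ Real.exp (ε * Λ * L) := by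
    have := ht.2
    gcongr
  have h6 : 2 * Λ * ∫ _τ in (0 : ℝ)..t, K * (a * G) ≤ 2 * Λ * (K * G * L) * a := by
    refine (mul_le_mul_of_nonneg_left hI (by positivity)).trans_eq (by ring)
  have h7 : 0 ≤ ∫ _τ in (0 : ℝ)..t, K * (a * G) :=
    intervalIntegral.integral_nonneg ht.1 fun τ _ => by positivity
  exact mul_le_mul h5 h6 (by positivity) (Real.exp_pos _).le

end existence

section existence

variable {d : ℕ} {P : AdmissiblePair d} {r s : ℝ}
variable {t₀ M β γ β₀ ε h L : ℝ} {ub bd : ℝ → XSpace P r}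

theorem rpow_neg_le_one {θ : ℝ} (hθ : 0 ≤ θ) (n : ℕ) : ((n : ℝ) + 1) ^ (-θ) ≤ 1 :=
  Real.rpow_le_one_of_one_le_of_nonpos (by linarith [n.cast_nonneg (α := ℝ)]) (by linarith)

theorem exists_linSol (B : Background P s t₀ M β γ β₀ ε h L ub bd)
    {us R : ℝ → XSpace P s} (hus : StronglyMeasurable us) {Cu : ℝ} (hCu : ∀ t, ‖us t‖ ≤ Cu)
    (hub : ∀ᵐ t, t ∈ Icc 0 L → inclX P (by linarith [B.hrs]) (us t) = ub t)
    (hR : StronglyMeasurable R) {CR : ℝ} (hCR : ∀ t, ‖R t‖ ≤ CR) (U₀ : XSpace P s) :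
    ∃ u : ℝ → XSpace P s, LinSol P B.hr B.hrs ε L ub R u ∧ u 0 = U₀ := by
  classical
  have hrs : r ≤ s := by linarith [B.hrs]
  have h0 := nonneg_of_half_lt B.hr
  have hs0 : 0 ≤ s := h0.trans hrs
  have hε := B.hε0
  have hL := B.path.nonneg
  have hθ : 0 < s - 1 - r := by linarith [B.hrs]
  have hCR0 : 0 ≤ CR := (norm_nonneg _).trans (hCR 0)
  obtain ⟨G, hG0, hG⟩ := exists_truncated_bound B hR hCR U₀
  obtain ⟨D, hD0, hD⟩ := exists_truncated_sub_bound (R := R) B hG0 hs0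
  obtain ⟨K, hK0, hK⟩ := B.exists_norm_AX_le
  choose U hUc hU0 hUp using fun n => exists_truncated_solution B hus hCu hub hR hCR U₀ n
  have hUG : ∀ n, ∀ t ∈ Icc 0 L, ‖U n t‖ ≤ G := fun n => hG n _ (hUc n) (hU0 n) (hUp n)
  have hlim : ∀ t ∈ Icc 0 L, ∃ W : XSpace P s, ‖W‖ ≤ (d + 1) * G ∧
      Filter.Tendsto (fun n => inclX P hs0 (U n t)) Filter.atTop (nhds (inclX P hs0 W)) := by
    intro t ht
    have hc : CauchySeq fun n => inclX P hs0 (U n t) := by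
      refine cauchySeq_of_le_tendsto_0' (fun n : ℕ => 2 * D * ((n : ℝ) + 1) ^ (-(s - 1 - r)))
        (fun n m hnm => ?_) (by simpa using (tendsto_add_one_rpow_neg hθ).const_mul (2 * D))
      rw [dist_eq_norm]
      refine (hD n m _ _ ((hU0 n).trans (hU0 m).symm) (hUp n) (hUp m) (hUG n) (hUG m) t ht).trans ?_
      have h1 : ((m : ℝ) + 1) ^ (-(s - 1 - r)) ≤ ((n : ℝ) + 1) ^ (-(s - 1 - r)) :=
        Real.rpow_le_rpow_of_nonpos (by positivity) (by gcongr) (by linarith)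
      nlinarith
    obtain ⟨w, hw⟩ := cauchySeq_tendsto_of_complete hc
    obtain ⟨W, rfl, hW⟩ := exists_inclX_eq_of_tendsto hs0 (fun n => hUG n t ht) hw
    exact ⟨W, hW, hw⟩
  choose! V hVb hV using hlim
  have hsub : ∀ t ∈ Icc 0 L, ∀ {r' : ℝ} (_ : 0 ≤ r') (hr' : r' < s),
      Filter.Tendsto (fun n => inclX P hr'.le (U n t - V t)) Filter.atTop (nhds 0) :=
    fun t ht r' h0' hr' => by
      refine tendsto_inclX_of_bounded h0' hr' hs0 (B := G + (d + 1) * G)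
        (.of_forall fun n => (norm_sub_le _ _).trans (add_le_add (hUG n t ht) (hVb t ht))) ?_
      simpa using (hV t ht).sub_const (inclX P hs0 (V t))
  have hder : ∀ t ∈ Icc 0 L, ∀ j, Filter.Tendsto (fun n => DX P n j (inclX P hrs (U n t)))
      Filter.atTop (nhds (derivX P B.hrs.le j (V t))) := fun t ht j => by
    have h1 : Filter.Tendsto (fun n => DX P n j (inclX P hrs (U n t)) - derivX P B.hrs.le j (U n t))
        Filter.atTop (nhds 0) := by
      refine squeeze_zero_norm (fun n => (norm_DX_sub_derivX_le P B.hrs.le n j (U n t)).trans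
        (mul_le_mul_of_nonneg_left (hUG n t ht) (by positivity))) ?_
      simpa using (tendsto_add_one_rpow_neg hθ).mul_const G
    have h2 : Filter.Tendsto (fun n => derivX P B.hrs.le j (U n t - V t)) Filter.atTop (nhds 0) := by
      have h3 := ((derivX P (le_refl (r + 1)) j).continuous.tendsto 0).comp
        (hsub t ht (by linarith) B.hrs)
      rw [map_zero] at h3
      exact h3.congr fun n => (derivX_eq_comp_inclX B.hrs.le j _).symm
    have h4 := (h1.add h2).add_const (derivX P B.hrs.le j (V t))
    simpa using h4
  have hDb : ∀ n, ∀ t ∈ Icc 0 L, ∀ j, ‖DX P n j (inclX P hrs (U n t))‖ ≤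
      (1 + ∑ j, ‖derivX P B.hrs.le j‖) * G := fun n t ht j => by
    have h1 := (norm_DX_sub_derivX_le P B.hrs.le n j (U n t)).trans
      (mul_le_mul (rpow_neg_le_one hθ.le n) (hUG n t ht) (norm_nonneg _) zero_le_one)
    have h2 := ((derivX P B.hrs.le j).le_opNorm (U n t)).trans (mul_le_mul
      (Finset.single_le_sum (f := fun j => ‖derivX P B.hrs.le j‖) (fun i _ => norm_nonneg _)
        (Finset.mem_univ j)) (hUG n t ht) (norm_nonneg _) (by positivity))
    have h3 := norm_add_le (DX P n j (inclX P hrs (U n t)) - derivX P B.hrs.le j (U n t))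
      (derivX P B.hrs.le j (U n t))
    rw [sub_add_cancel] at h3
    linarith
  refine ⟨V, ⟨⟨_, hVb⟩, PathOn.of_tendsto hUp
    (K := ε * CR + K * ((1 + ∑ j, ‖derivX P B.hrs.le j‖) * G)) (fun n => .of_forall fun t ht => ?_)
    (fun t ht => ?_) (.of_forall fun t ht => ?_)⟩, ?_⟩
  · refine (norm_sub_le _ _).trans (add_le_add ?_ (hK t ht _ _ fun j => hDb n t ht j))
    rw [norm_smul, Real.norm_of_nonneg hε]
    exact mul_le_mul_of_nonneg_left ((norm_inclX_le P hrs _).trans (hCR t)) hε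
  · have h1 := (hsub t ht h0 (by linarith [B.hrs] : r < s)).add_const (inclX P hrs (V t))
    simpa using h1
  · exact (tendsto_finsetSum _ fun j _ =>
      ((AX P B.hr ε j (ub t)).continuous.tendsto _).comp (hder t ht j)).const_sub _
  · have h1 := hV 0 ⟨le_rfl, hL⟩
    have h2 : Filter.Tendsto (fun n => inclX P hs0 (U n 0)) Filter.atTop (nhds (inclX P hs0 U₀)) :=
      tendsto_const_nhds.congr fun n => by rw [hU0]
    exact inclX_injective P hs0 (tendsto_nhds_unique h1 h2)

end existence

section weakConvergence

variable {H : Type*} [NormedAddCommGroup H] [InnerProductSpace ℂ H] {α : Type*} {l : Filter α}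

theorem tendsto_inner_of_cutoff [CompleteSpace H] {χ : ℕ → H →L[ℂ] H}
    (hχ : ∀ k, star (χ k) = χ k)
    (hχ1 : ∀ g, Filter.Tendsto (fun k => χ k g) Filter.atTop (nhds g)) {f : α → H} {f₀ : H} {B : ℝ}
    (hB : ∀ᶠ a in l, ‖f a‖ ≤ B)
    (hf : ∀ k, Filter.Tendsto (fun a => χ k (f a)) l (nhds (χ k f₀))) (g : H) :
    Filter.Tendsto (fun a => inner ℂ (f a) g) l (nhds (inner ℂ f₀ g)) := by
  rw [Metric.tendsto_nhds]
  intro δ hδ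
  have hC : 0 < |B| + ‖f₀‖ + 1 := by positivity
  obtain ⟨k, hk⟩ := ((Metric.tendsto_nhds.1 (hχ1 g)) (δ / 2 / (|B| + ‖f₀‖ + 1))
    (by positivity)).exists
  filter_upwards [hB, (Metric.tendsto_nhds.1 (hf k)) (δ / 2 / (‖g‖ + 1)) (by positivity)]
    with a h1 h2
  rw [dist_eq_norm] at hk h2 ⊢
  rw [lt_div_iff₀ (by positivity)] at hk h2
  have e : inner ℂ (f a) g - inner ℂ f₀ g =
      inner ℂ (χ k (f a) - χ k f₀) g - inner ℂ (f a - f₀) (χ k g - g) := by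
    rw [← map_sub, inner_apply_of_star_eq (hχ k), inner_sub_right, ← inner_sub_left]
    ring
  rw [e]
  have h3 := norm_inner_le_norm (𝕜 := ℂ) (χ k (f a) - χ k f₀) g
  have h4 := norm_inner_le_norm (𝕜 := ℂ) (f a - f₀) (χ k g - g)
  have h5 : ‖f a - f₀‖ ≤ |B| + ‖f₀‖ + 1 := by
    linarith [norm_sub_le (f a) f₀, le_abs_self B]
  have h6 := norm_sub_le (inner ℂ (χ k (f a) - χ k f₀) g) (inner ℂ (f a - f₀) (χ k g - g))
  nlinarith [norm_nonneg (χ k g - g), norm_nonneg (χ k (f a) - χ k f₀), norm_nonneg g]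

theorem tendsto_inner_of_weak {f g : α → H} {f₀ g₀ : H} {B : ℝ} (hB : ∀ᶠ a in l, ‖f a‖ ≤ B)
    (hf : ∀ g, Filter.Tendsto (fun a => inner ℂ (f a) g) l (nhds (inner ℂ f₀ g)))
    (hg : Filter.Tendsto g l (nhds g₀)) :
    Filter.Tendsto (fun a => inner ℂ (f a) (g a)) l (nhds (inner ℂ f₀ g₀)) := by
  have h1 : Filter.Tendsto (fun a => inner ℂ (f a) (g a - g₀)) l (nhds 0) := by
    refine squeeze_zero_norm' (a := fun a => |B| * ‖g a - g₀‖) ?_ ?_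
    · filter_upwards [hB] with a ha
      exact (norm_inner_le_norm _ _).trans
        (mul_le_mul_of_nonneg_right (ha.trans (le_abs_self B)) (norm_nonneg _))
    · simpa using ((tendsto_iff_norm_sub_tendsto_zero.1 hg).const_mul |B|)
  have h2 := (hf g₀).add h1
  rw [add_zero] at h2
  refine h2.congr fun a => ?_
  rw [inner_sub_right]
  ring

end weakConvergence

section cutoff

variable {d : ℕ} {s : ℝ}

/-- The quotient of the truncated weight and of the weight. -/
def cutoff (s : ℝ) (k : ℕ) (ξ : Sp d) : ℂ := ((min (jb ξ ^ s) k / jb ξ ^ s : ℝ) : ℂ)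

theorem norm_cutoff_le (s : ℝ) (k : ℕ) (ξ : Sp d) : ‖cutoff s k ξ‖ ≤ 1 := by
  have h1 : 0 < jb ξ ^ s := Real.rpow_pos_of_pos (jb_pos ξ) s
  rw [cutoff, Complex.norm_real, Real.norm_of_nonneg
    (div_nonneg (le_min h1.le k.cast_nonneg) h1.le)]
  exact (div_le_one h1).2 (min_le_left _ _)

theorem bddSym_cutoff (s : ℝ) (k : ℕ) : BddSym (cutoff (d := d) s k) := by
  refine ⟨Continuous.aestronglyMeasurable ?_, 1, .of_forall (norm_cutoff_le s k)⟩
  have h : Continuous fun ξ : Sp d => jb ξ ^ s := continuous_weight s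
  exact Complex.continuous_ofReal.comp ((h.min continuous_const).div h
    fun ξ => (Real.rpow_pos_of_pos (jb_pos ξ) s).ne')

theorem star_cutoff (s : ℝ) (k : ℕ) : star (multOp (cutoff (d := d) s k)) = multOp (cutoff s k) :=
  star_multOp (bddSym_cutoff s k) (bddSym_cutoff s k) (.of_forall fun ξ => by simp [cutoff])

theorem tendsto_multOp_cutoff (s : ℝ) (g : L2Sp d) :
    Filter.Tendsto (fun k => multOp (cutoff s k) g) Filter.atTop (nhds g) := by
  rw [Lp.tendsto_Lp_iff_tendsto_eLpNorm']
  have h1 : Filter.Tendsto (fun k : ℕ => ∫⁻ ξ, ‖(multOp (cutoff s k) g - g) ξ‖ₑ ^ (2 : ℝ))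
      Filter.atTop (nhds (∫⁻ _ξ : Sp d, 0)) := by
    refine tendsto_lintegral_of_dominated_convergence' (fun ξ => (2 * ‖g ξ‖ₑ) ^ (2 : ℝ))
      (fun k => ((Lp.aestronglyMeasurable _).enorm.pow_const _)) (fun k => ?_) ?_ ?_
    · filter_upwards [Lp.coeFn_sub (multOp (cutoff s k) g) g,
        multOp_coeFn (bddSym_cutoff s k) g] with ξ h1 h2
      rw [h1, Pi.sub_apply, h2]
      refine ENNReal.rpow_le_rpow (enorm_sub_le.trans ?_) zero_le_two
      rw [two_mul]
      refine add_le_add ?_ le_rfl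
      rw [enorm_mul]
      refine mul_le_of_le_one_left zero_le ?_
      rw [← ofReal_norm]
      exact ENNReal.ofReal_le_one.2 (norm_cutoff_le s k ξ)
    · have h3 := (Lp.memLp g).2
      rw [eLpNorm_lt_top_iff_lintegral_rpow_enorm_lt_top (by norm_num) (by norm_num)] at h3
      simp only [ENNReal.mul_rpow_of_nonneg _ _ (zero_le_two (α := ℝ))]
      rw [lintegral_const_mul' _ _ (by norm_num)]
      refine (ENNReal.mul_lt_top (by norm_num) ?_).ne
      simpa using h3
    · filter_upwards [ae_all_iff.2 fun k : ℕ => Lp.coeFn_sub (multOp (cutoff s k) g) g,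
        ae_all_iff.2 fun k : ℕ => multOp_coeFn (bddSym_cutoff s k) g] with ξ h1 h2
      refine tendsto_const_nhds.congr' ?_
      filter_upwards [Filter.eventually_ge_atTop ⌈jb ξ ^ s⌉₊] with k hk
      rw [h1 k, Pi.sub_apply, h2 k, cutoff, min_eq_left (Nat.ceil_le.1 hk),
        div_self (Real.rpow_pos_of_pos (jb_pos ξ) s).ne']
      simp
  rw [lintegral_zero] at h1
  have h2 := (ENNReal.continuous_rpow_const (y := (1 / 2 : ℝ))).continuousAt.tendsto.comp h1
  rw [ENNReal.zero_rpow_of_pos (by norm_num)] at h2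
  refine h2.congr fun k => ?_
  rw [eLpNorm_eq_lintegral_rpow_enorm_toReal (by norm_num) (by norm_num)]
  simp only [Function.comp_apply, ENNReal.toReal_ofNat]
  congr 1
  refine lintegral_congr_ae ?_
  filter_upwards [Lp.coeFn_sub (multOp (cutoff s k) g) g] with ξ h
  rw [h]

end cutoff

section fullWeight

variable {d : ℕ} (P : AdmissiblePair d) {r s : ℝ}

/-- The operator `⟨D⟩^s` from `X^s` to `X^0`. -/
def weightX (s : ℝ) : XSpace P s →L[ℝ] XSpace P 0 :=
  multX P (fun ξ => ((jb ξ ^ s : ℝ) : ℂ))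
    (Complex.continuous_ofReal.comp (continuous_weight s)).aestronglyMeasurable
    (fun ξ => by simp [jb_neg]) (C := 1) zero_le_one (.of_forall fun ξ => by
      rw [Complex.norm_real, Real.norm_of_nonneg (Real.rpow_nonneg (jb_pos ξ).le s),
        Real.rpow_zero, mul_comm])

/-- The weighted first component. -/
def tzH (s : ℝ) : XSpace P s →L[ℝ] L2Sp d := (zH P le_rfl).comp (weightX P s)

/-- The weighted velocity components. -/
def tvH (s : ℝ) (i : Fin d) : XSpace P s →L[ℝ] L2Sp d := (vH P le_rfl i).comp (weightX P s)

theorem tzH_coeFn (U : XSpace P s) :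
    (tzH P s U : Sp d → ℂ) =ᵐ[volume] fun ξ => ((jb ξ ^ s : ℝ) : ℂ) * (U : State d).1 ξ :=
  coeFn_fourierMult _ _ (U : State d).1

theorem tvH_coeFn (i : Fin d) (U : XSpace P s) :
    (tvH P s i U : Sp d → ℂ) =ᵐ[volume]
      fun ξ => ((jb ξ ^ s : ℝ) : ℂ) * P.op₁ ((U : State d).2 i) ξ := by
  have hm : AEStronglyMeasurable (fun ξ : Sp d => ((jb ξ ^ s : ℝ) : ℂ)) volume :=
    (Complex.continuous_ofReal.comp (continuous_weight s)).aestronglyMeasurable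
  have e : P.op₁ (fourierMult _ hm ((U : State d).2 i)) =
      fourierMult _ hm (P.op₁ ((U : State d).2 i)) := fourierMult_comm _ _ _
  have h := coeFn_fourierMult _ hm (P.op₁ ((U : State d).2 i))
  rw [← e] at h
  exact h

theorem multOp_cutoff_tzH (h0 : 0 ≤ r) (hrs : r ≤ s) (k : ℕ) (U : XSpace P s) :
    multOp (cutoff s k) (tzH P s U) = wzH P h0 s k (inclX P hrs U) := by
  have e : (zH P h0 (inclX P hrs U) : Sp d → ℂ) = ((U : State d).1 : Sp d → ℂ) := by
    rw [zH_coeFn, inclX_coe]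
  change _ = multOp (wt s k) (zH P h0 (inclX P hrs U))
  refine Lp.ext ?_
  filter_upwards [multOp_coeFn (bddSym_cutoff s k) (tzH P s U), tzH_coeFn P U,
    multOp_coeFn (bddSym_wt s k) (zH P h0 (inclX P hrs U))] with ξ h1 h2 h3
  have hj : ((jb ξ ^ s : ℝ) : ℂ) ≠ 0 :=
    Complex.ofReal_ne_zero.2 (Real.rpow_pos_of_pos (jb_pos ξ) s).ne'
  rw [h1, h2, h3, e, cutoff, wt, ← mul_assoc, Complex.ofReal_div, div_mul_cancel₀ _ hj]

theorem multOp_cutoff_tvH (h0 : 0 ≤ r) (hrs : r ≤ s) (k : ℕ) (i : Fin d) (U : XSpace P s) :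
    multOp (cutoff s k) (tvH P s i U) = wvH P h0 s k i (inclX P hrs U) := by
  have e : (vH P h0 i (inclX P hrs U) : Sp d → ℂ) = (P.op₁ ((U : State d).2 i) : Sp d → ℂ) := by
    rw [vH_coeFn, inclX_coe]
  change _ = multOp (wt s k) (vH P h0 i (inclX P hrs U))
  refine Lp.ext ?_
  filter_upwards [multOp_coeFn (bddSym_cutoff s k) (tvH P s i U), tvH_coeFn P i U,
    multOp_coeFn (bddSym_wt s k) (vH P h0 i (inclX P hrs U))] with ξ h1 h2 h3
  have hj : ((jb ξ ^ s : ℝ) : ℂ) ≠ 0 :=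
    Complex.ofReal_ne_zero.2 (Real.rpow_pos_of_pos (jb_pos ξ) s).ne'
  rw [h1, h2, h3, e, cutoff, wt, ← mul_assoc, Complex.ofReal_div, div_mul_cancel₀ _ hj]

theorem norm_le_tzH_add_tvH (U : XSpace P s) : ‖U‖ ≤ ‖tzH P s U‖ + ∑ i, ‖tvH P s i U‖ := by
  refine XSpace.norm_le_of_xNorm_le P U (by positivity) ((xNorm_le_sum P (U : State d)).trans ?_)
  rw [ENNReal.ofReal_add (norm_nonneg _) (by positivity),
    ENNReal.ofReal_sum_of_nonneg fun i _ => norm_nonneg _]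
  refine add_le_add ?_ (Finset.sum_le_sum fun i _ => ?_)
  · rw [hsNorm_eq, ofReal_norm, Lp.enorm_def]
    refine (eLpNorm_congr_ae ?_).le
    filter_upwards [tzH_coeFn P U] with ξ h
    rw [h]
    exact Complex.real_smul
  · rw [hsNorm_eq, ofReal_norm, Lp.enorm_def]
    refine (eLpNorm_congr_ae ?_).le
    filter_upwards [tvH_coeFn P i U] with ξ h
    rw [h]
    exact Complex.real_smul

end fullWeight

section strongContinuity

variable {d : ℕ} (P : AdmissiblePair d) {r s : ℝ}

/-- The symmetric form which defines the energy in `X^s`. -/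
def energyForm (hr : (d : ℝ) / 2 < r) (s ε : ℝ) (b : XSpace P r) (U V : XSpace P s) : ℝ :=
  (inner ℂ (tzH P s U) (tzH P s V)).re +
    ∑ i, (inner ℂ (tvH P s i U) (tvH P s i V + ε • mBm P hr b (tvH P s i V))).re

theorem inner_symmetrizer_symm (hr : (d : ℝ) / 2 < r) (ε : ℝ) (b : XSpace P r) (f g : L2Sp d) :
    (inner ℂ f (g + ε • mBm P hr b g)).re = (inner ℂ g (f + ε • mBm P hr b f)).re := by
  rw [← SX_apply, ← SX_apply, ← inner_apply_of_star_eq (star_SX P hr ε b)]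
  exact inner_re_symm (𝕜 := ℂ) _ _

theorem energyForm_sub_self (hr : (d : ℝ) / 2 < r) (s ε : ℝ) (b : XSpace P r) (U V : XSpace P s) :
    energyForm P hr s ε b (U - V) (U - V) =
      energyForm P hr s ε b U U - 2 * energyForm P hr s ε b U V + energyForm P hr s ε b V V := by
  have hz : ∀ x y : L2Sp d, (inner ℂ (x - y) (x - y)).re =
      (inner ℂ x x).re - 2 * (inner ℂ x y).re + (inner ℂ y y).re := fun x y => by
    have := inner_re_symm (𝕜 := ℂ) x y
    simp only [inner_sub_left, inner_sub_right, Complex.sub_re] at this ⊢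
    change (inner ℂ x y).re = (inner ℂ y x).re at this
    linarith
  have hv : ∀ i, (inner ℂ (tvH P s i (U - V)) (tvH P s i (U - V) +
      ε • mBm P hr b (tvH P s i (U - V)))).re =
      (inner ℂ (tvH P s i U) (tvH P s i U + ε • mBm P hr b (tvH P s i U))).re -
      2 * (inner ℂ (tvH P s i U) (tvH P s i V + ε • mBm P hr b (tvH P s i V))).re +
      (inner ℂ (tvH P s i V) (tvH P s i V + ε • mBm P hr b (tvH P s i V))).re := fun i => by
    have := inner_symmetrizer_symm P hr ε b (tvH P s i U) (tvH P s i V)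
    rw [map_sub, map_sub, smul_sub, sub_add_sub_comm, inner_sub_left, inner_sub_right,
      inner_sub_right, Complex.sub_re, Complex.sub_re, Complex.sub_re]
    linarith
  unfold energyForm
  rw [Finset.sum_congr rfl fun i _ => hv i, map_sub, hz, Finset.sum_add_distrib,
    Finset.sum_sub_distrib, ← Finset.mul_sum]
  ring

theorem tendsto_energyX (hr : (d : ℝ) / 2 < r) (h0 : 0 ≤ r) (hrs : r ≤ s) (ε : ℝ) (b : XSpace P r)
    (U : XSpace P s) : Filter.Tendsto (fun k => energyX P hr h0 s k ε b (inclX P hrs U))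
      Filter.atTop (nhds (energyForm P hr s ε b U U)) := by
  have hz : Filter.Tendsto (fun k => wzH P h0 s k (inclX P hrs U)) Filter.atTop
      (nhds (tzH P s U)) := by
    simp only [← multOp_cutoff_tzH P h0 hrs]
    exact tendsto_multOp_cutoff s _
  have hv : ∀ i, Filter.Tendsto (fun k => wvH P h0 s k i (inclX P hrs U)) Filter.atTop
      (nhds (tvH P s i U)) := fun i => by
    simp only [← multOp_cutoff_tvH P h0 hrs]
    exact tendsto_multOp_cutoff s _
  have h1 := fun i => (Complex.continuous_re.tendsto _).comp (((hv i).add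
    ((((mBm P hr b).continuous.tendsto _).comp (hv i)).const_smul ε)).inner (𝕜 := ℂ) (hv i))
  have h2 := ((Complex.continuous_re.tendsto _).comp (hz.inner (𝕜 := ℂ) hz)).add
    (tendsto_finsetSum Finset.univ fun i _ => h1 i)
  have e : energyForm P hr s ε b U U = (inner ℂ (tzH P s U) (tzH P s U)).re +
      ∑ i, (inner ℂ (tvH P s i U + ε • mBm P hr b (tvH P s i U)) (tvH P s i U)).re := by
    unfold energyForm
    congr 1
    exact Finset.sum_congr rfl fun i _ => inner_re_symm (𝕜 := ℂ) _ _
  rw [e]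
  exact h2

theorem energyForm_lower (hr : (d : ℝ) / 2 < r) (h0 : 0 ≤ r) (hrs : r ≤ s) {ε h : ℝ}
    {b : XSpace P r} (hb : ∀ x, h ≤ 1 + ε * ((b : State d).1.toPhys x).re) (U : XSpace P s) :
    min 1 h * (‖tzH P s U‖ ^ 2 + ∑ i, ‖tvH P s i U‖ ^ 2) ≤ energyForm P hr s ε b U U := by
  have hz : Filter.Tendsto (fun k => wzH P h0 s k (inclX P hrs U)) Filter.atTop
      (nhds (tzH P s U)) := by
    simp only [← multOp_cutoff_tzH P h0 hrs]
    exact tendsto_multOp_cutoff s _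
  have hv : ∀ i, Filter.Tendsto (fun k => wvH P h0 s k i (inclX P hrs U)) Filter.atTop
      (nhds (tvH P s i U)) := fun i => by
    simp only [← multOp_cutoff_tvH P h0 hrs]
    exact tendsto_multOp_cutoff s _
  exact le_of_tendsto_of_tendsto'
    (((hz.norm.pow 2).add (tendsto_finsetSum Finset.univ fun i _ => (hv i).norm.pow 2)).const_mul
      (min 1 h)) (tendsto_energyX P hr h0 hrs ε b U)
    fun k => energyX_lower P hr h0 s k hb (inclX P hrs U)

variable {P} {t₀ M β γ β₀ ε h L : ℝ} {ub bd : ℝ → XSpace P r}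

theorem LinSol.exists_energyForm_lipschitz (B : Background P s t₀ M β γ β₀ ε h L ub bd)
    {R u : ℝ → XSpace P s} (S : LinSol P B.hr B.hrs ε L ub R u) {C : ℝ} (hC : ∀ t, ‖R t‖ ≤ C) :
    ∃ K : ℝ, ∀ t ∈ Icc 0 L, ∀ τ ∈ Icc 0 L, |energyForm P B.hr s ε (ub t) (u t) (u t) -
      energyForm P B.hr s ε (ub τ) (u τ) (u τ)| ≤ K * |t - τ| := by
  obtain ⟨K, hK⟩ := LinSol.exists_energy_lipschitz B S hC
  have hrs : r ≤ s := by linarith [B.hrs]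
  refine ⟨K, fun t ht τ hτ => ?_⟩
  refine le_of_tendsto ((tendsto_energyX P B.hr (nonneg_of_half_lt B.hr) hrs ε (ub t) (u t)).sub
    (tendsto_energyX P B.hr (nonneg_of_half_lt B.hr) hrs ε (ub τ) (u τ))).abs ?_
  filter_upwards [Filter.eventually_ge_atTop 1] with k hk
  exact hK k hk t ht τ hτ

/-- Solutions are continuous in time with values in `X^s`. -/
theorem LinSol.continuousOn (B : Background P s t₀ M β γ β₀ ε h L ub bd)
    {R u : ℝ → XSpace P s} (S : LinSol P B.hr B.hrs ε L ub R u) {C : ℝ} (hC : ∀ t, ‖R t‖ ≤ C) :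
    ContinuousOn u (Icc 0 L) := by
  have hrs : r ≤ s := by linarith [B.hrs]
  have h0 := nonneg_of_half_lt B.hr
  have hs0 : 0 ≤ s := h0.trans hrs
  obtain ⟨Bd, hBd⟩ := S.bound
  obtain ⟨K, hK⟩ := LinSol.exists_energyForm_lipschitz B S hC
  intro a ha
  set l := nhdsWithin a (Icc 0 L)
  have hmem : ∀ᶠ t in l, t ∈ Icc 0 L := self_mem_nhdsWithin
  have hul : Filter.Tendsto (fun t => inclX P hrs (u t)) l (nhds (inclX P hrs (u a))) :=
    S.path.continuousOn a ha
  have hubl : Filter.Tendsto ub l (nhds (ub a)) := B.path.continuousOn a ha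
  have hBl : ∀ᶠ t in l, ‖u t‖ ≤ Bd := hmem.mono fun t ht => hBd t ht
  have hBz : ∀ᶠ t in l, ‖tzH P s (u t)‖ ≤ ‖tzH P s‖ * Bd := hBl.mono fun t ht =>
    ((tzH P s).le_opNorm _).trans (mul_le_mul_of_nonneg_left ht (norm_nonneg _))
  have hBv : ∀ i, ∀ᶠ t in l, ‖tvH P s i (u t)‖ ≤ ‖tvH P s i‖ * Bd := fun i => hBl.mono fun t ht =>
    ((tvH P s i).le_opNorm _).trans (mul_le_mul_of_nonneg_left ht (norm_nonneg _))
  have wz := tendsto_inner_of_cutoff (star_cutoff (d := d) s) (tendsto_multOp_cutoff s) hBz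
    (f₀ := tzH P s (u a)) (fun k => by
      simp only [multOp_cutoff_tzH P h0 hrs]
      exact ((wzH P h0 s k).continuous.tendsto _).comp hul)
  have wv := fun i => tendsto_inner_of_cutoff (star_cutoff (d := d) s) (tendsto_multOp_cutoff s)
    (hBv i) (f₀ := tvH P s i (u a)) (fun k => by
      simp only [multOp_cutoff_tvH P h0 hrs]
      exact ((wvH P h0 s k i).continuous.tendsto _).comp hul)
  have hS : ∀ f : L2Sp d, Filter.Tendsto (fun t => f + ε • mBm P B.hr (ub t) f) l
      (nhds (f + ε • mBm P B.hr (ub a) f)) := fun f => by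
    have h1 : Filter.Tendsto (fun t => mBm P B.hr (ub t) f) l (nhds (mBm P B.hr (ub a) f)) :=
      ((ContinuousLinearMap.apply ℝ (L2Sp d) f).continuous.tendsto _).comp
        (((mBm P B.hr).continuous.tendsto _).comp hubl)
    exact (h1.const_smul ε).const_add f
  have e1 : Filter.Tendsto (fun t => energyForm P B.hr s ε (ub t) (u t) (u t)) l
      (nhds (energyForm P B.hr s ε (ub a) (u a) (u a))) := by
    rw [tendsto_iff_norm_sub_tendsto_zero]
    have h1 : Filter.Tendsto (fun t => K * |t - a|) l (nhds 0) := by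
      have h2 : Continuous fun t => K * |t - a| := by fun_prop
      have h3 := h2.tendsto a
      simp only [sub_self, abs_zero, mul_zero] at h3
      exact h3.mono_left nhdsWithin_le_nhds
    refine squeeze_zero' (.of_forall fun t => norm_nonneg _) ?_ h1
    filter_upwards [hmem] with t ht
    exact hK t ht a ha
  have e2 : Filter.Tendsto (fun t => energyForm P B.hr s ε (ub t) (u t) (u a)) l
      (nhds (energyForm P B.hr s ε (ub a) (u a) (u a))) :=
    ((Complex.continuous_re.tendsto _).comp (wz (tzH P s (u a)))).add
      (tendsto_finsetSum Finset.univ fun i _ => (Complex.continuous_re.tendsto _).comp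
        (tendsto_inner_of_weak (hBv i) (wv i) (hS (tvH P s i (u a)))))
  have e3 : Filter.Tendsto (fun t => energyForm P B.hr s ε (ub t) (u a) (u a)) l
      (nhds (energyForm P B.hr s ε (ub a) (u a) (u a))) :=
    tendsto_const_nhds.add (tendsto_finsetSum Finset.univ fun i _ =>
      (Complex.continuous_re.tendsto _).comp
        (tendsto_const_nhds.inner (𝕜 := ℂ) (hS (tvH P s i (u a)))))
  have e4 : Filter.Tendsto (fun t => energyForm P B.hr s ε (ub t) (u t - u a) (u t - u a)) l
      (nhds 0) := by
    simp only [energyForm_sub_self]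
    have := (e1.sub (e2.const_mul 2)).add e3
    convert this using 2
    ring
  have hc : 0 < min 1 h := lt_min one_pos B.hh
  set c := min 1 h
  have hbd : ∀ᶠ t in l, ‖u t - u a‖ ≤
      (d + 1) * √(c⁻¹ * energyForm P B.hr s ε (ub t) (u t - u a) (u t - u a)) := by
    filter_upwards [hmem] with t ht
    have h1 := energyForm_lower P B.hr h0 hrs (B.hnc t ht) (u t - u a)
    have h2 : ‖tzH P s (u t - u a)‖ ≤
        √(c⁻¹ * energyForm P B.hr s ε (ub t) (u t - u a) (u t - u a)) := by
      refine Real.le_sqrt_of_sq_le ?_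
      rw [le_inv_mul_iff₀ hc]
      have : 0 ≤ ∑ i, ‖tvH P s i (u t - u a)‖ ^ 2 := by positivity
      nlinarith
    have h3 : ∀ i, ‖tvH P s i (u t - u a)‖ ≤
        √(c⁻¹ * energyForm P B.hr s ε (ub t) (u t - u a) (u t - u a)) := fun i => by
      refine Real.le_sqrt_of_sq_le ?_
      rw [le_inv_mul_iff₀ hc]
      have := Finset.single_le_sum (f := fun i => ‖tvH P s i (u t - u a)‖ ^ 2)
        (fun i _ => sq_nonneg _) (Finset.mem_univ i)
      nlinarith [sq_nonneg ‖tzH P s (u t - u a)‖]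
    refine (norm_le_tzH_add_tvH P _).trans ((add_le_add h2
      (Finset.sum_le_sum fun i _ => h3 i)).trans_eq ?_)
    rw [Finset.sum_const, Finset.card_univ, Fintype.card_fin, nsmul_eq_mul]
    ring
  change Filter.Tendsto u l (nhds (u a))
  rw [tendsto_iff_norm_sub_tendsto_zero]
  refine squeeze_zero' (.of_forall fun t => norm_nonneg _) hbd ?_
  have h5 := (((Real.continuous_sqrt.tendsto _).comp (e4.const_mul c⁻¹))).const_mul ((d : ℝ) + 1)
  simpa using h5

end strongContinuity

section timeInterval

theorem zero_mem_timeInterval {T ε : ℝ} (hT : 0 ≤ T) : 0 ∈ timeInterval T ε :=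
  ⟨le_rfl, by rwa [mul_zero]⟩

theorem Icc_subset_timeInterval {T ε : ℝ} (hε : 0 ≤ ε) {L : ℝ} (hL : L ∈ timeInterval T ε) :
    Icc 0 L ⊆ timeInterval T ε := fun _ ht =>
  ⟨ht.1, (mul_le_mul_of_nonneg_left ht.2 hε).trans hL.2⟩

theorem measurableSet_timeInterval (T ε : ℝ) : MeasurableSet (timeInterval T ε) :=
  (isClosed_Ici.inter (isClosed_le (by fun_prop) continuous_const :
    IsClosed {t : ℝ | ε * t ≤ T})).measurableSet

theorem ae_Icc_of_ae_restrict {T ε : ℝ} (hε : 0 ≤ ε) {L : ℝ} (hL : L ∈ timeInterval T ε)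
    {p : ℝ → Prop} (h : ∀ᵐ t ∂volume.restrict (timeInterval T ε), p t) :
    ∀ᵐ t, t ∈ Icc 0 L → p t := by
  rw [ae_restrict_iff' (measurableSet_timeInterval T ε)] at h
  exact h.mono fun t h1 ht => h1 (Icc_subset_timeInterval hε hL ht)

theorem continuousOn_timeInterval {Y : Type*} [TopologicalSpace Y] {T ε : ℝ} {u : ℝ → Y}
    (h : ∀ L ∈ timeInterval T ε, ContinuousOn u (Icc 0 L)) :
    ContinuousOn u (timeInterval T ε) := by
  intro t ht
  by_cases hL : ∃ L ∈ timeInterval T ε, t < L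
  · obtain ⟨L, hL, htL⟩ := hL
    refine (h L hL t ⟨ht.1, htL.le⟩).mono_of_mem_nhdsWithin ?_
    filter_upwards [self_mem_nhdsWithin, mem_nhdsWithin_of_mem_nhds (isOpen_Iio.mem_nhds htL)]
      with τ h1 h2 using ⟨h1.1, le_of_lt h2⟩
  · push Not at hL
    exact (h t ht t ⟨ht.1, le_rfl⟩).mono fun τ hτ => ⟨hτ.1, hL τ hτ⟩

end timeInterval

section timeNorms

variable {d : ℕ} {P : AdmissiblePair d} {T ε : ℝ}

theorem ae_xNorm_le_linfNorm {σ s : ℝ} (hσ : σ ≤ s) {I : Set ℝ} {U : ℝ → State d}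
    (h : MemLinf P s I U) :
    ∀ᵐ t ∂volume.restrict I, xNorm P σ (U t) ≤ ENNReal.ofReal (linfNorm P σ I U) := by
  obtain ⟨u, hu, hU⟩ := h
  have h1 : essSup (fun t => xNorm P σ (U t)) (volume.restrict I) ≤
      eLpNorm u ⊤ (volume.restrict I) := by
    rw [eLpNorm_exponent_top]
    refine essSup_mono_ae ?_
    filter_upwards [hU] with t ht
    rw [← ht, ← ofReal_norm, XSpace.enorm_eq]
    exact xNorm_mono P hσ _
  rw [linfNorm, ENNReal.ofReal_toReal (h1.trans_lt hu.2).ne]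
  exact ENNReal.ae_le_essSup _

theorem linfNorm_nonneg (s : ℝ) (I : Set ℝ) (U : ℝ → State d) : 0 ≤ linfNorm P s I U :=
  ENNReal.toReal_nonneg

theorem exists_pathOn_of_memW1inf {σ : ℝ} {U dU : ℝ → State d} (hε : 0 ≤ ε)
    (h : MemW1inf P σ (timeInterval T ε) U dU) : ∃ u v : ℝ → XSpace P σ,
      (∀ t ∈ timeInterval T ε, (u t : State d) = U t) ∧
      (∀ᵐ t ∂volume.restrict (timeInterval T ε), (v t : State d) = dU t) ∧
      ∀ L ∈ timeInterval T ε, PathOn L u v := by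
  obtain ⟨-, h1, u, v, hu, hv, huv⟩ := h
  refine ⟨u, v, hu, hv, fun L hL => ⟨hL.1, (huv L hL).1,
    ⟨linfNorm P σ (timeInterval T ε) dU, ?_⟩,
    fun t ht => (huv t (Icc_subset_timeInterval hε hL ht)).2⟩⟩
  refine ae_Icc_of_ae_restrict hε hL ?_
  filter_upwards [hv, ae_xNorm_le_linfNorm le_rfl h1] with t h2 h3
  exact XSpace.norm_le_of_xNorm_le P _ (linfNorm_nonneg _ _ _) (by rwa [h2])

theorem exists_bounded_of_memLinf {s : ℝ} {I : Set ℝ} {U : ℝ → State d} (h : MemLinf P s I U) :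
    ∃ u : ℝ → XSpace P s, StronglyMeasurable u ∧ (∃ C : ℝ, 0 ≤ C ∧ ∀ t, ‖u t‖ ≤ C) ∧
      ∀ᵐ t ∂volume.restrict I, (u t : State d) = U t := by
  obtain ⟨u, hu, hU⟩ := h
  obtain ⟨u', h1, h2, h3⟩ := exists_bounded_representative hu
  refine ⟨u', h1, h2, ?_⟩
  filter_upwards [hU, h3] with t h4 h5
  rw [h5, h4]

end timeNorms

section gluing

variable {d : ℕ} {P : AdmissiblePair d} {r s ε L : ℝ} {ub : ℝ → XSpace P r} {R u u' : ℝ → XSpace P s}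

theorem LinSol.mono {hr : (d : ℝ) / 2 < r} {hrs : r + 1 < s}
    (S : LinSol P hr hrs ε L ub R u) {L' : ℝ} (hL' : L' ∈ Icc 0 L) :
    LinSol P hr hrs ε L' ub R u := by
  obtain ⟨B, hB⟩ := S.bound
  exact ⟨⟨B, fun t ht => hB t ⟨ht.1, ht.2.trans hL'.2⟩⟩, S.path.mono hL'⟩

theorem LinSol.congr {hr : (d : ℝ) / 2 < r} {hrs : r + 1 < s}
    (S : LinSol P hr hrs ε L ub R u) (h : ∀ t ∈ Icc 0 L, u t = u' t) :
    LinSol P hr hrs ε L ub R u' := by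
  obtain ⟨B, hB⟩ := S.bound
  refine ⟨⟨B, fun t ht => by rw [← h t ht]; exact hB t ht⟩, ?_⟩
  have p := S.path.congr_deriv (v' := fun t => linRHS P hr hrs.le ε (ub t) (R t) (u' t))
    (.of_forall fun t ht => by rw [h t ht])
  refine ⟨p.nonneg, p.integrable, p.bound, fun t ht => ?_⟩
  rw [← h t ht, ← h 0 ⟨le_rfl, p.nonneg⟩]
  exact p.eq t ht

theorem exists_linSol_timeInterval {t₀ M β γ β₀ h T : ℝ} {bd : ℝ → XSpace P r} (hT : 0 ≤ T)
    (hε : 0 ≤ ε) (hr : (d : ℝ) / 2 < r) (hrs : r + 1 < s)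
    (B : ∀ L ∈ timeInterval T ε, Background P s t₀ M β γ β₀ ε h L ub bd)
    {us : ℝ → XSpace P s} (hus : StronglyMeasurable us) {Cu : ℝ} (hCu : ∀ t, ‖us t‖ ≤ Cu)
    (hub : ∀ᵐ t ∂volume.restrict (timeInterval T ε), inclX P (by linarith) (us t) = ub t)
    (hR : StronglyMeasurable R) {CR : ℝ} (hCR : ∀ t, ‖R t‖ ≤ CR) (U₀ : XSpace P s) :
    ∃ U : ℝ → XSpace P s, U 0 = U₀ ∧ ∀ L ∈ timeInterval T ε, LinSol P hr hrs ε L ub R U := by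
  have hex : ∀ L ∈ timeInterval T ε, ∃ u : ℝ → XSpace P s,
      LinSol P hr hrs ε L ub R u ∧ u 0 = U₀ := fun L hL =>
    exists_linSol (B L hL) hus hCu (ae_Icc_of_ae_restrict hε hL hub) hR hCR U₀
  choose! V hV hV0 using hex
  refine ⟨fun t => V t t, hV0 0 (zero_mem_timeInterval hT), fun L hL => ?_⟩
  refine (hV L hL).congr fun t ht => ?_
  have htI := Icc_subset_timeInterval hε hL ht
  exact LinSol.eq_of_eq_zero (B t htI) ((hV L hL).mono ht) (hV t htI)
    ((hV0 L hL).trans (hV0 t htI).symm) ⟨ht.1, le_rfl⟩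

end gluing

section weakDerivative

variable {d : ℕ} {P : AdmissiblePair d} {r s ε : ℝ}

theorem linRHS_coe (hr : (d : ℝ) / 2 < r) (hrs : r + 1 ≤ s) (ε : ℝ) (b : XSpace P r)
    (R u : XSpace P s) : (linRHS P hr hrs ε b R u : State d) =
      ε • (R : State d) - ∑ j, P.A ε j (b : State d) (State.deriv j (u : State d)) := by
  rw [linRHS, Submodule.coe_sub, Submodule.coe_smul, inclX_coe, Submodule.coe_sum]
  congr 1
  refine Finset.sum_congr rfl fun j _ => ?_
  rw [AX_coe, derivX_coe]

theorem exists_norm_linRHS_le (P : AdmissiblePair d) (hr : (d : ℝ) / 2 < r) (hrs : r + 1 ≤ s)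
    (ε C CR B : ℝ) : ∃ K : ℝ, ∀ (b : XSpace P r) (R u : XSpace P s), ‖b‖ ≤ C → ‖R‖ ≤ CR →
      ‖u‖ ≤ B → ‖linRHS P hr hrs ε b R u‖ ≤ K := by
  obtain ⟨K, hK0, hK⟩ := exists_norm_AX_le P hr ε C
  refine ⟨|ε| * CR + K * ((∑ j, ‖derivX P hrs j‖) * B), fun b R u hb hR hu => ?_⟩
  refine (norm_sub_le _ _).trans (add_le_add ?_ (hK b hb _ _ fun j => ?_))
  · rw [norm_smul, Real.norm_eq_abs]
    exact mul_le_mul_of_nonneg_left ((norm_inclX_le P _ R).trans hR) (abs_nonneg ε)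
  · exact ((derivX P hrs j).le_opNorm u).trans (mul_le_mul (Finset.single_le_sum
      (f := fun j => ‖derivX P hrs j‖) (fun i _ => norm_nonneg _) (Finset.mem_univ j)) hu
      (norm_nonneg _) (by positivity))

theorem continuousOn_clm₂ {X Y Z : Type*} [NormedAddCommGroup X] [NormedSpace ℝ X]
    [NormedAddCommGroup Y] [NormedSpace ℝ Y] [NormedAddCommGroup Z] [NormedSpace ℝ Z]
    (T : X →L[ℝ] Y →L[ℝ] Z) {f : ℝ → X} {g : ℝ → Y} {A : Set ℝ} (hf : ContinuousOn f A)
    (hg : ContinuousOn g A) : ContinuousOn (fun t => T (f t) (g t)) A :=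
  T.continuous₂.comp_continuousOn (hf.prodMk hg)

theorem continuousOn_AX (hr : (d : ℝ) / 2 < r) (ε : ℝ) (j : Fin d) {b w : ℝ → XSpace P r} {A : Set ℝ}
    (hb : ContinuousOn b A) (hw : ContinuousOn w A) :
    ContinuousOn (fun t => AX P hr ε j (b t) (w t)) A := by
  have h3 : ContinuousOn (fun t => linX P r j (w t)) A :=
    (linX P r j).continuous.comp_continuousOn hw
  have e : (fun t => AX P hr ε j (b t) (w t)) =
      (fun t => linX P r j (w t)) + ε • fun t => bilX P hr j (b t) (w t) := by
    funext t
    rw [AX, add_apply, smul_apply, Pi.add_apply, Pi.smul_apply]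
  rw [e]
  exact h3.add ((continuousOn_clm₂ (bilX P hr j) hb hw).const_smul ε)

theorem intervalIntegrable_linRHS (hr : (d : ℝ) / 2 < r) (hrs : r + 1 ≤ s) (ε : ℝ) {L : ℝ}
    (hL : 0 ≤ L) {b : ℝ → XSpace P r} {R u : ℝ → XSpace P s} (hb : ContinuousOn b (Icc 0 L))
    (hR : StronglyMeasurable R) {CR : ℝ} (hCR : ∀ t, ‖R t‖ ≤ CR) (hu : ContinuousOn u (Icc 0 L)) :
    IntervalIntegrable (fun t => linRHS P hr hrs ε (b t) (R t) (u t)) volume 0 L := by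
  have h1 : IntervalIntegrable (fun t => ε • inclX P (by linarith : r ≤ s) (R t)) volume 0 L := by
    refine (intervalIntegrable_const (c := |ε| * CR)).mono_fun
      (((inclX P _).continuous.comp_stronglyMeasurable hR).const_smul ε).aestronglyMeasurable
      (.of_forall fun t => ?_)
    change ‖ε • inclX P _ (R t)‖ ≤ ‖|ε| * CR‖
    rw [norm_smul, Real.norm_eq_abs]
    exact (mul_le_mul_of_nonneg_left ((norm_inclX_le P _ (R t)).trans (hCR t))
      (abs_nonneg ε)).trans (le_abs_self _)
  have h2 : ContinuousOn (fun t => ∑ j, AX P hr ε j (b t) (derivX P hrs j (u t))) (uIcc 0 L) := by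
    rw [uIcc_of_le hL]
    exact continuousOn_finsetSum _ fun j _ => continuousOn_AX hr ε j hb
      ((derivX P hrs j).continuous.comp_continuousOn hu)
  exact h1.sub h2.intervalIntegrable

theorem inclX_inclX {r' : ℝ} (h : r ≤ r') (h' : r' ≤ s) (U : XSpace P s) :
    inclX P h (inclX P h' U) = inclX P (h.trans h') U := by
  refine Subtype.ext ?_
  rw [inclX_coe, inclX_coe, inclX_coe]

theorem inclX_linRHS {r' : ℝ} (h : r ≤ r') (hr : (d : ℝ) / 2 < r) (hrs : r + 1 ≤ s)
    (hr' : (d : ℝ) / 2 < r') (hrs' : r' + 1 ≤ s) (ε : ℝ) (b : XSpace P r') (R u : XSpace P s) :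
    inclX P h (linRHS P hr' hrs' ε b R u) = linRHS P hr hrs ε (inclX P h b) R u := by
  refine Subtype.ext ?_
  rw [inclX_coe, linRHS_coe, linRHS_coe, inclX_coe]

end weakDerivative

section cauchyProblem

variable {d : ℕ} {P : AdmissiblePair d} {r s T ε : ℝ}

theorem isSolution_of_linSol (hε : 0 ≤ ε) {hr : (d : ℝ) / 2 < r} {hrs : r + 1 < s}
    {Ub R : ℝ → State d} {b b' : ℝ → XSpace P (s - 1)}
    (hb : ∀ t ∈ timeInterval T ε, (b t : State d) = Ub t)
    (pb : ∀ L ∈ timeInterval T ε, PathOn L b b') {R' : ℝ → XSpace P s} (hR' : StronglyMeasurable R')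
    {CR : ℝ} (hCR : ∀ t, ‖R' t‖ ≤ CR)
    (hR : ∀ᵐ t ∂volume.restrict (timeInterval T ε), (R' t : State d) = R t)
    {u : ℝ → XSpace P s}
    (S : ∀ L ∈ timeInterval T ε, LinSol P hr hrs ε L (fun t => inclX P (by linarith) (b t)) R' u)
    (hu : ContinuousOn u (timeInterval T ε)) :
    IsSolution P s T ε Ub R (u 0) fun t => u t := by
  have hr' : (d : ℝ) / 2 < s - 1 := by linarith
  have hle : s - 1 + 1 ≤ s := by linarith
  have hrs' : r ≤ s - 1 := by linarith
  have hs : s - 1 ≤ s := by linarith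
  refine ⟨⟨u, hu, fun _ _ => rfl⟩, ⟨fun t => inclX P hs (u t),
    fun t => linRHS P hr' hle ε (b t) (R' t) (u t), fun t _ => inclX_coe P hs _, ?_,
    fun t ht => ?_⟩, rfl⟩
  · filter_upwards [hR, ae_restrict_mem (measurableSet_timeInterval T ε)] with t h1 h2
    rw [linRHS_coe, h1, hb t h2]
  · have hint := intervalIntegrable_linRHS hr' hle ε ht.1 (pb t ht).continuousOn hR' hCR
      (hu.mono (Icc_subset_timeInterval hε ht))
    refine ⟨hint, inclX_injective P hrs' ?_⟩
    rw [map_add, ← (inclX P hrs').intervalIntegral_comp_comm hint, inclX_inclX, inclX_inclX]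
    simp only [inclX_linRHS hrs' hr hrs.le hr' hle]
    exact (S t ht).path.eq t ⟨ht.1, le_rfl⟩

theorem IsSolution.exists_linSol (hε : 0 ≤ ε) (hr : (d : ℝ) / 2 < r) (hrs : r + 1 < s)
    {Ub R : ℝ → State d} {U₀ : State d} {b b' : ℝ → XSpace P (s - 1)}
    (hb : ∀ t ∈ timeInterval T ε, (b t : State d) = Ub t)
    (pb : ∀ L ∈ timeInterval T ε, PathOn L b b') {R' : ℝ → XSpace P s}
    {CR : ℝ} (hCR : ∀ t, ‖R' t‖ ≤ CR)
    (hR : ∀ᵐ t ∂volume.restrict (timeInterval T ε), (R' t : State d) = R t)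
    {V : ℝ → State d} (hV : IsSolution P s T ε Ub R U₀ V) :
    ∃ w : ℝ → XSpace P s, (∀ t ∈ timeInterval T ε, (w t : State d) = V t) ∧
      ∀ L ∈ timeInterval T ε, LinSol P hr hrs ε L (fun t => inclX P (by linarith) (b t)) R' w := by
  obtain ⟨⟨w, hwc, hw⟩, ⟨u, v, hu, hv, huv⟩, -⟩ := hV
  have hr' : (d : ℝ) / 2 < s - 1 := by linarith
  have hrs' : r ≤ s - 1 := by linarith
  have hs : r ≤ s := by linarith
  refine ⟨w, hw, fun L hL => ?_⟩
  have hsub := Icc_subset_timeInterval hε hL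
  obtain ⟨B, hB⟩ :=
    (isCompact_Icc.image_of_continuousOn (hwc.mono hsub)).isBounded.exists_norm_le
  obtain ⟨C, hC⟩ :=
    (isCompact_Icc.image_of_continuousOn (pb L hL).continuousOn).isBounded.exists_norm_le
  obtain ⟨K, hK⟩ := exists_norm_linRHS_le P hr hrs.le ε C CR B
  have hvR : ∀ᵐ t, t ∈ Icc 0 L → inclX P hrs' (v t) =
      linRHS P hr hrs.le ε (inclX P hrs' (b t)) (R' t) (w t) := by
    filter_upwards [ae_Icc_of_ae_restrict hε hL hv, ae_Icc_of_ae_restrict hε hL hR] with t h1 h2 ht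
    refine Subtype.ext ?_
    rw [inclX_coe, h1 ht, linRHS_coe, inclX_coe, h2 ht, hb t (hsub ht), hw t (hsub ht)]
  have hint : ∀ t ∈ Icc 0 L, IntervalIntegrable v volume 0 t := fun t ht => (huv t (hsub ht)).1
  have huw : ∀ t ∈ Icc 0 L, inclX P hrs' (u t) = inclX P hs (w t) := fun t ht => by
    refine Subtype.ext ?_
    rw [inclX_coe, inclX_coe, hu t (hsub ht), hw t (hsub ht)]
  have hL0 : L ∈ Icc 0 L := ⟨hL.1, le_rfl⟩
  have p : PathOn L (fun t => inclX P hs (w t)) fun t => inclX P hrs' (v t) := by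
    refine ⟨hL.1, ⟨(inclX P hrs').integrable_comp (hint L hL0).1,
      (inclX P hrs').integrable_comp (hint L hL0).2⟩, ⟨K, ?_⟩, fun t ht => ?_⟩
    · filter_upwards [hvR] with t h1 ht
      rw [h1 ht]
      exact hK _ _ _ ((norm_inclX_le P hrs' _).trans (hC _ (mem_image_of_mem _ ht))) (hCR t)
        (hB _ (mem_image_of_mem _ ht))
    · rw [← huw t ht, ← huw 0 ⟨le_rfl, hL.1⟩, (huv t (hsub ht)).2, map_add,
        (inclX P hrs').intervalIntegral_comp_comm (hint t ht)]
  exact ⟨⟨B, fun t ht => hB _ (mem_image_of_mem _ ht)⟩, p.congr_deriv hvR⟩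

end cauchyProblem

section constants

/-- The amplification constant of the energy estimate, as a function of `1 / h` and of
`|U̲|_{t=0}|_{X^{t₀}}`. -/
def ampConst (d : ℕ) (t₀ : ℝ) (p : ℝ × ℝ) : ℝ :=
  √(2 * ((d + 1) ^ 3 * (1 + (sobolevConst d t₀).toReal * max p.2 0) * max 1 p.1))

/-- The growth rate of the energy estimate, as a function of `1 / h`, `T`,
`|U̲|_{W^{1,∞}X^{t₀}}` and `|U̲|_{L^∞X^s}`. -/
def growthConst (d : ℕ) (s t₀ M : ℝ) (p : ℝ × ℝ × ℝ × ℝ) : ℝ :=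
  (d + 1) ^ 2 * energyRate d s t₀ |M| (max p.2.2.2 0) (max p.2.2.1 0) * max 1 p.1 + 1

/-- The constant in front of the forcing term in the energy estimate. -/
def forcingConst (d : ℕ) (s t₀ M : ℝ) (p : ℝ × ℝ × ℝ × ℝ) : ℝ :=
  2 * growthConst d s t₀ M p * Real.exp (growthConst d s t₀ M p * max p.2.1 0)

variable {d : ℕ} {s t₀ M : ℝ}

theorem monotone_ampConst : Monotone (ampConst d t₀) := fun p q hpq => by
  have h1 := hpq.1
  have h2 := hpq.2
  unfold ampConst
  gcongr

theorem ampConst_pos (p : ℝ × ℝ) : 0 < ampConst d t₀ p := by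
  unfold ampConst
  positivity

theorem energyRate_mono {β β' γ γ' : ℝ} (hs : 0 ≤ s) (hM : 0 ≤ M) (hβ0 : 0 ≤ β)
    (hβ : β ≤ β') (hγ : γ ≤ γ') : energyRate d s t₀ M β γ ≤ energyRate d s t₀ M β' γ' := by
  have hβ' := hβ0.trans hβ
  unfold energyRate energyConst
  gcongr

theorem monotone_growthConst (hs : 0 ≤ s) : Monotone (growthConst d s t₀ M) := fun p q hpq => by
  have h1 := hpq.1
  have h2 : max p.2.2.1 0 ≤ max q.2.2.1 0 := max_le_max_right 0 hpq.2.2.1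
  have h3 : max p.2.2.2 0 ≤ max q.2.2.2 0 := max_le_max_right 0 hpq.2.2.2
  have h4 := energyRate_mono (d := d) (t₀ := t₀) hs (abs_nonneg M) (le_max_right p.2.2.2 0) h3 h2
  have h5 := energyRate_nonneg (d := d) (t₀ := t₀) hs (abs_nonneg M) (le_max_right p.2.2.2 0)
    (le_max_right p.2.2.1 0)
  unfold growthConst
  gcongr
  exact mul_nonneg (by positivity) (h5.trans h4)

theorem growthConst_pos (hs : 0 ≤ s) (p : ℝ × ℝ × ℝ × ℝ) : 0 < growthConst d s t₀ M p := by
  have h5 := energyRate_nonneg (d := d) (t₀ := t₀) hs (abs_nonneg M) (le_max_right p.2.2.2 0)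
    (le_max_right p.2.2.1 0)
  unfold growthConst
  positivity

theorem monotone_forcingConst (hs : 0 ≤ s) : Monotone (forcingConst d s t₀ M) := fun p q hpq => by
  have h1 := monotone_growthConst (d := d) (t₀ := t₀) (M := M) hs hpq
  have h2 : max p.2.1 0 ≤ max q.2.1 0 := max_le_max_right 0 hpq.2.1
  have h3 := (growthConst_pos (d := d) (t₀ := t₀) (M := M) hs p).le
  have h4 := (growthConst_pos (d := d) (t₀ := t₀) (M := M) hs q).le
  unfold forcingConst
  gcongr

theorem forcingConst_pos (hs : 0 ≤ s) (p : ℝ × ℝ × ℝ × ℝ) : 0 < forcingConst d s t₀ M p := by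
  have h3 := growthConst_pos (d := d) (t₀ := t₀) (M := M) hs p
  unfold forcingConst
  positivity

theorem inv_min_one {h : ℝ} (hh : 0 < h) : (min 1 h)⁻¹ = max 1 (1 / h) := by
  rcases le_total 1 h with h1 | h1
  · rw [min_eq_left h1, inv_one, max_eq_left ((div_le_one hh).2 h1)]
  · rw [min_eq_right h1, max_eq_right ((one_le_div hh).2 h1), one_div]

/-- The bound given by the energy method, in terms of the constants above. -/
theorem energy_bound_le_const {P : AdmissiblePair d} (hs : 0 ≤ s) (hM : SymbolBound P.G₁ M)
    {ε h T β γ N x J t : ℝ} (hh : 0 < h) (hε : 0 ≤ ε) (hβ : 0 ≤ β) (hγ : 0 ≤ γ) (hN : 0 ≤ N)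
    (hx : 0 ≤ x) (hJ : 0 ≤ J) (ht : t ∈ timeInterval T ε) :
    Real.exp (ε * ((d + 1) ^ 2 * energyRate d s t₀ M β γ * (min 1 h)⁻¹) * t) *
        (√(2 * ((d + 1) ^ 3 * (1 + (sobolevConst d t₀).toReal * N) * (min 1 h)⁻¹ * x ^ 2)) +
          2 * ((d + 1) ^ 2 * energyRate d s t₀ M β γ * (min 1 h)⁻¹) * (ε * J)) ≤
      ampConst d t₀ (1 / h, N) * Real.exp (ε * growthConst d s t₀ M (1 / h, T, γ, β) * t) * x +
        ε * forcingConst d s t₀ M (1 / h, T, γ, β) * J := by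
  have e1 : √(2 * ((d + 1) ^ 3 * (1 + (sobolevConst d t₀).toReal * N) * (min 1 h)⁻¹ * x ^ 2)) =
      ampConst d t₀ (1 / h, N) * x := by
    rw [ampConst, max_eq_left hN, ← inv_min_one hh, ← mul_assoc 2, Real.sqrt_mul' _ (sq_nonneg x),
      Real.sqrt_sq hx]
  have e2 : (d + 1) ^ 2 * energyRate d s t₀ M β γ * (min 1 h)⁻¹ ≤
      growthConst d s t₀ M (1 / h, T, γ, β) := by
    rw [growthConst, max_eq_left hβ, max_eq_left hγ, abs_of_nonneg hM.nonneg, inv_min_one hh]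
    linarith
  have hT : 0 ≤ T := (mul_nonneg hε ht.1).trans ht.2
  have h0 : 0 ≤ (d + 1) ^ 2 * energyRate d s t₀ M β γ * (min 1 h)⁻¹ := by
    have := energyRate_nonneg (d := d) (t₀ := t₀) hs hM.nonneg hβ hγ
    have := lt_min one_pos hh
    positivity
  have ha := (ampConst_pos (d := d) (t₀ := t₀) (1 / h, N)).le
  rw [e1, forcingConst, max_eq_left hT]
  generalize (d + 1) ^ 2 * energyRate d s t₀ M β γ * (min 1 h)⁻¹ = Λ at *
  generalize growthConst d s t₀ M (1 / h, T, γ, β) = Λ' at *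
  generalize ampConst d t₀ (1 / h, N) = a at *
  have ht0 := ht.1
  have h1 : Real.exp (ε * Λ * t) ≤ Real.exp (ε * Λ' * t) := by gcongr
  have h2 : Real.exp (ε * Λ' * t) ≤ Real.exp (Λ' * T) := by
    refine Real.exp_le_exp.2 ?_
    have := mul_le_mul_of_nonneg_left ht.2 (h0.trans e2)
    linarith
  calc Real.exp (ε * Λ * t) * (a * x + 2 * Λ * (ε * J)) =
        a * Real.exp (ε * Λ * t) * x + ε * (2 * Λ * Real.exp (ε * Λ * t)) * J := by ring
    _ ≤ a * Real.exp (ε * Λ' * t) * x + ε * (2 * Λ' * Real.exp (Λ' * T)) * J := by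
        have := h1.trans h2
        have := h0.trans e2
        gcongr

end constants

end

theorem theorem3p1 (d : ℕ) (hd : d = 1 ∨ d = 2) (s t₀ M : ℝ) (hs : (d : ℝ) / 2 + 1 < s)
    (ht₀ : (d : ℝ) / 2 < t₀) (ht₀s : t₀ ≤ s - 1) :
    ∃ (κ : ℝ × ℝ → ℝ) (lam nu : ℝ × ℝ × ℝ × ℝ → ℝ),
      (Monotone κ ∧ ∀ p, 0 < κ p) ∧ (Monotone lam ∧ ∀ p, 0 < lam p) ∧
      (Monotone nu ∧ ∀ p, 0 < nu p) ∧
      ∀ P : AdmissiblePair d, SymbolBound P.G₁ M → SymbolBound P.G₂ M →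
      ∀ T ε h : ℝ, 0 < T → 0 ≤ ε → ε ≤ 1 → 0 < h →
      ∀ Ub dUb R : ℝ → State d, ∀ U₀ : State d,
        MemW1inf P (s - 1) (timeInterval T ε) Ub dUb →
        MemLinf P s (timeInterval T ε) Ub →
        NonCavitation ε h (timeInterval T ε) Ub →
        MemLinf P s (timeInterval T ε) R →
        U₀ ∈ XSpace P s →
        ∃ U : ℝ → State d, IsSolution P s T ε Ub R U₀ U ∧
          (∀ V : ℝ → State d, IsSolution P s T ε Ub R U₀ V →
            ∀ t ∈ timeInterval T ε, V t = U t) ∧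
          ∀ t ∈ timeInterval T ε,
            (xNorm P s (U t)).toReal ≤
              κ (1 / h, (xNorm P t₀ (Ub 0)).toReal) *
                Real.exp (ε * lam (1 / h, T,
                  linfNorm P t₀ (timeInterval T ε) Ub + linfNorm P t₀ (timeInterval T ε) dUb,
                  linfNorm P s (timeInterval T ε) Ub) * t) *
                (xNorm P s U₀).toReal +
              ε * nu (1 / h, T,
                  linfNorm P t₀ (timeInterval T ε) Ub + linfNorm P t₀ (timeInterval T ε) dUb,
                  linfNorm P s (timeInterval T ε) Ub) *
                ∫ τ in (0 : ℝ)..t, (xNorm P s (R τ)).toReal := by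
  have hs0 : 0 ≤ s := nonneg_of_half_lt (by linarith : (d : ℝ) / 2 < s)
  refine ⟨ampConst d t₀, growthConst d s t₀ M, forcingConst d s t₀ M,
    ⟨monotone_ampConst, ampConst_pos⟩, ⟨monotone_growthConst hs0, growthConst_pos hs0⟩,
    ⟨monotone_forcingConst hs0, forcingConst_pos hs0⟩, ?_⟩
  intro P h₁ h₂ T ε h hT hε0 hε1 hh Ub dUb R U₀ hW hUb hnc hR hU₀
  have hr : (d : ℝ) / 2 < ((d : ℝ) / 2 + s - 1) / 2 := by linarith
  have hrs : ((d : ℝ) / 2 + s - 1) / 2 + 1 < s := by linarith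
  set r : ℝ := ((d : ℝ) / 2 + s - 1) / 2
  have hrs' : r ≤ s - 1 := by linarith
  set I := timeInterval T ε
  have h0I : (0 : ℝ) ∈ I := zero_mem_timeInterval hT.le
  set β := linfNorm P s I Ub with hβdef
  set γ := linfNorm P t₀ I Ub + linfNorm P t₀ I dUb with hγdef
  have hβ : 0 ≤ β := linfNorm_nonneg _ _ _
  have hγ : 0 ≤ γ := add_nonneg (linfNorm_nonneg _ _ _) (linfNorm_nonneg _ _ _)
  obtain ⟨b, b', hb, hb', pb⟩ := exists_pathOn_of_memW1inf hε0 hW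
  set ub : ℝ → XSpace P r := fun t => inclX P hrs' (b t)
  have hubcoe : ∀ t ∈ I, (ub t : State d) = Ub t := fun t ht => (inclX_coe P hrs' _).trans (hb t ht)
  have hN : xNorm P t₀ (Ub 0) < ⊤ := by
    rw [← hb 0 h0I]
    exact (xNorm_mono P ht₀s _).trans_lt (XSpace.xNorm_lt_top _)
  have B : ∀ L ∈ I, Background P s t₀ M β γ
      ((sobolevConst d t₀).toReal * (xNorm P t₀ (Ub 0)).toReal) ε h L ub
      fun t => inclX P hrs' (b' t) := fun L hL =>
    { h₁ := h₁, h₂ := h₂, hs := hs, hr := hr, hrs := hrs, ht₀ := ht₀, hh := hh, hβ := hβ, hγ := hγ,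
      hε0 := hε0, hε1 := hε1
      path := (pb L hL).map (inclX P hrs')
      hub := by
        filter_upwards [ae_Icc_of_ae_restrict hε0 hL (ae_xNorm_le_linfNorm le_rfl hUb)] with t k1 ht
        rw [hubcoe t (Icc_subset_timeInterval hε0 hL ht)]
        exact k1 ht
      hbd := by
        filter_upwards [ae_Icc_of_ae_restrict hε0 hL (ae_xNorm_le_linfNorm ht₀s hW.2.1),
          ae_Icc_of_ae_restrict hε0 hL hb'] with t k1 k2 ht
        rw [inclX_coe, k2 ht]
        exact (k1 ht).trans (ENNReal.ofReal_le_ofReal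
          (le_add_of_nonneg_left (linfNorm_nonneg _ _ _)))
      hnc := fun t ht x => by
        rw [hubcoe t (Icc_subset_timeInterval hε0 hL ht)]
        exact hnc t (Icc_subset_timeInterval hε0 hL ht) x
      hβ₀ := norm_bL_le P hr ht₀ ENNReal.toReal_nonneg (by
        rw [hubcoe 0 h0I, ENNReal.ofReal_toReal hN.ne]) }
  obtain ⟨us, husm, ⟨Cu, -, hCu⟩, hus⟩ := exists_bounded_of_memLinf hUb
  obtain ⟨R', hR'm, ⟨CR, -, hCR⟩, hR'⟩ := exists_bounded_of_memLinf hR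
  have hub : ∀ᵐ t ∂volume.restrict I, inclX P (by linarith : r ≤ s) (us t) = ub t := by
    filter_upwards [hus, ae_restrict_mem (measurableSet_timeInterval T ε)] with t k1 k2
    refine Subtype.ext ?_
    rw [inclX_coe, k1, hubcoe t k2]
  obtain ⟨U, hU0, hU⟩ := exists_linSol_timeInterval hT.le hε0 hr hrs B husm hCu hub hR'm hCR ⟨U₀, hU₀⟩
  have hUc : ContinuousOn U I :=
    continuousOn_timeInterval fun L hL => LinSol.continuousOn (B L hL) (hU L hL) hCR
  have hU0' : (U 0 : State d) = U₀ := by rw [hU0]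
  refine ⟨fun t => U t, ?_, fun V hV t ht => ?_, fun t ht => ?_⟩
  · have hsol := isSolution_of_linSol hε0 hb pb hR'm hCR hR' hU hUc
    rwa [hU0'] at hsol
  · obtain ⟨w, hw, hwS⟩ := IsSolution.exists_linSol hε0 hr hrs hb pb hCR hR' hV
    have hw0 : w 0 = U 0 := Subtype.ext (by rw [hw 0 h0I, hU0', hV.2.2])
    rw [← hw t ht, LinSol.eq_of_eq_zero (B t ht) (hwS t ht) (hU t ht) hw0 ⟨ht.1, le_rfl⟩]
  · have hRi : IntervalIntegrable (fun t => ‖R' t‖) volume 0 t :=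
      (intervalIntegrable_const (c := CR)).mono_fun hR'm.norm.aestronglyMeasurable
        (.of_forall fun τ => by
          change ‖‖R' τ‖‖ ≤ ‖CR‖
          rw [norm_norm]
          exact (hCR τ).trans (le_abs_self CR))
    have hJ : ∫ τ in (0 : ℝ)..t, (xNorm P s (R τ)).toReal = ∫ τ in (0 : ℝ)..t, ‖R' τ‖ := by
      refine intervalIntegral.integral_congr_ae ?_
      filter_upwards [ae_Icc_of_ae_restrict hε0 ht hR'] with τ k1 hτ
      rw [uIoc_of_le ht.1] at hτ
      rw [XSpace.norm_def, k1 (Ioc_subset_Icc_self hτ)]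
    have key := LinSol.norm_le (B t ht) (hU t ht) hRi ⟨ht.1, le_rfl⟩
    rw [intervalIntegral.integral_const_mul] at key
    have key' := key.trans (energy_bound_le_const hs0 h₁ hh hε0 hβ hγ ENNReal.toReal_nonneg
      (norm_nonneg (U 0)) (intervalIntegral.integral_nonneg ht.1 fun τ _ => norm_nonneg _) ht)
    rw [XSpace.norm_def, XSpace.norm_def, hU0', ← hJ] at key'
    exact key'
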